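/- Let $(\mathsf E,\otimes,\mathbb 1_{\mathsf E})$ be a symmetric monoidal category. *Symmetric monoidal enriched categories.* A symmetric monoidal $\mathsf E$-enriched category is an $\mathsf E$-enriched category $C$ with an enriched functor $-\otimes-:C\otimes C\to C$, an object $\mathbb 1_C$, and invertible enriched natural transformations (associator, unitors, commutator) which make the underlying category a symmetric monoidal category. A lax symmetric monoidal functor $f:C\to D$ is an enriched functor with an enriched natural transformation $f(x)\otimes f(y)\to f(x\otimes y)$ and an element $\mathbb 1_D\to f(\mathbb 1_C)$ which make the underlying functor a lax symmetric monoidal functor. Together with the monoidal enriched natural transformations they form a strict 2-category $\mathsf{CMon}_{\mathrm{lax}}(\mathsf{Cat}_{\mathsf E})$. The tensor product $C\otimes D$ has objects $\mathrm{Ob}(C)\times\mathrm{Ob}(D)$ and mapping objects $(C\otimes D)((x,y),(x',y'))=C(x,x')\otimes D(y,y')$, with the componentwise symmetric monoidal structure; the unit $\mathcal I$ has one object $*$ and $\mathcal I(*,*)=\mathbb 1_{\mathsf E}$. *Enriched operads.* Let $\mathsf{Operad}_{\mathsf E}$ be the strict 2-category of (coloured, symmetric) $\mathsf E$-enriched operads,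 morphisms of operads, and natural transformations (families of unary operations $f(x)\to g(x)$ which commute with all the operations, as an equality of morphisms in $\mathsf E$). The Hadamard product $P\otimes_{\mathbb H}Q$ has colours $\mathrm{Ob}(P)\times\mathrm{Ob}(Q)$ and operations $P(x_1,\dots,x_n;x)\otimes Q(y_1,\dots,y_n;y)$; its unit $u\mathrm{Com}$ has one colour and all its objects of operations are $\mathbb 1_{\mathsf E}$. *Monoidal contexts.* A monoidal context is a strict 2-category with a symmetric monoidal structure on its underlying category which is extended to the 2-morphisms so that the tensor product is a strict 2-functor and the associator, the unitors and the braiding are strictly 2-natural. A strong context functor is a strict 2-functor $G$ between monoidal contexts whose underlying functor is a strong symmetric monoidal functor, with strictly 2-natural structural isomorphisms $G(X)\otimes G(Y)\simeq G(X\otimes Y)$. Both $\mathsf{CMon}_{\mathrm{lax}}(\mathsf{Cat}_{\mathsf E})$ and $\mathsf{Operad}_{\mathsf E}$ are monoidal contexts for the tensor products above. *The construction.* For a symmetric monoidal enriched category $C$ let $\mathcal E\mathrm{nd}(C)$ have the objects of $C$ as colours and $$\mathcal E\mathrm{nd}(C)(x_1,\dots,x_n;x)=C(x_1\otimes\cdots\otimes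 x_n,x)$$ (the $1$-fold tensor product is the identity, the $0$-fold one is $\mathbb 1_C$), with the composition induced by the composition and the tensor product of $C$ and the action of the symmetric groups induced by the commutator. For a lax symmetric monoidal functor $f:C\to D$, let $\mathcal E\mathrm{nd}(f)$ be $f$ on colours and the composite $$C(x_1\otimes\cdots\otimes x_n,x)\to D(f(x_1\otimes\cdots\otimes x_n),f(x))\to D(f(x_1)\otimes\cdots\otimes f(x_n),f(x))$$ on operations. For a monoidal enriched natural transformation $A:f\to g$ let $\mathcal E\mathrm{nd}(A)$ be given by the same elements $A(x)$ of $D(f(x),g(x))$. **Proposition.** These constructions are well defined and form a strict 2-functor $$\mathcal E\mathrm{nd}:\mathsf{CMon}_{\mathrm{lax}}(\mathsf{Cat}_{\mathsf E})\to\mathsf{Operad}_{\mathsf E}.$$ It is strictly fully faithful: for all $C,D$ the functor $$\mathsf{CMon}_{\mathrm{lax}}(\mathsf{Cat}_{\mathsf E})(C,D)\to\mathsf{Operad}_{\mathsf E}(\mathcal E\mathrm{nd}(C),\mathcal E\mathrm{nd}(D))$$ is an isomorphism of categories. Moreover $\mathcal E\mathrm{nd}$ has the structure of a strong context functor, whose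 structural isomorphisms are the canonical isomorphisms $$\mathcal E\mathrm{nd}(C)\otimes_{\mathbb H}\mathcal E\mathrm{nd}(D)\simeq\mathcal E\mathrm{nd}(C\otimes D)$$ which are the identity on colours and are given on operations by $$C(x_1\otimes\cdots\otimes x_n,x)\otimes D(y_1\otimes\cdots\otimes y_n,y)=(C\otimes D)\big((x_1\otimes\cdots\otimes x_n,\,y_1\otimes\cdots\otimes y_n),(x,y)\big)\simeq(C\otimes D)\big((x_1,y_1)\otimes\cdots\otimes(x_n,y_n),(x,y)\big),$$ and the canonical isomorphism $u\mathrm{Com}\simeq\mathcal E\mathrm{nd}(\mathcal I)$, which is the identity of $\mathbb 1_{\mathsf E}$ on operations. -/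

import Mathlib

open CategoryTheory MonoidalCategory

universe v u w

set_option linter.unusedVariables false
set_option linter.unusedSectionVars false

/-! ### Monoidal contexts and strong context functors -/

/-- A monoidal context: a strict 2-category `B` whose underlying category is a symmetric monoidal
category (the instance arguments), such that the tensor product is extended to 2-morphisms as a
strict 2-functor `B × B → B`, for which the associator, the unitors and the braiding are strictly
2-natural.  Equalities between 2-morphisms whose sources and targets are equal 1-morphisms are
expressed with `eqToHom`. -/
class MonoidalContext (B : Type u) [Bicategory.{w, v} B] [Bicategory.Strict B]
    [MonoidalCategory B] [SymmetricCategory B] where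
  /-- The tensor product of two 2-morphisms. -/
  tensor₂ {a a' b b' : B} {f f' : a ⟶ a'} {g g' : b ⟶ b'} (η : f ⟶ f') (θ : g ⟶ g') :
    (f ⊗ₘ g) ⟶ (f' ⊗ₘ g')
  tensor₂_id {a a' b b' : B} (f : a ⟶ a') (g : b ⟶ b') :
    tensor₂ (𝟙 f) (𝟙 g) = 𝟙 (f ⊗ₘ g)
  tensor₂_comp {a a' b b' : B} {f f' f'' : a ⟶ a'} {g g' g'' : b ⟶ b'}
    (η : f ⟶ f') (η' : f' ⟶ f'') (θ : g ⟶ g') (θ' : g' ⟶ g'') :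
    tensor₂ (η ≫ η') (θ ≫ θ') = tensor₂ η θ ≫ tensor₂ η' θ'
  tensor₂_whiskerLeft {a a' a'' b b' b'' : B} (f : a ⟶ a') (g : b ⟶ b')
    {h h' : a' ⟶ a''} {k k' : b' ⟶ b''} (η : h ⟶ h') (θ : k ⟶ k') :
    tensor₂ (Bicategory.whiskerLeft f η) (Bicategory.whiskerLeft g θ) =
      eqToHom (tensorHom_comp_tensorHom f g h k).symm ≫
        Bicategory.whiskerLeft (f ⊗ₘ g) (tensor₂ η θ) ≫
          eqToHom (tensorHom_comp_tensorHom f g h' k')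
  tensor₂_whiskerRight {a a' a'' b b' b'' : B} {f f' : a ⟶ a'} {g g' : b ⟶ b'}
    (η : f ⟶ f') (θ : g ⟶ g') (h : a' ⟶ a'') (k : b' ⟶ b'') :
    tensor₂ (Bicategory.whiskerRight η h) (Bicategory.whiskerRight θ k) =
      eqToHom (tensorHom_comp_tensorHom f g h k).symm ≫
        Bicategory.whiskerRight (tensor₂ η θ) (h ⊗ₘ k) ≫
          eqToHom (tensorHom_comp_tensorHom f' g' h k)
  associator_naturality₂ {a a' b b' c c' : B} {f f' : a ⟶ a'} {g g' : b ⟶ b'} {h h' : c ⟶ c'}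
    (η : f ⟶ f') (θ : g ⟶ g') (ζ : h ⟶ h') :
    Bicategory.whiskerRight (tensor₂ (tensor₂ η θ) ζ) (α_ a' b' c').hom =
      eqToHom (associator_naturality f g h) ≫
        Bicategory.whiskerLeft (α_ a b c).hom (tensor₂ η (tensor₂ θ ζ)) ≫
          eqToHom (associator_naturality f' g' h').symm
  leftUnitor_naturality₂ {a a' : B} {f f' : a ⟶ a'} (η : f ⟶ f') :
    Bicategory.whiskerRight (tensor₂ (𝟙 (𝟙 (𝟙_ B))) η) (λ_ a').hom =
      eqToHom (id_tensorHom (𝟙_ B) f ▸ leftUnitor_naturality f) ≫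
        Bicategory.whiskerLeft (λ_ a).hom η ≫
          eqToHom (id_tensorHom (𝟙_ B) f' ▸ leftUnitor_naturality f').symm
  rightUnitor_naturality₂ {a a' : B} {f f' : a ⟶ a'} (η : f ⟶ f') :
    Bicategory.whiskerRight (tensor₂ η (𝟙 (𝟙 (𝟙_ B)))) (ρ_ a').hom =
      eqToHom (tensorHom_id f (𝟙_ B) ▸ rightUnitor_naturality f) ≫
        Bicategory.whiskerLeft (ρ_ a).hom η ≫
          eqToHom (tensorHom_id f' (𝟙_ B) ▸ rightUnitor_naturality f').symm
  braiding_naturality₂ {a a' b b' : B} {f f' : a ⟶ a'} {g g' : b ⟶ b'}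
    (η : f ⟶ f') (θ : g ⟶ g') :
    Bicategory.whiskerRight (tensor₂ η θ) (β_ a' b').hom =
      eqToHom (BraidedCategory.braiding_naturality f g) ≫
        Bicategory.whiskerLeft (β_ a b).hom (tensor₂ θ η) ≫
          eqToHom (BraidedCategory.braiding_naturality f' g').symm

section TwoFunctors

universe v₁ v₂ u₁ u₂ w₁ w₂

variable {B : Type u₁} [Bicategory.{w₁, v₁} B] [Bicategory.Strict B]
  {B' : Type u₂} [Bicategory.{w₂, v₂} B'] [Bicategory.Strict B']

/-- The data `G` of maps on objects, 1-morphisms and 2-morphisms is a strict 2-functor. -/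
def IsStrictTwoFunctor (G : PrelaxFunctorStruct B B') : Prop :=
  ∃ F : StrictPseudofunctor B B', F.toPrelaxFunctorStruct = G

/-- A strict 2-functor is strictly fully faithful if it induces isomorphisms of categories
`B(X, Y) → B'(G X, G Y)`. -/
def IsStrictlyFullyFaithful (G : PrelaxFunctorStruct B B') : Prop :=
  ∀ X Y : B, Function.Bijective (fun f : X ⟶ Y => G.map f) ∧
    ∀ f g : X ⟶ Y, Function.Bijective (fun η : f ⟶ g => G.map₂ η)

/-- The functor between underlying categories of a strict 2-functor. -/
def IsStrictTwoFunctor.functor {G : PrelaxFunctorStruct B B'} (hG : IsStrictTwoFunctor G) :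
    B ⥤ B' where
  obj X := G.obj X
  map f := G.map f
  map_id X := by
    obtain ⟨F, rfl⟩ := hG
    exact F.map_id X
  map_comp f g := by
    obtain ⟨F, rfl⟩ := hG
    exact F.map_comp f g

/-- The structure of a strong context functor on a strict 2-functor `G` between monoidal contexts:
the structure of a strong symmetric monoidal functor on the underlying functor, such that the
isomorphisms `G X ⊗ G Y ≅ G (X ⊗ Y)` are strictly 2-natural. -/
structure StrongContextStructure [MonoidalCategory B] [SymmetricCategory B] [MonoidalContext B]
    [MonoidalCategory B'] [SymmetricCategory B'] [MonoidalContext B']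
    (G : PrelaxFunctorStruct B B') (hG : IsStrictTwoFunctor G) where
  /-- The strong symmetric monoidal structure. -/
  braided : hG.functor.Braided
  μ_natural₂ {a a' b b' : B} {f f' : a ⟶ a'} {g g' : b ⟶ b'} (η : f ⟶ f') (θ : g ⟶ g') :
    Bicategory.whiskerRight (MonoidalContext.tensor₂ (G.map₂ η) (G.map₂ θ))
        (Functor.LaxMonoidal.μ hG.functor a' b') =
      eqToHom (Functor.LaxMonoidal.μ_natural (F := hG.functor) f g) ≫
        Bicategory.whiskerLeft (Functor.LaxMonoidal.μ hG.functor a b)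
          (G.map₂ (MonoidalContext.tensor₂ η θ)) ≫
        eqToHom (Functor.LaxMonoidal.μ_natural (F := hG.functor) f' g').symm

end TwoFunctors

/-! ### Elements of enriched categories -/

section Elements

variable {E : Type u} [Category.{v} E] [MonoidalCategory E]

/-- The element `a ⊗ b` of `X ⊗ Y` given by elements `a` of `X` and `b` of `Y`; an element of an
object of `E` is a morphism from the monoidal unit. -/
def elPair {X Y : E} (a : 𝟙_ E ⟶ X) (b : 𝟙_ E ⟶ Y) : 𝟙_ E ⟶ X ⊗ Y :=
  (λ_ (𝟙_ E)).inv ≫ (a ⊗ₘ b)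

variable {C : Type w} [EnrichedCategory E C]

/-- Composition of elements (first `a`, then `b`), that is, the composition of the underlying
category. -/
def elComp {x y z : C} (a : 𝟙_ E ⟶ (x ⟶[E] y)) (b : 𝟙_ E ⟶ (y ⟶[E] z)) : 𝟙_ E ⟶ (x ⟶[E] z) :=
  elPair a b ≫ eComp E x y z

/-- The morphism `C(x, y) ⟶ C(x', y)` given by composition with an element of `C(x', x)`. -/
def elPre {x' x : C} (a : 𝟙_ E ⟶ (x' ⟶[E] x)) (y : C) : (x ⟶[E] y) ⟶ (x' ⟶[E] y) :=
  (λ_ _).inv ≫ a ▷ _ ≫ eComp E x' x y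

/-- The morphism `C(x, y) ⟶ C(x, y')` given by composition with an element of `C(y, y')`. -/
def elPost (x : C) {y y' : C} (b : 𝟙_ E ⟶ (y ⟶[E] y')) : (x ⟶[E] y) ⟶ (x ⟶[E] y') :=
  (ρ_ _).inv ≫ _ ◁ b ≫ eComp E x y y'

/-- The identity element, seen as an element of `C(x, y)` when `x = y`. -/
def elOfEq {x y : C} (h : x = y) : 𝟙_ E ⟶ (x ⟶[E] y) :=
  eId E x ≫ eqToHom (by rw [h])

lemma elOfEq_rfl (x : C) : elOfEq (E := E) (rfl : x = x) = eId E x := by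
  simp [elOfEq]

lemma elPair_comp {X Y X' Y' : E} (a : 𝟙_ E ⟶ X) (b : 𝟙_ E ⟶ Y) (f : X ⟶ X') (g : Y ⟶ Y') :
    elPair a b ≫ (f ⊗ₘ g) = elPair (a ≫ f) (b ≫ g) := by
  simp [elPair]

lemma elPair_eq_left {X Y : E} (a : 𝟙_ E ⟶ X) (b : 𝟙_ E ⟶ Y) :
    elPair a b = b ≫ (λ_ Y).inv ≫ a ▷ Y := by
  rw [elPair, tensorHom_def', leftUnitor_inv_naturality_assoc]

lemma elPair_eq_right {X Y : E} (a : 𝟙_ E ⟶ X) (b : 𝟙_ E ⟶ Y) :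
    elPair a b = a ≫ (ρ_ X).inv ≫ X ◁ b := by
  rw [elPair, MonoidalCategory.tensorHom_def, rightUnitor_inv_naturality_assoc, unitors_inv_equal]

lemma comp_elPost {x y y' : C} (a : 𝟙_ E ⟶ (x ⟶[E] y)) (b : 𝟙_ E ⟶ (y ⟶[E] y')) :
    a ≫ elPost x b = elComp a b := by
  simp [elPost, elComp, elPair_eq_right]

lemma comp_elPre {x' x y : C} (a : 𝟙_ E ⟶ (x' ⟶[E] x)) (b : 𝟙_ E ⟶ (x ⟶[E] y)) :
    b ≫ elPre a y = elComp a b := by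
  simp [elPre, elComp, elPair_eq_left]

lemma elPost_id (x y : C) : elPost (E := E) x (eId E y) = 𝟙 _ := by
  simp [elPost]

lemma elPre_id (x y : C) : elPre (E := E) (eId E x) y = 𝟙 _ := by
  simp [elPre]

lemma elPost_elPost (x : C) {y y' y'' : C} (b : 𝟙_ E ⟶ (y ⟶[E] y'))
    (b' : 𝟙_ E ⟶ (y' ⟶[E] y'')) : elPost x b ≫ elPost x b' = elPost x (elComp b b') := by
  have h := e_assoc' E x y y' y''
  simp only [elPost, elComp, elPair_eq_right, Category.assoc, MonoidalCategory.whiskerLeft_comp]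
  rw [rightUnitor_inv_naturality_assoc, rightUnitor_inv_naturality_assoc,
    ← whisker_exchange_assoc, ← h]
  simp

lemma elPre_elPre {x'' x' x : C} (a : 𝟙_ E ⟶ (x' ⟶[E] x)) (a' : 𝟙_ E ⟶ (x'' ⟶[E] x')) (y : C) :
    elPre a y ≫ elPre a' y = elPre (elComp a' a) y := by
  have h := e_assoc E x'' x' x y
  simp only [elPre, elComp, elPair_eq_left, Category.assoc, comp_whiskerRight]
  rw [leftUnitor_inv_naturality_assoc, leftUnitor_inv_naturality_assoc,
    whisker_exchange_assoc, ← h]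
  simp [-e_assoc]

lemma elPre_elPost {x' x y y' : C} (a : 𝟙_ E ⟶ (x' ⟶[E] x)) (b : 𝟙_ E ⟶ (y ⟶[E] y')) :
    elPre a y ≫ elPost x' b = elPost x b ≫ elPre a y' := by
  have h := e_assoc E x' x y y'
  simp only [elPre, elPost, Category.assoc]
  rw [rightUnitor_inv_naturality_assoc, ← whisker_exchange_assoc (eComp E x' x y) b,
    leftUnitor_inv_naturality_assoc (eComp E x y y'),
    whisker_exchange_assoc a (eComp E x y y'), ← h,
    leftUnitor_inv_naturality_assoc (_ ◁ b), whisker_exchange_assoc a,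
    leftUnitor_inv_naturality_assoc (ρ_ _).inv, whisker_exchange_assoc a]
  simp [-e_assoc]

lemma elComp_assoc {x y z t : C} (a : 𝟙_ E ⟶ (x ⟶[E] y)) (b : 𝟙_ E ⟶ (y ⟶[E] z))
    (c : 𝟙_ E ⟶ (z ⟶[E] t)) : elComp (elComp a b) c = elComp a (elComp b c) := by
  rw [← comp_elPost, ← comp_elPost a b, Category.assoc, elPost_elPost, comp_elPost]

lemma id_elComp {x y : C} (a : 𝟙_ E ⟶ (x ⟶[E] y)) : elComp (eId E x) a = a := by
  rw [← comp_elPre, elPre_id, Category.comp_id]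

lemma elComp_id {x y : C} (a : 𝟙_ E ⟶ (x ⟶[E] y)) : elComp a (eId E y) = a := by
  rw [← comp_elPost, elPost_id, Category.comp_id]

variable {D : Type w} [EnrichedCategory E D] (F : EnrichedFunctor E C D)

lemma elComp_map {x y z : C} (a : 𝟙_ E ⟶ (x ⟶[E] y)) (b : 𝟙_ E ⟶ (y ⟶[E] z)) :
    elComp a b ≫ F.map x z = elComp (a ≫ F.map x y) (b ≫ F.map y z) := by
  simp [elComp, ← elPair_comp]

lemma elPost_map (x : C) {y y' : C} (b : 𝟙_ E ⟶ (y ⟶[E] y')) :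
    elPost x b ≫ F.map x y' = F.map x y ≫ elPost (F.obj x) (b ≫ F.map y y') := by
  simp only [elPost, Category.assoc, EnrichedFunctor.map_comp, MonoidalCategory.whiskerLeft_comp]
  rw [rightUnitor_inv_naturality_assoc, MonoidalCategory.tensorHom_def, Category.assoc,
    whisker_exchange_assoc]

lemma elPre_map {x' x : C} (a : 𝟙_ E ⟶ (x' ⟶[E] x)) (y : C) :
    elPre a y ≫ F.map x' y = F.map x y ≫ elPre (a ≫ F.map x' x) (F.obj y) := by
  simp only [elPre, Category.assoc, EnrichedFunctor.map_comp, comp_whiskerRight]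
  rw [leftUnitor_inv_naturality_assoc, MonoidalCategory.tensorHom_def', Category.assoc,
    ← whisker_exchange_assoc]

lemma elPost_map_assoc (x : C) {y y' : C} (b : 𝟙_ E ⟶ (y ⟶[E] y')) {Z : E}
    (h : (F.obj x ⟶[E] F.obj y') ⟶ Z) :
    elPost x b ≫ F.map x y' ≫ h = F.map x y ≫ elPost (F.obj x) (b ≫ F.map y y') ≫ h := by
  rw [← Category.assoc, elPost_map, Category.assoc]

lemma elPre_map_assoc {x' x : C} (a : 𝟙_ E ⟶ (x' ⟶[E] x)) (y : C) {Z : E}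
    (h : (F.obj x' ⟶[E] F.obj y) ⟶ Z) :
    elPre a y ≫ F.map x' y ≫ h = F.map x y ≫ elPre (a ≫ F.map x' x) (F.obj y) ≫ h := by
  rw [← Category.assoc, elPre_map, Category.assoc]

end Elements

/-! ### Symmetric monoidal enriched categories -/

/-- A symmetric monoidal `E`-enriched category: an enriched category with an enriched functor
`C ⊗ C ⟶ C`, a unit object, and invertible enriched natural transformations (the associator, the
unitors and the commutator) which make the underlying category a symmetric monoidal category. -/
structure SymMonECat (E : Type u) [Category.{v} E] [MonoidalCategory E] [SymmetricCategory E] where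
  /-- The objects. -/
  carrier : Type w
  /-- The enriched category structure. -/
  enriched : EnrichedCategory E carrier
  /-- The tensor product of objects. -/
  tObj : carrier → carrier → carrier
  /-- The tensor product functor on morphisms. -/
  tHom (x x' y y' : carrier) : (x ⟶[E] x') ⊗ (y ⟶[E] y') ⟶ (tObj x y ⟶[E] tObj x' y')
  /-- The unit object. -/
  one : carrier
  /-- The associator. -/
  assoc (x y z : carrier) : 𝟙_ E ⟶ (tObj (tObj x y) z ⟶[E] tObj x (tObj y z))
  /-- The inverse of the associator. -/
  assocInv (x y z : carrier) : 𝟙_ E ⟶ (tObj x (tObj y z) ⟶[E] tObj (tObj x y) z)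
  /-- The left unitor. -/
  lUnit (x : carrier) : 𝟙_ E ⟶ (tObj one x ⟶[E] x)
  /-- The inverse of the left unitor. -/
  lUnitInv (x : carrier) : 𝟙_ E ⟶ (x ⟶[E] tObj one x)
  /-- The right unitor. -/
  rUnit (x : carrier) : 𝟙_ E ⟶ (tObj x one ⟶[E] x)
  /-- The inverse of the right unitor. -/
  rUnitInv (x : carrier) : 𝟙_ E ⟶ (x ⟶[E] tObj x one)
  /-- The commutator. -/
  comm (x y : carrier) : 𝟙_ E ⟶ (tObj x y ⟶[E] tObj y x)
  tHom_id (x y : carrier) : elPair (eId E x) (eId E y) ≫ tHom x x y y = eId E (tObj x y)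
  tHom_comp (x x' x'' y y' y'' : carrier) :
    (tHom x x' y y' ⊗ₘ tHom x' x'' y' y'') ≫ eComp E _ _ _ =
      tensorμ _ _ _ _ ≫ (eComp E x x' x'' ⊗ₘ eComp E y y' y'') ≫ tHom x x'' y y''
  assoc_assocInv (x y z : carrier) : elComp (assoc x y z) (assocInv x y z) = eId E _
  assocInv_assoc (x y z : carrier) : elComp (assocInv x y z) (assoc x y z) = eId E _
  lUnit_lUnitInv (x : carrier) : elComp (lUnit x) (lUnitInv x) = eId E _
  lUnitInv_lUnit (x : carrier) : elComp (lUnitInv x) (lUnit x) = eId E _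
  rUnit_rUnitInv (x : carrier) : elComp (rUnit x) (rUnitInv x) = eId E _
  rUnitInv_rUnit (x : carrier) : elComp (rUnitInv x) (rUnit x) = eId E _
  comm_comm (x y : carrier) : elComp (comm x y) (comm y x) = eId E _
  assoc_natural (x x' y y' z z' : carrier) :
    tHom x x' y y' ▷ (z ⟶[E] z') ≫ tHom _ _ z z' ≫ elPost _ (assoc x' y' z') =
      (α_ _ _ _).hom ≫ (x ⟶[E] x') ◁ tHom y y' z z' ≫ tHom x x' _ _ ≫ elPre (assoc x y z) _
  lUnit_natural (x x' : carrier) :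
    (λ_ (x ⟶[E] x')).inv ≫ eId E one ▷ _ ≫ tHom one one x x' ≫ elPost _ (lUnit x') =
      elPre (lUnit x) x'
  rUnit_natural (x x' : carrier) :
    (ρ_ (x ⟶[E] x')).inv ≫ _ ◁ eId E one ≫ tHom x x' one one ≫ elPost _ (rUnit x') =
      elPre (rUnit x) x'
  comm_natural (x x' y y' : carrier) :
    tHom x x' y y' ≫ elPost _ (comm x' y') = (β_ _ _).hom ≫ tHom y y' x x' ≫ elPre (comm x y) _
  pentagon (x y z t : carrier) :
    elComp (elPair (assoc x y z) (eId E t) ≫ tHom _ _ _ _)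
        (elComp (assoc x (tObj y z) t) (elPair (eId E x) (assoc y z t) ≫ tHom _ _ _ _)) =
      elComp (assoc (tObj x y) z t) (assoc x y (tObj z t))
  triangle (x y : carrier) :
    elComp (assoc x one y) (elPair (eId E x) (lUnit y) ≫ tHom _ _ _ _) =
      elPair (rUnit x) (eId E y) ≫ tHom _ _ _ _
  hexagon (x y z : carrier) :
    elComp (assoc x y z) (elComp (comm x (tObj y z)) (assoc y z x)) =
      elComp (elPair (comm x y) (eId E z) ≫ tHom _ _ _ _)
        (elComp (assoc y x z) (elPair (eId E y) (comm x z) ≫ tHom _ _ _ _))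

attribute [instance] SymMonECat.enriched

section SymMon

variable {E : Type u} [Category.{v} E] [MonoidalCategory E] [SymmetricCategory E]

namespace SymMonECat

variable (C : SymMonECat.{v, u, w} E)

/-- The tensor product of two elements of mapping objects of `C`. -/
def tEl {x x' y y' : C.carrier} (a : 𝟙_ E ⟶ (x ⟶[E] x')) (b : 𝟙_ E ⟶ (y ⟶[E] y')) :
    𝟙_ E ⟶ (C.tObj x y ⟶[E] C.tObj x' y') :=
  elPair a b ≫ C.tHom x x' y y'

lemma tEl_id (x y : C.carrier) : C.tEl (eId E x) (eId E y) = eId E (C.tObj x y) := C.tHom_id x y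

end SymMonECat

lemma elPair_elPair {X Y X' Y' : E} (a : 𝟙_ E ⟶ X) (b : 𝟙_ E ⟶ Y) (a' : 𝟙_ E ⟶ X')
    (b' : 𝟙_ E ⟶ Y') :
    elPair (elPair a b) (elPair a' b') ≫ tensorμ X Y X' Y' =
      elPair (elPair a a') (elPair b b') := by
  have h : (λ_ (𝟙_ E)).inv ≫ ((λ_ (𝟙_ E)).inv ⊗ₘ (λ_ (𝟙_ E)).inv) ≫
      tensorμ (𝟙_ E) (𝟙_ E) (𝟙_ E) (𝟙_ E) =
      (λ_ (𝟙_ E)).inv ≫ ((λ_ (𝟙_ E)).inv ⊗ₘ (λ_ (𝟙_ E)).inv) := by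
    have h1 := tensor_left_unitality (𝟙_ E) (𝟙_ E)
    rw [← cancel_mono ((λ_ (𝟙_ E)).hom ⊗ₘ (λ_ (𝟙_ E)).hom), tensorHom_def' (λ_ (𝟙_ E)).inv]
    simp only [Category.assoc]
    rw [← h1]
    simp [MonoidalCategory.tensorHom_def]
  have e1 : elPair (elPair a b) (elPair a' b') =
      (λ_ (𝟙_ E)).inv ≫ ((λ_ (𝟙_ E)).inv ⊗ₘ (λ_ (𝟙_ E)).inv) ≫ ((a ⊗ₘ b) ⊗ₘ (a' ⊗ₘ b')) := by
    rw [elPair, elPair, elPair, ← tensorHom_comp_tensorHom]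
  rw [e1, Category.assoc, Category.assoc, tensorμ_natural, reassoc_of% h]
  rw [elPair, elPair, elPair, ← tensorHom_comp_tensorHom]

namespace SymMonECat

variable (C : SymMonECat.{v, u, w} E)

lemma tEl_comp {x x' x'' y y' y'' : C.carrier} (a : 𝟙_ E ⟶ (x ⟶[E] x'))
    (a' : 𝟙_ E ⟶ (x' ⟶[E] x'')) (b : 𝟙_ E ⟶ (y ⟶[E] y')) (b' : 𝟙_ E ⟶ (y' ⟶[E] y'')) :
    C.tEl (elComp a a') (elComp b b') = elComp (C.tEl a b) (C.tEl a' b') := by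
  simp only [tEl, elComp]
  rw [← elPair_comp (elPair a b), Category.assoc, C.tHom_comp, ← Category.assoc, elPair_elPair,
    ← elPair_comp]
  simp

lemma tEl_comp_id {x x' x'' y : C.carrier} (a : 𝟙_ E ⟶ (x ⟶[E] x'))
    (a' : 𝟙_ E ⟶ (x' ⟶[E] x'')) :
    C.tEl (elComp a a') (eId E y) = elComp (C.tEl a (eId E y)) (C.tEl a' (eId E y)) := by
  rw [← tEl_comp, elComp_id]

lemma tEl_id_comp {x y y' y'' : C.carrier} (b : 𝟙_ E ⟶ (y ⟶[E] y'))
    (b' : 𝟙_ E ⟶ (y' ⟶[E] y'')) :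
    C.tEl (eId E x) (elComp b b') = elComp (C.tEl (eId E x) b) (C.tEl (eId E x) b') := by
  rw [← tEl_comp, elComp_id]

end SymMonECat

/-- A lax symmetric monoidal functor between symmetric monoidal enriched categories. -/
structure LaxHom (C D : SymMonECat.{v, u, w} E) extends
    EnrichedFunctor E C.carrier D.carrier where
  /-- The structural maps `f(x) ⊗ f(y) ⟶ f(x ⊗ y)`. -/
  mu (x y : C.carrier) : 𝟙_ E ⟶ (D.tObj (obj x) (obj y) ⟶[E] obj (C.tObj x y))
  /-- The structural map `1 ⟶ f(1)`. -/
  eps : 𝟙_ E ⟶ (D.one ⟶[E] obj C.one)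
  mu_natural (x x' y y' : C.carrier) :
    (map x x' ⊗ₘ map y y') ≫ D.tHom _ _ _ _ ≫ elPost _ (mu x' y') =
      C.tHom x x' y y' ≫ map _ _ ≫ elPre (mu x y) _
  mu_assoc (x y z : C.carrier) :
    elComp (D.tEl (mu x y) (eId E (obj z))) (elComp (mu (C.tObj x y) z) (C.assoc x y z ≫ map _ _)) =
      elComp (D.assoc _ _ _) (elComp (D.tEl (eId E (obj x)) (mu y z)) (mu x (C.tObj y z)))
  mu_lUnit (x : C.carrier) :
    elComp (D.tEl eps (eId E (obj x))) (elComp (mu C.one x) (C.lUnit x ≫ map _ _)) = D.lUnit (obj x)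
  mu_rUnit (x : C.carrier) :
    elComp (D.tEl (eId E (obj x)) eps) (elComp (mu x C.one) (C.rUnit x ≫ map _ _)) = D.rUnit (obj x)
  mu_comm (x y : C.carrier) :
    elComp (mu x y) (C.comm x y ≫ map _ _) = elComp (D.comm _ _) (mu y x)

namespace LaxHom

variable {C D D' D'' : SymMonECat.{v, u, w} E}

lemma ext_of {f g : LaxHom C D} (hobj : f.obj = g.obj) (hmap : f.map ≍ g.map)
    (hmu : f.mu ≍ g.mu) (heps : f.eps ≍ g.eps) : f = g := by
  obtain ⟨⟨_, _, _, _⟩, _, _, _, _, _, _, _⟩ := f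
  obtain ⟨⟨_, _, _, _⟩, _, _, _, _, _, _, _⟩ := g
  cases hobj; cases hmap; cases hmu; cases heps
  rfl

lemma tEl_mu (f : LaxHom C D) {x x' y y' : C.carrier} (a : 𝟙_ E ⟶ (x ⟶[E] x'))
    (b : 𝟙_ E ⟶ (y ⟶[E] y')) :
    elComp (D.tEl (a ≫ f.map _ _) (b ≫ f.map _ _)) (f.mu x' y') =
      elComp (f.mu x y) (C.tEl a b ≫ f.map _ _) := by
  have h := f.mu_natural x x' y y'
  rw [← comp_elPost, ← comp_elPre, SymMonECat.tEl, SymMonECat.tEl, ← elPair_comp]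
  simp [h]

/-- The identity lax symmetric monoidal functor. -/
def id (C : SymMonECat.{v, u, w} E) : LaxHom C C where
  obj x := x
  map x y := 𝟙 _
  map_id x := by simp
  map_comp x y z := by simp
  mu x y := eId E _
  eps := eId E _
  mu_natural x x' y y' := by simp [elPost_id, elPre_id]
  mu_assoc x y z := by simp [C.tEl_id, id_elComp, elComp_id]
  mu_lUnit x := by simp [C.tEl_id, id_elComp]
  mu_rUnit x := by simp [C.tEl_id, id_elComp]
  mu_comm x y := by simp [id_elComp, elComp_id]

/-- The composition of lax symmetric monoidal functors. -/
def comp (f : LaxHom C D) (g : LaxHom D D') : LaxHom C D' where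
  obj x := g.obj (f.obj x)
  map x y := f.map x y ≫ g.map _ _
  map_id x := by simp
  map_comp x y z := by simp
  mu x y := elComp (g.mu _ _) (f.mu x y ≫ g.map _ _)
  eps := elComp g.eps (f.eps ≫ g.map _ _)
  mu_natural x x' y y' := by
    have hf := f.mu_natural x x' y y'
    have hg := g.mu_natural (f.obj x) (f.obj x') (f.obj y) (f.obj y')
    rw [← elPost_elPost, ← elPre_elPre, ← tensorHom_comp_tensorHom]
    simp only [Category.assoc]
    rw [reassoc_of% hg, elPre_elPost, ← elPost_map_assoc, reassoc_of% hf, elPre_map_assoc]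
  mu_assoc x y z := by
    have hf := congrArg (· ≫ g.map _ _) (f.mu_assoc x y z)
    have hg := g.mu_assoc (f.obj x) (f.obj y) (f.obj z)
    have h1 := g.tEl_mu (f.mu x y) (eId E (f.obj z))
    have h2 := g.tEl_mu (eId E (f.obj x)) (f.mu y z)
    have h3 := congrArg (fun k => elComp k (f.mu x (C.tObj y z) ≫ g.map _ _)) h2
    have h4 := congrArg (fun k => elComp k (elComp (f.mu (C.tObj x y) z ≫ g.map _ _)
      ((C.assoc x y z ≫ f.map _ _) ≫ g.map _ _))) h1
    have h5 := congrArg (fun k => elComp k (elComp (D.tEl (eId E (f.obj x)) (f.mu y z) ≫ g.map _ _)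
      (f.mu x (C.tObj y z) ≫ g.map _ _))) hg
    simp only [EnrichedFunctor.map_id, elComp_map, elComp_assoc] at hf h3 h4 h5
    simp only [SymMonECat.tEl_comp_id, SymMonECat.tEl_id_comp, elComp_assoc,
      ← Category.assoc (C.assoc x y z)]
    rw [h4, hf, h5, h3]
  mu_lUnit x := by
    have hf := congrArg (· ≫ g.map _ _) (f.mu_lUnit x)
    have hg := g.mu_lUnit (f.obj x)
    have h1 := congrArg (fun k => elComp k (elComp (f.mu C.one x ≫ g.map _ _)
      ((C.lUnit x ≫ f.map _ _) ≫ g.map _ _))) (g.tEl_mu f.eps (eId E (f.obj x)))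
    simp only [EnrichedFunctor.map_id, elComp_map, elComp_assoc] at hf h1
    simp only [SymMonECat.tEl_comp_id, elComp_assoc, ← Category.assoc (C.lUnit x)]
    rw [h1, hf, hg]
  mu_rUnit x := by
    have hf := congrArg (· ≫ g.map _ _) (f.mu_rUnit x)
    have hg := g.mu_rUnit (f.obj x)
    have h1 := congrArg (fun k => elComp k (elComp (f.mu x C.one ≫ g.map _ _)
      ((C.rUnit x ≫ f.map _ _) ≫ g.map _ _))) (g.tEl_mu (eId E (f.obj x)) f.eps)
    simp only [EnrichedFunctor.map_id, elComp_map, elComp_assoc] at hf h1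
    simp only [SymMonECat.tEl_id_comp, elComp_assoc, ← Category.assoc (C.rUnit x)]
    rw [h1, hf, hg]
  mu_comm x y := by
    have hf := congrArg (· ≫ g.map _ _) (f.mu_comm x y)
    have hg := congrArg (fun k => elComp k (f.mu y x ≫ g.map _ _)) (g.mu_comm (f.obj x) (f.obj y))
    simp only [elComp_map, elComp_assoc] at hf hg
    simp only [elComp_assoc, ← Category.assoc (C.comm x y)]
    rw [hf, hg]

end LaxHom

/-- A monoidal enriched natural transformation between lax symmetric monoidal functors.  The
naturality square is a diagram in `E`, which in general is stronger than naturality with respect to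
the elements of the mapping objects. -/
@[ext]
structure MonTrans {C D : SymMonECat.{v, u, w} E} (f g : LaxHom C D) where
  /-- The components. -/
  app (x : C.carrier) : 𝟙_ E ⟶ (f.obj x ⟶[E] g.obj x)
  natural (x y : C.carrier) :
    f.map x y ≫ elPost (f.obj x) (app y) = g.map x y ≫ elPre (app x) (g.obj y)
  app_tensor (x y : C.carrier) :
    elComp (f.mu x y) (app (C.tObj x y)) = elComp (D.tEl (app x) (app y)) (g.mu x y)
  app_one : elComp f.eps (app C.one) = g.eps

namespace MonTrans

variable {C D D' : SymMonECat.{v, u, w} E}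

lemma el_natural {f g : LaxHom C D} (η : MonTrans f g) {x y : C.carrier}
    (a : 𝟙_ E ⟶ (x ⟶[E] y)) :
    elComp (a ≫ f.map x y) (η.app y) = elComp (η.app x) (a ≫ g.map x y) := by
  rw [← comp_elPost, ← comp_elPre, Category.assoc, Category.assoc, η.natural]

/-- The identity. -/
def id (f : LaxHom C D) : MonTrans f f where
  app x := eId E _
  natural x y := by rw [elPost_id, elPre_id]
  app_tensor x y := by rw [D.tEl_id, id_elComp, elComp_id]
  app_one := by rw [elComp_id]

/-- Vertical composition. -/
def comp {f g h : LaxHom C D} (η : MonTrans f g) (θ : MonTrans g h) : MonTrans f h where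
  app x := elComp (η.app x) (θ.app x)
  natural x y := by
    rw [← elPost_elPost, ← Category.assoc, η.natural, Category.assoc, elPre_elPost,
      ← Category.assoc, θ.natural, Category.assoc, elPre_elPre]
  app_tensor x y := by
    rw [← elComp_assoc, η.app_tensor, elComp_assoc, θ.app_tensor, ← elComp_assoc, ← D.tEl_comp]
  app_one := by rw [← elComp_assoc, η.app_one, θ.app_one]

/-- Left whiskering. -/
def whiskerLeft (f : LaxHom C D) {g h : LaxHom D D'} (η : MonTrans g h) :
    MonTrans (f.comp g) (f.comp h) where
  app x := η.app (f.obj x)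
  natural x y := by simp [LaxHom.comp, η.natural]
  app_tensor x y := by
    simp only [LaxHom.comp]
    rw [elComp_assoc, η.el_natural, ← elComp_assoc, η.app_tensor, elComp_assoc]
  app_one := by
    simp only [LaxHom.comp]
    rw [elComp_assoc, η.el_natural, ← elComp_assoc, η.app_one]

/-- Right whiskering. -/
def whiskerRight {f g : LaxHom C D} (η : MonTrans f g) (h : LaxHom D D') :
    MonTrans (f.comp h) (g.comp h) where
  app x := η.app x ≫ h.map _ _
  natural x y := by
    simp only [LaxHom.comp, Category.assoc]
    rw [← elPost_map, ← elPre_map, reassoc_of% η.natural x y]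
  app_tensor x y := by
    simp only [LaxHom.comp]
    rw [elComp_assoc, ← elComp_map, η.app_tensor, elComp_map, ← elComp_assoc, ← elComp_assoc,
      h.tEl_mu]
  app_one := by
    simp only [LaxHom.comp]
    rw [elComp_assoc, ← elComp_map, η.app_one]

instance : Category (LaxHom C D) where
  Hom f g := MonTrans f g
  id f := MonTrans.id f
  comp η θ := MonTrans.comp η θ
  id_comp η := by
    ext x; exact id_elComp _
  comp_id η := by
    ext x; exact elComp_id _
  assoc η θ ζ := by
    ext x; exact elComp_assoc _ _ _

@[ext]
lemma hom_ext {f g : LaxHom C D} {η θ : f ⟶ g} (h : ∀ x, MonTrans.app η x = MonTrans.app θ x) :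
    η = θ :=
  MonTrans.ext (funext h)

lemma eq_conj {f f' g g' : LaxHom C D} (h : f = f') (k : g' = g) {η : f ⟶ g} {η' : f' ⟶ g'}
    (H : ∀ x, MonTrans.app η x ≍ MonTrans.app η' x) : η = eqToHom h ≫ η' ≫ eqToHom k := by
  subst h k
  rw [eqToHom_refl, eqToHom_refl, Category.comp_id, Category.id_comp]
  exact hom_ext fun x => eq_of_heq (H x)

lemma whiskerRight_eqToHom {f g : LaxHom C D} (h : f = g) (k : LaxHom D D') :
    MonTrans.whiskerRight (eqToHom h) k =
      (eqToHom (by rw [h]) : f.comp k ⟶ g.comp k) := by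
  subst h
  exact hom_ext fun x => k.map_id _

lemma whiskerLeft_eqToHom (f : LaxHom C D) {g h : LaxHom D D'} (k : g = h) :
    MonTrans.whiskerLeft f (eqToHom k) =
      (eqToHom (by rw [k]) : f.comp g ⟶ f.comp h) := by
  subst k
  rfl

end MonTrans

namespace LaxHom

variable {C D D' D'' : SymMonECat.{v, u, w} E}

lemma id_comp' (f : LaxHom C D) : (LaxHom.id C).comp f = f :=
  ext_of rfl (heq_of_eq (by funext x y; exact Category.id_comp _))
    (heq_of_eq (by funext x y; simp [LaxHom.comp, LaxHom.id, elComp_id]))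
    (heq_of_eq (by simp [LaxHom.comp, LaxHom.id, elComp_id]))

lemma comp_id' (f : LaxHom C D) : f.comp (LaxHom.id D) = f :=
  ext_of rfl (heq_of_eq (by funext x y; exact Category.comp_id _))
    (heq_of_eq (by funext x y; simp [LaxHom.comp, LaxHom.id, id_elComp]))
    (heq_of_eq (by simp [LaxHom.comp, LaxHom.id, id_elComp]))

lemma assoc' (f : LaxHom C D) (g : LaxHom D D') (h : LaxHom D' D'') :
    (f.comp g).comp h = f.comp (g.comp h) :=
  ext_of rfl (heq_of_eq (by funext x y; exact Category.assoc _ _ _))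
    (heq_of_eq (by funext x y; simp [LaxHom.comp, elComp_map, elComp_assoc]))
    (heq_of_eq (by simp [LaxHom.comp, elComp_map, elComp_assoc]))

end LaxHom

/-- The strict 2-category of symmetric monoidal enriched categories, lax symmetric monoidal functors
and monoidal enriched natural transformations. -/
instance : Bicategory (SymMonECat.{v, u, w} E) where
  Hom C D := LaxHom C D
  id C := LaxHom.id C
  comp f g := f.comp g
  homCategory C D := inferInstanceAs (Category (LaxHom C D))
  whiskerLeft f _ _ η := MonTrans.whiskerLeft f η
  whiskerRight η h := MonTrans.whiskerRight η h
  associator f g h := eqToIso (LaxHom.assoc' f g h)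
  leftUnitor f := eqToIso (LaxHom.id_comp' f)
  rightUnitor f := eqToIso (LaxHom.comp_id' f)
  whiskerLeft_id f g := rfl
  whiskerLeft_comp f _ _ _ η θ := rfl
  id_whiskerLeft η :=
    MonTrans.eq_conj (LaxHom.id_comp' _) (LaxHom.id_comp' _).symm fun x => HEq.rfl
  comp_whiskerLeft f g _ _ η :=
    MonTrans.eq_conj (LaxHom.assoc' _ _ _) (LaxHom.assoc' _ _ _).symm fun x => HEq.rfl
  id_whiskerRight f g := MonTrans.hom_ext fun x => g.map_id _
  comp_whiskerRight η θ h := MonTrans.hom_ext fun x => elComp_map h.toEnrichedFunctor _ _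
  whiskerRight_id η :=
    MonTrans.eq_conj (LaxHom.comp_id' _) (LaxHom.comp_id' _).symm fun x =>
      heq_of_eq (Category.comp_id _)
  whiskerRight_comp η g h :=
    MonTrans.eq_conj (LaxHom.assoc' _ _ _).symm (LaxHom.assoc' _ _ _) fun x =>
      heq_of_eq (Category.assoc _ _ _).symm
  whisker_assoc f _ _ η h :=
    MonTrans.eq_conj (LaxHom.assoc' _ _ _) (LaxHom.assoc' _ _ _).symm fun x => HEq.rfl
  whisker_exchange η θ := MonTrans.hom_ext fun x => (θ.el_natural _).symm
  pentagon f g h k := by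
    simp only [eqToIso.hom, MonTrans.whiskerRight_eqToHom, MonTrans.whiskerLeft_eqToHom]
    exact (by simp : ∀ {X₁ X₂ X₃ X₄ X₅ : LaxHom _ _} (h₁ : X₁ = X₂) (h₂ : X₂ = X₃) (h₃ : X₃ = X₄)
      (h₄ : X₁ = X₅) (h₅ : X₅ = X₄), eqToHom h₁ ≫ eqToHom h₂ ≫ eqToHom h₃ =
        eqToHom h₄ ≫ eqToHom h₅) _ _ _ _ _
  triangle f g := by
    simp only [eqToIso.hom, MonTrans.whiskerRight_eqToHom, MonTrans.whiskerLeft_eqToHom]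
    exact eqToHom_trans _ _

instance : Bicategory.Strict (SymMonECat.{v, u, w} E) where
  id_comp {a b} f := LaxHom.id_comp' (C := a) (D := b) f
  comp_id {a b} f := LaxHom.comp_id' (C := a) (D := b) f
  assoc {a b c d} f g h := LaxHom.assoc' (C := a) (D := b) (D' := c) (D'' := d) f g h
  leftUnitor_eqToIso _ := rfl
  rightUnitor_eqToIso _ := rfl
  associator_eqToIso _ _ _ := rfl

end SymMon

/-! ### The tensor product of symmetric monoidal enriched categories -/

section Shuffle

variable {E : Type u} [Category.{v} E] [MonoidalCategory E] [SymmetricCategory E]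

lemma tensorμ_braiding (X₁ X₂ Y₁ Y₂ : E) :
    tensorμ X₁ X₂ Y₁ Y₂ ≫ ((β_ X₁ Y₁).hom ⊗ₘ (β_ X₂ Y₂).hom) =
      (β_ (X₁ ⊗ X₂) (Y₁ ⊗ Y₂)).hom ≫ tensorμ Y₁ Y₂ X₁ X₂ := by
  simp [tensorμ, SymmetricCategory.braiding_swap_eq_inv_braiding Y₁ X₂, MonoidalCategory.tensorHom_def]
  have h : Y₁ ◁ (β_ X₁ Y₂).hom ▷ X₂ ≫ Y₁ ◁ (β_ Y₂ X₁).hom ▷ X₂ = 𝟙 _ := by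
    rw [← MonoidalCategory.whiskerLeft_comp, ← comp_whiskerRight, SymmetricCategory.symmetry]
    simp
  rw [reassoc_of% h]
  simp

lemma tensorμ_tensorμ (A₁ B₁ A₂ B₂ A₃ B₃ A₄ B₄ : E) :
   (tensorμ A₁ B₁ A₂ B₂ ⊗ₘ tensorμ A₃ B₃ A₄ B₄) ≫ tensorμ (A₁ ⊗ A₂) (B₁ ⊗ B₂) (A₃ ⊗ A₄) (B₃ ⊗ B₄) ≫
     (tensorμ A₁ A₂ A₃ A₄ ⊗ₘ tensorμ B₁ B₂ B₃ B₄) =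
   tensorμ (A₁ ⊗ B₁) (A₂ ⊗ B₂) (A₃ ⊗ B₃) (A₄ ⊗ B₄) ≫ (tensorμ A₁ B₁ A₃ B₃ ⊗ₘ tensorμ A₂ B₂ A₄ B₄) ≫
     tensorμ (A₁ ⊗ A₃) (B₁ ⊗ B₃) (A₂ ⊗ A₄) (B₂ ⊗ B₄) := by
  let _ : BraidedCategory (E × E) :=
    { braiding X Y := Iso.prod (β_ X.1 Y.1) (β_ X.2 Y.2) }
  let _ : (tensor E).LaxBraided := { braided X Y := by exact tensorμ_braiding _ _ _ _ }
  have := tensorμ_comp_μ_tensorHom_μ_comp_μ (tensor E) (A₁, B₁) (A₂, B₂) (A₃, B₃) (A₄, B₄)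
  exact this.symm

lemma leftUnitor_inv_elPair {A B X Y : E} (a : 𝟙_ E ⟶ A) (b : 𝟙_ E ⟶ B) :
    (λ_ (X ⊗ Y)).inv ≫ elPair a b ▷ (X ⊗ Y) ≫ tensorμ A B X Y =
      ((λ_ X).inv ≫ a ▷ X) ⊗ₘ ((λ_ Y).inv ≫ b ▷ Y) := by
  rw [elPair, comp_whiskerRight, Category.assoc, tensorμ_natural_left,
    ← tensorHom_comp_tensorHom]
  have h := tensor_left_unitality X Y
  rw [← cancel_mono ((λ_ X).inv ⊗ₘ (λ_ Y).inv)] at h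
  simp only [Category.assoc, tensorHom_comp_tensorHom, Iso.hom_inv_id, Category.comp_id,
    id_tensorHom_id] at h
  rw [← reassoc_of% h]
  simp

lemma rightUnitor_inv_elPair {A B X Y : E} (a : 𝟙_ E ⟶ A) (b : 𝟙_ E ⟶ B) :
    (ρ_ (X ⊗ Y)).inv ≫ (X ⊗ Y) ◁ elPair a b ≫ tensorμ X Y A B =
      ((ρ_ X).inv ≫ X ◁ a) ⊗ₘ ((ρ_ Y).inv ≫ Y ◁ b) := by
  rw [elPair, MonoidalCategory.whiskerLeft_comp, Category.assoc, tensorμ_natural_right,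
    ← tensorHom_comp_tensorHom]
  have h := tensor_right_unitality X Y
  rw [← cancel_mono ((ρ_ X).inv ⊗ₘ (ρ_ Y).inv)] at h
  simp only [Category.assoc, tensorHom_comp_tensorHom, Iso.hom_inv_id, Category.comp_id,
    id_tensorHom_id] at h
  rw [← reassoc_of% h]
  simp

end Shuffle

section Product

variable {E : Type u} [Category.{v} E] [MonoidalCategory E] [SymmetricCategory E]
variable (C D : Type w) [EnrichedCategory E C] [EnrichedCategory E D]

/-- The tensor product of two enriched categories. -/
@[reducible]
def prodEnriched : EnrichedCategory E (C × D) where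
  Hom x y := (x.1 ⟶[E] y.1) ⊗ (x.2 ⟶[E] y.2)
  id x := elPair (eId E x.1) (eId E x.2)
  comp x y z := tensorμ _ _ _ _ ≫ (eComp E x.1 y.1 z.1 ⊗ₘ eComp E x.2 y.2 z.2)
  id_comp x y := by
    have h := leftUnitor_inv_elPair (X := (x.1 ⟶[E] y.1)) (Y := (x.2 ⟶[E] y.2))
      (eId E x.1) (eId E x.2)
    rw [reassoc_of% h]
    simp
  comp_id x y := by
    have h := rightUnitor_inv_elPair (X := (x.1 ⟶[E] y.1)) (Y := (x.2 ⟶[E] y.2))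
      (eId E y.1) (eId E y.2)
    rw [reassoc_of% h]
    simp
  assoc x y z t := by
    rw [Iso.inv_comp_eq]
    simp only [comp_whiskerRight, MonoidalCategory.whiskerLeft_comp, Category.assoc]
    rw [tensorμ_natural_left_assoc, tensorμ_natural_right_assoc, ← tensor_associativity_assoc]
    simp [e_assoc']

attribute [local instance] prodEnriched

variable {C D}

lemma prod_elComp {x y z : C × D} (a : 𝟙_ E ⟶ (x.1 ⟶[E] y.1)) (b : 𝟙_ E ⟶ (x.2 ⟶[E] y.2))
    (a' : 𝟙_ E ⟶ (y.1 ⟶[E] z.1)) (b' : 𝟙_ E ⟶ (y.2 ⟶[E] z.2)) :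
    elComp (x := x) (y := y) (z := z) (elPair a b) (elPair a' b') =
      elPair (elComp a a') (elComp b b') := by
  change elPair (elPair a b) (elPair a' b') ≫ tensorμ _ _ _ _ ≫ (eComp E _ _ _ ⊗ₘ eComp E _ _ _) = _
  rw [← Category.assoc, elPair_elPair, elPair_comp]
  rfl

lemma prod_elPost (x : C × D) {y z : C × D} (a : 𝟙_ E ⟶ (y.1 ⟶[E] z.1))
    (b : 𝟙_ E ⟶ (y.2 ⟶[E] z.2)) :
    elPost (y := y) (y' := z) x (elPair a b) = (elPost x.1 a ⊗ₘ elPost x.2 b) := by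
  change (ρ_ _).inv ≫ _ ◁ elPair a b ≫ tensorμ _ _ _ _ ≫ (eComp E _ _ _ ⊗ₘ eComp E _ _ _) = _
  have h := rightUnitor_inv_elPair (X := (x.1 ⟶[E] y.1)) (Y := (x.2 ⟶[E] y.2)) a b
  rw [reassoc_of% h]
  simp [elPost]

lemma prod_elPre {x y : C × D} (a : 𝟙_ E ⟶ (x.1 ⟶[E] y.1))
    (b : 𝟙_ E ⟶ (x.2 ⟶[E] y.2)) (z : C × D) :
    elPre (x' := x) (x := y) (elPair a b) z = (elPre a z.1 ⊗ₘ elPre b z.2) := by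
  change (λ_ _).inv ≫ elPair a b ▷ _ ≫ tensorμ _ _ _ _ ≫ (eComp E _ _ _ ⊗ₘ eComp E _ _ _) = _
  have h := leftUnitor_inv_elPair (X := (y.1 ⟶[E] z.1)) (Y := (y.2 ⟶[E] z.2)) a b
  rw [reassoc_of% h]
  simp [elPre]

lemma prod_eId (x : C × D) : eId E x = elPair (eId E x.1) (eId E x.2) := rfl

lemma prod_tEl {X X' Y Y' Z Z' : E} (a : 𝟙_ E ⟶ X) (b : 𝟙_ E ⟶ Y)
    (a' : 𝟙_ E ⟶ X') (b' : 𝟙_ E ⟶ Y') (f : X ⊗ X' ⟶ Z) (g : Y ⊗ Y' ⟶ Z') :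
    elPair (elPair a b) (elPair a' b') ≫ tensorμ X Y X' Y' ≫ (f ⊗ₘ g) =
      elPair (elPair a a' ≫ f) (elPair b b' ≫ g) := by
  rw [← Category.assoc, elPair_elPair, elPair_comp]

end Product

namespace SymMonECat

variable {E : Type u} [Category.{v} E] [MonoidalCategory E] [SymmetricCategory E]

attribute [local instance] prodEnriched

/-- The tensor product of two symmetric monoidal enriched categories. -/
def tensor (C D : SymMonECat.{v, u, w} E) : SymMonECat.{v, u, w} E where
  carrier := C.carrier × D.carrier
  enriched := prodEnriched C.carrier D.carrier
  tObj x y := (C.tObj x.1 y.1, D.tObj x.2 y.2)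
  tHom x x' y y' := tensorμ _ _ _ _ ≫ (C.tHom x.1 x'.1 y.1 y'.1 ⊗ₘ D.tHom x.2 x'.2 y.2 y'.2)
  one := (C.one, D.one)
  assoc x y z := elPair (C.assoc x.1 y.1 z.1) (D.assoc x.2 y.2 z.2)
  assocInv x y z := elPair (C.assocInv x.1 y.1 z.1) (D.assocInv x.2 y.2 z.2)
  lUnit x := elPair (C.lUnit x.1) (D.lUnit x.2)
  lUnitInv x := elPair (C.lUnitInv x.1) (D.lUnitInv x.2)
  rUnit x := elPair (C.rUnit x.1) (D.rUnit x.2)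
  rUnitInv x := elPair (C.rUnitInv x.1) (D.rUnitInv x.2)
  comm x y := elPair (C.comm x.1 y.1) (D.comm x.2 y.2)
  tHom_id x y := by
    change elPair (elPair (eId E _) (eId E _)) (elPair (eId E _) (eId E _)) ≫ _ = elPair _ _
    rw [← Category.assoc, elPair_elPair, elPair_comp, C.tHom_id, D.tHom_id]
  tHom_comp x x' x'' y y' y'' := by
    change (_ ⊗ₘ _) ≫ tensorμ _ _ _ _ ≫ (eComp E _ _ _ ⊗ₘ eComp E _ _ _) =
      tensorμ _ _ _ _ ≫ ((tensorμ _ _ _ _ ≫ (eComp E _ _ _ ⊗ₘ eComp E _ _ _)) ⊗ₘ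
        (tensorμ _ _ _ _ ≫ (eComp E _ _ _ ⊗ₘ eComp E _ _ _))) ≫ _
    simp only [← tensorHom_comp_tensorHom, Category.assoc, tensorμ_natural_assoc]
    simp only [tensorHom_comp_tensorHom, C.tHom_comp, D.tHom_comp]
    simp only [← tensorHom_comp_tensorHom]
    have h := tensorμ_tensorμ (x.1 ⟶[E] x'.1) (x.2 ⟶[E] x'.2) (y.1 ⟶[E] y'.1) (y.2 ⟶[E] y'.2)
      (x'.1 ⟶[E] x''.1) (x'.2 ⟶[E] x''.2) (y'.1 ⟶[E] y''.1) (y'.2 ⟶[E] y''.2)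
    rw [reassoc_of% h]
  assoc_assocInv x y z := by
    rw [prod_elComp, C.assoc_assocInv, D.assoc_assocInv]; rfl
  assocInv_assoc x y z := by
    rw [prod_elComp, C.assocInv_assoc, D.assocInv_assoc]; rfl
  lUnit_lUnitInv x := by
    rw [prod_elComp, C.lUnit_lUnitInv, D.lUnit_lUnitInv]; rfl
  lUnitInv_lUnit x := by
    rw [prod_elComp, C.lUnitInv_lUnit, D.lUnitInv_lUnit]; rfl
  rUnit_rUnitInv x := by
    rw [prod_elComp, C.rUnit_rUnitInv, D.rUnit_rUnitInv]; rfl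
  rUnitInv_rUnit x := by
    rw [prod_elComp, C.rUnitInv_rUnit, D.rUnitInv_rUnit]; rfl
  comm_comm x y := by
    rw [prod_elComp, C.comm_comm, D.comm_comm]; rfl
  assoc_natural x x' y y' z z' := by
    rw [prod_elPost, prod_elPre]
    change (tensorμ _ _ _ _ ≫ (_ ⊗ₘ _)) ▷ (_ ⊗ _) ≫ (tensorμ _ _ _ _ ≫ (_ ⊗ₘ _)) ≫ _ =
      (α_ (_ ⊗ _) (_ ⊗ _) (_ ⊗ _)).hom ≫ (_ ⊗ _) ◁ (tensorμ _ _ _ _ ≫ (_ ⊗ₘ _)) ≫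
        (tensorμ _ _ _ _ ≫ (_ ⊗ₘ _)) ≫ _
    simp only [comp_whiskerRight, MonoidalCategory.whiskerLeft_comp, Category.assoc]
    rw [tensorμ_natural_left_assoc, tensorμ_natural_right_assoc, ← tensor_associativity_assoc]
    simp only [tensorHom_comp_tensorHom, C.assoc_natural, D.assoc_natural]
  lUnit_natural x x' := by
    rw [prod_elPost, prod_elPre, ← C.lUnit_natural, ← D.lUnit_natural]
    change (λ_ (_ ⊗ _)).inv ≫ elPair _ _ ▷ _ ≫ (tensorμ _ _ _ _ ≫ (_ ⊗ₘ _)) ≫ _ = _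
    have h := leftUnitor_inv_elPair (X := (x.1 ⟶[E] x'.1)) (Y := (x.2 ⟶[E] x'.2))
      (eId E C.one) (eId E D.one)
    rw [Category.assoc, reassoc_of% h]
    simp only [tensorHom_comp_tensorHom, Category.assoc]
  rUnit_natural x x' := by
    rw [prod_elPost, prod_elPre, ← C.rUnit_natural, ← D.rUnit_natural]
    change (ρ_ (_ ⊗ _)).inv ≫ _ ◁ elPair _ _ ≫ (tensorμ _ _ _ _ ≫ (_ ⊗ₘ _)) ≫ _ = _
    have h := rightUnitor_inv_elPair (X := (x.1 ⟶[E] x'.1)) (Y := (x.2 ⟶[E] x'.2))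
      (eId E C.one) (eId E D.one)
    rw [Category.assoc, reassoc_of% h]
    simp only [tensorHom_comp_tensorHom, Category.assoc]
  comm_natural x x' y y' := by
    rw [prod_elPost, prod_elPre]
    change (tensorμ _ _ _ _ ≫ (_ ⊗ₘ _)) ≫ _ = (β_ (_ ⊗ _) (_ ⊗ _)).hom ≫
      (tensorμ _ _ _ _ ≫ (_ ⊗ₘ _)) ≫ _
    simp only [Category.assoc, tensorHom_comp_tensorHom, C.comm_natural, D.comm_natural]
    rw [← tensorHom_comp_tensorHom, ← Category.assoc, tensorμ_braiding, Category.assoc]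
  pentagon x y z t := by
    simp only [prod_tEl, prod_elComp, prod_eId]
    exact congrArg₂ elPair (C.pentagon _ _ _ _) (D.pentagon _ _ _ _)
  triangle x y := by
    simp only [prod_tEl, prod_elComp, prod_eId]
    exact congrArg₂ elPair (C.triangle _ _) (D.triangle _ _)
  hexagon x y z := by
    simp only [prod_tEl, prod_elComp, prod_eId]
    exact congrArg₂ elPair (C.hexagon _ _ _) (D.hexagon _ _ _)

end SymMonECat

/-! ### The symmetric monoidal 2-category of symmetric monoidal enriched categories -/

section Shuffle

variable {E : Type u} [Category.{v} E] [MonoidalCategory E]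

lemma elPair_assoc {X Y Z : E} (a : 𝟙_ E ⟶ X) (b : 𝟙_ E ⟶ Y) (c : 𝟙_ E ⟶ Z) :
    elPair (elPair a b) c ≫ (α_ X Y Z).hom = elPair a (elPair b c) := by
  simp only [elPair_eq_left a]
  simp [elPair_eq_left]

lemma elPair_assocInv {X Y Z : E} (a : 𝟙_ E ⟶ X) (b : 𝟙_ E ⟶ Y) (c : 𝟙_ E ⟶ Z) :
    elPair a (elPair b c) ≫ (α_ X Y Z).inv = elPair (elPair a b) c := by
  rw [← elPair_assoc, Category.assoc, Iso.hom_inv_id, Category.comp_id]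

lemma elPair_leftUnitor {Y : E} (b : 𝟙_ E ⟶ Y) :
    elPair (𝟙 _) b ≫ (λ_ Y).hom = b := by
  simp [elPair_eq_left]

lemma elPair_rightUnitor {Y : E} (b : 𝟙_ E ⟶ Y) :
    elPair b (𝟙 _) ≫ (ρ_ Y).hom = b := by
  simp [elPair_eq_right]

lemma comp_leftUnitor_inv {Y : E} (b : 𝟙_ E ⟶ Y) :
    b ≫ (λ_ Y).inv = elPair (𝟙 _) b := by
  rw [← cancel_mono (λ_ Y).hom, elPair_leftUnitor]; simp

lemma comp_rightUnitor_inv {Y : E} (b : 𝟙_ E ⟶ Y) :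
    b ≫ (ρ_ Y).inv = elPair b (𝟙 _) := by
  rw [← cancel_mono (ρ_ Y).hom, elPair_rightUnitor]; simp

variable [SymmetricCategory E]

lemma braiding_unit : (β_ (𝟙_ E) (𝟙_ E)).hom = 𝟙 _ := by
  rw [← cancel_mono (λ_ (𝟙_ E)).hom, braiding_leftUnitor, Category.id_comp, unitors_equal]

lemma tensorμ_unit : tensorμ (𝟙_ E) (𝟙_ E) (𝟙_ E) (𝟙_ E) = 𝟙 _ := by
  rw [tensorμ, braiding_unit]
  monoidal

lemma elPair_braiding {X Y : E} (a : 𝟙_ E ⟶ X) (b : 𝟙_ E ⟶ Y) :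
    elPair a b ≫ (β_ X Y).hom = elPair b a := by
  rw [elPair, elPair, Category.assoc, BraidedCategory.braiding_naturality, braiding_unit,
    Category.id_comp]

lemma tensorμ_self (X₁ X₂ Y₁ Y₂ : E) :
    tensorμ X₁ X₂ Y₁ Y₂ ≫ tensorμ X₁ Y₁ X₂ Y₂ = 𝟙 _ := by
  have h : X₁ ◁ (β_ X₂ Y₁).hom ▷ Y₂ ≫ X₁ ◁ (β_ Y₁ X₂).hom ▷ Y₂ = 𝟙 _ := by
    rw [← MonoidalCategory.whiskerLeft_comp, ← comp_whiskerRight, SymmetricCategory.symmetry]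
    simp
  simp [tensorμ, reassoc_of% h]

lemma braiding_tensorμ (X₁ X₂ Y₁ Y₂ : E) :
    ((β_ X₁ X₂).hom ⊗ₘ (β_ Y₁ Y₂).hom) ≫ tensorμ X₂ X₁ Y₂ Y₁ =
      tensorμ X₁ X₂ Y₁ Y₂ ≫ (β_ (X₁ ⊗ Y₁) (X₂ ⊗ Y₂)).hom := by
  have h := congrArg (fun k => tensorμ X₁ X₂ Y₁ Y₂ ≫ k ≫ tensorμ X₂ X₁ Y₂ Y₁)
    (tensorμ_braiding X₁ Y₁ X₂ Y₂)
  simp only [Category.assoc, tensorμ_self, Category.comp_id] at h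
  rw [← h, ← Category.assoc (tensorμ X₁ X₂ Y₁ Y₂), tensorμ_self, Category.id_comp]

lemma associator_monoidal_inv (X₁ X₂ X₃ Y₁ Y₂ Y₃ : E) :
    ((α_ X₁ X₂ X₃).inv ⊗ₘ (α_ Y₁ Y₂ Y₃).inv) ≫ tensorμ (X₁ ⊗ X₂) X₃ (Y₁ ⊗ Y₂) Y₃ ≫
        (tensorμ X₁ X₂ Y₁ Y₂ ▷ (X₃ ⊗ Y₃)) =
      tensorμ X₁ (X₂ ⊗ X₃) Y₁ (Y₂ ⊗ Y₃) ≫ ((X₁ ⊗ Y₁) ◁ tensorμ X₂ X₃ Y₂ Y₃) ≫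
        (α_ (X₁ ⊗ Y₁) (X₂ ⊗ Y₂) (X₃ ⊗ Y₃)).inv := by
  have h := associator_monoidal X₁ X₂ X₃ Y₁ Y₂ Y₃
  rw [← cancel_mono (α_ (X₁ ⊗ Y₁) (X₂ ⊗ Y₂) (X₃ ⊗ Y₃)).hom]
  simp only [Category.assoc, Iso.inv_hom_id, Category.comp_id]
  rw [h, tensorHom_comp_tensorHom_assoc]
  simp

lemma leftUnitor_monoidal_inv (X₁ X₂ : E) :
    ((λ_ X₁).inv ⊗ₘ (λ_ X₂).inv) ≫ tensorμ (𝟙_ E) X₁ (𝟙_ E) X₂ ≫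
      ((λ_ (𝟙_ E)).hom ▷ (X₁ ⊗ X₂)) = (λ_ (X₁ ⊗ X₂)).inv := by
  have h := leftUnitor_monoidal X₁ X₂
  rw [← cancel_mono (λ_ (X₁ ⊗ X₂)).hom]
  simp only [Category.assoc]
  rw [← h]
  simp

lemma rightUnitor_monoidal_inv (X₁ X₂ : E) :
    ((ρ_ X₁).inv ⊗ₘ (ρ_ X₂).inv) ≫ tensorμ X₁ (𝟙_ E) X₂ (𝟙_ E) ≫
      ((X₁ ⊗ X₂) ◁ (λ_ (𝟙_ E)).hom) = (ρ_ (X₁ ⊗ X₂)).inv := by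
  have h := rightUnitor_monoidal X₁ X₂
  rw [← cancel_mono (ρ_ (X₁ ⊗ X₂)).hom]
  simp only [Category.assoc]
  rw [← h]
  simp

end Shuffle

namespace SymMonECat

variable (E : Type u) [Category.{v} E] [MonoidalCategory E]

lemma unit_pair {E : Type u} [Category.{v} E] [MonoidalCategory E] :
    elPair (𝟙 (𝟙_ E)) (𝟙 (𝟙_ E)) ≫ (λ_ (𝟙_ E)).hom = 𝟙 _ := by
  simp [elPair]

/-- The enriched category with one object, whose mapping object is the unit of `E`. -/
@[reducible]
def unitEnriched : EnrichedCategory E PUnit.{w + 1} where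
  Hom _ _ := 𝟙_ E
  id _ := 𝟙 _
  comp _ _ _ := (λ_ _).hom
  comp_id _ _ := by rw [unitors_equal]; simp
  assoc _ _ _ _ := by simp [unitors_equal]

attribute [local instance] unitEnriched

variable {E}

lemma unit_elComp {x y z : PUnit.{w + 1}} {a b : 𝟙_ E ⟶ 𝟙_ E} (ha : a = 𝟙 _) (hb : b = 𝟙 _) :
    elComp (C := PUnit.{w + 1}) (x := x) (y := y) (z := z) a b = 𝟙 _ := by
  rw [ha, hb]
  exact unit_pair

lemma unit_elPost (x y z : PUnit.{w + 1}) :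
    elPost (C := PUnit.{w + 1}) (y := y) (y' := z) x (𝟙 (𝟙_ E)) = 𝟙 _ :=
  elPost_id (C := PUnit.{w + 1}) x y

lemma unit_elPre (x y z : PUnit.{w + 1}) :
    elPre (C := PUnit.{w + 1}) (x' := x) (x := y) (𝟙 (𝟙_ E)) z = 𝟙 _ :=
  elPre_id (C := PUnit.{w + 1}) y z

variable (E) [SymmetricCategory E]

/-- The unit symmetric monoidal enriched category. -/
def unit : SymMonECat.{v, u, w} E where
  carrier := PUnit
  enriched := unitEnriched E
  tObj _ _ := PUnit.unit
  tHom _ _ _ _ := (λ_ _).hom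
  one := PUnit.unit
  assoc _ _ _ := 𝟙 _
  assocInv _ _ _ := 𝟙 _
  lUnit _ := 𝟙 _
  lUnitInv _ := 𝟙 _
  rUnit _ := 𝟙 _
  rUnitInv _ := 𝟙 _
  comm _ _ := 𝟙 _
  tHom_id _ _ := unit_pair
  tHom_comp _ _ _ _ _ _ := by
    change ((λ_ (𝟙_ E)).hom ⊗ₘ (λ_ (𝟙_ E)).hom) ≫ (λ_ (𝟙_ E)).hom =
      tensorμ _ _ _ _ ≫ ((λ_ (𝟙_ E)).hom ⊗ₘ (λ_ (𝟙_ E)).hom) ≫ (λ_ (𝟙_ E)).hom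
    rw [tensorμ_unit, Category.id_comp]
  assoc_assocInv _ _ _ := unit_elComp rfl rfl
  assocInv_assoc _ _ _ := unit_elComp rfl rfl
  lUnit_lUnitInv _ := unit_elComp rfl rfl
  lUnitInv_lUnit _ := unit_elComp rfl rfl
  rUnit_rUnitInv _ := unit_elComp rfl rfl
  rUnitInv_rUnit _ := unit_elComp rfl rfl
  comm_comm _ _ := unit_elComp rfl rfl
  assoc_natural _ _ _ _ _ _ := by
    rw [unit_elPost, unit_elPre]
    change (λ_ (𝟙_ E)).hom ▷ 𝟙_ E ≫ (λ_ (𝟙_ E)).hom ≫ 𝟙 _ =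
      (α_ _ _ _).hom ≫ 𝟙_ E ◁ (λ_ (𝟙_ E)).hom ≫ (λ_ (𝟙_ E)).hom ≫ 𝟙 _
    simp [unitors_equal]
  lUnit_natural _ _ := by
    rw [unit_elPost, unit_elPre]
    change (λ_ (𝟙_ E)).inv ≫ 𝟙 _ ▷ 𝟙_ E ≫ (λ_ (𝟙_ E)).hom ≫ 𝟙 (𝟙_ E) = 𝟙 (𝟙_ E)
    simp
  rUnit_natural _ _ := by
    rw [unit_elPost, unit_elPre]
    change (ρ_ (𝟙_ E)).inv ≫ 𝟙_ E ◁ 𝟙 _ ≫ (λ_ (𝟙_ E)).hom ≫ 𝟙 (𝟙_ E) = 𝟙 (𝟙_ E)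
    simp [unitors_equal]
  comm_natural _ _ _ _ := by
    rw [unit_elPost, unit_elPre]
    change (λ_ (𝟙_ E)).hom ≫ 𝟙 _ = (β_ (𝟙_ E) (𝟙_ E)).hom ≫ (λ_ (𝟙_ E)).hom ≫ 𝟙 _
    rw [braiding_unit, Category.id_comp]
  pentagon _ _ _ _ :=
    (unit_elComp unit_pair (unit_elComp rfl unit_pair)).trans (unit_elComp rfl rfl).symm
  triangle _ _ := (unit_elComp rfl unit_pair).trans unit_pair.symm
  hexagon _ _ _ :=
    (unit_elComp rfl (unit_elComp rfl rfl)).trans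
      (unit_elComp unit_pair (unit_elComp rfl unit_pair)).symm

end SymMonECat

namespace LaxHom

variable {E : Type u} [Category.{v} E] [MonoidalCategory E] [SymmetricCategory E]
variable {C C' D D' : SymMonECat.{v, u, w} E}

open SymMonECat

lemma elComp_pair {x y z : (SymMonECat.tensor C D).carrier} {p : 𝟙_ E ⟶ (x ⟶[E] y)}
    {q : 𝟙_ E ⟶ (y ⟶[E] z)} {a : 𝟙_ E ⟶ (x.1 ⟶[E] y.1)} {b : 𝟙_ E ⟶ (x.2 ⟶[E] y.2)}
    {a' : 𝟙_ E ⟶ (y.1 ⟶[E] z.1)} {b' : 𝟙_ E ⟶ (y.2 ⟶[E] z.2)} (hp : p = elPair a b)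
    (hq : q = elPair a' b') : elComp p q = elPair (elComp a a') (elComp b b') := by
  subst hp hq
  exact prod_elComp a b a' b'

lemma tEl_pair {x x' y y' : (SymMonECat.tensor C D).carrier} {p : 𝟙_ E ⟶ (x ⟶[E] x')}
    {q : 𝟙_ E ⟶ (y ⟶[E] y')} {a : 𝟙_ E ⟶ (x.1 ⟶[E] x'.1)} {b : 𝟙_ E ⟶ (x.2 ⟶[E] x'.2)}
    {a' : 𝟙_ E ⟶ (y.1 ⟶[E] y'.1)} {b' : 𝟙_ E ⟶ (y.2 ⟶[E] y'.2)} (hp : p = elPair a b)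
    (hq : q = elPair a' b') :
    (SymMonECat.tensor C D).tEl p q = elPair (C.tEl a a') (D.tEl b b') := by
  subst hp hq
  exact prod_tEl a b a' b' _ _

lemma comp_pair {X Y X' Y' : E} {p : 𝟙_ E ⟶ X ⊗ Y} {a : 𝟙_ E ⟶ X} {b : 𝟙_ E ⟶ Y}
    {f : X ⟶ X'} {g : Y ⟶ Y'} (hp : p = elPair a b) :
    p ≫ (f ⊗ₘ g) = elPair (a ≫ f) (b ≫ g) := by
  subst hp
  exact elPair_comp a b f g

/-- The tensor product of lax symmetric monoidal functors. -/
def tensor (f : LaxHom C C') (g : LaxHom D D') :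
    LaxHom (SymMonECat.tensor C D) (SymMonECat.tensor C' D') where
  obj x := (f.obj x.1, g.obj x.2)
  map x y := f.map x.1 y.1 ⊗ₘ g.map x.2 y.2
  map_id x := by
    change elPair _ _ ≫ _ = elPair _ _
    rw [elPair_comp, f.map_id, g.map_id]
  map_comp x y z := by
    change (tensorμ _ _ _ _ ≫ (_ ⊗ₘ _)) ≫ (_ ⊗ₘ _) = (_ ⊗ₘ _) ≫ tensorμ _ _ _ _ ≫ (_ ⊗ₘ _)
    rw [tensorμ_natural_assoc, Category.assoc, tensorHom_comp_tensorHom, tensorHom_comp_tensorHom,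
      f.map_comp, g.map_comp]
  mu x y := elPair (f.mu x.1 y.1) (g.mu x.2 y.2)
  eps := elPair f.eps g.eps
  mu_natural x x' y y' := by
    have h1 := prod_elPost (C := C'.carrier) (D := D'.carrier)
      (C'.tObj (f.obj x.1) (f.obj y.1), D'.tObj (g.obj x.2) (g.obj y.2))
      (y := (C'.tObj (f.obj x'.1) (f.obj y'.1), D'.tObj (g.obj x'.2) (g.obj y'.2)))
      (z := (f.obj (C.tObj x'.1 y'.1), g.obj (D.tObj x'.2 y'.2)))
      (f.mu x'.1 y'.1) (g.mu x'.2 y'.2)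
    have h2 := prod_elPre (C := C'.carrier) (D := D'.carrier)
      (x := (C'.tObj (f.obj x.1) (f.obj y.1), D'.tObj (g.obj x.2) (g.obj y.2)))
      (y := (f.obj (C.tObj x.1 y.1), g.obj (D.tObj x.2 y.2)))
      (f.mu x.1 y.1) (g.mu x.2 y.2)
      (f.obj (C.tObj x'.1 y'.1), g.obj (D.tObj x'.2 y'.2))
    refine (congrArg (fun k => ((f.map _ _ ⊗ₘ g.map _ _) ⊗ₘ (f.map _ _ ⊗ₘ g.map _ _)) ≫
      (tensorμ _ _ _ _ ≫ (C'.tHom _ _ _ _ ⊗ₘ D'.tHom _ _ _ _)) ≫ k) h1).trans ?_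
    refine Eq.trans ?_ (congrArg (fun k => (tensorμ _ _ _ _ ≫ (C.tHom _ _ _ _ ⊗ₘ
      D.tHom _ _ _ _)) ≫ (f.map _ _ ⊗ₘ g.map _ _) ≫ k) h2).symm
    simp only [Category.assoc, tensorμ_natural_assoc, tensorHom_comp_tensorHom]
    rw [f.mu_natural, g.mu_natural]
  mu_assoc x y z := by
    refine (elComp_pair (tEl_pair rfl rfl) (elComp_pair rfl (comp_pair rfl))).trans ?_
    symm
    have h := tEl_pair (C := C') (D := D') (x := (f.obj x.1, g.obj x.2))
      (x' := (f.obj x.1, g.obj x.2)) (p := eId (C := (SymMonECat.tensor C' D').carrier) E (f.obj x.1, g.obj x.2))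
      (y := (C'.tObj (f.obj y.1) (f.obj z.1), D'.tObj (g.obj y.2) (g.obj z.2)))
      (y' := (f.obj (C.tObj y.1 z.1), g.obj (D.tObj y.2 z.2)))
      (q := elPair (f.mu y.1 z.1) (g.mu y.2 z.2)) rfl rfl
    refine (elComp_pair rfl (elComp_pair h rfl)).trans ?_
    exact (congrArg₂ elPair (f.mu_assoc x.1 y.1 z.1) (g.mu_assoc x.2 y.2 z.2)).symm
  mu_lUnit x :=
    (elComp_pair (tEl_pair rfl rfl) (elComp_pair rfl (comp_pair rfl))).trans
      (congrArg₂ elPair (f.mu_lUnit x.1) (g.mu_lUnit x.2))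
  mu_rUnit x :=
    (elComp_pair (tEl_pair rfl rfl) (elComp_pair rfl (comp_pair rfl))).trans
      (congrArg₂ elPair (f.mu_rUnit x.1) (g.mu_rUnit x.2))
  mu_comm x y := by
    refine (elComp_pair rfl (comp_pair rfl)).trans ?_
    symm
    refine (elComp_pair rfl rfl).trans ?_
    exact (congrArg₂ elPair (f.mu_comm x.1 y.1) (g.mu_comm x.2 y.2)).symm

end LaxHom

namespace MonTrans

variable {E : Type u} [Category.{v} E] [MonoidalCategory E] [SymmetricCategory E]
variable {C C' D D' : SymMonECat.{v, u, w} E}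

open SymMonECat

/-- The tensor product of monoidal enriched natural transformations. -/
def tensor {f f' : LaxHom C C'} {g g' : LaxHom D D'} (η : MonTrans f f') (θ : MonTrans g g') :
    MonTrans (f.tensor g) (f'.tensor g') where
  app x := elPair (η.app x.1) (θ.app x.2)
  natural x y := by
    have h1 := prod_elPost (C := C'.carrier) (D := D'.carrier)
      (f.obj x.1, g.obj x.2) (y := (f.obj y.1, g.obj y.2)) (z := (f'.obj y.1, g'.obj y.2))
      (η.app y.1) (θ.app y.2)
    have h2 := prod_elPre (C := C'.carrier) (D := D'.carrier)
      (x := (f.obj x.1, g.obj x.2)) (y := (f'.obj x.1, g'.obj x.2))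
      (η.app x.1) (θ.app x.2) (f'.obj y.1, g'.obj y.2)
    refine (congrArg (fun k => (f.map _ _ ⊗ₘ g.map _ _) ≫ k) h1).trans ?_
    refine Eq.trans ?_ (congrArg (fun k => (f'.map _ _ ⊗ₘ g'.map _ _) ≫ k) h2).symm
    simp only [tensorHom_comp_tensorHom]
    rw [η.natural, θ.natural]
  app_tensor x y := by
    refine (LaxHom.elComp_pair rfl rfl).trans ?_
    symm
    refine (LaxHom.elComp_pair (LaxHom.tEl_pair (C := C') (D := D') rfl rfl) rfl).trans ?_
    exact (congrArg₂ elPair (η.app_tensor x.1 y.1) (θ.app_tensor x.2 y.2)).symm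
  app_one := (LaxHom.elComp_pair rfl rfl).trans (congrArg₂ elPair η.app_one θ.app_one)

end MonTrans

section Shuffle

variable {E : Type u} [Category.{v} E] [MonoidalCategory E] [SymmetricCategory E]

lemma shuffle_assoc {X₁ X₂ X₃ Y₁ Y₂ Y₃ Z₁ Z₂ Z₃ : E} (f₁ : X₁ ⊗ Y₁ ⟶ Z₁) (f₂ : X₂ ⊗ Y₂ ⟶ Z₂)
    (f₃ : X₃ ⊗ Y₃ ⟶ Z₃) :
    (tensorμ (X₁ ⊗ X₂) X₃ (Y₁ ⊗ Y₂) Y₃ ≫ ((tensorμ X₁ X₂ Y₁ Y₂ ≫ (f₁ ⊗ₘ f₂)) ⊗ₘ f₃)) ≫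
      (α_ Z₁ Z₂ Z₃).hom =
    ((α_ X₁ X₂ X₃).hom ⊗ₘ (α_ Y₁ Y₂ Y₃).hom) ≫ tensorμ X₁ (X₂ ⊗ X₃) Y₁ (Y₂ ⊗ Y₃) ≫
      (f₁ ⊗ₘ (tensorμ X₂ X₃ Y₂ Y₃ ≫ (f₂ ⊗ₘ f₃))) := by
  have h := associator_monoidal X₁ X₂ X₃ Y₁ Y₂ Y₃
  have e1 : (tensorμ X₁ X₂ Y₁ Y₂ ≫ (f₁ ⊗ₘ f₂)) ⊗ₘ f₃ =
      tensorμ X₁ X₂ Y₁ Y₂ ▷ (X₃ ⊗ Y₃) ≫ ((f₁ ⊗ₘ f₂) ⊗ₘ f₃) := by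
    rw [← tensorHom_id, tensorHom_comp_tensorHom, Category.id_comp]
  have e2 : f₁ ⊗ₘ (tensorμ X₂ X₃ Y₂ Y₃ ≫ (f₂ ⊗ₘ f₃)) =
      (X₁ ⊗ Y₁) ◁ tensorμ X₂ X₃ Y₂ Y₃ ≫ (f₁ ⊗ₘ (f₂ ⊗ₘ f₃)) := by
    rw [← id_tensorHom, tensorHom_comp_tensorHom, Category.id_comp]
  rw [e1, e2, ← reassoc_of% h]
  simp only [Category.assoc, associator_naturality]

lemma shuffle_assocInv {X₁ X₂ X₃ Y₁ Y₂ Y₃ Z₁ Z₂ Z₃ : E} (f₁ : X₁ ⊗ Y₁ ⟶ Z₁) (f₂ : X₂ ⊗ Y₂ ⟶ Z₂)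
    (f₃ : X₃ ⊗ Y₃ ⟶ Z₃) :
    (tensorμ X₁ (X₂ ⊗ X₃) Y₁ (Y₂ ⊗ Y₃) ≫ (f₁ ⊗ₘ (tensorμ X₂ X₃ Y₂ Y₃ ≫ (f₂ ⊗ₘ f₃)))) ≫
      (α_ Z₁ Z₂ Z₃).inv =
    ((α_ X₁ X₂ X₃).inv ⊗ₘ (α_ Y₁ Y₂ Y₃).inv) ≫ tensorμ (X₁ ⊗ X₂) X₃ (Y₁ ⊗ Y₂) Y₃ ≫
      ((tensorμ X₁ X₂ Y₁ Y₂ ≫ (f₁ ⊗ₘ f₂)) ⊗ₘ f₃) := by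
  rw [Iso.comp_inv_eq, Category.assoc, shuffle_assoc, tensorHom_comp_tensorHom_assoc]
  simp

lemma shuffle_leftUnitor {X Y Z : E} (f : X ⊗ Y ⟶ Z) :
    (tensorμ (𝟙_ E) X (𝟙_ E) Y ≫ ((λ_ (𝟙_ E)).hom ⊗ₘ f)) ≫ (λ_ Z).hom =
      ((λ_ X).hom ⊗ₘ (λ_ Y).hom) ≫ f := by
  rw [leftUnitor_monoidal, MonoidalCategory.tensorHom_def]
  simp

lemma shuffle_leftUnitorInv {X Y Z : E} (f : X ⊗ Y ⟶ Z) :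
    f ≫ (λ_ Z).inv =
      ((λ_ X).inv ⊗ₘ (λ_ Y).inv) ≫ tensorμ (𝟙_ E) X (𝟙_ E) Y ≫ ((λ_ (𝟙_ E)).hom ⊗ₘ f) := by
  rw [Iso.comp_inv_eq, Category.assoc, shuffle_leftUnitor, tensorHom_comp_tensorHom_assoc]
  simp

lemma shuffle_rightUnitor {X Y Z : E} (f : X ⊗ Y ⟶ Z) :
    (tensorμ X (𝟙_ E) Y (𝟙_ E) ≫ (f ⊗ₘ (λ_ (𝟙_ E)).hom)) ≫ (ρ_ Z).hom =
      ((ρ_ X).hom ⊗ₘ (ρ_ Y).hom) ≫ f := by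
  rw [rightUnitor_monoidal, tensorHom_def']
  simp

lemma shuffle_rightUnitorInv {X Y Z : E} (f : X ⊗ Y ⟶ Z) :
    f ≫ (ρ_ Z).inv =
      ((ρ_ X).inv ⊗ₘ (ρ_ Y).inv) ≫ tensorμ X (𝟙_ E) Y (𝟙_ E) ≫ (f ⊗ₘ (λ_ (𝟙_ E)).hom) := by
  rw [Iso.comp_inv_eq, Category.assoc, shuffle_rightUnitor, tensorHom_comp_tensorHom_assoc]
  simp

lemma shuffle_braiding {X₁ X₂ Y₁ Y₂ Z₁ Z₂ : E} (f₁ : X₁ ⊗ Y₁ ⟶ Z₁) (f₂ : X₂ ⊗ Y₂ ⟶ Z₂) :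
    (tensorμ X₁ X₂ Y₁ Y₂ ≫ (f₁ ⊗ₘ f₂)) ≫ (β_ Z₁ Z₂).hom =
      ((β_ X₁ X₂).hom ⊗ₘ (β_ Y₁ Y₂).hom) ≫ tensorμ X₂ X₁ Y₂ Y₁ ≫ (f₂ ⊗ₘ f₁) := by
  have h := braiding_tensorμ X₁ X₂ Y₁ Y₂
  rw [reassoc_of% h, Category.assoc, BraidedCategory.braiding_naturality]

end Shuffle

namespace LaxHom

variable {E : Type u} [Category.{v} E] [MonoidalCategory E] [SymmetricCategory E]

open SymMonECat

lemma tEl_of_id {C : SymMonECat.{v, u, w} E} {x y : C.carrier} {p : 𝟙_ E ⟶ (x ⟶[E] x)}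
    {q : 𝟙_ E ⟶ (y ⟶[E] y)} (hp : p = eId E x) (hq : q = eId E y) :
    C.tEl p q = eId E (C.tObj x y) := by
  subst hp hq
  exact C.tEl_id x y

lemma id_id_elComp {C : Type w} [EnrichedCategory E C] {x y : C} {p q : 𝟙_ E ⟶ (x ⟶[E] x)}
    {r s : 𝟙_ E ⟶ (x ⟶[E] y)} (hp : p = eId E x) (hq : q = eId E x) (h : r = s) :
    elComp p (elComp q r) = s := by
  subst hp hq h
  rw [id_elComp, id_elComp]

lemma id_comm_elComp {C : Type w} [EnrichedCategory E C] {x y : C} {p : 𝟙_ E ⟶ (x ⟶[E] x)}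
    {q : 𝟙_ E ⟶ (y ⟶[E] y)}
    {r s : 𝟙_ E ⟶ (x ⟶[E] y)} (hp : p = eId E x) (hq : q = eId E y) (h : r = s) :
    elComp p r = elComp s q := by
  subst hp hq h
  rw [id_elComp, elComp_id]

lemma id_elComp_id {C : Type w} [EnrichedCategory E C] {x y : C} {p q : 𝟙_ E ⟶ (x ⟶[E] x)}
    {p' q' : 𝟙_ E ⟶ (y ⟶[E] y)} {r s : 𝟙_ E ⟶ (x ⟶[E] y)} (hp : p = eId E x) (hq : q = eId E x)
    (h : r = s) (hp' : p' = eId E y) (hq' : q' = eId E y) :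
    elComp p (elComp q r) = elComp s (elComp p' q') := by
  subst hp hq hp' hq' h
  rw [id_elComp, id_elComp, elComp_id, elComp_id]

lemma natural_of_id {C : Type w} [EnrichedCategory E C] {x y : C} {p : 𝟙_ E ⟶ (y ⟶[E] y)}
    {q : 𝟙_ E ⟶ (x ⟶[E] x)} {A B B' : E} {f : A ⟶ B} {g : B ⟶ (x ⟶[E] y)} {f' : A ⟶ B'}
    {g' : B' ⟶ (x ⟶[E] y)} (hp : p = eId E y) (hq : q = eId E x) (h : f' ≫ g' = f ≫ g) :
    f ≫ g ≫ elPost x p = f' ≫ g' ≫ elPre q y := by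
  rw [hp, hq, elPost_id, elPre_id, Category.comp_id, Category.comp_id, h]

variable (C D K : SymMonECat.{v, u, w} E)

/-- The associator. -/
def associator : LaxHom ((C.tensor D).tensor K) (C.tensor (D.tensor K)) where
  obj x := (x.1.1, (x.1.2, x.2))
  map _ _ := (α_ _ _ _).hom
  map_id _ := elPair_assoc _ _ _
  map_comp _ _ _ := shuffle_assoc _ _ _
  mu _ _ := eId E _
  eps := eId E _
  mu_natural _ _ _ _ :=
    natural_of_id rfl rfl (shuffle_assoc _ _ _)
  mu_assoc _ _ _ :=
    id_elComp_id (tEl_of_id rfl rfl) rfl (elPair_assoc _ _ _) (tEl_of_id rfl rfl) rfl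
  mu_lUnit _ := id_id_elComp (tEl_of_id rfl rfl) rfl (elPair_assoc _ _ _)
  mu_rUnit _ := id_id_elComp (tEl_of_id rfl rfl) rfl (elPair_assoc _ _ _)
  mu_comm _ _ := id_comm_elComp rfl rfl (elPair_assoc _ _ _)

/-- The inverse of the associator. -/
def associatorInv : LaxHom (C.tensor (D.tensor K)) ((C.tensor D).tensor K) where
  obj x := ((x.1, x.2.1), x.2.2)
  map _ _ := (α_ _ _ _).inv
  map_id _ := elPair_assocInv _ _ _
  map_comp _ _ _ := shuffle_assocInv _ _ _
  mu _ _ := eId E _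
  eps := eId E _
  mu_natural _ _ _ _ :=
    natural_of_id rfl rfl (shuffle_assocInv _ _ _)
  mu_assoc _ _ _ :=
    id_elComp_id (tEl_of_id rfl rfl) rfl (elPair_assocInv _ _ _) (tEl_of_id rfl rfl) rfl
  mu_lUnit _ := id_id_elComp (tEl_of_id rfl rfl) rfl (elPair_assocInv _ _ _)
  mu_rUnit _ := id_id_elComp (tEl_of_id rfl rfl) rfl (elPair_assocInv _ _ _)
  mu_comm _ _ := id_comm_elComp rfl rfl (elPair_assocInv _ _ _)

/-- The left unitor. -/
def leftUnitor : LaxHom ((SymMonECat.unit E).tensor C) C where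
  obj x := x.2
  map _ _ := (λ_ _).hom
  map_id _ := elPair_leftUnitor _
  map_comp _ _ _ := shuffle_leftUnitor _
  mu _ _ := eId E _
  eps := eId E _
  mu_natural _ _ _ _ :=
    natural_of_id rfl rfl (shuffle_leftUnitor _)
  mu_assoc _ _ _ :=
    id_elComp_id (tEl_of_id rfl rfl) rfl (elPair_leftUnitor _) (tEl_of_id rfl rfl) rfl
  mu_lUnit _ := id_id_elComp (tEl_of_id rfl rfl) rfl (elPair_leftUnitor _)
  mu_rUnit _ := id_id_elComp (tEl_of_id rfl rfl) rfl (elPair_leftUnitor _)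
  mu_comm _ _ := id_comm_elComp rfl rfl (elPair_leftUnitor _)

/-- The inverse of the left unitor. -/
def leftUnitorInv : LaxHom C ((SymMonECat.unit E).tensor C) where
  obj x := (PUnit.unit, x)
  map _ _ := (λ_ _).inv
  map_id _ := comp_leftUnitor_inv _
  map_comp _ _ _ := shuffle_leftUnitorInv _
  mu _ _ := eId E _
  eps := eId E _
  mu_natural _ _ _ _ :=
    natural_of_id rfl rfl (shuffle_leftUnitorInv _)
  mu_assoc _ _ _ :=
    id_elComp_id (tEl_of_id rfl rfl) rfl (comp_leftUnitor_inv _) (tEl_of_id rfl rfl) rfl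
  mu_lUnit _ := id_id_elComp (tEl_of_id rfl rfl) rfl (comp_leftUnitor_inv _)
  mu_rUnit _ := id_id_elComp (tEl_of_id rfl rfl) rfl (comp_leftUnitor_inv _)
  mu_comm _ _ := id_comm_elComp rfl rfl (comp_leftUnitor_inv _)

/-- The right unitor. -/
def rightUnitor : LaxHom (C.tensor (SymMonECat.unit E)) C where
  obj x := x.1
  map _ _ := (ρ_ _).hom
  map_id _ := elPair_rightUnitor _
  map_comp _ _ _ := shuffle_rightUnitor _
  mu _ _ := eId E _
  eps := eId E _
  mu_natural _ _ _ _ :=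
    natural_of_id rfl rfl (shuffle_rightUnitor _)
  mu_assoc _ _ _ :=
    id_elComp_id (tEl_of_id rfl rfl) rfl (elPair_rightUnitor _) (tEl_of_id rfl rfl) rfl
  mu_lUnit _ := id_id_elComp (tEl_of_id rfl rfl) rfl (elPair_rightUnitor _)
  mu_rUnit _ := id_id_elComp (tEl_of_id rfl rfl) rfl (elPair_rightUnitor _)
  mu_comm _ _ := id_comm_elComp rfl rfl (elPair_rightUnitor _)

/-- The inverse of the right unitor. -/
def rightUnitorInv : LaxHom C (C.tensor (SymMonECat.unit E)) where
  obj x := (x, PUnit.unit)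
  map _ _ := (ρ_ _).inv
  map_id _ := comp_rightUnitor_inv _
  map_comp _ _ _ := shuffle_rightUnitorInv _
  mu _ _ := eId E _
  eps := eId E _
  mu_natural _ _ _ _ :=
    natural_of_id rfl rfl (shuffle_rightUnitorInv _)
  mu_assoc _ _ _ :=
    id_elComp_id (tEl_of_id rfl rfl) rfl (comp_rightUnitor_inv _) (tEl_of_id rfl rfl) rfl
  mu_lUnit _ := id_id_elComp (tEl_of_id rfl rfl) rfl (comp_rightUnitor_inv _)
  mu_rUnit _ := id_id_elComp (tEl_of_id rfl rfl) rfl (comp_rightUnitor_inv _)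
  mu_comm _ _ := id_comm_elComp rfl rfl (comp_rightUnitor_inv _)

/-- The braiding. -/
def braiding : LaxHom (C.tensor D) (D.tensor C) where
  obj x := (x.2, x.1)
  map _ _ := (β_ _ _).hom
  map_id _ := elPair_braiding _ _
  map_comp _ _ _ := shuffle_braiding _ _
  mu _ _ := eId E _
  eps := eId E _
  mu_natural _ _ _ _ :=
    natural_of_id rfl rfl (shuffle_braiding _ _)
  mu_assoc _ _ _ :=
    id_elComp_id (tEl_of_id rfl rfl) rfl (elPair_braiding _ _) (tEl_of_id rfl rfl) rfl
  mu_lUnit _ := id_id_elComp (tEl_of_id rfl rfl) rfl (elPair_braiding _ _)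
  mu_rUnit _ := id_id_elComp (tEl_of_id rfl rfl) rfl (elPair_braiding _ _)
  mu_comm _ _ := id_comm_elComp rfl rfl (elPair_braiding _ _)

end LaxHom

namespace LaxHom

variable {E : Type u} [Category.{v} E] [MonoidalCategory E] [SymmetricCategory E]
variable {C C' C'' D D' D'' K K' L : SymMonECat.{v, u, w} E}

lemma elComp_eq_id {A : Type w} [EnrichedCategory E A] {x : A} {p q : 𝟙_ E ⟶ (x ⟶[E] x)}
    (hp : p = eId E x) (hq : q = eId E x) : elComp p q = eId E x := by
  subst hp hq
  exact id_elComp _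

lemma comp_map_eq_id (f : LaxHom C D) {x : C.carrier} {p : 𝟙_ E ⟶ (x ⟶[E] x)} (hp : p = eId E x) :
    p ≫ f.map x x = eId E (f.obj x) := by
  rw [hp, f.map_id]

lemma eq_of_eq_id {A : Type w} [EnrichedCategory E A] {x : A} {p q : 𝟙_ E ⟶ (x ⟶[E] x)}
    (hp : p = eId E x) (hq : q = eId E x) : p = q :=
  hp.trans hq.symm

lemma tensor_id : (LaxHom.id C).tensor (LaxHom.id D) = LaxHom.id (C.tensor D) :=
  ext_of rfl (heq_of_eq (by funext x y; exact id_tensorHom_id _ _)) HEq.rfl HEq.rfl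

lemma tensor_comp (f : LaxHom C C') (f' : LaxHom C' C'') (g : LaxHom D D') (g' : LaxHom D' D'') :
    (f.tensor g).comp (f'.tensor g') = (f.comp f').tensor (g.comp g') :=
  ext_of rfl (heq_of_eq (by funext x y; exact tensorHom_comp_tensorHom _ _ _ _))
    (heq_of_eq (by funext x y; exact elComp_pair rfl (comp_pair rfl)))
    (heq_of_eq (elComp_pair rfl (comp_pair rfl)))

lemma associator_naturality (f : LaxHom C C') (g : LaxHom D D') (h : LaxHom K K') :
    ((f.tensor g).tensor h).comp (associator C' D' K') =
      (associator C D K).comp (f.tensor (g.tensor h)) :=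
  ext_of rfl (heq_of_eq (by funext x y; exact MonoidalCategory.associator_naturality _ _ _))
    (heq_of_eq (by
      funext x y
      exact id_comm_elComp rfl (comp_map_eq_id (f.tensor (g.tensor h)) rfl) (elPair_assoc _ _ _)))
    (heq_of_eq (id_comm_elComp rfl (comp_map_eq_id (f.tensor (g.tensor h)) rfl)
      (elPair_assoc _ _ _)))

lemma leftUnitor_naturality (f : LaxHom C C') :
    ((LaxHom.id (SymMonECat.unit E)).tensor f).comp (leftUnitor C') =
      (leftUnitor C).comp f :=
  ext_of rfl (heq_of_eq (by
      funext x y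
      exact (congrArg (· ≫ _) (id_tensorHom _ _)).trans
        (MonoidalCategory.leftUnitor_naturality _)))
    (heq_of_eq (by
      funext x y
      exact id_comm_elComp rfl (comp_map_eq_id f rfl) (elPair_leftUnitor _)))
    (heq_of_eq (id_comm_elComp rfl (comp_map_eq_id f rfl) (elPair_leftUnitor _)))

lemma rightUnitor_naturality (f : LaxHom C C') :
    (f.tensor (LaxHom.id (SymMonECat.unit E))).comp (rightUnitor C') =
      (rightUnitor C).comp f :=
  ext_of rfl (heq_of_eq (by
      funext x y
      exact (congrArg (· ≫ _) (tensorHom_id _ _)).trans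
        (MonoidalCategory.rightUnitor_naturality _)))
    (heq_of_eq (by
      funext x y
      exact id_comm_elComp rfl (comp_map_eq_id f rfl) (elPair_rightUnitor _)))
    (heq_of_eq (id_comm_elComp rfl (comp_map_eq_id f rfl) (elPair_rightUnitor _)))

lemma braiding_naturality (f : LaxHom C C') (g : LaxHom D D') :
    (f.tensor g).comp (braiding C' D') = (braiding C D).comp (g.tensor f) :=
  ext_of rfl (heq_of_eq (by
      funext x y
      exact BraidedCategory.braiding_naturality _ _))
    (heq_of_eq (by
      funext x y
      exact id_comm_elComp rfl (comp_map_eq_id (g.tensor f) rfl) (elPair_braiding _ _)))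
    (heq_of_eq (id_comm_elComp rfl (comp_map_eq_id (g.tensor f) rfl) (elPair_braiding _ _)))

variable (C D K L)

lemma associator_inv : (associator C D K).comp (associatorInv C D K) = LaxHom.id _ :=
  ext_of rfl (heq_of_eq (by funext x y; exact Iso.hom_inv_id _))
    (heq_of_eq (by
      funext x y; exact elComp_eq_id rfl (comp_map_eq_id (associatorInv C D K) rfl)))
    (heq_of_eq (elComp_eq_id rfl (comp_map_eq_id (associatorInv C D K) rfl)))

lemma inv_associator : (associatorInv C D K).comp (associator C D K) = LaxHom.id _ :=
  ext_of rfl (heq_of_eq (by funext x y; exact Iso.inv_hom_id _))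
    (heq_of_eq (by
      funext x y; exact elComp_eq_id rfl (comp_map_eq_id (associator C D K) rfl)))
    (heq_of_eq (elComp_eq_id rfl (comp_map_eq_id (associator C D K) rfl)))

lemma leftUnitor_inv : (leftUnitor C).comp (leftUnitorInv C) = LaxHom.id _ :=
  ext_of rfl (heq_of_eq (by funext x y; exact Iso.hom_inv_id _))
    (heq_of_eq (by
      funext x y; exact elComp_eq_id rfl (comp_map_eq_id (leftUnitorInv C) rfl)))
    (heq_of_eq (elComp_eq_id rfl (comp_map_eq_id (leftUnitorInv C) rfl)))

lemma inv_leftUnitor : (leftUnitorInv C).comp (leftUnitor C) = LaxHom.id _ :=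
  ext_of rfl (heq_of_eq (by funext x y; exact Iso.inv_hom_id _))
    (heq_of_eq (by
      funext x y; exact elComp_eq_id rfl (comp_map_eq_id (leftUnitor C) rfl)))
    (heq_of_eq (elComp_eq_id rfl (comp_map_eq_id (leftUnitor C) rfl)))

lemma rightUnitor_inv : (rightUnitor C).comp (rightUnitorInv C) = LaxHom.id _ :=
  ext_of rfl (heq_of_eq (by funext x y; exact Iso.hom_inv_id _))
    (heq_of_eq (by
      funext x y; exact elComp_eq_id rfl (comp_map_eq_id (rightUnitorInv C) rfl)))
    (heq_of_eq (elComp_eq_id rfl (comp_map_eq_id (rightUnitorInv C) rfl)))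

lemma inv_rightUnitor : (rightUnitorInv C).comp (rightUnitor C) = LaxHom.id _ :=
  ext_of rfl (heq_of_eq (by funext x y; exact Iso.inv_hom_id _))
    (heq_of_eq (by
      funext x y; exact elComp_eq_id rfl (comp_map_eq_id (rightUnitor C) rfl)))
    (heq_of_eq (elComp_eq_id rfl (comp_map_eq_id (rightUnitor C) rfl)))

lemma braiding_braiding : (braiding C D).comp (braiding D C) = LaxHom.id _ :=
  ext_of rfl (heq_of_eq (by funext x y; exact SymmetricCategory.symmetry _ _))
    (heq_of_eq (by
      funext x y; exact elComp_eq_id rfl (comp_map_eq_id (braiding D C) rfl)))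
    (heq_of_eq (elComp_eq_id rfl (comp_map_eq_id (braiding D C) rfl)))

lemma pentagon : ((associator C D K).tensor (LaxHom.id L)).comp
      ((associator C (D.tensor K) L).comp ((LaxHom.id C).tensor (associator D K L))) =
    (associator (C.tensor D) K L).comp (associator C D (K.tensor L)) :=
  ext_of rfl (heq_of_eq (by
      funext x y
      refine Eq.trans ?_ (MonoidalCategory.pentagon _ _ _ _)
      exact congrArg₂ (fun a b => a ≫ (α_ _ _ _).hom ≫ b) (tensorHom_id _ _) (id_tensorHom _ _)))
    (heq_of_eq (by
      funext x y
      exact eq_of_eq_id (elComp_eq_id (elComp_eq_id rfl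
        (comp_map_eq_id ((LaxHom.id C).tensor (associator D K L)) rfl))
        (comp_map_eq_id ((associator C (D.tensor K) L).comp
          ((LaxHom.id C).tensor (associator D K L))) rfl))
        (elComp_eq_id rfl (comp_map_eq_id (associator C D (K.tensor L)) rfl))))
    (heq_of_eq (eq_of_eq_id (elComp_eq_id (elComp_eq_id rfl
        (comp_map_eq_id ((LaxHom.id C).tensor (associator D K L)) rfl))
        (comp_map_eq_id ((associator C (D.tensor K) L).comp
          ((LaxHom.id C).tensor (associator D K L))) rfl))
        (elComp_eq_id rfl (comp_map_eq_id (associator C D (K.tensor L)) rfl))))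

lemma triangle : (associator C (SymMonECat.unit E) D).comp
      ((LaxHom.id C).tensor (leftUnitor D)) = (rightUnitor C).tensor (LaxHom.id D) :=
  ext_of rfl (heq_of_eq (by
      funext x y
      exact (congrArg (_ ≫ ·) (id_tensorHom _ _)).trans
        ((MonoidalCategory.triangle _ _).trans (tensorHom_id _ _).symm)))
    (heq_of_eq (by
      funext x y
      exact elComp_eq_id rfl (comp_map_eq_id ((LaxHom.id C).tensor (leftUnitor D)) rfl)))
    (heq_of_eq (elComp_eq_id rfl (comp_map_eq_id ((LaxHom.id C).tensor (leftUnitor D)) rfl)))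

lemma hexagon_forward : (associator C D K).comp
      ((braiding C (D.tensor K)).comp (associator D K C)) =
    ((braiding C D).tensor (LaxHom.id K)).comp
      ((associator D C K).comp ((LaxHom.id D).tensor (braiding C K))) :=
  ext_of rfl (heq_of_eq (by
      funext x y
      refine (BraidedCategory.hexagon_forward _ _ _).trans ?_
      exact congrArg₂ (fun a b => a ≫ (α_ _ _ _).hom ≫ b) (tensorHom_id _ _).symm
        (id_tensorHom _ _).symm))
    (heq_of_eq (by
      funext x y
      exact eq_of_eq_id (elComp_eq_id (elComp_eq_id rfl
        (comp_map_eq_id (associator D K C) rfl))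
        (comp_map_eq_id ((braiding C (D.tensor K)).comp (associator D K C)) rfl))
        (elComp_eq_id (elComp_eq_id rfl
          (comp_map_eq_id ((LaxHom.id D).tensor (braiding C K)) rfl))
          (comp_map_eq_id ((associator D C K).comp
            ((LaxHom.id D).tensor (braiding C K))) rfl))))
    (heq_of_eq (eq_of_eq_id (elComp_eq_id (elComp_eq_id rfl
        (comp_map_eq_id (associator D K C) rfl))
        (comp_map_eq_id ((braiding C (D.tensor K)).comp (associator D K C)) rfl))
        (elComp_eq_id (elComp_eq_id rfl
          (comp_map_eq_id ((LaxHom.id D).tensor (braiding C K)) rfl))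
          (comp_map_eq_id ((associator D C K).comp
            ((LaxHom.id D).tensor (braiding C K))) rfl))))

lemma hexagon_reverse : (associatorInv C D K).comp
      ((braiding (C.tensor D) K).comp (associatorInv K C D)) =
    ((LaxHom.id C).tensor (braiding D K)).comp
      ((associatorInv C K D).comp ((braiding C K).tensor (LaxHom.id D))) :=
  ext_of rfl (heq_of_eq (by
      funext x y
      refine (BraidedCategory.hexagon_reverse _ _ _).trans ?_
      exact congrArg₂ (fun a b => a ≫ (α_ _ _ _).inv ≫ b) (id_tensorHom _ _).symm
        (tensorHom_id _ _).symm))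
    (heq_of_eq (by
      funext x y
      exact eq_of_eq_id (elComp_eq_id (elComp_eq_id rfl
        (comp_map_eq_id (associatorInv K C D) rfl))
        (comp_map_eq_id ((braiding (C.tensor D) K).comp (associatorInv K C D)) rfl))
        (elComp_eq_id (elComp_eq_id rfl
          (comp_map_eq_id ((braiding C K).tensor (LaxHom.id D)) rfl))
          (comp_map_eq_id ((associatorInv C K D).comp
            ((braiding C K).tensor (LaxHom.id D))) rfl))))
    (heq_of_eq (eq_of_eq_id (elComp_eq_id (elComp_eq_id rfl
        (comp_map_eq_id (associatorInv K C D) rfl))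
        (comp_map_eq_id ((braiding (C.tensor D) K).comp (associatorInv K C D)) rfl))
        (elComp_eq_id (elComp_eq_id rfl
          (comp_map_eq_id ((braiding C K).tensor (LaxHom.id D)) rfl))
          (comp_map_eq_id ((associatorInv C K D).comp
            ((braiding C K).tensor (LaxHom.id D))) rfl))))

end LaxHom

section SymMonInstances

variable {E : Type u} [Category.{v} E] [MonoidalCategory E] [SymmetricCategory E]

instance : MonoidalCategoryStruct (SymMonECat.{v, u, w} E) where
  tensorObj C D := C.tensor D
  whiskerLeft C _ _ f := (LaxHom.id C).tensor f
  whiskerRight f D := LaxHom.tensor f (LaxHom.id D)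
  tensorHom f g := LaxHom.tensor f g
  tensorUnit := SymMonECat.unit E
  associator C D K :=
    { hom := LaxHom.associator C D K
      inv := LaxHom.associatorInv C D K
      hom_inv_id := LaxHom.associator_inv C D K
      inv_hom_id := LaxHom.inv_associator C D K }
  leftUnitor C :=
    { hom := LaxHom.leftUnitor C
      inv := LaxHom.leftUnitorInv C
      hom_inv_id := LaxHom.leftUnitor_inv C
      inv_hom_id := LaxHom.inv_leftUnitor C }
  rightUnitor C :=
    { hom := LaxHom.rightUnitor C
      inv := LaxHom.rightUnitorInv C
      hom_inv_id := LaxHom.rightUnitor_inv C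
      inv_hom_id := LaxHom.inv_rightUnitor C }

/-- The symmetric monoidal structure on the category of symmetric monoidal enriched categories and
lax symmetric monoidal functors. -/
instance : MonoidalCategory (SymMonECat.{v, u, w} E) :=
  MonoidalCategory.ofTensorHom
    (fun _ _ => LaxHom.tensor_id)
    (fun _ _ _ _ => rfl) (fun _ _ => rfl)
    (fun f g f' g' => LaxHom.tensor_comp f f' g g')
    (fun f g h => LaxHom.associator_naturality f g h)
    (fun f => LaxHom.leftUnitor_naturality f)
    (fun f => LaxHom.rightUnitor_naturality f)
    (fun C D K L => LaxHom.pentagon C D K L)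
    (fun C D => LaxHom.triangle C D)

instance : SymmetricCategory (SymMonECat.{v, u, w} E) where
  braiding C D :=
    { hom := LaxHom.braiding C D
      inv := LaxHom.braiding D C
      hom_inv_id := LaxHom.braiding_braiding C D
      inv_hom_id := LaxHom.braiding_braiding D C }
  braiding_naturality_right C _ _ f := LaxHom.braiding_naturality (LaxHom.id C) f
  braiding_naturality_left f D := LaxHom.braiding_naturality f (LaxHom.id D)
  hexagon_forward C D K := LaxHom.hexagon_forward C D K
  hexagon_reverse C D K := LaxHom.hexagon_reverse C D K
  symmetry C D := LaxHom.braiding_braiding C D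

instance : MonoidalContext (SymMonECat.{v, u, w} E) where
  tensor₂ η θ := MonTrans.tensor η θ
  tensor₂_id f g := MonTrans.hom_ext fun x => rfl
  tensor₂_comp η η' θ θ' := MonTrans.hom_ext fun x => by symm; exact LaxHom.elComp_pair rfl rfl
  tensor₂_whiskerLeft f g _ _ _ _ η θ := MonTrans.eq_conj _ _ fun x => HEq.rfl
  tensor₂_whiskerRight η θ h k := MonTrans.eq_conj _ _ fun x =>
    heq_of_eq (elPair_comp _ _ _ _).symm
  associator_naturality₂ η θ ζ := MonTrans.eq_conj _ _ fun x =>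
    heq_of_eq (elPair_assoc _ _ _)
  leftUnitor_naturality₂ η := MonTrans.eq_conj _ _ fun x =>
    heq_of_eq (elPair_leftUnitor _)
  rightUnitor_naturality₂ η := MonTrans.eq_conj _ _ fun x =>
    heq_of_eq (elPair_rightUnitor _)
  braiding_naturality₂ η θ := MonTrans.eq_conj _ _ fun x =>
    heq_of_eq (elPair_braiding _ _)

end SymMonInstances

/-! ### Enriched operads -/

/-- Position of the input `j ≠ i` of an operation, after an operation of arity `m` has been
substituted into the input `i`. -/
def OuterPos {n : ℕ} (i : Fin n) (m : ℕ) (j : Fin n) (p : ℕ) : Prop :=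
  (j < i ∧ p = j.val) ∨ (i < j ∧ p + 1 = j.val + m)

/-- `g` is the list of inputs obtained from the list `c` by replacing its `i`-th entry by the
list `e`. -/
structure IsGraft {O : Type w} {n m k : ℕ} (i : Fin n) (c : Fin n → O) (e : Fin m → O)
    (g : Fin k → O) : Prop where
  length : k + 1 = n + m
  outer (j : Fin n) (p : Fin k) : OuterPos i m j p.val → g p = c j
  inner (j : Fin m) (p : Fin k) : p.val = i.val + j.val → g p = e j

/-- `ρ` is the permutation of the inputs of a partial composite at `i` which is induced by the
permutations `σ` of the inputs of the outer operation and `τ` of those of the inner operation. -/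
structure IsGraftPerm {n m k : ℕ} (i : Fin n) (σ : Equiv.Perm (Fin n)) (τ : Equiv.Perm (Fin m))
    (ρ : Equiv.Perm (Fin k)) : Prop where
  outer (j : Fin n) (p : Fin k) : OuterPos i m j p.val → OuterPos (σ i) m (σ j) (ρ p).val
  inner (j : Fin m) (p : Fin k) : p.val = i.val + j.val → (ρ p).val = (σ i).val + (τ j).val

namespace IsGraft

variable {O : Type w} {n m k : ℕ} {i : Fin n} {c : Fin n → O} {e : Fin m → O} {g : Fin k → O}

lemma map {O' : Type w} (h : IsGraft i c e g) (f : O → O') :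
    IsGraft i (fun j => f (c j)) (fun j => f (e j)) (fun j => f (g j)) where
  length := h.length
  outer j p hp := congrArg f (h.outer j p hp)
  inner j p hp := congrArg f (h.inner j p hp)

lemma one_left (x : O) : IsGraft (0 : Fin 1) (fun _ => x) e e where
  length := by omega
  outer j p hp := by
    rcases hp with ⟨h, _⟩ | ⟨h, _⟩ <;> exact absurd (Subsingleton.elim j 0) (by omega)
  inner j p hp := congrArg e (Fin.ext (by simpa using hp))

lemma one_right {x : O} {c' : Fin n → O} (h : ∀ j, j ≠ i → c' j = c j) (hx : c' i = x) :
    IsGraft i c (fun _ : Fin 1 => x) c' where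
  length := rfl
  outer j p hp := by
    have h1 : p = j := by
      rcases hp with ⟨_, h⟩ | ⟨_, h⟩ <;> exact Fin.ext (by omega)
    have h2 : j ≠ i := by
      rcases hp with ⟨h, _⟩ | ⟨h, _⟩ <;> omega
    rw [h1, h j h2]
  inner j p hp := by
    have h1 : p = i := Fin.ext (by omega)
    rw [h1, hx]

end IsGraft

/-- The data of a (coloured, symmetric) operad enriched in `E`. -/
structure OperadData (E : Type u) [Category.{v} E] [MonoidalCategory E] where
  /-- The objects, or colours. -/
  Ob : Type w
  /-- The operations with inputs `c` and output `d`. -/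
  obj {n : ℕ} (c : Fin n → Ob) (d : Ob) : E
  /-- The action of permutations of the inputs. -/
  act {n : ℕ} {c c' : Fin n → Ob} (σ : Equiv.Perm (Fin n)) (h : ∀ i, c' i = c (σ i)) (d : Ob) :
    obj c d ⟶ obj c' d
  /-- Partial composition: an operation with output `x` is substituted into the `i`-th input. -/
  comp {n m k : ℕ} {c : Fin n → Ob} {e : Fin m → Ob} {g : Fin k → Ob} (i : Fin n) {x : Ob}
    (hx : c i = x) (hg : IsGraft i c e g) (d : Ob) : obj c d ⊗ obj e x ⟶ obj g d
  /-- The identity operations. -/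
  unit (x : Ob) : 𝟙_ E ⟶ obj (fun _ : Fin 1 => x) x

section Operads

variable {E : Type u} [Category.{v} E] [MonoidalCategory E]

namespace OperadData

/-- The laws of a (coloured, symmetric) enriched operad. -/
structure IsOperad [SymmetricCategory E] (P : OperadData.{v, u, w} E) : Prop where
  act_one {n : ℕ} (c : Fin n → P.Ob) (d : P.Ob) :
    P.act (c := c) (c' := c) 1 (fun _ => rfl) d = 𝟙 _
  act_mul {n : ℕ} {c c' c'' : Fin n → P.Ob} (σ τ : Equiv.Perm (Fin n))
    (h : ∀ i, c' i = c (σ i)) (h' : ∀ i, c'' i = c' (τ i)) (h'' : ∀ i, c'' i = c ((σ * τ) i))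
    (d : P.Ob) : P.act σ h d ≫ P.act τ h' d = P.act (σ * τ) h'' d
  unit_comp {n : ℕ} (c : Fin n → P.Ob) (d : P.Ob) :
    (λ_ _).inv ≫ P.unit d ▷ P.obj c d ≫ P.comp 0 rfl (IsGraft.one_left d) d = 𝟙 _
  comp_unit {n : ℕ} (c : Fin n → P.Ob) (i : Fin n) (d : P.Ob) :
    (ρ_ _).inv ≫ P.obj c d ◁ P.unit (c i) ≫
      P.comp i rfl (IsGraft.one_right (fun _ _ => rfl) rfl) d = 𝟙 (P.obj c d)
  /-- Associativity of the substitution into an input of the inner operation. -/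
  assoc_seq {n m l k k' r : ℕ} {c : Fin n → P.Ob} {e : Fin m → P.Ob} {f : Fin l → P.Ob}
    {s : Fin k → P.Ob} {s' : Fin k' → P.Ob} {t : Fin r → P.Ob} (i : Fin n) (j : Fin m)
    (i' : Fin k) {x y : P.Ob} (hx : c i = x) (hy : e j = y) (hy' : s i' = y)
    (hi' : i'.val = i.val + j.val) (hs : IsGraft i c e s) (hst : IsGraft i' s f t)
    (hs' : IsGraft j e f s') (hst' : IsGraft i c s' t) (d : P.Ob) :
    P.comp i hx hs d ▷ P.obj f y ≫ P.comp i' hy' hst d =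
      (α_ _ _ _).hom ≫ P.obj c d ◁ P.comp j hy hs' x ≫ P.comp i hx hst' d
  /-- Commutation of the substitutions into two different inputs. -/
  assoc_par {n m l k k' r : ℕ} {c : Fin n → P.Ob} {e : Fin m → P.Ob} {f : Fin l → P.Ob}
    {s : Fin k → P.Ob} {s' : Fin k' → P.Ob} {t : Fin r → P.Ob} (i j : Fin n) (hij : i ≠ j)
    (i' : Fin k') (j' : Fin k) {x y : P.Ob} (hx : c i = x) (hy : c j = y) (hx' : s' i' = x)
    (hy' : s j' = y) (hi' : OuterPos j l i i'.val) (hj' : OuterPos i m j j'.val)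
    (hs : IsGraft i c e s) (hst : IsGraft j' s f t) (hs' : IsGraft j c f s')
    (hst' : IsGraft i' s' e t) (d : P.Ob) :
    P.comp i hx hs d ▷ P.obj f y ≫ P.comp j' hy' hst d =
      (α_ _ _ _).hom ≫ P.obj c d ◁ (β_ _ _).hom ≫ (α_ _ _ _).inv ≫
        P.comp j hy hs' d ▷ P.obj e x ≫ P.comp i' hx' hst' d
  act_comp {n m k : ℕ} {c c' : Fin n → P.Ob} {e e' : Fin m → P.Ob} {g g' : Fin k → P.Ob}
    (i : Fin n) {x : P.Ob} (σ : Equiv.Perm (Fin n)) (τ : Equiv.Perm (Fin m))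
    (ρ : Equiv.Perm (Fin k)) (hρ : IsGraftPerm i σ τ ρ) (hσ : ∀ j, c' j = c (σ j))
    (hτ : ∀ j, e' j = e (τ j)) (h : ∀ j, g' j = g (ρ j)) (hx : c (σ i) = x) (hx' : c' i = x)
    (hg : IsGraft (σ i) c e g) (hg' : IsGraft i c' e' g') (d : P.Ob) :
    (P.act σ hσ d ⊗ₘ P.act τ hτ x) ≫ P.comp i hx' hg' d = P.comp (σ i) hx hg d ≫ P.act ρ h d

variable (P : OperadData.{v, u, w} E)

/-- Composition with a unary operation, on the output. -/
def post {n : ℕ} (c : Fin n → P.Ob) {d d' : P.Ob} (b : 𝟙_ E ⟶ P.obj (fun _ : Fin 1 => d) d') :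
    P.obj c d ⟶ P.obj c d' :=
  (λ_ _).inv ≫ b ▷ P.obj c d ≫ P.comp 0 rfl (IsGraft.one_left d) d'

/-- Composition with a unary operation, on the `i`-th input; the list of inputs `c'` is obtained
from `c` by replacing the `i`-th entry. -/
def preAt {n : ℕ} {c c' : Fin n → P.Ob} (i : Fin n) {x y : P.Ob}
    (a : 𝟙_ E ⟶ P.obj (fun _ : Fin 1 => y) x) (hx : c i = x) (hy : c' i = y)
    (h : ∀ j, j ≠ i → c' j = c j) (d : P.Ob) : P.obj c d ⟶ P.obj c' d :=
  (ρ_ _).inv ≫ P.obj c d ◁ a ≫ P.comp i hx (IsGraft.one_right h hy) d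

/-- Composition with unary operations on the first `t` inputs. -/
def preUpTo {n : ℕ} {x y : Fin n → P.Ob} (a : ∀ j, 𝟙_ E ⟶ P.obj (fun _ : Fin 1 => y j) (x j))
    (d : P.Ob) : ∀ (t : ℕ) (ht : t ≤ n) (c c' : Fin n → P.Ob) (hc : ∀ j, j.val < t → c j = x j)
      (hc' : ∀ j, c' j = if j.val < t then y j else c j), (P.obj c d ⟶ P.obj c' d)
  | 0, _, c, c', _, hc' => eqToHom (by
      have : c' = c := funext fun j => by simpa using hc' j
      rw [this])
  | t + 1, ht, c, c', hc, hc' =>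
    preUpTo a d t (Nat.le_of_succ_le ht) c (fun j => if j.val < t then y j else c j)
        (fun j hj => hc j (by omega)) (fun _ => rfl) ≫
      P.preAt ⟨t, ht⟩ (a ⟨t, ht⟩) (by simpa using hc ⟨t, ht⟩ (Nat.lt_succ_self t))
        (by simpa using hc' ⟨t, ht⟩)
        (fun j hj => by
          have h1 : j.val ≠ t := fun h => hj (Fin.ext h)
          have h2 : j.val < t + 1 ↔ j.val < t := by omega
          rw [hc' j]
          simp only [h2]) d

/-- Composition with unary operations on all inputs. -/
def pre {n : ℕ} {x y : Fin n → P.Ob} (a : ∀ j, 𝟙_ E ⟶ P.obj (fun _ : Fin 1 => y j) (x j))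
    (d : P.Ob) : P.obj x d ⟶ P.obj y d :=
  P.preUpTo a d n le_rfl x y (fun _ _ => rfl) (fun j => by simp)

/-- Composition of unary operations: `b` after `a`. -/
def uComp {x y z : P.Ob} (b : 𝟙_ E ⟶ P.obj (fun _ : Fin 1 => y) z)
    (a : 𝟙_ E ⟶ P.obj (fun _ : Fin 1 => x) y) : 𝟙_ E ⟶ P.obj (fun _ : Fin 1 => x) z :=
  elPair b a ≫ P.comp 0 rfl (IsGraft.one_left y) z

end OperadData

end Operads

/-- An enriched operad. -/
structure EnrichedOperad (E : Type u) [Category.{v} E] [MonoidalCategory E] [SymmetricCategory E]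
    extends OperadData.{v, u, w} E where
  isOperad : toOperadData.IsOperad

/-- The data of a morphism of enriched operads. -/
structure OperadHomData {E : Type u} [Category.{v} E] [MonoidalCategory E]
    (P Q : OperadData.{v, u, w} E) where
  /-- The map on objects. -/
  onOb : P.Ob → Q.Ob
  /-- The map on operations. -/
  map {n : ℕ} (c : Fin n → P.Ob) (d : P.Ob) : P.obj c d ⟶ Q.obj (fun j => onOb (c j)) (onOb d)

/-- The laws of a morphism of enriched operads. -/
structure OperadHomData.IsHom {E : Type u} [Category.{v} E] [MonoidalCategory E]
    {P Q : OperadData.{v, u, w} E} (f : OperadHomData P Q) : Prop where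
  map_act {n : ℕ} {c c' : Fin n → P.Ob} (σ : Equiv.Perm (Fin n)) (h : ∀ i, c' i = c (σ i))
    (d : P.Ob) :
    P.act σ h d ≫ f.map c' d = f.map c d ≫ Q.act σ (fun i => congrArg f.onOb (h i)) (f.onOb d)
  map_comp {n m k : ℕ} {c : Fin n → P.Ob} {e : Fin m → P.Ob} {g : Fin k → P.Ob} (i : Fin n)
    {x : P.Ob} (hx : c i = x) (hg : IsGraft i c e g) (d : P.Ob) :
    P.comp i hx hg d ≫ f.map g d =
      (f.map c d ⊗ₘ f.map e x) ≫ Q.comp i (congrArg f.onOb hx) (hg.map f.onOb) (f.onOb d)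
  map_unit (x : P.Ob) : P.unit x ≫ f.map _ x = Q.unit (f.onOb x)

/-- A morphism of enriched operads. -/
structure OperadHom {E : Type u} [Category.{v} E] [MonoidalCategory E]
    (P Q : OperadData.{v, u, w} E) extends OperadHomData P Q where
  isHom : toOperadHomData.IsHom

/-- Naturality for a family of unary operations `f(x) ⟶ g(x)`. -/
def IsOperadTrans {E : Type u} [Category.{v} E] [MonoidalCategory E]
    {P Q : OperadData.{v, u, w} E} (f g : OperadHomData P Q)
    (app : ∀ x : P.Ob, 𝟙_ E ⟶ Q.obj (fun _ : Fin 1 => f.onOb x) (g.onOb x)) : Prop :=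
  ∀ {n : ℕ} (c : Fin n → P.Ob) (d : P.Ob),
    f.map c d ≫ Q.post (fun j => f.onOb (c j)) (app d) =
      g.map c d ≫ Q.pre (fun j => app (c j)) (g.onOb d)

/-- A natural transformation between morphisms of enriched operads. -/
@[ext]
structure OperadTrans {E : Type u} [Category.{v} E] [MonoidalCategory E]
    {P Q : OperadData.{v, u, w} E} (f g : OperadHom P Q) where
  /-- The components. -/
  app (x : P.Ob) : 𝟙_ E ⟶ Q.obj (fun _ : Fin 1 => f.onOb x) (g.onOb x)
  natural : IsOperadTrans f.toOperadHomData g.toOperadHomData app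

section OperadLemmas

variable {E : Type u} [Category.{v} E] [MonoidalCategory E]

lemma whiskerLeft_elPair (X : E) {Y Z : E} (a : 𝟙_ E ⟶ Y) (b : 𝟙_ E ⟶ Z) :
    (ρ_ X).inv ≫ (ρ_ (X ⊗ 𝟙_ E)).inv ≫ (X ⊗ 𝟙_ E) ◁ b ≫ (X ◁ a) ▷ Z ≫ (α_ X Y Z).hom =
      (ρ_ X).inv ≫ X ◁ elPair a b := by
  rw [elPair_eq_right, whisker_exchange_assoc]
  simp

namespace OperadData

variable (P : OperadData.{v, u, w} E)

lemma comp_post {x d d' : P.Ob} (a : 𝟙_ E ⟶ P.obj (fun _ : Fin 1 => x) d)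
    (b : 𝟙_ E ⟶ P.obj (fun _ : Fin 1 => d) d') :
    a ≫ P.post (fun _ => x) b = P.uComp b a := by
  simp [post, uComp, elPair_eq_left]

lemma comp_preAt {x y d : P.Ob} (b : 𝟙_ E ⟶ P.obj (fun _ : Fin 1 => y) d)
    (a : 𝟙_ E ⟶ P.obj (fun _ : Fin 1 => x) y) (hx hy h) :
    b ≫ P.preAt (c := fun _ : Fin 1 => y) (c' := fun _ : Fin 1 => x) 0 a hx hy h d =
      P.uComp b a := by
  simp [preAt, uComp, elPair_eq_right]

lemma preUpTo_zero {n : ℕ} {x y : Fin n → P.Ob}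
    (a : ∀ j, 𝟙_ E ⟶ P.obj (fun _ : Fin 1 => y j) (x j)) (d : P.Ob) (ht : 0 ≤ n)
    (c : Fin n → P.Ob) (hc hc') : P.preUpTo a d 0 ht c c hc hc' = 𝟙 _ :=
  eqToHom_refl _ _

lemma preUpTo_succ {n : ℕ} {x y : Fin n → P.Ob}
    (a : ∀ j, 𝟙_ E ⟶ P.obj (fun _ : Fin 1 => y j) (x j)) (d : P.Ob) (t : ℕ) (ht : t + 1 ≤ n)
    (c c₁ c' : Fin n → P.Ob) (hc : ∀ j, j.val < t + 1 → c j = x j)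
    (hc' : ∀ j, c' j = if j.val < t + 1 then y j else c j)
    (hc₁ : ∀ j, c₁ j = if j.val < t then y j else c j) :
    P.preUpTo a d (t + 1) ht c c' hc hc' =
      P.preUpTo a d t (Nat.le_of_succ_le ht) c c₁ (fun j hj => hc j (by omega)) hc₁ ≫
        P.preAt ⟨t, ht⟩ (a ⟨t, ht⟩)
          (by rw [hc₁, if_neg (lt_irrefl t)]; exact hc ⟨t, ht⟩ (Nat.lt_succ_self t))
          (by rw [hc', if_pos (Nat.lt_succ_self t)])
          (fun j hj => by
            have h1 : j.val ≠ t := fun h => hj (Fin.ext h)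
            have h2 : j.val < t + 1 ↔ j.val < t := by omega
            rw [hc' j, hc₁ j]
            simp only [h2]) d := by
  obtain rfl : c₁ = fun j => if j.val < t then y j else c j := funext hc₁
  rfl

lemma comp_pre {x y d : P.Ob} (b : 𝟙_ E ⟶ P.obj (fun _ : Fin 1 => y) d)
    (a : 𝟙_ E ⟶ P.obj (fun _ : Fin 1 => x) y) :
    b ≫ P.pre (x := fun _ : Fin 1 => y) (y := fun _ => x) (fun _ => a) d = P.uComp b a := by
  rw [pre, preUpTo_succ P _ d 0 le_rfl (fun _ => y) (fun _ => y) _ _ _ (fun j => by simp),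
    preUpTo_zero, Category.id_comp]
  exact P.comp_preAt b a _ _ _

end OperadData

namespace OperadHom

variable {P Q : OperadData.{v, u, w} E} (f : OperadHom P Q)

lemma map_post {n : ℕ} (c : Fin n → P.Ob) {d d' : P.Ob}
    (b : 𝟙_ E ⟶ P.obj (fun _ : Fin 1 => d) d') :
    P.post c b ≫ f.map c d' =
      f.map c d ≫ Q.post (fun j => f.onOb (c j)) (b ≫ f.map _ _) := by
  simp only [OperadData.post, Category.assoc]
  rw [f.isHom.map_comp, leftUnitor_inv_naturality_assoc, tensorHom_def'_assoc,
    comp_whiskerRight_assoc, ← whisker_exchange_assoc b]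

lemma map_preAt {n : ℕ} {c c' : Fin n → P.Ob} (i : Fin n) {x y : P.Ob}
    (a : 𝟙_ E ⟶ P.obj (fun _ : Fin 1 => y) x) (hx : c i = x) (hy : c' i = y)
    (h : ∀ j, j ≠ i → c' j = c j) (d : P.Ob) :
    P.preAt i a hx hy h d ≫ f.map c' d =
      f.map c d ≫ Q.preAt (c := fun j => f.onOb (c j)) (c' := fun j => f.onOb (c' j)) i
        (a ≫ f.map _ _) (congrArg f.onOb hx) (congrArg f.onOb hy)
        (fun j hj => congrArg f.onOb (h j hj)) (f.onOb d) := by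
  simp only [OperadData.preAt, Category.assoc]
  rw [f.isHom.map_comp, rightUnitor_inv_naturality_assoc, MonoidalCategory.tensorHom_def,
    Category.assoc, whiskerLeft_comp_assoc, whisker_exchange_assoc]

lemma map_preUpTo {n : ℕ} {x y : Fin n → P.Ob}
    (a : ∀ j, 𝟙_ E ⟶ P.obj (fun _ : Fin 1 => y j) (x j)) (d : P.Ob) (t : ℕ) (ht : t ≤ n) :
    ∀ (c c' : Fin n → P.Ob) (hc : ∀ j, j.val < t → c j = x j)
      (hc' : ∀ j, c' j = if j.val < t then y j else c j),
    P.preUpTo a d t ht c c' hc hc' ≫ f.map c' d =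
      f.map c d ≫ Q.preUpTo (fun j => a j ≫ f.map _ _) (f.onOb d) t ht
        (fun j => f.onOb (c j)) (fun j => f.onOb (c' j)) (fun j hj => congrArg f.onOb (hc j hj))
        (fun j => by rw [hc' j]; split_ifs <;> rfl) := by
  induction t with
  | zero =>
    intro c c' hc hc'
    obtain rfl : c' = c := funext fun j => by simpa using hc' j
    rw [OperadData.preUpTo_zero, OperadData.preUpTo_zero, Category.id_comp, Category.comp_id]
  | succ t ih =>
    intro c c' hc hc'
    rw [P.preUpTo_succ a d t ht c (fun j => if j.val < t then y j else c j) c' hc hc'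
        (fun _ => rfl),
      Q.preUpTo_succ _ _ t ht _ (fun j => f.onOb (if j.val < t then y j else c j)) _ _ _
        (fun j => by split_ifs <;> rfl), Category.assoc, map_preAt,
      ← Category.assoc, ih, Category.assoc]

lemma map_pre {n : ℕ} {x y : Fin n → P.Ob}
    (a : ∀ j, 𝟙_ E ⟶ P.obj (fun _ : Fin 1 => y j) (x j)) (d : P.Ob) :
    P.pre a d ≫ f.map y d =
      f.map x d ≫ Q.pre (fun j => a j ≫ f.map _ _) (f.onOb d) :=
  f.map_preUpTo a d n le_rfl _ _ _ _

lemma map_uComp {x y z : P.Ob} (b : 𝟙_ E ⟶ P.obj (fun _ : Fin 1 => y) z)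
    (a : 𝟙_ E ⟶ P.obj (fun _ : Fin 1 => x) y) :
    P.uComp b a ≫ f.map _ _ = Q.uComp (b ≫ f.map _ _) (a ≫ f.map _ _) := by
  rw [OperadData.uComp, Category.assoc, f.isHom.map_comp, ← Category.assoc, elPair_comp]
  rfl

lemma ext_of {f g : OperadHom P Q} (hOb : f.onOb = g.onOb)
    (hmap : @f.map ≍ @g.map) : f = g := by
  obtain ⟨⟨_, _⟩, _⟩ := f
  obtain ⟨⟨_, _⟩, _⟩ := g
  cases hOb; cases hmap
  rfl

/-- The identity. -/
def id (P : OperadData.{v, u, w} E) : OperadHom P P where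
  onOb x := x
  map c d := 𝟙 _
  isHom :=
    { map_act := fun σ h d => by simp
      map_comp := fun i x hx hg d => by simp
      map_unit := fun x => by simp }

variable {R : OperadData.{v, u, w} E}

/-- Composition. -/
def comp (f : OperadHom P Q) (g : OperadHom Q R) : OperadHom P R where
  onOb x := g.onOb (f.onOb x)
  map c d := f.map c d ≫ g.map _ _
  isHom :=
    { map_act := fun σ h d => by
        rw [← Category.assoc, f.isHom.map_act, Category.assoc, g.isHom.map_act, Category.assoc]
      map_comp := fun i x hx hg d => by
        rw [← Category.assoc, f.isHom.map_comp, Category.assoc, g.isHom.map_comp,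
          tensorHom_comp_tensorHom_assoc]
      map_unit := fun x => by
        rw [← Category.assoc, f.isHom.map_unit, g.isHom.map_unit] }

end OperadHom

namespace EnrichedOperad

variable [SymmetricCategory E] (P : EnrichedOperad.{v, u, w} E)

lemma post_post {n : ℕ} (c : Fin n → P.Ob) {d d' d'' : P.Ob}
    (b : 𝟙_ E ⟶ P.obj (fun _ : Fin 1 => d) d') (b' : 𝟙_ E ⟶ P.obj (fun _ : Fin 1 => d') d'') :
    P.post c b ≫ P.post c b' = P.post c (P.uComp b' b) := by
  have h := P.isOperad.assoc_seq (0 : Fin 1) (0 : Fin 1) (0 : Fin 1) (c := fun _ => d')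
    (e := fun _ => d) (f := c) (s := fun _ => d) (s' := c) (t := c) rfl rfl rfl rfl
    (IsGraft.one_left d') (IsGraft.one_left d) (IsGraft.one_left d) (IsGraft.one_left d') d''
  simp only [OperadData.post, OperadData.uComp, elPair_eq_left, Category.assoc, comp_whiskerRight]
  rw [h, leftUnitor_inv_naturality_assoc, leftUnitor_inv_naturality_assoc,
    whisker_exchange_assoc]
  simp

lemma post_preAt {n : ℕ} {c c' : Fin n → P.Ob} (i : Fin n) {x y : P.Ob}
    (a : 𝟙_ E ⟶ P.obj (fun _ : Fin 1 => y) x) (hx : c i = x) (hy : c' i = y)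
    (h : ∀ j, j ≠ i → c' j = c j) {d d' : P.Ob} (b : 𝟙_ E ⟶ P.obj (fun _ : Fin 1 => d) d') :
    P.post c b ≫ P.preAt i a hx hy h d' = P.preAt i a hx hy h d ≫ P.post c' b := by
  have h := P.isOperad.assoc_seq (0 : Fin 1) i i (c := fun _ => d)
    (e := c) (f := fun _ : Fin 1 => y) (s := c) (s' := c') (t := c') rfl hx hx (by simp)
    (IsGraft.one_left d) (IsGraft.one_right h hy) (IsGraft.one_right h hy)
    (IsGraft.one_left d) d'
  simp only [OperadData.post, OperadData.preAt, Category.assoc]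
  rw [rightUnitor_inv_naturality_assoc, ← whisker_exchange_assoc, h,
    leftUnitor_inv_naturality_assoc (P.comp i hx _ d), whisker_exchange_assoc b,
    leftUnitor_inv_naturality_assoc (_ ◁ a), whisker_exchange_assoc b,
    leftUnitor_inv_naturality_assoc (ρ_ _).inv, whisker_exchange_assoc b]
  simp

lemma preAt_preAt_same {n : ℕ} {c c' c'' : Fin n → P.Ob} (i : Fin n) {x y z : P.Ob}
    (a : 𝟙_ E ⟶ P.obj (fun _ : Fin 1 => y) x) (a' : 𝟙_ E ⟶ P.obj (fun _ : Fin 1 => z) y)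
    (hx : c i = x) (hy : c' i = y) (hz : c'' i = z)
    (h : ∀ j, j ≠ i → c' j = c j) (h' : ∀ j, j ≠ i → c'' j = c' j)
    (h'' : ∀ j, j ≠ i → c'' j = c j) (d : P.Ob) :
    P.preAt i a hx hy h d ≫ P.preAt i a' hy hz h' d =
      P.preAt i (P.uComp a a') hx hz h'' d := by
  have h := P.isOperad.assoc_seq i (0 : Fin 1) i (c := c)
    (e := fun _ => y) (f := fun _ : Fin 1 => z) (s := c') (s' := fun _ : Fin 1 => z) (t := c'')
    hx rfl hy (by simp)
    (IsGraft.one_right h hy) (IsGraft.one_right h' hz) (IsGraft.one_left y)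
    (IsGraft.one_right h'' hz) d
  simp only [OperadData.preAt, OperadData.uComp, elPair_eq_right, Category.assoc,
    MonoidalCategory.whiskerLeft_comp]
  rw [rightUnitor_inv_naturality_assoc, rightUnitor_inv_naturality_assoc,
    ← whisker_exchange_assoc, h]
  simp

lemma preAt_preAt_comm {n : ℕ} {c c₁ c₂ c' : Fin n → P.Ob} (i j : Fin n) (hij : i ≠ j)
    {x y z t : P.Ob}
    (a : 𝟙_ E ⟶ P.obj (fun _ : Fin 1 => y) x) (b : 𝟙_ E ⟶ P.obj (fun _ : Fin 1 => t) z)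
    (hx : c i = x) (hy : c₁ i = y) (h : ∀ k, k ≠ i → c₁ k = c k)
    (hz : c₁ j = z) (ht : c' j = t) (h' : ∀ k, k ≠ j → c' k = c₁ k)
    (hz₂ : c j = z) (ht₂ : c₂ j = t) (h₂ : ∀ k, k ≠ j → c₂ k = c k)
    (hx₂ : c₂ i = x) (hy₂ : c' i = y) (h₂' : ∀ k, k ≠ i → c' k = c₂ k) (d : P.Ob) :
    P.preAt i a hx hy h d ≫ P.preAt j b hz ht h' d =
      P.preAt j b hz₂ ht₂ h₂ d ≫ P.preAt i a hx₂ hy₂ h₂' d := by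
  have hh := P.isOperad.assoc_par i j hij i j (c := c)
    (e := fun _ : Fin 1 => y) (f := fun _ : Fin 1 => t) (s := c₁) (s' := c₂) (t := c')
    hx hz₂ hx₂ hz
    (by rcases lt_or_gt_of_ne hij with h | h
        · exact Or.inl ⟨h, rfl⟩
        · exact Or.inr ⟨h, rfl⟩)
    (by rcases lt_or_gt_of_ne hij with h | h
        · exact Or.inr ⟨h, rfl⟩
        · exact Or.inl ⟨h, rfl⟩)
    (IsGraft.one_right h hy) (IsGraft.one_right h' ht) (IsGraft.one_right h₂ ht₂)
    (IsGraft.one_right h₂' hy₂) d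
  simp only [OperadData.preAt, Category.assoc]
  rw [rightUnitor_inv_naturality_assoc, rightUnitor_inv_naturality_assoc,
    ← whisker_exchange_assoc, ← whisker_exchange_assoc, hh,
    rightUnitor_inv_naturality_assoc (P.comp j hz₂ _ d), ← whisker_exchange_assoc (P.comp j hz₂ _ d),
    rightUnitor_inv_naturality_assoc (_ ◁ b), ← whisker_exchange_assoc (_ ◁ b)]
  have h1 := whiskerLeft_elPair (P.obj c d) a b
  have h2 := congrArg (· ≫ (α_ _ _ _).inv) (whiskerLeft_elPair (P.obj c d) b a)
  simp only [Category.assoc, Iso.hom_inv_id, Category.comp_id] at h2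
  rw [reassoc_of% h1, reassoc_of% h2, ← whiskerLeft_comp_assoc, elPair_braiding]

lemma post_unit {n : ℕ} (c : Fin n → P.Ob) (d : P.Ob) : P.post c (P.unit d) = 𝟙 _ :=
  P.isOperad.unit_comp c d

lemma preAt_unit {n : ℕ} {c : Fin n → P.Ob} (i : Fin n) {x : P.Ob} (hx : c i = x) (hy h)
    (d : P.Ob) : P.preAt (c' := c) i (P.unit x) hx hy h d = 𝟙 _ := by
  subst hx
  exact P.isOperad.comp_unit c i d

lemma post_preUpTo {n : ℕ} {x y : Fin n → P.Ob}
    (a : ∀ j, 𝟙_ E ⟶ P.obj (fun _ : Fin 1 => y j) (x j)) {d d' : P.Ob}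
    (b : 𝟙_ E ⟶ P.obj (fun _ : Fin 1 => d) d') (t : ℕ) (ht : t ≤ n) :
    ∀ (c c' : Fin n → P.Ob) (hc : ∀ j, j.val < t → c j = x j)
      (hc' : ∀ j, c' j = if j.val < t then y j else c j),
    P.post c b ≫ P.preUpTo a d' t ht c c' hc hc' =
      P.preUpTo a d t ht c c' hc hc' ≫ P.post c' b := by
  induction t with
  | zero =>
    intro c c' hc hc'
    obtain rfl : c' = c := funext fun j => by simpa using hc' j
    rw [OperadData.preUpTo_zero, OperadData.preUpTo_zero, Category.id_comp, Category.comp_id]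
  | succ t ih =>
    intro c c' hc hc'
    rw [P.preUpTo_succ a d t ht c (fun j => if j.val < t then y j else c j) c' hc hc'
        (fun _ => rfl),
      P.preUpTo_succ a d' t ht c (fun j => if j.val < t then y j else c j) c' hc hc'
        (fun _ => rfl), ← Category.assoc, ih, Category.assoc, post_preAt, Category.assoc]

lemma post_pre {n : ℕ} {x y : Fin n → P.Ob}
    (a : ∀ j, 𝟙_ E ⟶ P.obj (fun _ : Fin 1 => y j) (x j)) {d d' : P.Ob}
    (b : 𝟙_ E ⟶ P.obj (fun _ : Fin 1 => d) d') :
    P.post x b ≫ P.pre a d' = P.pre a d ≫ P.post y b :=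
  P.post_preUpTo a b n le_rfl _ _ _ _

lemma preUpTo_unit {n : ℕ} {x : Fin n → P.Ob} (d : P.Ob) (t : ℕ) (ht : t ≤ n) :
    ∀ (c : Fin n → P.Ob) (hc hc'),
    P.preUpTo (x := x) (y := x) (fun j => P.unit (x j)) d t ht c c hc hc' = 𝟙 _ := by
  induction t with
  | zero =>
    intro c hc hc'
    rw [OperadData.preUpTo_zero]
  | succ t ih =>
    intro c hc hc'
    rw [P.preUpTo_succ _ d t ht c c c hc hc'
      (fun j => by split_ifs with h; exacts [hc j (by omega), rfl]), ih, preAt_unit,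
      Category.comp_id]

lemma pre_unit {n : ℕ} (x : Fin n → P.Ob) (d : P.Ob) :
    P.pre (x := x) (y := x) (fun j => P.unit (x j)) d = 𝟙 _ :=
  P.preUpTo_unit d n le_rfl _ _ _

lemma preAt_preUpTo {n : ℕ} {x y : Fin n → P.Ob}
    (a : ∀ j, 𝟙_ E ⟶ P.obj (fun _ : Fin 1 => y j) (x j)) (d : P.Ob) (i : Fin n) {p q : P.Ob}
    (b : 𝟙_ E ⟶ P.obj (fun _ : Fin 1 => q) p) (t : ℕ) (ht : t ≤ n) (hti : t ≤ i.val) :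
    ∀ (c c₁ c₂ c' : Fin n → P.Ob) (hp : c i = p) (hq : c₁ i = q) (h : ∀ j, j ≠ i → c₁ j = c j)
      (hc hc') (hc₂ hc₂') (hp₂ : c₂ i = p) (hq₂ : c' i = q) (h₂ : ∀ j, j ≠ i → c' j = c₂ j),
    P.preAt i b hp hq h d ≫ P.preUpTo a d t ht c₁ c' hc hc' =
      P.preUpTo a d t ht c c₂ hc₂ hc₂' ≫ P.preAt i b hp₂ hq₂ h₂ d := by
  induction t with
  | zero =>
    intro c c₁ c₂ c' hp hq h hc hc' hc₂ hc₂' hp₂ hq₂ h₂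
    obtain rfl : c' = c₁ := funext fun j => by simpa using hc' j
    obtain rfl : c₂ = c := funext fun j => by simpa using hc₂' j
    rw [OperadData.preUpTo_zero, OperadData.preUpTo_zero, Category.id_comp, Category.comp_id]
  | succ t ih =>
    intro c c₁ c₂ c' hp hq h hc hc' hc₂ hc₂' hp₂ hq₂ h₂
    have hti' : ¬ i.val < t := by omega
    rw [P.preUpTo_succ a d t ht c₁ (fun j => if j.val < t then y j else c₁ j) c' hc hc'
        (fun _ => rfl),
      P.preUpTo_succ a d t ht c (fun j => if j.val < t then y j else c j) c₂ hc₂ hc₂'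
        (fun _ => rfl), ← Category.assoc,
      ih (by omega) (by omega) c c₁ (fun j => if j.val < t then y j else c j) _ hp hq h _ _
        (fun j hj => hc₂ j (by omega)) (fun _ => rfl) (by simp [hti', hp]) (by simp [hti', hq])
        (fun j hj => by simp [h j hj]), Category.assoc, Category.assoc]
    congr 1
    apply preAt_preAt_comm
    intro hh
    rw [hh] at hti
    simp at hti

lemma preUpTo_preUpTo {n : ℕ} {x y z : Fin n → P.Ob}
    (a : ∀ j, 𝟙_ E ⟶ P.obj (fun _ : Fin 1 => y j) (x j))
    (a' : ∀ j, 𝟙_ E ⟶ P.obj (fun _ : Fin 1 => z j) (y j)) (d : P.Ob) (t : ℕ) (ht : t ≤ n) :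
    ∀ (c c' c'' : Fin n → P.Ob) (hc hc') (hc₂ hc₂') (hc₃ hc₃'),
    P.preUpTo a d t ht c c' hc hc' ≫ P.preUpTo a' d t ht c' c'' hc₂ hc₂' =
      P.preUpTo (fun j => P.uComp (a j) (a' j)) d t ht c c'' hc₃ hc₃' := by
  induction t with
  | zero =>
    intro c c' c'' hc hc' hc₂ hc₂' hc₃ hc₃'
    obtain rfl : c' = c := funext fun j => by simpa using hc' j
    obtain rfl : c'' = c' := funext fun j => by simpa using hc₂' j
    rw [OperadData.preUpTo_zero, OperadData.preUpTo_zero, OperadData.preUpTo_zero,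
      Category.id_comp]
  | succ t ih =>
    intro c c' c'' hc hc' hc₂ hc₂' hc₃ hc₃'
    rw [P.preUpTo_succ a d t ht c (fun j => if j.val < t then y j else c j) c' hc hc'
        (fun _ => rfl),
      P.preUpTo_succ a' d t ht c' (fun j => if j.val < t then z j else c' j) c'' hc₂ hc₂'
        (fun _ => rfl),
      P.preUpTo_succ _ d t ht c (fun j => if j.val < t then z j else c j) c'' hc₃ hc₃'
        (fun _ => rfl),
      ← ih (by omega) c (fun j => if j.val < t then y j else c j) (fun j => if j.val < t then z j else c j)
        (fun j hj => hc j (by omega)) (fun _ => rfl) (fun j hj => by simp [hj])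
        (fun j => by split_ifs <;> rfl),
      Category.assoc, Category.assoc,
      ← Category.assoc (P.preAt _ _ _ _ _ _),
      preAt_preUpTo P a' d ⟨t, ht⟩ (a ⟨t, ht⟩) t _ le_rfl
        (fun j => if j.val < t then y j else c j) c'
        (fun j => if j.val < t then z j else c j) (fun j => if j.val < t then z j else c' j)
        _ _ _ _ _ (fun j hj => by simp [hj]) (fun j => by split_ifs <;> rfl)
        (by simpa using hc ⟨t, ht⟩ (Nat.lt_succ_self t))
        (by simpa using hc' ⟨t, ht⟩)
        (fun j hj => by
          have h1 : j.val ≠ t := fun h => hj (Fin.ext h)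
          have h2 : j.val < t + 1 ↔ j.val < t := by omega
          simp only [hc' j, h2]
          split_ifs <;> rfl),
      Category.assoc]
    congr 2
    apply preAt_preAt_same

lemma pre_pre {n : ℕ} {x y z : Fin n → P.Ob}
    (a : ∀ j, 𝟙_ E ⟶ P.obj (fun _ : Fin 1 => y j) (x j))
    (a' : ∀ j, 𝟙_ E ⟶ P.obj (fun _ : Fin 1 => z j) (y j)) (d : P.Ob) :
    P.pre a d ≫ P.pre a' d = P.pre (fun j => P.uComp (a j) (a' j)) d :=
  P.preUpTo_preUpTo a a' d n le_rfl _ _ _ _ _ _ _ _ _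

lemma uComp_unit {x y : P.Ob} (a : 𝟙_ E ⟶ P.obj (fun _ : Fin 1 => x) y) :
    P.uComp a (P.unit x) = a := by
  rw [← OperadData.comp_pre]
  exact (congrArg (a ≫ ·) (P.pre_unit (fun _ : Fin 1 => x) y)).trans (Category.comp_id _)

lemma unit_uComp {x y : P.Ob} (a : 𝟙_ E ⟶ P.obj (fun _ : Fin 1 => x) y) :
    P.uComp (P.unit y) a = a := by
  rw [← OperadData.comp_post, post_unit, Category.comp_id]

lemma uComp_assoc {x y z t : P.Ob} (c : 𝟙_ E ⟶ P.obj (fun _ : Fin 1 => z) t)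
    (b : 𝟙_ E ⟶ P.obj (fun _ : Fin 1 => y) z) (a : 𝟙_ E ⟶ P.obj (fun _ : Fin 1 => x) y) :
    P.uComp (P.uComp c b) a = P.uComp c (P.uComp b a) := by
  rw [← OperadData.comp_post _ _ (P.uComp c b), ← post_post, ← Category.assoc,
    OperadData.comp_post, OperadData.comp_post]

end EnrichedOperad

end OperadLemmas

section OperadBicategory

variable {E : Type u} [Category.{v} E] [MonoidalCategory E] [SymmetricCategory E]

namespace OperadTrans

variable {P Q R : EnrichedOperad.{v, u, w} E}

lemma el_natural {f g : OperadHom P.toOperadData Q.toOperadData} (η : OperadTrans f g)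
    {x y : P.Ob} (a : 𝟙_ E ⟶ P.obj (fun _ : Fin 1 => x) y) :
    Q.uComp (η.app y) (a ≫ f.map _ _) = Q.uComp (a ≫ g.map _ _) (η.app x) := by
  have h := congrArg (a ≫ ·) (η.natural (fun _ : Fin 1 => x) y)
  simp only [← Category.assoc] at h
  exact (Q.comp_post _ _).symm.trans (h.trans (Q.comp_pre _ _))

/-- The identity. -/
def id (f : OperadHom P.toOperadData Q.toOperadData) : OperadTrans f f where
  app x := Q.unit (f.onOb x)
  natural c d := by
    have h1 := Q.post_unit (fun j => f.onOb (c j)) (f.onOb d)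
    have h2 := Q.pre_unit (fun j => f.onOb (c j)) (f.onOb d)
    rw [h1, h2]

/-- Vertical composition. -/
def comp {f g h : OperadHom P.toOperadData Q.toOperadData} (η : OperadTrans f g)
    (θ : OperadTrans g h) : OperadTrans f h where
  app x := Q.uComp (θ.app x) (η.app x)
  natural c d := by
    have h1 := Q.post_post (fun j => f.onOb (c j)) (η.app d) (θ.app d)
    have h2 := Q.pre_pre (fun j => θ.app (c j)) (fun j => η.app (c j)) (h.onOb d)
    have h3 := Q.post_pre (fun j => η.app (c j)) (θ.app d)
    have h4 := η.natural c d
    have h5 := θ.natural c d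
    rw [← h1, ← h2, ← Category.assoc, h4, Category.assoc, ← h3, ← Category.assoc, h5,
      Category.assoc]

/-- Left whiskering. -/
def whiskerLeft (f : OperadHom P.toOperadData Q.toOperadData)
    {g h : OperadHom Q.toOperadData R.toOperadData} (η : OperadTrans g h) :
    OperadTrans (f.comp g) (f.comp h) where
  app x := η.app (f.onOb x)
  natural c d := by
    have h := congrArg (f.map c d ≫ ·) (η.natural (fun j => f.onOb (c j)) (f.onOb d))
    simp only [← Category.assoc] at h
    exact h

/-- Right whiskering. -/
def whiskerRight {f g : OperadHom P.toOperadData Q.toOperadData} (η : OperadTrans f g)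
    (h : OperadHom Q.toOperadData R.toOperadData) :
    OperadTrans (f.comp h) (g.comp h) where
  app x := η.app x ≫ h.map _ _
  natural c d := by
    have h1 := h.map_post (fun j => f.onOb (c j)) (η.app d)
    have h2 := h.map_pre (fun j => η.app (c j)) (g.onOb d)
    have h3 := congrArg (· ≫ h.map _ _) (η.natural c d)
    simp only [Category.assoc, h1, h2] at h3
    simp only [OperadHom.comp, Category.assoc]
    exact h3

instance : Category (OperadHom P.toOperadData Q.toOperadData) where
  Hom f g := OperadTrans f g
  id f := OperadTrans.id f
  comp η θ := OperadTrans.comp η θ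
  id_comp η := by
    ext x; exact Q.uComp_unit _
  comp_id η := by
    ext x; exact Q.unit_uComp _
  assoc η θ ζ := by
    ext x; exact (Q.uComp_assoc _ _ _).symm

@[ext]
lemma hom_ext {f g : OperadHom P.toOperadData Q.toOperadData} {η θ : f ⟶ g}
    (h : ∀ x, OperadTrans.app η x = OperadTrans.app θ x) : η = θ :=
  OperadTrans.ext (funext h)

lemma eq_conj {f f' g g' : OperadHom P.toOperadData Q.toOperadData} (h : f = f') (k : g' = g)
    {η : f ⟶ g} {η' : f' ⟶ g'} (H : ∀ x, OperadTrans.app η x ≍ OperadTrans.app η' x) :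
    η = eqToHom h ≫ η' ≫ eqToHom k := by
  subst h k
  rw [eqToHom_refl, eqToHom_refl, Category.comp_id, Category.id_comp]
  exact hom_ext fun x => eq_of_heq (H x)

lemma whiskerRight_eqToHom {f g : OperadHom P.toOperadData Q.toOperadData} (h : f = g)
    (k : OperadHom Q.toOperadData R.toOperadData) :
    OperadTrans.whiskerRight (eqToHom h) k =
      (eqToHom (by rw [h]) : f.comp k ⟶ g.comp k) := by
  subst h
  exact hom_ext fun x => k.isHom.map_unit _

lemma whiskerLeft_eqToHom (f : OperadHom P.toOperadData Q.toOperadData)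
    {g h : OperadHom Q.toOperadData R.toOperadData} (k : g = h) :
    OperadTrans.whiskerLeft f (eqToHom k) =
      (eqToHom (by rw [k]) : f.comp g ⟶ f.comp h) := by
  subst k
  rfl

end OperadTrans

namespace OperadHom

variable {P Q R S : OperadData.{v, u, w} E}

lemma id_comp' (f : OperadHom P Q) : (OperadHom.id P).comp f = f :=
  ext_of rfl (heq_of_eq (by funext n c d; exact Category.id_comp _))

lemma comp_id' (f : OperadHom P Q) : f.comp (OperadHom.id Q) = f :=
  ext_of rfl (heq_of_eq (by funext n c d; exact Category.comp_id _))

lemma assoc' (f : OperadHom P Q) (g : OperadHom Q R) (h : OperadHom R S) :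
    (f.comp g).comp h = f.comp (g.comp h) :=
  ext_of rfl (heq_of_eq (by funext n c d; exact Category.assoc _ _ _))

end OperadHom

/-- The strict 2-category of enriched operads. -/
instance : Bicategory (EnrichedOperad.{v, u, w} E) where
  Hom P Q := OperadHom P.toOperadData Q.toOperadData
  id P := OperadHom.id P.toOperadData
  comp f g := f.comp g
  homCategory P Q := inferInstanceAs (Category (OperadHom P.toOperadData Q.toOperadData))
  whiskerLeft f _ _ η := OperadTrans.whiskerLeft f η
  whiskerRight η h := OperadTrans.whiskerRight η h
  associator f g h := eqToIso (OperadHom.assoc' f g h)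
  leftUnitor f := eqToIso (OperadHom.id_comp' f)
  rightUnitor f := eqToIso (OperadHom.comp_id' f)
  whiskerLeft_id f g := rfl
  whiskerLeft_comp f _ _ _ η θ := rfl
  id_whiskerLeft η :=
    OperadTrans.eq_conj (OperadHom.id_comp' _) (OperadHom.id_comp' _).symm fun x => HEq.rfl
  comp_whiskerLeft f g _ _ η :=
    OperadTrans.eq_conj (OperadHom.assoc' _ _ _) (OperadHom.assoc' _ _ _).symm fun x => HEq.rfl
  id_whiskerRight f g := OperadTrans.hom_ext fun x => g.isHom.map_unit _
  comp_whiskerRight η θ h := OperadTrans.hom_ext fun x => h.map_uComp _ _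
  whiskerRight_id η :=
    OperadTrans.eq_conj (OperadHom.comp_id' _) (OperadHom.comp_id' _).symm fun x =>
      heq_of_eq (Category.comp_id _)
  whiskerRight_comp η g h :=
    OperadTrans.eq_conj (OperadHom.assoc' _ _ _).symm (OperadHom.assoc' _ _ _) fun x =>
      heq_of_eq (Category.assoc _ _ _).symm
  whisker_assoc f _ _ η h :=
    OperadTrans.eq_conj (OperadHom.assoc' _ _ _) (OperadHom.assoc' _ _ _).symm fun x => HEq.rfl
  whisker_exchange η θ := OperadTrans.hom_ext fun x => (θ.el_natural _).symm
  pentagon f g h k := by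
    simp only [eqToIso.hom, OperadTrans.whiskerRight_eqToHom, OperadTrans.whiskerLeft_eqToHom]
    exact (by simp : ∀ {X₁ X₂ X₃ X₄ X₅ : OperadHom _ _} (h₁ : X₁ = X₂) (h₂ : X₂ = X₃)
      (h₃ : X₃ = X₄) (h₄ : X₁ = X₅) (h₅ : X₅ = X₄), eqToHom h₁ ≫ eqToHom h₂ ≫ eqToHom h₃ =
        eqToHom h₄ ≫ eqToHom h₅) _ _ _ _ _
  triangle f g := by
    simp only [eqToIso.hom, OperadTrans.whiskerRight_eqToHom, OperadTrans.whiskerLeft_eqToHom]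
    exact eqToHom_trans _ _

instance : Bicategory.Strict (EnrichedOperad.{v, u, w} E) where
  id_comp {P Q} f := OperadHom.id_comp' (P := P.toOperadData) (Q := Q.toOperadData) f
  comp_id {P Q} f := OperadHom.comp_id' (P := P.toOperadData) (Q := Q.toOperadData) f
  assoc {P Q R S} f g h := OperadHom.assoc' (P := P.toOperadData) (Q := Q.toOperadData)
    (R := R.toOperadData) (S := S.toOperadData) f g h
  leftUnitor_eqToIso _ := rfl
  rightUnitor_eqToIso _ := rfl
  associator_eqToIso _ _ _ := rfl

end OperadBicategory

/-! ### The Hadamard product of enriched operads -/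

section Hadamard

variable {E : Type u} [Category.{v} E] [MonoidalCategory E] [SymmetricCategory E]

lemma shuffle_par (X₁ X₂ Y₁ Y₂ Z₁ Z₂ : E) :
    tensorμ X₁ X₂ Y₁ Y₂ ▷ (Z₁ ⊗ Z₂) ≫ tensorμ (X₁ ⊗ Y₁) (X₂ ⊗ Y₂) Z₁ Z₂ ≫
      (((α_ X₁ Y₁ Z₁).hom ≫ X₁ ◁ (β_ Y₁ Z₁).hom ≫ (α_ X₁ Z₁ Y₁).inv) ⊗ₘ
        ((α_ X₂ Y₂ Z₂).hom ≫ X₂ ◁ (β_ Y₂ Z₂).hom ≫ (α_ X₂ Z₂ Y₂).inv)) =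
    (α_ _ _ _).hom ≫ (X₁ ⊗ X₂) ◁ (β_ (Y₁ ⊗ Y₂) (Z₁ ⊗ Z₂)).hom ≫ (α_ _ _ _).inv ≫
      tensorμ X₁ X₂ Z₁ Z₂ ▷ (Y₁ ⊗ Y₂) ≫ tensorμ (X₁ ⊗ Z₁) (X₂ ⊗ Z₂) Y₁ Y₂ := by
  have h1 := tensor_associativity X₁ X₂ Y₁ Y₂ Z₁ Z₂
  have h2 := tensor_associativity X₁ X₂ Z₁ Z₂ Y₁ Y₂
  have h3 := tensorμ_braiding Y₁ Y₂ Z₁ Z₂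
  simp only [← tensorHom_comp_tensorHom]
  rw [reassoc_of% h1, ← tensorμ_natural_right_assoc, ← whiskerLeft_comp_assoc, h3,
    whiskerLeft_comp_assoc]
  congr 2
  rw [Iso.eq_inv_comp, ← reassoc_of% h2]
  simp

namespace OperadData

/-- The Hadamard product. -/
def tensor (P Q : OperadData.{v, u, w} E) : OperadData.{v, u, w} E where
  Ob := P.Ob × Q.Ob
  obj c d := P.obj (fun j => (c j).1) d.1 ⊗ Q.obj (fun j => (c j).2) d.2
  act σ h d := P.act σ (fun i => congrArg Prod.fst (h i)) d.1 ⊗ₘ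
    Q.act σ (fun i => congrArg Prod.snd (h i)) d.2
  comp i _ hx hg d := tensorμ _ _ _ _ ≫ (P.comp i (congrArg Prod.fst hx) (hg.map Prod.fst) d.1 ⊗ₘ
    Q.comp i (congrArg Prod.snd hx) (hg.map Prod.snd) d.2)
  unit x := elPair (P.unit x.1) (Q.unit x.2)

variable {P Q : OperadData.{v, u, w} E}

lemma tensor_post {n : ℕ} (c : Fin n → (P.tensor Q).Ob) {d d' : (P.tensor Q).Ob}
    (a : 𝟙_ E ⟶ P.obj (fun _ : Fin 1 => d.1) d'.1) (b : 𝟙_ E ⟶ Q.obj (fun _ : Fin 1 => d.2) d'.2) :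
    (P.tensor Q).post c (d := d) (d' := d') (elPair a b) =
      P.post (fun j => (c j).1) a ⊗ₘ Q.post (fun j => (c j).2) b := by
  have h := leftUnitor_inv_elPair (X := P.obj (fun j => (c j).1) d.1)
    (Y := Q.obj (fun j => (c j).2) d.2) a b
  change (λ_ (_ ⊗ _)).inv ≫ elPair a b ▷ (_ ⊗ _) ≫ tensorμ _ _ _ _ ≫ (_ ⊗ₘ _) = _
  rw [reassoc_of% h]
  simp only [tensorHom_comp_tensorHom, Category.assoc, post]

lemma tensor_preAt {n : ℕ} {c c' : Fin n → (P.tensor Q).Ob} (i : Fin n) {x y : (P.tensor Q).Ob}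
    (a : 𝟙_ E ⟶ P.obj (fun _ : Fin 1 => y.1) x.1) (b : 𝟙_ E ⟶ Q.obj (fun _ : Fin 1 => y.2) x.2)
    (hx : c i = x) (hy : c' i = y) (h : ∀ j, j ≠ i → c' j = c j) (d : (P.tensor Q).Ob) :
    (P.tensor Q).preAt i (elPair a b) hx hy h d =
      P.preAt (c := fun j => (c j).1) (c' := fun j => (c' j).1) i a (congrArg Prod.fst hx)
          (congrArg Prod.fst hy) (fun j hj => congrArg Prod.fst (h j hj)) d.1 ⊗ₘ
        Q.preAt (c := fun j => (c j).2) (c' := fun j => (c' j).2) i b (congrArg Prod.snd hx)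
          (congrArg Prod.snd hy) (fun j hj => congrArg Prod.snd (h j hj)) d.2 := by
  have h := rightUnitor_inv_elPair (X := P.obj (fun j => (c j).1) d.1)
    (Y := Q.obj (fun j => (c j).2) d.2) a b
  change (ρ_ (_ ⊗ _)).inv ≫ (_ ⊗ _) ◁ elPair a b ≫ tensorμ _ _ _ _ ≫ (_ ⊗ₘ _) = _
  rw [reassoc_of% h]
  simp only [tensorHom_comp_tensorHom, Category.assoc, preAt]

lemma tensor_preUpTo {n : ℕ} {x y : Fin n → (P.tensor Q).Ob}
    (p : ∀ j, 𝟙_ E ⟶ (P.tensor Q).obj (fun _ : Fin 1 => y j) (x j))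
    (a : ∀ j, 𝟙_ E ⟶ P.obj (fun _ : Fin 1 => (y j).1) (x j).1)
    (b : ∀ j, 𝟙_ E ⟶ Q.obj (fun _ : Fin 1 => (y j).2) (x j).2)
    (hp : ∀ j, p j = elPair (a j) (b j)) (d : (P.tensor Q).Ob) (t : ℕ)
    (ht : t ≤ n) : ∀ (c c' : Fin n → (P.tensor Q).Ob) (hc hc'),
    (P.tensor Q).preUpTo p d t ht c c' hc hc' =
      P.preUpTo a d.1 t ht (fun j => (c j).1) (fun j => (c' j).1)
          (fun j hj => congrArg Prod.fst (hc j hj))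
          (fun j => by rw [hc' j]; split_ifs <;> rfl) ⊗ₘ
        Q.preUpTo b d.2 t ht (fun j => (c j).2) (fun j => (c' j).2)
          (fun j hj => congrArg Prod.snd (hc j hj))
          (fun j => by rw [hc' j]; split_ifs <;> rfl) := by
  induction t with
  | zero =>
    intro c c' hc hc'
    obtain rfl : c' = c := funext fun j => by simpa using hc' j
    rw [preUpTo_zero, preUpTo_zero, preUpTo_zero, id_tensorHom_id]
    rfl
  | succ t ih =>
    intro c c' hc hc'
    have h1 : ∀ j, (if j.val < t then y j else c j).1 =
        if j.val < t then (y j).1 else (c j).1 := fun j => by split_ifs <;> rfl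
    have h2 : ∀ j, (if j.val < t then y j else c j).2 =
        if j.val < t then (y j).2 else (c j).2 := fun j => by split_ifs <;> rfl
    rw [(P.tensor Q).preUpTo_succ _ d t ht c (fun j => if j.val < t then y j else c j) c' hc hc'
        (fun _ => rfl), ih, hp ⟨t, ht⟩, tensor_preAt]
    refine (tensorHom_comp_tensorHom _ _ _ _).trans (congrArg₂ (· ⊗ₘ ·) ?_ ?_)
    · symm
      exact P.preUpTo_succ a d.1 t ht _ (fun j => (if j.val < t then y j else c j).1) _ _ _ h1
    · symm
      exact Q.preUpTo_succ b d.2 t ht _ (fun j => (if j.val < t then y j else c j).2) _ _ _ h2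

lemma tensor_pre {n : ℕ} {x y : Fin n → (P.tensor Q).Ob}
    (a : ∀ j, 𝟙_ E ⟶ P.obj (fun _ : Fin 1 => (y j).1) (x j).1)
    (b : ∀ j, 𝟙_ E ⟶ Q.obj (fun _ : Fin 1 => (y j).2) (x j).2) (d : (P.tensor Q).Ob) :
    (P.tensor Q).pre (x := x) (y := y) (fun j => elPair (a j) (b j)) d =
      P.pre a d.1 ⊗ₘ Q.pre b d.2 :=
  tensor_preUpTo (fun j => elPair (a j) (b j)) a b (fun _ => rfl) d n le_rfl _ _ _ _

lemma tensor_isOperad (hP : P.IsOperad) (hQ : Q.IsOperad) : (P.tensor Q).IsOperad where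
  act_one c d := by
    change P.act 1 _ d.1 ⊗ₘ Q.act 1 _ d.2 = 𝟙 (_ ⊗ _)
    rw [hP.act_one, hQ.act_one, id_tensorHom_id]
  act_mul {n c c' c''} σ τ h h' h'' d := by
    change (P.act _ _ _ ⊗ₘ Q.act _ _ _) ≫ (P.act _ _ _ ⊗ₘ Q.act _ _ _) =
      (P.act _ _ _ ⊗ₘ Q.act _ _ _)
    rw [tensorHom_comp_tensorHom,
      hP.act_mul σ τ _ _ (fun i => congrArg Prod.fst (h'' i)),
      hQ.act_mul σ τ _ _ (fun i => congrArg Prod.snd (h'' i))]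
  unit_comp c d := by
    refine (tensor_post c (P.unit d.1) (Q.unit d.2)).trans ?_
    refine (congrArg₂ (· ⊗ₘ ·) (hP.unit_comp _ _) (hQ.unit_comp _ _)).trans ?_
    exact id_tensorHom_id _ _
  comp_unit c i d := by
    refine (tensor_preAt (c := c) (c' := c) i (P.unit (c i).1) (Q.unit (c i).2) rfl rfl
      (fun _ _ => rfl) d).trans ?_
    refine (congrArg₂ (· ⊗ₘ ·) (hP.comp_unit _ i _) (hQ.comp_unit _ i _)).trans ?_
    exact id_tensorHom_id _ _
  assoc_seq {n m l k k' r c e f s s' t} i j i' x y hx hy hy' hi' hs hst hs' hst' d := by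
    change (tensorμ _ _ _ _ ≫ (P.comp _ _ _ _ ⊗ₘ Q.comp _ _ _ _)) ▷ (_ ⊗ _) ≫
        tensorμ _ _ _ _ ≫ (P.comp _ _ _ _ ⊗ₘ Q.comp _ _ _ _) =
      (α_ (_ ⊗ _) (_ ⊗ _) (_ ⊗ _)).hom ≫
        (_ ⊗ _) ◁ (tensorμ _ _ _ _ ≫ (P.comp _ _ _ _ ⊗ₘ Q.comp _ _ _ _)) ≫
        tensorμ _ _ _ _ ≫ (P.comp _ _ _ _ ⊗ₘ Q.comp _ _ _ _)
    simp only [comp_whiskerRight, MonoidalCategory.whiskerLeft_comp, Category.assoc]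
    rw [tensorμ_natural_left_assoc, tensorμ_natural_right_assoc, ← tensor_associativity_assoc]
    simp only [tensorHom_comp_tensorHom]
    rw [hP.assoc_seq i j i' _ (congrArg Prod.fst hy) _ hi' (hs.map Prod.fst) (hst.map Prod.fst)
        (hs'.map Prod.fst) (hst'.map Prod.fst),
      hQ.assoc_seq i j i' _ (congrArg Prod.snd hy) _ hi' (hs.map Prod.snd) (hst.map Prod.snd)
        (hs'.map Prod.snd) (hst'.map Prod.snd)]
  assoc_par {n m l k k' r c e f s s' t} i j hij i' j' x y hx hy hx' hy' hi' hj' hs hst hs' hst'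
      d := by
    change (tensorμ _ _ _ _ ≫ (P.comp _ _ _ _ ⊗ₘ Q.comp _ _ _ _)) ▷ (_ ⊗ _) ≫
        tensorμ _ _ _ _ ≫ (P.comp _ _ _ _ ⊗ₘ Q.comp _ _ _ _) =
      (α_ (_ ⊗ _) (_ ⊗ _) (_ ⊗ _)).hom ≫ (_ ⊗ _) ◁ (β_ (_ ⊗ _) (_ ⊗ _)).hom ≫
        (α_ (_ ⊗ _) (_ ⊗ _) (_ ⊗ _)).inv ≫
        (tensorμ _ _ _ _ ≫ (P.comp _ _ _ _ ⊗ₘ Q.comp _ _ _ _)) ▷ (_ ⊗ _) ≫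
        tensorμ _ _ _ _ ≫ (P.comp _ _ _ _ ⊗ₘ Q.comp _ _ _ _)
    simp only [comp_whiskerRight, Category.assoc]
    rw [tensorμ_natural_left_assoc, tensorμ_natural_left_assoc]
    have h := shuffle_par (P.obj (fun j => (c j).1) d.1) (Q.obj (fun j => (c j).2) d.2)
      (P.obj (fun j => (e j).1) x.1) (Q.obj (fun j => (e j).2) x.2)
      (P.obj (fun j => (f j).1) y.1) (Q.obj (fun j => (f j).2) y.2)
    rw [← reassoc_of% h]
    simp only [tensorHom_comp_tensorHom, Category.assoc]
    rw [hP.assoc_par i j hij i' j' _ (congrArg Prod.fst hy) (congrArg Prod.fst hx') _ hi' hj'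
        (hs.map Prod.fst) (hst.map Prod.fst) (hs'.map Prod.fst) (hst'.map Prod.fst),
      hQ.assoc_par i j hij i' j' _ (congrArg Prod.snd hy) (congrArg Prod.snd hx') _ hi' hj'
        (hs.map Prod.snd) (hst.map Prod.snd) (hs'.map Prod.snd) (hst'.map Prod.snd)]
  act_comp {n m k c c' e e' g g'} i x σ τ ρ hρ hσ hτ h hx hx' hg hg' d := by
    change ((P.act _ _ _ ⊗ₘ Q.act _ _ _) ⊗ₘ (P.act _ _ _ ⊗ₘ Q.act _ _ _)) ≫
        tensorμ _ _ _ _ ≫ (P.comp _ _ _ _ ⊗ₘ Q.comp _ _ _ _) =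
      (tensorμ _ _ _ _ ≫ (P.comp _ _ _ _ ⊗ₘ Q.comp _ _ _ _)) ≫ (P.act _ _ _ ⊗ₘ Q.act _ _ _)
    rw [tensorμ_natural_assoc, Category.assoc, tensorHom_comp_tensorHom, tensorHom_comp_tensorHom,
      hP.act_comp i σ τ ρ hρ _ _ (fun j => congrArg Prod.fst (h j)) (congrArg Prod.fst hx) _
        (hg.map Prod.fst),
      hQ.act_comp i σ τ ρ hρ _ _ (fun j => congrArg Prod.snd (h j)) (congrArg Prod.snd hx) _
        (hg.map Prod.snd)]

end OperadData

end Hadamard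

section Hadamard

variable {E : Type u} [Category.{v} E] [MonoidalCategory E] [SymmetricCategory E]

variable (E) in
/-- The unit for the Hadamard product: the operad for commutative monoids, with one object. -/
def OperadData.uCom : OperadData.{v, u, w} E where
  Ob := PUnit
  obj _ _ := 𝟙_ E
  act _ _ _ := 𝟙 _
  comp _ _ _ _ _ := (λ_ _).hom
  unit _ := 𝟙 _

lemma OperadData.uCom_isOperad : (OperadData.uCom.{v, u, w} E).IsOperad where
  act_one _ _ := rfl
  act_mul _ _ _ _ _ _ := Category.id_comp _
  unit_comp _ _ := by
    change (λ_ (𝟙_ E)).inv ≫ 𝟙 (𝟙_ E) ▷ 𝟙_ E ≫ (λ_ (𝟙_ E)).hom = 𝟙 (𝟙_ E)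
    simp
  comp_unit _ _ _ := by
    change (ρ_ (𝟙_ E)).inv ≫ 𝟙_ E ◁ 𝟙 (𝟙_ E) ≫ (λ_ (𝟙_ E)).hom = 𝟙 (𝟙_ E)
    simp [unitors_equal]
  assoc_seq := by
    intros
    change (λ_ (𝟙_ E)).hom ▷ 𝟙_ E ≫ (λ_ (𝟙_ E)).hom =
      (α_ _ _ _).hom ≫ 𝟙_ E ◁ (λ_ (𝟙_ E)).hom ≫ (λ_ (𝟙_ E)).hom
    simp [unitors_equal]
  assoc_par := by
    intros
    change (λ_ (𝟙_ E)).hom ▷ 𝟙_ E ≫ (λ_ (𝟙_ E)).hom =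
      (α_ _ _ _).hom ≫ 𝟙_ E ◁ (β_ (𝟙_ E) (𝟙_ E)).hom ≫ (α_ _ _ _).inv ≫
        (λ_ (𝟙_ E)).hom ▷ 𝟙_ E ≫ (λ_ (𝟙_ E)).hom
    rw [braiding_unit]
    simp
  act_comp := by
    intros
    change (𝟙 (𝟙_ E) ⊗ₘ 𝟙 (𝟙_ E)) ≫ (λ_ (𝟙_ E)).hom = (λ_ (𝟙_ E)).hom ≫ 𝟙 _
    simp

namespace OperadHom

/-- The Hadamard product of morphisms. -/
def tensor {P P' Q Q' : OperadData.{v, u, w} E} (f : OperadHom P P') (g : OperadHom Q Q') :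
    OperadHom (P.tensor Q) (P'.tensor Q') where
  onOb x := (f.onOb x.1, g.onOb x.2)
  map c d := f.map _ d.1 ⊗ₘ g.map _ d.2
  isHom :=
    { map_act := fun σ h d => by
        change (_ ⊗ₘ _) ≫ (_ ⊗ₘ _) = (_ ⊗ₘ _) ≫ (_ ⊗ₘ _)
        rw [tensorHom_comp_tensorHom, tensorHom_comp_tensorHom, f.isHom.map_act, g.isHom.map_act]
      map_comp := fun i x hx hg d => by
        change (tensorμ _ _ _ _ ≫ (P.comp _ _ _ _ ⊗ₘ Q.comp _ _ _ _)) ≫ (_ ⊗ₘ _) =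
          ((_ ⊗ₘ _) ⊗ₘ (_ ⊗ₘ _)) ≫ tensorμ _ _ _ _ ≫ (P'.comp _ _ _ _ ⊗ₘ Q'.comp _ _ _ _)
        rw [tensorμ_natural_assoc, Category.assoc, tensorHom_comp_tensorHom,
          tensorHom_comp_tensorHom, f.isHom.map_comp i (congrArg Prod.fst hx),
          g.isHom.map_comp i (congrArg Prod.snd hx)]
      map_unit := fun x => by
        change elPair _ _ ≫ (_ ⊗ₘ _) = elPair _ _
        rw [elPair_comp, f.isHom.map_unit, g.isHom.map_unit] }

variable (P Q R S : OperadData.{v, u, w} E)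

/-- The associator. -/
def associator : OperadHom ((P.tensor Q).tensor R) (P.tensor (Q.tensor R)) where
  onOb x := (x.1.1, (x.1.2, x.2))
  map c d := (α_ _ _ _).hom
  isHom :=
    { map_act := fun σ h d => MonoidalCategory.associator_naturality _ _ _
      map_comp := fun i x hx hg d => shuffle_assoc _ _ _
      map_unit := fun x => elPair_assoc _ _ _ }

/-- The inverse of the associator. -/
def associatorInv : OperadHom (P.tensor (Q.tensor R)) ((P.tensor Q).tensor R) where
  onOb x := ((x.1, x.2.1), x.2.2)
  map c d := (α_ _ _ _).inv
  isHom :=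
    { map_act := fun σ h d => MonoidalCategory.associator_inv_naturality _ _ _
      map_comp := fun i x hx hg d => shuffle_assocInv _ _ _
      map_unit := fun x => elPair_assocInv _ _ _ }

/-- The left unitor. -/
def leftUnitor : OperadHom ((OperadData.uCom E).tensor P) P where
  onOb x := x.2
  map c d := (λ_ _).hom
  isHom :=
    { map_act := fun σ h d =>
        (congrArg (· ≫ _) (id_tensorHom _ _)).trans (MonoidalCategory.leftUnitor_naturality _)
      map_comp := fun i x hx hg d => shuffle_leftUnitor _
      map_unit := fun x => elPair_leftUnitor _ }

/-- The inverse of the left unitor. -/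
def leftUnitorInv : OperadHom P ((OperadData.uCom E).tensor P) where
  onOb x := (PUnit.unit, x)
  map c d := (λ_ _).inv
  isHom :=
    { map_act := fun σ h d =>
        (MonoidalCategory.leftUnitor_inv_naturality _).trans
          (congrArg (_ ≫ ·) (id_tensorHom _ _).symm)
      map_comp := fun i x hx hg d => shuffle_leftUnitorInv _
      map_unit := fun x => comp_leftUnitor_inv _ }

/-- The right unitor. -/
def rightUnitor : OperadHom (P.tensor (OperadData.uCom E)) P where
  onOb x := x.1
  map c d := (ρ_ _).hom
  isHom :=
    { map_act := fun σ h d =>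
        (congrArg (· ≫ _) (tensorHom_id _ _)).trans (MonoidalCategory.rightUnitor_naturality _)
      map_comp := fun i x hx hg d => shuffle_rightUnitor _
      map_unit := fun x => elPair_rightUnitor _ }

/-- The inverse of the right unitor. -/
def rightUnitorInv : OperadHom P (P.tensor (OperadData.uCom E)) where
  onOb x := (x, PUnit.unit)
  map c d := (ρ_ _).inv
  isHom :=
    { map_act := fun σ h d =>
        (MonoidalCategory.rightUnitor_inv_naturality _).trans
          (congrArg (_ ≫ ·) (tensorHom_id _ _).symm)
      map_comp := fun i x hx hg d => shuffle_rightUnitorInv _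
      map_unit := fun x => comp_rightUnitor_inv _ }

/-- The braiding. -/
def braiding : OperadHom (P.tensor Q) (Q.tensor P) where
  onOb x := (x.2, x.1)
  map c d := (β_ _ _).hom
  isHom :=
    { map_act := fun σ h d => BraidedCategory.braiding_naturality _ _
      map_comp := fun i x hx hg d => shuffle_braiding _ _
      map_unit := fun x => elPair_braiding _ _ }

variable {P Q R S}

lemma tensor_id : (OperadHom.id P).tensor (OperadHom.id Q) = OperadHom.id (P.tensor Q) :=
  ext_of rfl (heq_of_eq (by funext n c d; exact id_tensorHom_id _ _))

lemma tensor_comp {P' P'' Q' Q'' : OperadData.{v, u, w} E} (f : OperadHom P P')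
    (f' : OperadHom P' P'') (g : OperadHom Q Q') (g' : OperadHom Q' Q'') :
    (f.tensor g).comp (f'.tensor g') = (f.comp f').tensor (g.comp g') :=
  ext_of rfl (heq_of_eq (by funext n c d; exact tensorHom_comp_tensorHom _ _ _ _))

end OperadHom

namespace EnrichedOperad

variable (P Q : EnrichedOperad.{v, u, w} E)

/-- The Hadamard product of two enriched operads. -/
def tensor : EnrichedOperad.{v, u, w} E where
  toOperadData := P.toOperadData.tensor Q.toOperadData
  isOperad := OperadData.tensor_isOperad P.isOperad Q.isOperad

variable (E) in
/-- The unit for the Hadamard product. -/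
def uCom : EnrichedOperad.{v, u, w} E where
  toOperadData := OperadData.uCom E
  isOperad := OperadData.uCom_isOperad

end EnrichedOperad

/-- The Hadamard product of natural transformations. -/
def OperadTrans.tensor {P P' Q Q' : OperadData.{v, u, w} E} {f f' : OperadHom P P'}
    {g g' : OperadHom Q Q'} (η : OperadTrans f f') (θ : OperadTrans g g') :
    OperadTrans (f.tensor g) (f'.tensor g') where
  app x := elPair (η.app x.1) (θ.app x.2)
  natural c d := by
    have h1 := OperadData.tensor_post (P := P') (Q := Q') (fun j => (f.tensor g).onOb (c j))
      (d := (f.tensor g).onOb d) (d' := (f'.tensor g').onOb d) (η.app d.1) (θ.app d.2)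
    have h2 := OperadData.tensor_pre (P := P') (Q := Q')
      (x := fun j => (f'.tensor g').onOb (c j)) (y := fun j => (f.tensor g).onOb (c j))
      (fun j => η.app (c j).1) (fun j => θ.app (c j).2) ((f'.tensor g').onOb d)
    refine (congrArg ((f.tensor g).map c d ≫ ·) h1).trans ?_
    refine Eq.trans ?_ (congrArg ((f'.tensor g').map c d ≫ ·) h2).symm
    refine (tensorHom_comp_tensorHom _ _ _ _).trans ?_
    refine Eq.trans ?_ (tensorHom_comp_tensorHom _ _ _ _).symm
    exact congrArg₂ (· ⊗ₘ ·) (η.natural _ _) (θ.natural _ _)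

instance : MonoidalCategoryStruct (EnrichedOperad.{v, u, w} E) where
  tensorObj P Q := P.tensor Q
  whiskerLeft P _ _ f := (OperadHom.id P.toOperadData).tensor f
  whiskerRight f Q := OperadHom.tensor f (OperadHom.id Q.toOperadData)
  tensorHom f g := OperadHom.tensor f g
  tensorUnit := EnrichedOperad.uCom E
  associator P Q R :=
    { hom := OperadHom.associator P.toOperadData Q.toOperadData R.toOperadData
      inv := OperadHom.associatorInv P.toOperadData Q.toOperadData R.toOperadData
      hom_inv_id :=
        OperadHom.ext_of rfl (heq_of_eq (by funext n c d; exact Iso.hom_inv_id _))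
      inv_hom_id :=
        OperadHom.ext_of rfl (heq_of_eq (by funext n c d; exact Iso.inv_hom_id _)) }
  leftUnitor P :=
    { hom := OperadHom.leftUnitor P.toOperadData
      inv := OperadHom.leftUnitorInv P.toOperadData
      hom_inv_id :=
        OperadHom.ext_of rfl (heq_of_eq (by funext n c d; exact Iso.hom_inv_id _))
      inv_hom_id :=
        OperadHom.ext_of rfl (heq_of_eq (by funext n c d; exact Iso.inv_hom_id _)) }
  rightUnitor P :=
    { hom := OperadHom.rightUnitor P.toOperadData
      inv := OperadHom.rightUnitorInv P.toOperadData
      hom_inv_id :=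
        OperadHom.ext_of rfl (heq_of_eq (by funext n c d; exact Iso.hom_inv_id _))
      inv_hom_id :=
        OperadHom.ext_of rfl (heq_of_eq (by funext n c d; exact Iso.inv_hom_id _)) }

/-- The symmetric monoidal structure on the category of enriched operads given by the Hadamard
product. -/
instance : MonoidalCategory (EnrichedOperad.{v, u, w} E) :=
  MonoidalCategory.ofTensorHom
    (fun _ _ => OperadHom.tensor_id)
    (fun _ _ _ _ => rfl) (fun _ _ => rfl)
    (fun f g f' g' => OperadHom.tensor_comp f f' g g')
    (fun f g h => OperadHom.ext_of rfl (heq_of_eq (by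
      funext n c d; exact MonoidalCategory.associator_naturality _ _ _)))
    (fun f => OperadHom.ext_of rfl (heq_of_eq (by
      funext n c d
      exact (congrArg (· ≫ _) (id_tensorHom _ _)).trans
        (MonoidalCategory.leftUnitor_naturality _))))
    (fun f => OperadHom.ext_of rfl (heq_of_eq (by
      funext n c d
      exact (congrArg (· ≫ _) (tensorHom_id _ _)).trans
        (MonoidalCategory.rightUnitor_naturality _))))
    (fun P Q R S => OperadHom.ext_of rfl (heq_of_eq (by
      funext n c d
      refine Eq.trans ?_ (MonoidalCategory.pentagon _ _ _ _)
      exact congrArg₂ (fun a b => a ≫ (α_ _ _ _).hom ≫ b) (tensorHom_id _ _) (id_tensorHom _ _))))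
    (fun P Q => OperadHom.ext_of rfl (heq_of_eq (by
      funext n c d
      exact (congrArg (_ ≫ ·) (id_tensorHom _ _)).trans
        ((MonoidalCategory.triangle _ _).trans (tensorHom_id _ _).symm))))

instance : SymmetricCategory (EnrichedOperad.{v, u, w} E) where
  braiding P Q :=
    { hom := OperadHom.braiding P.toOperadData Q.toOperadData
      inv := OperadHom.braiding Q.toOperadData P.toOperadData
      hom_inv_id :=
        OperadHom.ext_of rfl (heq_of_eq (by funext n c d; exact SymmetricCategory.symmetry _ _))
      inv_hom_id :=
        OperadHom.ext_of rfl (heq_of_eq (by funext n c d; exact SymmetricCategory.symmetry _ _)) }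
  braiding_naturality_right P _ _ f := OperadHom.ext_of rfl (heq_of_eq (by
    funext n c d; exact BraidedCategory.braiding_naturality _ _))
  braiding_naturality_left f Q := OperadHom.ext_of rfl (heq_of_eq (by
    funext n c d; exact BraidedCategory.braiding_naturality _ _))
  hexagon_forward P Q R := OperadHom.ext_of rfl (heq_of_eq (by
    funext n c d
    refine (BraidedCategory.hexagon_forward _ _ _).trans ?_
    exact congrArg₂ (fun a b => a ≫ (α_ _ _ _).hom ≫ b) (tensorHom_id _ _).symm
      (id_tensorHom _ _).symm))
  hexagon_reverse P Q R := OperadHom.ext_of rfl (heq_of_eq (by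
    funext n c d
    refine (BraidedCategory.hexagon_reverse _ _ _).trans ?_
    exact congrArg₂ (fun a b => a ≫ (α_ _ _ _).inv ≫ b) (id_tensorHom _ _).symm
      (tensorHom_id _ _).symm))
  symmetry P Q :=
    OperadHom.ext_of rfl (heq_of_eq (by funext n c d; exact SymmetricCategory.symmetry _ _))

lemma OperadData.tensor_uComp {P Q : OperadData.{v, u, w} E} {x y z : (P.tensor Q).Ob}
    (b : 𝟙_ E ⟶ P.obj (fun _ : Fin 1 => y.1) z.1) (b' : 𝟙_ E ⟶ Q.obj (fun _ : Fin 1 => y.2) z.2)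
    (a : 𝟙_ E ⟶ P.obj (fun _ : Fin 1 => x.1) y.1) (a' : 𝟙_ E ⟶ Q.obj (fun _ : Fin 1 => x.2) y.2) :
    (P.tensor Q).uComp (x := x) (y := y) (z := z) (elPair b b') (elPair a a') =
      elPair (P.uComp b a) (Q.uComp b' a') :=
  prod_tEl b b' a a' _ _

lemma OperadTrans.tensor_whiskerRight_app {P P' P'' Q Q' Q'' : EnrichedOperad.{v, u, w} E}
    {f f' : OperadHom P.toOperadData P'.toOperadData}
    {g g' : OperadHom Q.toOperadData Q'.toOperadData} (η : OperadTrans f f') (θ : OperadTrans g g')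
    (h : OperadHom P'.toOperadData P''.toOperadData)
    (k : OperadHom Q'.toOperadData Q''.toOperadData) (x : (P.tensor Q).Ob) :
    OperadTrans.app (OperadTrans.tensor (OperadTrans.whiskerRight η h)
        (OperadTrans.whiskerRight θ k)) x ≍
      OperadTrans.app (OperadTrans.whiskerRight (P := P.tensor Q) (Q := P'.tensor Q')
        (R := P''.tensor Q'') (OperadTrans.tensor η θ) (h.tensor k)) x := by
  have h := elPair_comp (η.app x.1) (θ.app x.2) (h.map _ _) (k.map _ _)
  exact heq_of_eq h.symm

lemma OperadTrans.tensor_id' {P P' Q Q' : EnrichedOperad.{v, u, w} E}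
    (f : OperadHom P.toOperadData P'.toOperadData) (g : OperadHom Q.toOperadData Q'.toOperadData) :
    OperadTrans.tensor (𝟙 f) (𝟙 g) =
      OperadTrans.id (P := P.tensor Q) (Q := P'.tensor Q') (f.tensor g) :=
  OperadTrans.ext rfl

lemma OperadTrans.tensor_comp' {P P' Q Q' : EnrichedOperad.{v, u, w} E}
    {f f' f'' : OperadHom P.toOperadData P'.toOperadData}
    {g g' g'' : OperadHom Q.toOperadData Q'.toOperadData} (η : OperadTrans f f')
    (η' : OperadTrans f' f'') (θ : OperadTrans g g') (θ' : OperadTrans g' g'') :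
    OperadTrans.tensor (OperadTrans.comp η η') (OperadTrans.comp θ θ') =
      OperadTrans.comp (P := P.tensor Q) (Q := P'.tensor Q') (OperadTrans.tensor η θ)
        (OperadTrans.tensor η' θ') :=
  OperadTrans.ext (funext fun x =>
    (OperadData.tensor_uComp (x := (f.tensor g).onOb x) (y := (f'.tensor g').onOb x)
      (z := (f''.tensor g'').onOb x) _ _ _ _).symm)

instance : MonoidalContext (EnrichedOperad.{v, u, w} E) where
  tensor₂ η θ := OperadTrans.tensor η θ
  tensor₂_id f g := OperadTrans.tensor_id' f g
  tensor₂_comp η η' θ θ' := OperadTrans.tensor_comp' η η' θ θ'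
  tensor₂_whiskerLeft {a a' a'' b b' b''} f g _ _ _ _ η θ :=
    OperadTrans.eq_conj (P := a.tensor b) (Q := a''.tensor b'') _ _ fun x => HEq.rfl
  tensor₂_whiskerRight {a a' a'' b b' b'' f f' g g'} η θ h k :=
    OperadTrans.eq_conj (P := a.tensor b) (Q := a''.tensor b'') _ _
      (OperadTrans.tensor_whiskerRight_app η θ h k)
  associator_naturality₂ η θ ζ := OperadTrans.eq_conj _ _ fun x =>
    heq_of_eq (elPair_assoc _ _ _)
  leftUnitor_naturality₂ η := OperadTrans.eq_conj _ _ fun x =>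
    heq_of_eq (elPair_leftUnitor _)
  rightUnitor_naturality₂ η := OperadTrans.eq_conj _ _ fun x =>
    heq_of_eq (elPair_rightUnitor _)
  braiding_naturality₂ η θ := OperadTrans.eq_conj _ _ fun x =>
    heq_of_eq (elPair_braiding _ _)

end Hadamard

/-! ### Multiple tensors -/

section MultiTensor

variable {E : Type u} [Category.{v} E] [MonoidalCategory E] [SymmetricCategory E]

namespace SymMonECat

variable (C : SymMonECat.{v, u, w} E)

/-- The `n`-fold tensor product `c 0 ⊗ (c 1 ⊗ (⋯ ⊗ c (n - 1)))`: the unit object for `n = 0`, and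
`c 0` for `n = 1`. -/
def tens : {n : ℕ} → (Fin n → C.carrier) → C.carrier
  | 0, _ => C.one
  | 1, c => c 0
  | n + 2, c => C.tObj (c 0) (tens (fun j : Fin (n + 1) => c j.succ))

/-- The canonical element `c 0 ⊗ (c 1 ⊗ ⋯ ⊗ c n) ⟶ c 0 ⊗ ⋯ ⊗ c n`. -/
def consEl : {n : ℕ} → (c : Fin (n + 1) → C.carrier) →
    (𝟙_ E ⟶ (C.tObj (c 0) (C.tens (fun j : Fin n => c j.succ)) ⟶[E] C.tens c))
  | 0, c => C.rUnit (c 0)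
  | _ + 1, _ => eId E _

/-- The canonical element `c 0 ⊗ ⋯ ⊗ c n ⟶ c 0 ⊗ (c 1 ⊗ ⋯ ⊗ c n)`. -/
def unconsEl : {n : ℕ} → (c : Fin (n + 1) → C.carrier) →
    (𝟙_ E ⟶ (C.tens c ⟶[E] C.tObj (c 0) (C.tens (fun j : Fin n => c j.succ))))
  | 0, c => C.rUnitInv (c 0)
  | _ + 1, _ => eId E _

lemma tens_congr {n k : ℕ} (hk : k = n) {c : Fin n → C.carrier} {g : Fin k → C.carrier}
    (h : ∀ (j : Fin n) (p : Fin k), p.val = j.val → g p = c j) : C.tens g = C.tens c := by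
  subst hk
  rw [show g = c from funext fun j => h j j rfl]

/-- The canonical element `⨂ g ⟶ (⨂ a) ⊗ (⨂ b)` where the list `g` is the concatenation of the
lists `a` and `b`. -/
def splitEl : {m l k : ℕ} → (a : Fin m → C.carrier) → (b : Fin l → C.carrier) →
    (g : Fin k → C.carrier) → (hk : k = m + l) →
    (ha : ∀ (j : Fin m) (p : Fin k), p.val = j.val → g p = a j) →
    (hb : ∀ (j : Fin l) (p : Fin k), p.val = m + j.val → g p = b j) →
    (𝟙_ E ⟶ (C.tens g ⟶[E] C.tObj (C.tens a) (C.tens b)))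
  | 0, l, k, _, b, g, hk, _, hb =>
    elComp (elOfEq (C.tens_congr (c := b) (g := g) (by omega)
      fun j p hp => hb j p (by omega))) (C.lUnitInv (C.tens b))
  | m + 1, l, 0, _, _, _, hk, _, _ => absurd hk (by omega)
  | m + 1, l, k + 1, a, b, g, hk, ha, hb =>
    elComp (C.unconsEl g) (elComp
      (C.tEl (elOfEq (ha 0 0 rfl))
        (splitEl (fun j : Fin m => a j.succ) b (fun j : Fin k => g j.succ) (by omega)
          (fun j p hp => ha j.succ p.succ (by simp [hp]))
          (fun j p hp => hb j p.succ (by simp [hp]; omega))))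
      (elComp (C.assocInv (a 0) (C.tens fun j : Fin m => a j.succ) (C.tens b))
        (C.tEl (C.consEl a) (eId E (C.tens b)))))

/-- The morphism `C(⨂ e, c i) ⟶ C(⨂ g, ⨂ c)` which tensors with the identities of the `c j` for
`j ≠ i`, where `g` is obtained from the list `c` by replacing its `i`-th entry by the list `e`. -/
def insertHom : {n m k : ℕ} → (c : Fin n → C.carrier) → (e : Fin m → C.carrier) →
    (g : Fin k → C.carrier) → (i : Fin n) → IsGraft i c e g →
    ((C.tens e ⟶[E] c i) ⟶ (C.tens g ⟶[E] C.tens c))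
  | 0, _, _, _, _, _, i, _ => i.elim0
  | 1, m, k, c, e, g, ⟨0, _⟩, h =>
    elPre (elOfEq (C.tens_congr (c := e) (g := g) (by have := h.length; omega)
      fun j p hp => h.inner j p (by simpa using hp))) (c 0)
  | n + 2, m, k, c, e, g, ⟨0, _⟩, h =>
    (ρ_ _).inv ≫ _ ◁ eId E (C.tens fun j : Fin (n + 1) => c j.succ) ≫
      C.tHom (C.tens e) (c 0) _ _ ≫
        elPre (C.splitEl e (fun j : Fin (n + 1) => c j.succ) g (by have := h.length; omega)
          (fun j p hp => h.inner j p (by simpa using hp))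
          (fun j p hp => h.outer j.succ p
            (Or.inr ⟨Fin.mk_lt_mk.2 (Nat.succ_pos _), by simp; omega⟩))) _
  | n + 2, m, 0, _, _, _, ⟨_ + 1, _⟩, h => absurd h.length (by omega)
  | n + 2, m, k + 1, c, e, g, ⟨i + 1, hi⟩, h =>
    insertHom (fun j : Fin (n + 1) => c j.succ) e (fun j : Fin k => g j.succ)
        ⟨i, Nat.lt_of_succ_lt_succ hi⟩
        { length := by have := h.length; omega
          outer := fun j p hp => h.outer j.succ p.succ (by
            simp only [OuterPos, Fin.lt_def, Fin.val_succ] at hp ⊢; omega)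
          inner := fun j p hp => h.inner j p.succ (by simp at hp ⊢; omega) } ≫
      (λ_ _).inv ≫
        elOfEq (E := E) (h.outer 0 0 (Or.inl ⟨Fin.mk_lt_mk.2 (Nat.succ_pos _), rfl⟩)) ▷ _ ≫
        C.tHom (g 0) (c 0) _ _ ≫ elPre (C.unconsEl g) _

/-- The canonical element `c q ⊗ (⨂ c') ⟶ ⨂ c`, where the list `c'` is obtained from `c` by removing
its entry at the position `q`. -/
def moveEl : {n : ℕ} → (c : Fin (n + 1) → C.carrier) → (c' : Fin n → C.carrier) →
    (q : Fin (n + 1)) → (∀ j, c' j = c (q.succAbove j)) →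
    (𝟙_ E ⟶ (C.tObj (c q) (C.tens c') ⟶[E] C.tens c))
  | _, c, c', ⟨0, _⟩, h =>
    elComp (C.tEl (eId E (c 0)) (elOfEq (C.tens_congr (c := fun j => c j.succ) rfl
      fun j p hp => by rw [Fin.ext hp, h j]; rfl))) (C.consEl c)
  | 0, _, _, ⟨q + 1, hq⟩, _ => absurd hq (by omega)
  | n + 1, c, c', ⟨q + 1, hq⟩, h =>
    elComp (C.tEl (eId E (c ⟨q + 1, hq⟩)) (C.unconsEl c')) (elComp
      (C.assocInv (c ⟨q + 1, hq⟩) (c' 0) (C.tens fun j : Fin n => c' j.succ)) (elComp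
      (C.tEl (C.comm (c ⟨q + 1, hq⟩) (c' 0)) (eId E (C.tens fun j : Fin n => c' j.succ))) (elComp
      (C.assoc (c' 0) (c ⟨q + 1, hq⟩) (C.tens fun j : Fin n => c' j.succ))
      (C.tEl (y' := C.tens fun j : Fin (n + 1) => c j.succ)
        (elOfEq ((h 0).trans (congrArg c (Fin.succ_succAbove_zero
          (⟨q, Nat.lt_of_succ_lt_succ hq⟩ : Fin (n + 1))))))
        (moveEl (fun j : Fin (n + 1) => c j.succ) (fun j : Fin n => c' j.succ)
          ⟨q, Nat.lt_of_succ_lt_succ hq⟩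
          (fun j => (h j.succ).trans (congrArg c (Fin.succ_succAbove_succ
            (⟨q, Nat.lt_of_succ_lt_succ hq⟩ : Fin (n + 1)) j))))))))

end SymMonECat

/-- The permutation of `n` letters obtained from a permutation `σ` of `n + 1` letters by removing
`0` from the source and `σ 0` from the target. -/
def permTail {n : ℕ} (σ : Equiv.Perm (Fin (n + 1))) : Equiv.Perm (Fin n) :=
  Equiv.removeNone ((finSuccEquiv' 0).symm.trans (σ.trans (finSuccEquiv' (σ 0))))

lemma succAbove_permTail {n : ℕ} (σ : Equiv.Perm (Fin (n + 1))) (j : Fin n) :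
    (σ 0).succAbove (permTail σ j) = σ j.succ := by
  have h1 : σ j.succ ≠ σ 0 := fun h => Fin.succ_ne_zero j (σ.injective h)
  obtain ⟨k, hk⟩ := Fin.exists_succAbove_eq h1
  have h2 : ((finSuccEquiv' (0 : Fin (n + 1))).symm.trans
      (σ.trans (finSuccEquiv' (σ 0)))) (some j) = some k := by
    simp [← hk]
  have h3 := Equiv.removeNone_some _ ⟨k, h2⟩
  rw [h2] at h3
  rw [permTail, Option.some_injective _ h3, hk]

namespace SymMonECat

variable (C : SymMonECat.{v, u, w} E)

/-- The canonical element `⨂ c' ⟶ ⨂ c`, where `c' i = c (σ i)` for a permutation `σ`. -/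
def permEl : {n : ℕ} → (c c' : Fin n → C.carrier) → (σ : Equiv.Perm (Fin n)) →
    (∀ i, c' i = c (σ i)) → (𝟙_ E ⟶ (C.tens c' ⟶[E] C.tens c))
  | 0, _, _, _, _ => eId E C.one
  | _ + 1, c, c', σ, h =>
    elComp (C.unconsEl c') (elComp
      (C.tEl (elOfEq (h 0)) (permEl (fun j => c ((σ 0).succAbove j)) (fun j => c' j.succ) (permTail σ)
        (fun j => by rw [h, succAbove_permTail])))
      (C.moveEl c (fun j => c ((σ 0).succAbove j)) (σ 0) (fun _ => rfl)))

end SymMonECat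

namespace LaxHom

variable {C D : SymMonECat.{v, u, w} E} (f : LaxHom C D)

/-- The structural maps `f(c 0) ⊗ ⋯ ⊗ f(c (n - 1)) ⟶ f(c 0 ⊗ ⋯ ⊗ c (n - 1))`. -/
def muN : {n : ℕ} → (c : Fin n → C.carrier) →
    (𝟙_ E ⟶ (D.tens (fun j => f.obj (c j)) ⟶[E] f.obj (C.tens c)))
  | 0, _ => f.eps
  | 1, c => eId E (f.obj (c 0))
  | _ + 2, c => elComp (D.tEl (eId E (f.obj (c 0))) (muN fun j => c j.succ)) (f.mu (c 0) _)

end LaxHom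

lemma SymMonECat.tens_tensor (C D : SymMonECat.{v, u, w} E) : ∀ {n : ℕ}
    (c : Fin n → C.carrier × D.carrier), (C.tensor D).tens c =
      (C.tens (fun j => (c j).1), D.tens (fun j => (c j).2))
  | 0, _ => rfl
  | 1, _ => rfl
  | n + 2, c => congrArg (fun t => (C.tensor D).tObj (c 0) t) (tens_tensor C D fun j => c j.succ)

end MultiTensor

/-! ### The construction of endomorphism operads -/

section End

variable {E : Type u} [Category.{v} E] [MonoidalCategory E] [SymmetricCategory E]

/-- The data of the operad `End(C)`, whose operations are the
`C(c 0 ⊗ ⋯ ⊗ c (n - 1), d)`. -/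
def endData (C : SymMonECat.{v, u, w} E) : OperadData.{v, u, w} E where
  Ob := C.carrier
  obj c d := C.tens c ⟶[E] d
  act {_ c c'} σ h d := elPre (C.permEl c c' σ h) d
  comp {_ _ _ c e g} i x hx hg d :=
    (β_ _ _).hom ≫ (eqToHom (by rw [hx]) ≫ C.insertHom c e g i hg) ▷ _ ≫ eComp E _ _ d
  unit x := eId E x

/-- The data of the morphism of operads `End(f)`: a composite
`C(⨂ c, d) ⟶ D(f(⨂ c), f(d)) ⟶ D(⨂ f(c), f(d))`. -/
def endHomData {C D : SymMonECat.{v, u, w} E} (f : LaxHom C D) :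
    OperadHomData (endData C) (endData D) where
  onOb := f.obj
  map c d := f.map (C.tens c) d ≫ elPre (f.muN c) (f.obj d)

/-- The canonical map `End(C) ⊗ End(D) ⟶ End(C ⊗ D)`, which is an identity on objects, and is given on
operations by the composite of the identity
`C(⨂ x, x') ⊗ D(⨂ y, y') = (C ⊗ D)((⨂ x, ⨂ y), (x', y'))` with the identification of `(⨂ x, ⨂ y)` with
`⨂ (x, y)`. -/
def endMu (C D : SymMonECat.{v, u, w} E) :
    OperadHomData ((endData C).tensor (endData D)) (endData (C.tensor D)) where
  onOb x := x
  map c d := elPre (C := (C.tensor D).carrier)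
    (x := (C.tens (fun j => (c j).1), D.tens (fun j => (c j).2)))
    (elOfEq (C := (C.tensor D).carrier) (C.tens_tensor D c)) d

variable (E) in
/-- The canonical map from the unit operad to `End` of the unit symmetric monoidal enriched
category; it is an identity on operations. -/
def endEps : OperadHomData (OperadData.uCom.{v, u, w} E) (endData (SymMonECat.unit.{v, u, w} E)) where
  onOb x := x
  map _ _ := 𝟙 (𝟙_ E)

variable (E) in
/-- The constructions `End` on objects, 1-morphisms and 2-morphisms give operads, morphisms of
operads and natural transformations, and the canonical maps `End(C) ⊗ End(D) ⟶ End(C ⊗ D)`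
and `uCom ⟶ End(I)` are morphisms of operads. -/
structure EndWellDefined : Prop where
  obj (C : SymMonECat.{v, u, w} E) : (endData C).IsOperad
  map {C D : SymMonECat.{v, u, w} E} (f : LaxHom C D) : (endHomData f).IsHom
  map₂ {C D : SymMonECat.{v, u, w} E} {f g : LaxHom C D} (η : MonTrans f g) :
    IsOperadTrans (endHomData f) (endHomData g) η.app
  mu (C D : SymMonECat.{v, u, w} E) : (endMu C D).IsHom
  eps : (endEps.{v, u, w} E).IsHom

namespace EndWellDefined

/-- The construction `End` from symmetric monoidal enriched categories to enriched operads, on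
objects, 1-morphisms and 2-morphisms. -/
def toStruct (h : EndWellDefined.{v, u, w} E) :
    PrelaxFunctorStruct (SymMonECat.{v, u, w} E) (EnrichedOperad.{v, u, w} E) where
  obj C := { toOperadData := endData C, isOperad := h.obj C }
  map f := { toOperadHomData := endHomData f, isHom := h.map f }
  map₂ η := { app := MonTrans.app η, natural := h.map₂ η }

/-- The morphism of operads `End(C) ⊗ End(D) ⟶ End(C ⊗ D)`. -/
def muHom (h : EndWellDefined.{v, u, w} E) (C D : SymMonECat.{v, u, w} E) :
    h.toStruct.obj C ⊗ h.toStruct.obj D ⟶ h.toStruct.obj (C ⊗ D) :=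
  OperadHom.mk (endMu C D) (h.mu C D)

/-- The morphism of operads `uCom ⟶ End(I)`. -/
def epsHom (h : EndWellDefined.{v, u, w} E) :
    𝟙_ (EnrichedOperad.{v, u, w} E) ⟶ h.toStruct.obj (𝟙_ (SymMonECat.{v, u, w} E)) :=
  OperadHom.mk (endEps E) h.eps

end EndWellDefined

end End

/-!
The proof has to show that a large number of maps between mapping objects, each built by recursion
from associators, unitors, commutators and identities, agree.  All these equations are reduced to
one coherence principle.

*Coherence.*  The elements of the mapping objects of `C` are the morphisms of a symmetric monoidal
category `C.Und`.  In a symmetric monoidal category, let objects be represented as iterated tensor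
products of labelled factors (`SymCoh.Rep`).  The factors can be inserted, one after the other and
each at its place with respect to a well-ordering of the labels, into any tensor product of labelled
objects; a morphism is canonical if it is compatible with these insertions (`SymCoh.IsCan`).  Since
the insertions are isomorphisms, a canonical morphism is unique (`SymCoh.IsCan.eq`); associators
and unitors are canonical, and so are braidings if the labels are different (by the Yang–Baxter
equation).  Giving different labels to the factors of a list, one gets the equations between elements
like those of permutations.

*Operad laws.*  The composition of `End(C)` inserts an operation into a tensor product, by tensoring
with the identities of the other factors.  A map between mapping objects is a canonical insertion
(`SymMonECat.IsIns`) if it is `- ⊗ Z`, up to canonical elements.  Canonical insertions are unique as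
well (`IsIns.eq`), because `- ⊗ Z` is dinatural in `Z`, and they are compatible with composition
(`IsIns.seq`) and with each other at different places (`IsIns.par`, which is the interchange law of
the tensor product).  This gives `endData_isOperad`.

*Morphisms.*  A lax symmetric monoidal functor has iterated structural maps `muN`, and all the
elements and insertions above form commutative squares with them (`LaxHom.Sq`, `LaxHom.InsSq`).
This gives `endHomData_isHom`.  The same squares for the identity functor of `C ⊗ D`, with the
identifications `⨂ (x, y) = (⨂ x, ⨂ y)` in place of the structural maps, show that the comparison map
`End(C) ⊗ End(D) ⟶ End(C ⊗ D)` is a morphism of operads (`endMu_isHom`).  Its naturality and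
coherence hold because its components are identities, as are the structural maps of the strict
functors involved (`LaxHom.muN_eq_elOfEq`).

*Full faithfulness.*  A morphism of operads `F : End(C) ⟶ End(D)` is given by its values on unary
operations, which form an enriched functor, and by the images `F.elN c` of the universal operations
`1 : ⨂ c ⟶ ⨂ c`, as in the Yoneda lemma (`OperadHom.mapN_eq`).  The universal operations of longer
lists are substitutions of binary ones (`OperadHom.elN_cons_succ`).  So `F` amounts to the functor
with the images of the universal binary and nullary operations as structural maps; the axioms of a
lax symmetric monoidal functor are the compatibility of `F` with substitutions and with the
transposition (`OperadHom.toLaxHom`).  In the same way, naturality with respect to all the operations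
reduces to that with respect to unary and universal operations (`monTransOfIsOperadTrans`).
-/

/-! ### Coherence in symmetric monoidal categories -/

namespace SymCoh

universe v₁ u₁

variable {V : Type u₁} [Category.{v₁} V] [MonoidalCategory V] [SymmetricCategory V]

/-- The exchange `A ⊗ (B ⊗ X) ⟶ B ⊗ (A ⊗ X)` of the first two factors. -/
def exch (A B X : V) : A ⊗ (B ⊗ X) ⟶ B ⊗ (A ⊗ X) :=
  (α_ A B X).inv ≫ (β_ A B).hom ▷ X ≫ (α_ B A X).hom

lemma exch_exch (A B X : V) : exch A B X ≫ exch B A X = 𝟙 _ := by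
  simp only [exch, Category.assoc, Iso.hom_inv_id_assoc]
  rw [← comp_whiskerRight_assoc, SymmetricCategory.symmetry]
  simp

instance (A B X : V) : IsIso (exch A B X) := ⟨exch B A X, exch_exch A B X, exch_exch B A X⟩

lemma exch_naturality (A B : V) {X Y : V} (f : X ⟶ Y) :
    A ◁ (B ◁ f) ≫ exch A B Y = exch A B X ≫ B ◁ (A ◁ f) := by
  simp only [exch, Category.assoc]
  rw [associator_inv_naturality_right_assoc, whisker_exchange_assoc, associator_naturality_right]

lemma exch_naturality_left {A A' : V} (f : A ⟶ A') (B X : V) :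
    f ▷ (B ⊗ X) ≫ exch A' B X = exch A B X ≫ B ◁ (f ▷ X) := by
  simp only [exch, Category.assoc]
  rw [associator_inv_naturality_left_assoc, ← comp_whiskerRight_assoc,
    BraidedCategory.braiding_naturality_left, comp_whiskerRight_assoc, associator_naturality_middle]

lemma exch_naturality_middle (A : V) {B B' : V} (f : B ⟶ B') (X : V) :
    A ◁ (f ▷ X) ≫ exch A B' X = exch A B X ≫ f ▷ (A ⊗ X) := by
  simp only [exch, Category.assoc]
  rw [associator_inv_naturality_middle_assoc, ← comp_whiskerRight_assoc,
    BraidedCategory.braiding_naturality_right, comp_whiskerRight_assoc, associator_naturality_left]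

lemma exch_unit_left (B X : V) :
    exch (𝟙_ V) B X ≫ B ◁ (λ_ X).hom = (λ_ (B ⊗ X)).hom := by
  simp [exch]

lemma exch_unit_right (A X : V) :
    exch A (𝟙_ V) X ≫ (λ_ (A ⊗ X)).hom = A ◁ (λ_ X).hom := by
  simp [exch]

lemma exch_tensor_left (A A' B X : V) :
    exch (A ⊗ A') B X ≫ B ◁ (α_ A A' X).hom =
      (α_ A A' (B ⊗ X)).hom ≫ A ◁ exch A' B X ≫ exch A B (A' ⊗ X) := by
  simp only [exch]
  rw [BraidedCategory.braiding_tensor_left_hom]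
  monoidal

lemma exch_tensor_right (A B B' X : V) :
    exch A (B ⊗ B') X ≫ (α_ B B' (A ⊗ X)).hom =
      A ◁ (α_ B B' X).hom ≫ exch A B (B' ⊗ X) ≫ B ◁ exch A B' X := by
  simp only [exch]
  rw [BraidedCategory.braiding_tensor_right_hom]
  monoidal

/-- The Yang–Baxter equation for exchanges. -/
lemma exch_braid (A B D X : V) :
    exch A B (D ⊗ X) ≫ B ◁ exch A D X ≫ exch B D (A ⊗ X) =
      A ◁ exch B D X ≫ exch A D (B ⊗ X) ≫ D ◁ exch A B X := by
  have h := congrArg (· ▷ X) (BraidedCategory.yang_baxter A B D)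
  simp only [comp_whiskerRight] at h
  have h' := congrArg (fun k => A ◁ (α_ B D X).inv ≫ (α_ A (B ⊗ D) X).inv ≫ k ≫
    (α_ D (B ⊗ A) X).hom ≫ D ◁ (α_ B A X).hom) h
  simp only [exch]
  refine Eq.trans ?_ (h'.trans ?_) <;> monoidal

variable {ι : Type*} (x : ι → V)

/-- The right nested tensor product of the objects with labels in a list. -/
@[reducible] def T : List ι → V
  | [] => 𝟙_ V
  | a :: s => x a ⊗ T s

/-- The morphisms from `X` to a tensor product of labelled objects, for a variable list of
labels. -/
@[ext]
structure Sig (X : V) where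
  /-- The list of labels. -/
  list : List ι
  /-- The morphism to the tensor product of the labelled objects. -/
  hom : X ⟶ T x list

variable {x}

namespace Sig

/-- Precomposition. -/
def pre {X Y : V} (f : X ⟶ Y) (p : Sig x Y) : Sig x X := ⟨p.list, f ≫ p.hom⟩

lemma pre_pre {X Y Z : V} (f : X ⟶ Y) (g : Y ⟶ Z) (p : Sig x Z) :
    pre f (pre g p) = pre (f ≫ g) p := by
  simp [pre]

@[simp] lemma pre_id {X : V} (p : Sig x X) : pre (𝟙 X) p = p := by
  simp [pre]

lemma eq_of_pre {X Y : V} {f g : X ⟶ Y} {p : Sig x Y} [IsIso p.hom] (h : pre f p = pre g p) :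
    f = g := by
  have h1 : f ≫ p.hom = g ≫ p.hom := eq_of_heq (Sig.mk.inj h).2
  exact (cancel_mono p.hom).1 h1

variable (x) in
/-- The identity of a tensor product of labelled objects. -/
def one (s : List ι) : Sig x (T x s) := ⟨s, 𝟙 _⟩

lemma pre_one {X : V} (p : Sig x X) : pre p.hom (one x p.list) = p := by
  simp [pre, one]

/-- Tensoring with a labelled object from the left. -/
def cons (a : ι) {X : V} (p : Sig x X) : Sig x (x a ⊗ X) := ⟨a :: p.list, x a ◁ p.hom⟩

lemma cons_pre (a : ι) {X Y : V} (f : X ⟶ Y) (p : Sig x Y) :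
    cons a (pre f p) = pre (x a ◁ f) (cons a p) := by
  ext1
  · rfl
  · exact heq_of_eq (MonoidalCategory.whiskerLeft_comp _ _ _)

lemma one_cons (a : ι) (s : List ι) : one x (a :: s) = cons a (one x s) := by
  ext1
  · rfl
  · exact heq_of_eq (MonoidalCategory.whiskerLeft_id _ _).symm

end Sig

open Sig

open Classical in
/-- The insertion of a labelled object into the tensor product of a list of labelled objects, in
front of the first label that is not smaller.  The labels are compared by an auxiliary
well-ordering. -/
noncomputable def ins (a : ι) : ∀ s : List ι, Sig x (x a ⊗ T x s)
  | [] => cons a (one x [])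
  | b :: s => if WellOrderingRel b a then pre (exch (x a) (x b) (T x s)) (cons b (ins a s))
      else cons a (one x (b :: s))

lemma ins_cons_lt {a b : ι} (h : WellOrderingRel b a) (s : List ι) :
    ins a (b :: s) = pre (exch (x a) (x b) (T x s)) (cons b (ins a s)) := if_pos h

lemma ins_cons_not_lt {a b : ι} (h : ¬ WellOrderingRel b a) (s : List ι) :
    ins a (b :: s) = cons a (one x (b :: s)) := if_neg h

/-- The insertion of a labelled object, for a morphism to a tensor product of labelled objects. -/
noncomputable def insS (a : ι) {X : V} (p : Sig x X) : Sig x (x a ⊗ X) :=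
  pre (x a ◁ p.hom) (ins a p.list)

lemma insS_pre (a : ι) {X Y : V} (f : X ⟶ Y) (p : Sig x Y) :
    insS a (pre f p) = pre (x a ◁ f) (insS a p) := by
  simp [insS, pre]

lemma insS_one (a : ι) (s : List ι) : insS a (one x s) = ins a s := by
  simp [insS, one]

lemma ins_isIso (a : ι) (s : List ι) : IsIso (ins (x := x) a s).hom := by
  have h (s : List ι) : IsIso (cons a (one x s)).hom :=
    inferInstanceAs (IsIso (x a ◁ 𝟙 (T x s)))
  induction s with
  | nil => exact h _
  | cons b s ih =>
    by_cases hb : WellOrderingRel b a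
    · rw [ins_cons_lt hb]
      have : IsIso (x b ◁ (ins (x := x) a s).hom) := inferInstance
      exact IsIso.comp_isIso' inferInstance this
    · rw [ins_cons_not_lt hb]
      exact h _

lemma insS_isIso (a : ι) {X : V} (p : Sig x X) (h : IsIso p.hom) : IsIso (insS a p).hom := by
  have := ins_isIso (x := x) a p.list
  have h1 : IsIso (x a ◁ p.hom) := inferInstance
  exact IsIso.comp_isIso' h1 this

lemma insS_cons_lt {a b : ι} (h : WellOrderingRel b a) {X : V} (p : Sig x X) :
    insS a (cons b p) = pre (exch (x a) (x b) X) (cons b (insS a p)) := by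
  rw [← pre_one p, cons_pre, insS_pre, insS_pre, cons_pre, ← one_cons, insS_one, insS_one,
    ins_cons_lt h, pre_pre, pre_pre]
  exact congrArg (pre · _) (exch_naturality _ _ _)

/-- If `a` is smaller than all the labels before which it could be inserted, it is inserted in the
first place. -/
lemma insS_of_head {a : ι} {X : V} (p : Sig x X)
    (h : ∀ d ∈ p.list.head?, ¬ WellOrderingRel d a) : insS a p = cons a p := by
  rw [← pre_one p, insS_pre, cons_pre, insS_one]
  congr 1
  rcases hs : p.list with _ | ⟨d, s⟩
  · rfl
  · exact ins_cons_not_lt (h d (by rw [hs]; rfl)) s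

/-- A lower bound for the first label persists under the insertion of a label. -/
lemma head_ins {a b : ι} (hab : ¬ WellOrderingRel b a) (s : List ι)
    (h : ∀ d ∈ s.head?, ¬ WellOrderingRel d a) :
    ∀ d ∈ (ins (x := x) b s).list.head?, ¬ WellOrderingRel d a := by
  cases s with
  | nil => simpa [ins, cons] using hab
  | cons d s =>
    by_cases hd : WellOrderingRel d b
    · rw [ins_cons_lt hd]
      simpa [pre, cons] using h
    · rw [ins_cons_not_lt hd]
      simpa [cons] using hab

/-- The insertions are moved past all the labels smaller than `a` by the Yang–Baxter equation; at
the first other label, `a` is inserted in the first place. -/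
lemma ins_ins_of_lt {a b : ι} (hab : WellOrderingRel a b) (s : List ι) :
    pre (exch (x a) (x b) (T x s)) (insS b (ins a s)) = insS a (ins b s) := by
  have hba : ¬ WellOrderingRel b a := fun h => asymm_of WellOrderingRel hab h
  have key : ∀ s : List ι, (∀ d ∈ s.head?, ¬ WellOrderingRel d a) →
      pre (exch (x a) (x b) (T x s)) (insS b (ins a s)) = insS a (ins b s) := by
    intro s h
    rw [insS_of_head (ins b s) (head_ins hba s h), ← insS_one a s, insS_of_head (one x s) h,
      insS_cons_lt hab, pre_pre, exch_exch, pre_id, insS_one]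
  induction s with
  | nil => exact key _ (by simp)
  | cons d s ih =>
    by_cases hd : WellOrderingRel d a
    · have hdb : WellOrderingRel d b := trans_of WellOrderingRel hd hab
      have h := exch_braid (x a) (x b) (x d) (T x s)
      rw [ins_cons_lt hd, ins_cons_lt hdb, insS_pre, insS_pre, insS_cons_lt hdb, insS_cons_lt hd,
        ← ih, cons_pre]
      simp only [pre_pre]
      exact congrArg (pre · _) h
    · exact key _ (by simpa using hd)

/-- Two different labels may be inserted in either order.  In contrast to this, two insertions of
the same label do not commute with the exchange, so that coherence needs different labels. -/
lemma ins_ins {a b : ι} (hab : a ≠ b) (s : List ι) :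
    pre (exch (x a) (x b) (T x s)) (insS b (ins a s)) = insS a (ins b s) := by
  rcases trichotomous_of WellOrderingRel a b with h | h | h
  · exact ins_ins_of_lt h s
  · exact absurd h hab
  · rw [← ins_ins_of_lt h, pre_pre, exch_exch, pre_id]

lemma insS_insS {a b : ι} (hab : a ≠ b) {X : V} (p : Sig x X) :
    pre (exch (x a) (x b) X) (insS b (insS a p)) = insS a (insS b p) := by
  rw [← pre_one p, insS_pre, insS_pre, insS_pre, insS_pre, insS_one, insS_one, ← ins_ins hab,
    pre_pre, pre_pre, exch_naturality]

variable (x) in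
/-- A representation of an object as an iterated tensor product of labelled objects. -/
inductive Rep : V → Type _
  | unit : Rep (𝟙_ V)
  | leaf (a : ι) {o : V} (h : x a = o) : Rep o
  | node {o o' : V} (r : Rep o) (r' : Rep o') : Rep (o ⊗ o')

namespace Rep

/-- The labels which occur in a representation, in their order. -/
def labels : ∀ {o : V}, Rep x o → List ι
  | _, unit => []
  | _, leaf a _ => [a]
  | _, node r r' => r.labels ++ r'.labels

/-- The successive insertion of the labelled factors of an object. -/
noncomputable def app : ∀ {o : V}, Rep x o → ∀ {X : V}, Sig x X → Sig x (o ⊗ X)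
  | _, unit, X, p => pre (λ_ X).hom p
  | _, leaf a h, X, p => pre (eqToHom h.symm ▷ X) (insS a p)
  | _, node r r', _, p => pre (α_ _ _ _).hom (app r (app r' p))

lemma app_pre {o : V} (r : Rep x o) : ∀ {X Y : V} (f : X ⟶ Y) (p : Sig x Y),
    r.app (pre f p) = pre (o ◁ f) (r.app p) := by
  induction r with
  | unit => intro X Y f p; simp [app, pre_pre]
  | leaf a h =>
    intro X Y f p
    rw [app, app, insS_pre, pre_pre, pre_pre, whisker_exchange]
  | node r r' ih ih' =>
    intro X Y f p
    rw [app, app, ih', ih, pre_pre, pre_pre, associator_naturality_right]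

lemma app_isIso {o : V} (r : Rep x o) : ∀ {X : V} (p : Sig x X), IsIso p.hom →
    IsIso (r.app p).hom := by
  induction r with
  | unit => intro X p h; exact IsIso.comp_isIso' inferInstance h
  | leaf a h =>
    intro X p hp
    exact IsIso.comp_isIso' inferInstance (insS_isIso a p hp)
  | node r r' ih ih' =>
    intro X p hp
    exact IsIso.comp_isIso' inferInstance (ih _ (ih' _ hp))

lemma insS_app {o : V} (r : Rep x o) (a : ι) (h : a ∉ r.labels) : ∀ {X : V} (p : Sig x X),
    pre (exch (x a) o X) (r.app (insS a p)) = insS a (r.app p) := by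
  induction r with
  | unit =>
    intro X p
    rw [app, app, insS_pre, pre_pre, exch_unit_right]
  | leaf b hb =>
    intro X p
    rw [app, app, insS_pre, pre_pre, ← exch_naturality_middle, ← pre_pre, insS_insS]
    simpa [labels] using h
  | node r r' ih ih' =>
    intro X p
    simp only [labels, List.mem_append, not_or] at h
    rw [app, app, insS_pre, ← ih h.1, ← ih' h.2, app_pre, pre_pre, pre_pre, pre_pre,
      Category.assoc, exch_tensor_right]

/-- The insertions of disjoint lists of factors commute. -/
lemma app_app {o o' : V} (r : Rep x o) (r' : Rep x o') (h : ∀ a ∈ r.labels, a ∉ r'.labels) :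
    ∀ {X : V} (p : Sig x X), pre (exch o o' X) (r'.app (r.app p)) = r.app (r'.app p) := by
  induction r with
  | unit =>
    intro X p
    rw [app, app, app_pre, pre_pre, exch_unit_left]
  | leaf a ha =>
    intro X p
    rw [app, app, app_pre, pre_pre, ← exch_naturality_left, ← pre_pre, insS_app]
    simpa [labels] using h
  | node r₁ r₂ ih₁ ih₂ =>
    intro X p
    rw [app, app, app_pre, ← ih₂ (fun a ha => h a (by simp [labels, ha])), app_pre,
      ← ih₁ (fun a ha => h a (by simp [labels, ha])), pre_pre, pre_pre, pre_pre,
      exch_tensor_left, Category.assoc]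

end Rep

open SymCoh.Rep

/-- A morphism between represented objects is canonical if it is compatible with the insertion of
the factors into any tensor product of labelled objects. -/
structure IsCan {o o' : V} (r : Rep x o) (r' : Rep x o') (f : o ⟶ o') : Prop where
  pre_app {X : V} (p : Sig x X) : pre (f ▷ X) (r'.app p) = r.app p

namespace IsCan

variable {o o' o'' o₁ o₁' : V} {r : Rep x o} {r' : Rep x o'} {r'' : Rep x o''}
  {r₁ : Rep x o₁} {r₁' : Rep x o₁'}

lemma app_one_isIso (r : Rep x o) : IsIso (r.app (one x [])).hom :=
  r.app_isIso _ (inferInstanceAs (IsIso (𝟙 _)))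

/-- Coherence: there is at most one canonical morphism. -/
lemma eq {f g : o ⟶ o'} (hf : IsCan r r' f) (hg : IsCan r r' g) : f = g := by
  have h := (hf.pre_app (one x [])).trans (hg.pre_app (one x [])).symm
  have := app_one_isIso r'
  exact (whiskerRight_iff f g).1 (eq_of_pre h)

lemma isIso {f : o ⟶ o'} (hf : IsCan r r' f) : IsIso f := by
  have h1 := app_one_isIso r'
  have h2 := app_one_isIso r
  rw [← hf.pre_app] at h2
  have h3 : IsIso (f ▷ T x ([] : List ι) ≫ (r'.app (one x [])).hom) := h2
  have h4 : IsIso (f ▷ 𝟙_ V) := IsIso.of_isIso_comp_right _ (r'.app (one x [])).hom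
  have h5 : f = (ρ_ _).inv ≫ f ▷ 𝟙_ V ≫ (ρ_ _).hom := by simp
  rw [h5]
  infer_instance

lemma id (r : Rep x o) : IsCan r r (𝟙 o) := ⟨fun p => by simp⟩

lemma comp {f : o ⟶ o'} {g : o' ⟶ o''} (hf : IsCan r r' f) (hg : IsCan r' r'' g) :
    IsCan r r'' (f ≫ g) := ⟨fun p => by
  rw [comp_whiskerRight, ← pre_pre, hg.pre_app, hf.pre_app]⟩

lemma tensor {f : o ⟶ o'} {g : o₁ ⟶ o₁'} (hf : IsCan r r' f) (hg : IsCan r₁ r₁' g) :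
    IsCan (r.node r₁) (r'.node r₁') (f ⊗ₘ g) := ⟨fun {X} p => by
  rw [app, app, ← hg.pre_app p, app_pre, ← hf.pre_app (r₁'.app p), pre_pre, pre_pre, pre_pre,
    MonoidalCategory.tensorHom_def', comp_whiskerRight, Category.assoc,
    associator_naturality_left, associator_naturality_middle_assoc, Category.assoc]⟩

lemma of_inv {f : o ⟶ o'} {g : o' ⟶ o} (hf : IsCan r r' f) (h : g ≫ f = 𝟙 _) :
    IsCan r' r g := ⟨fun p => by
  rw [← hf.pre_app p, pre_pre, ← comp_whiskerRight, h, id_whiskerRight, pre_id]⟩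

lemma associator (r : Rep x o) (r' : Rep x o') (r'' : Rep x o'') :
    IsCan ((r.node r').node r'') (r.node (r'.node r'')) (α_ o o' o'').hom := ⟨fun {X} p => by
  simp only [app, app_pre, pre_pre]
  rw [pentagon]⟩

lemma leftUnitor (r : Rep x o) : IsCan (Rep.unit.node r) r (λ_ o).hom := ⟨fun {X} p => by
  simp only [app, pre_pre]
  simp⟩

lemma rightUnitor (r : Rep x o) : IsCan (r.node Rep.unit) r (ρ_ o).hom := ⟨fun {X} p => by
  simp only [app, app_pre, pre_pre]
  simp⟩

lemma braiding (r : Rep x o) (r' : Rep x o') (h : ∀ a ∈ r.labels, a ∉ r'.labels) :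
    IsCan (r.node r') (r'.node r) (β_ o o').hom := ⟨fun {X} p => by
  rw [app, app, pre_pre, ← app_app r r' h, pre_pre]
  simp [exch]⟩

lemma leaf (a : ι) (h : x a = o) (h' : x a = o') (k : o = o') :
    IsCan (Rep.leaf a h) (Rep.leaf a h') (eqToHom k) := by
  subst k
  exact IsCan.id _

end IsCan

variable (x) in
/-- The representation of the tensor product of a list of labelled objects. -/
def repT : ∀ s : List ι, Rep x (T x s)
  | [] => Rep.unit
  | a :: s => (Rep.leaf a rfl).node (repT s)

lemma labels_repT (s : List ι) : (repT x s).labels = s := by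
  induction s with
  | nil => rfl
  | cons a s ih => exact congrArg (a :: ·) ih

lemma exists_isCan_append {o : V} (r : Rep x o) : ∀ s : List ι,
    ∃ f : o ⊗ T x s ⟶ T x (r.labels ++ s),
      IsCan (r.node (repT x s)) (repT x (r.labels ++ s)) f := by
  induction r with
  | unit => exact fun s => ⟨_, IsCan.leftUnitor _⟩
  | leaf a h =>
    exact fun s => ⟨_, IsCan.tensor (IsCan.leaf a h rfl h.symm) (IsCan.id _)⟩
  | node r r' ih ih' =>
    intro s
    obtain ⟨f', hf'⟩ := ih' s
    obtain ⟨f, hf⟩ := ih (r'.labels ++ s)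
    rw [labels, List.append_assoc]
    exact ⟨_, (IsCan.associator _ _ _).comp (((IsCan.id r).tensor hf').comp hf)⟩

lemma exists_isCan_repT {o : V} (r : Rep x o) :
    ∃ f : o ⟶ T x r.labels, IsCan r (repT x r.labels) f := by
  have h := exists_isCan_append r []
  rw [List.append_nil] at h
  obtain ⟨f, hf⟩ := h
  exact ⟨_, ((IsCan.rightUnitor r).of_inv (Iso.inv_hom_id _)).comp hf⟩

lemma exists_isCan_perm {s t : List ι} (h : s.Perm t) (hs : s.Nodup) :
    ∃ f : T x s ⟶ T x t, IsCan (repT x s) (repT x t) f := by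
  induction h with
  | nil => exact ⟨_, IsCan.id _⟩
  | cons a h ih =>
    obtain ⟨f, hf⟩ := ih (List.nodup_cons.1 hs).2
    exact ⟨_, (IsCan.id (Rep.leaf a rfl)).tensor hf⟩
  | swap a b l =>
    refine ⟨_, ((IsCan.associator _ _ _).of_inv (Iso.inv_hom_id _)).comp
      (((IsCan.braiding (Rep.leaf b rfl) (Rep.leaf a rfl) ?_).tensor (IsCan.id (repT x l))).comp
        (IsCan.associator _ _ _))⟩
    simp only [List.nodup_cons, List.mem_cons, not_or] at hs
    simpa [labels] using hs.1.1
  | trans h₁ h₂ ih₁ ih₂ =>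
    obtain ⟨f, hf⟩ := ih₁ hs
    obtain ⟨g, hg⟩ := ih₂ (h₁.nodup_iff.1 hs)
    exact ⟨_, hf.comp hg⟩

/-- Two objects which are represented as tensor products with the same factors are canonically
isomorphic. -/
lemma exists_isCan {o o' : V} (r : Rep x o) (r' : Rep x o') (hr : r.labels.Nodup)
    (hr' : r'.labels.Nodup) (h : ∀ a, a ∈ r.labels ↔ a ∈ r'.labels) :
    ∃ f : o ≅ o', IsCan r r' f.hom := by
  obtain ⟨f, hf⟩ := exists_isCan_repT r
  obtain ⟨g, hg⟩ := exists_isCan_perm (x := x) ((List.perm_ext_iff_of_nodup hr hr').2 h) hr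
  obtain ⟨f', hf'⟩ := exists_isCan_repT r'
  have := hf'.isIso
  have h1 := hf.comp (hg.comp (hf'.of_inv (IsIso.inv_hom_id f')))
  have := h1.isIso
  exact ⟨asIso _, h1⟩

end SymCoh

/-! ### The underlying symmetric monoidal category -/

section ElementOperators

variable {E : Type u} [Category.{v} E] [MonoidalCategory E] [SymmetricCategory E]

namespace SymMonECat

variable (C : SymMonECat.{v, u, w} E)

lemma tEl_eq_left {x x' y y' : C.carrier} (a : 𝟙_ E ⟶ (x ⟶[E] x')) (b : 𝟙_ E ⟶ (y ⟶[E] y')) :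
    C.tEl a b = b ≫ (λ_ _).inv ≫ a ▷ _ ≫ C.tHom x x' y y' := by
  rw [tEl, elPair_eq_left]
  simp only [Category.assoc]

lemma tEl_eq_right {x x' y y' : C.carrier} (a : 𝟙_ E ⟶ (x ⟶[E] x')) (b : 𝟙_ E ⟶ (y ⟶[E] y')) :
    C.tEl a b = a ≫ (ρ_ _).inv ≫ _ ◁ b ≫ C.tHom x x' y y' := by
  rw [tEl, elPair_eq_right]
  simp only [Category.assoc]

lemma el_assoc_natural {x x' y y' z z' : C.carrier} (a : 𝟙_ E ⟶ (x ⟶[E] x'))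
    (b : 𝟙_ E ⟶ (y ⟶[E] y')) (c : 𝟙_ E ⟶ (z ⟶[E] z')) :
    elComp (C.tEl (C.tEl a b) c) (C.assoc x' y' z') =
      elComp (C.assoc x y z) (C.tEl a (C.tEl b c)) := by
  have h := C.assoc_natural x x' y y' z z'
  have h1 : C.tEl (C.tEl a b) c =
      elPair (elPair a b) c ≫ C.tHom x x' y y' ▷ _ ≫ C.tHom _ _ z z' := by
    rw [tEl, tEl, ← tensorHom_id, ← Category.assoc, elPair_comp, Category.comp_id]
  have h2 : C.tEl a (C.tEl b c) =
      elPair a (elPair b c) ≫ _ ◁ C.tHom y y' z z' ≫ C.tHom x x' _ _ := by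
    rw [tEl, tEl, ← id_tensorHom, ← Category.assoc, elPair_comp, Category.comp_id]
  rw [← comp_elPost, ← comp_elPre, h1, h2, ← elPair_assoc]
  simp only [Category.assoc, h]

lemma el_lUnit_natural {x x' : C.carrier} (a : 𝟙_ E ⟶ (x ⟶[E] x')) :
    elComp (C.tEl (eId E C.one) a) (C.lUnit x') = elComp (C.lUnit x) a := by
  rw [← comp_elPost, ← comp_elPre, tEl_eq_left, ← C.lUnit_natural]
  simp only [Category.assoc]

lemma el_rUnit_natural {x x' : C.carrier} (a : 𝟙_ E ⟶ (x ⟶[E] x')) :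
    elComp (C.tEl a (eId E C.one)) (C.rUnit x') = elComp (C.rUnit x) a := by
  rw [← comp_elPost, ← comp_elPre, tEl_eq_right, ← C.rUnit_natural]
  simp only [Category.assoc]

lemma el_comm_natural {x x' y y' : C.carrier} (a : 𝟙_ E ⟶ (x ⟶[E] x'))
    (b : 𝟙_ E ⟶ (y ⟶[E] y')) :
    elComp (C.tEl a b) (C.comm x' y') = elComp (C.comm x y) (C.tEl b a) := by
  have h := C.comm_natural x x' y y'
  rw [← comp_elPost, ← comp_elPre, tEl, tEl, ← elPair_braiding a b]
  simp only [Category.assoc, h]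

/-- The objects of the underlying symmetric monoidal category of a symmetric monoidal enriched
category. -/
def Und : Type w := C.carrier

/-- The underlying category, whose morphisms are the elements of the mapping objects. -/
instance : Category.{v} C.Und where
  Hom x y := 𝟙_ E ⟶ EnrichedCategory.Hom (V := E) (C := C.carrier) x y
  id x := eId E (C := C.carrier) x
  comp a b := elComp a b
  id_comp a := id_elComp a
  comp_id a := elComp_id a
  assoc a b c := elComp_assoc a b c

instance : MonoidalCategoryStruct C.Und where
  tensorObj x y := C.tObj x y
  whiskerLeft x _ _ a := C.tEl (eId E (C := C.carrier) x) a
  whiskerRight a y := C.tEl a (eId E (C := C.carrier) y)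
  tensorHom a b := C.tEl a b
  tensorUnit := C.one
  associator x y z := ⟨C.assoc x y z, C.assocInv x y z, C.assoc_assocInv x y z,
    C.assocInv_assoc x y z⟩
  leftUnitor x := ⟨C.lUnit x, C.lUnitInv x, C.lUnit_lUnitInv x, C.lUnitInv_lUnit x⟩
  rightUnitor x := ⟨C.rUnit x, C.rUnitInv x, C.rUnit_rUnitInv x, C.rUnitInv_rUnit x⟩

/-- The axioms hold for elements because they hold in `C`; only the naturality of the structural
isomorphisms has to be passed from mapping objects to elements. -/
instance : MonoidalCategory C.Und :=
  MonoidalCategory.ofTensorHom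
    (fun x y => C.tEl_id x y)
    (fun _ _ _ _ => rfl) (fun _ _ => rfl)
    (fun f g f' g' => (C.tEl_comp f f' g g').symm)
    (fun f g h => C.el_assoc_natural f g h)
    (fun f => C.el_lUnit_natural f)
    (fun f => C.el_rUnit_natural f)
    (fun x y z t => C.pentagon x y z t)
    (fun x y => C.triangle x y)

/-- The other hexagon axiom follows by the symmetry. -/
lemma hexagon_reverse' (x y z : C.carrier) :
    elComp (C.assocInv x y z) (elComp (C.comm (C.tObj x y) z) (C.assocInv z x y)) =
      elComp (C.tEl (eId E x) (C.comm y z)) (elComp (C.assocInv x z y)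
        (C.tEl (C.comm x z) (eId E y))) := by
  let β (x y : C.Und) : x ⊗ y ≅ y ⊗ x := ⟨C.comm x y, C.comm y x, C.comm_comm x y, C.comm_comm y x⟩
  have key (x y z : C.Und) : (α_ x y z).inv ≫ (β z (x ⊗ y)).inv ≫ (α_ z x y).inv =
      x ◁ (β z y).inv ≫ (α_ x z y).inv ≫ (β z x).inv ▷ y := by
    have h : α_ z x y ≪≫ β z (x ⊗ y) ≪≫ α_ x y z =
      whiskerRightIso (β z x) y ≪≫ α_ x z y ≪≫ whiskerLeftIso x (β z y) :=
        Iso.ext (C.hexagon z x y)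
    have h2 := congrArg Iso.inv h
    simp only [Iso.trans_inv, Category.assoc] at h2
    exact h2
  exact key x y z

instance : SymmetricCategory C.Und where
  braiding x y := ⟨C.comm x y, C.comm y x, C.comm_comm x y, C.comm_comm y x⟩
  braiding_naturality_right x _ _ f := C.el_comm_natural (eId E (C := C.carrier) x) f
  braiding_naturality_left f z := C.el_comm_natural f (eId E (C := C.carrier) z)
  hexagon_forward x y z := C.hexagon x y z
  hexagon_reverse x y z := C.hexagon_reverse' x y z
  symmetry x y := C.comm_comm x y

/-- The elements which transport along an equality of objects are the usual transports in the
underlying category. -/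
lemma elOfEq_eq {x y : C.Und} (h : x = y) :
    elOfEq (E := E) (C := C.carrier) h = (eqToHom h : x ⟶ y) := by
  subst h
  exact elOfEq_rfl (E := E) (C := C.carrier) x

end SymMonECat

end ElementOperators

/-! ### Canonical elements of iterated tensor products -/

section CanonicalElements

variable {E : Type u} [Category.{v} E] [MonoidalCategory E] [SymmetricCategory E]

namespace SymMonECat

open SymCoh

variable (C : SymMonECat.{v, u, w} E) {ι : Type*} {x : ι → C.Und}

/-- The representation of an iterated tensor product by labels of its factors. -/
def repTens : {n : ℕ} → (c : Fin n → C.carrier) → (l : Fin n → ι) → (∀ j, x (l j) = c j) →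
    Rep x (C.tens c : C.Und)
  | 0, _, _, _ => Rep.unit (V := C.Und)
  | 1, _, l, h => Rep.leaf (l 0) (h 0)
  | n + 2, c, l, h => Rep.node (V := C.Und) (Rep.leaf (l 0) (h 0))
      (repTens (fun j : Fin (n + 1) => c j.succ) (fun j => l j.succ) (fun j => h j.succ))

lemma labels_repTens : ∀ {n : ℕ} (c : Fin n → C.carrier) (l : Fin n → ι)
    (h : ∀ j, x (l j) = c j), (C.repTens c l h).labels = List.ofFn l
  | 0, _, _, _ => rfl
  | 1, _, _, _ => by simp [repTens, Rep.labels]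
  | n + 2, c, l, h => by
    rw [List.ofFn_succ, ← labels_repTens (fun j : Fin (n + 1) => c j.succ) _
      (fun j => h j.succ)]
    rfl

lemma mem_labels_repTens {n : ℕ} (c : Fin n → C.carrier) (l : Fin n → ι)
    (h : ∀ j, x (l j) = c j) (a : ι) : a ∈ (C.repTens c l h).labels ↔ ∃ j, l j = a := by
  rw [labels_repTens, List.mem_ofFn]

variable {C}

lemma isCan_leaf {o o' : C.carrier} {a b : ι} (hab : a = b) (h : x a = o) (h' : x b = o')
    (k : o = o') :
    IsCan (V := C.Und) (Rep.leaf a h) (Rep.leaf b h') (elOfEq (E := E) (C := C.carrier) k) := by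
  subst hab
  have e := C.elOfEq_eq (x := o) (y := o') k
  exact e ▸ IsCan.leaf (V := C.Und) a h h' k

lemma isCan_tens_congr {n k : ℕ} (hk : k = n) {c : Fin n → C.carrier} {g : Fin k → C.carrier}
    {l : Fin n → ι} {lg : Fin k → ι} (hl : ∀ j, x (l j) = c j) (hg : ∀ j, x (lg j) = g j)
    (h : ∀ (j : Fin n) (p : Fin k), p.val = j.val → lg p = l j) (e : C.tens g = C.tens c) :
    IsCan (V := C.Und) (C.repTens g lg hg) (C.repTens c l hl)
      (elOfEq (E := E) (C := C.carrier) e) := by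
  subst hk
  obtain rfl : lg = l := funext fun j => h j j rfl
  obtain rfl : c = g := funext fun j => (hl j).symm.trans (hg j)
  rw [elOfEq_rfl]
  exact IsCan.id (V := C.Und) _

lemma isCan_consEl {n : ℕ} (c : Fin (n + 1) → C.carrier) (l : Fin (n + 1) → ι)
    (h : ∀ j, x (l j) = c j) :
    IsCan (V := C.Und) (Rep.node (V := C.Und) (Rep.leaf (l 0) (h 0))
      (C.repTens (fun j : Fin n => c j.succ) (fun j => l j.succ) (fun j => h j.succ)))
      (C.repTens c l h) (C.consEl c) := by
  cases n with
  | zero => exact IsCan.rightUnitor (V := C.Und) _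
  | succ n => exact IsCan.id (V := C.Und) _

lemma unconsEl_consEl {n : ℕ} (c : Fin (n + 1) → C.carrier) :
    elComp (C.unconsEl c) (C.consEl c) = eId E _ := by
  cases n with
  | zero => exact C.rUnitInv_rUnit _
  | succ n => exact id_elComp _

lemma consEl_unconsEl {n : ℕ} (c : Fin (n + 1) → C.carrier) :
    elComp (C.consEl c) (C.unconsEl c) = eId E _ := by
  cases n with
  | zero => exact C.rUnit_rUnitInv _
  | succ n => exact id_elComp _

lemma isCan_unconsEl {n : ℕ} (c : Fin (n + 1) → C.carrier) (l : Fin (n + 1) → ι)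
    (h : ∀ j, x (l j) = c j) :
    IsCan (V := C.Und) (C.repTens c l h) (Rep.node (V := C.Und) (Rep.leaf (l 0) (h 0))
      (C.repTens (fun j : Fin n => c j.succ) (fun j => l j.succ) (fun j => h j.succ)))
      (C.unconsEl c) :=
  (isCan_consEl c l h).of_inv (V := C.Und) (unconsEl_consEl c)

lemma isCan_assocInv {o o' o'' : C.Und} (r : Rep x o) (r' : Rep x o') (r'' : Rep x o'') :
    IsCan (V := C.Und) (r.node (r'.node r'')) ((r.node r').node r'')
      (C.assocInv o o' o'') :=
  (IsCan.associator r r' r'').of_inv (C.assocInv_assoc o o' o'')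

lemma isCan_lUnitInv {o : C.Und} (r : Rep x o) :
    IsCan (V := C.Und) r (Rep.unit.node r) (C.lUnitInv o) :=
  (IsCan.leftUnitor r).of_inv (C.lUnitInv_lUnit o)

lemma isCan_rUnitInv {o : C.Und} (r : Rep x o) :
    IsCan (V := C.Und) r (r.node Rep.unit) (C.rUnitInv o) :=
  (IsCan.rightUnitor r).of_inv (C.rUnitInv_rUnit o)

lemma isCan_eId {o : C.Und} (r : Rep x o) :
    IsCan (V := C.Und) r r (eId E (C := C.carrier) o) := IsCan.id r

lemma isCan_elComp {o o' o'' : C.Und} {r : Rep x o} {r' : Rep x o'} {r'' : Rep x o''}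
    {f : o ⟶ o'} {g : o' ⟶ o''} (hf : IsCan r r' f) (hg : IsCan r' r'' g) :
    IsCan (V := C.Und) r r'' (elComp (C := C.carrier) f g) := hf.comp hg

lemma isCan_tEl {o o' o₁ o₁' : C.Und} {r : Rep x o} {r' : Rep x o'} {r₁ : Rep x o₁}
    {r₁' : Rep x o₁'} {f : o ⟶ o'} {g : o₁ ⟶ o₁'} (hf : IsCan r r' f) (hg : IsCan r₁ r₁' g) :
    IsCan (V := C.Und) (r.node r₁) (r'.node r₁') (C.tEl f g) := hf.tensor hg

lemma isCan_splitEl : ∀ {m l k : ℕ} (a : Fin m → C.carrier) (b : Fin l → C.carrier)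
    (g : Fin k → C.carrier) (hk : k = m + l)
    (ha : ∀ (j : Fin m) (p : Fin k), p.val = j.val → g p = a j)
    (hb : ∀ (j : Fin l) (p : Fin k), p.val = m + j.val → g p = b j)
    (la : Fin m → ι) (lb : Fin l → ι) (lg : Fin k → ι) (hla : ∀ j, x (la j) = a j)
    (hlb : ∀ j, x (lb j) = b j) (hlg : ∀ j, x (lg j) = g j)
    (ha' : ∀ (j : Fin m) (p : Fin k), p.val = j.val → lg p = la j)
    (hb' : ∀ (j : Fin l) (p : Fin k), p.val = m + j.val → lg p = lb j),
    IsCan (V := C.Und) (C.repTens g lg hlg)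
      (Rep.node (V := C.Und) (C.repTens a la hla) (C.repTens b lb hlb))
      (C.splitEl a b g hk ha hb)
  | 0, l, k, a, b, g, hk, ha, hb, la, lb, lg, hla, hlb, hlg, ha', hb' =>
    isCan_elComp (isCan_tens_congr (by omega) hlb hlg (fun j p hp => hb' j p (by omega)) _)
      (isCan_lUnitInv _)
  | m + 1, l, 0, _, _, _, hk, _, _, _, _, _, _, _, _, _, _ => absurd hk (by omega)
  | m + 1, l, k + 1, a, b, g, hk, ha, hb, la, lb, lg, hla, hlb, hlg, ha', hb' => by
    rw [splitEl]
    refine isCan_elComp (isCan_unconsEl g lg hlg) (isCan_elComp (isCan_tEl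
      (isCan_leaf (ha' 0 0 rfl) _ _ _) (isCan_splitEl _ _ _ _ _ _ (fun j => la j.succ) lb
        (fun j => lg j.succ) (fun j => hla j.succ) hlb _
        (fun j p hp => ha' j.succ p.succ (by simp [hp]))
        (fun j p hp => hb' j p.succ (by simp [hp]; omega))))
      (isCan_elComp (isCan_assocInv _ _ _) (isCan_tEl (isCan_consEl a la hla) (isCan_eId _))))

/-- The labels have to be different, because the element exchanges the factor `q` with the factors
in front of it. -/
lemma isCan_moveEl : ∀ {n : ℕ} (c : Fin (n + 1) → C.carrier) (c' : Fin n → C.carrier)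
    (q : Fin (n + 1)) (h : ∀ j, c' j = c (q.succAbove j)) (l : Fin (n + 1) → ι)
    (hl : ∀ j, x (l j) = c j) (hinj : Function.Injective l) (l' : Fin n → ι)
    (hl' : ∀ j, x (l' j) = c' j) (h' : ∀ j, l' j = l (q.succAbove j)),
    IsCan (V := C.Und) (Rep.node (V := C.Und) (Rep.leaf (l q) (hl q)) (C.repTens c' l' hl'))
      (C.repTens c l hl) (C.moveEl c c' q h)
  | _, c, c', ⟨0, _⟩, h, l, hl, hinj, l', hl', h' => by
    rw [moveEl]
    exact isCan_elComp (isCan_tEl (isCan_eId _) (isCan_tens_congr rfl _ _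
      (fun j p hp => by rw [Fin.ext hp, h' j]; rfl) _)) (isCan_consEl c l hl)
  | 0, _, _, ⟨q + 1, hq⟩, _, _, _, _, _, _, _ => absurd hq (by omega)
  | n + 1, c, c', ⟨q + 1, hq⟩, h, l, hl, hinj, l', hl', h' => by
    rw [moveEl]
    refine isCan_elComp (isCan_tEl (isCan_eId _) (isCan_unconsEl c' l' hl')) (isCan_elComp
      (isCan_assocInv _ _ _) (isCan_elComp (isCan_tEl (IsCan.braiding (V := C.Und) _ _ ?_)
        (isCan_eId _)) (isCan_elComp (IsCan.associator (V := C.Und) _ _ _)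
          (isCan_tEl (isCan_leaf ?_ _ (hl 0) _) (isCan_moveEl
            (fun j : Fin (n + 1) => c j.succ) (fun j : Fin n => c' j.succ)
            ⟨q, Nat.lt_of_succ_lt_succ hq⟩ _ (fun j => l j.succ) (fun j => hl j.succ) ?_
            (fun j => l' j.succ) (fun j => hl' j.succ) ?_)))))
    · intro a ha hb
      simp only [Rep.labels, List.mem_singleton] at ha hb
      have h1 := h' 0
      rw [← hb, ha] at h1
      exact Fin.succAbove_ne _ _ (hinj h1).symm
    · exact (h' 0).trans (congrArg l (Fin.succ_succAbove_zero
        (⟨q, Nat.lt_of_succ_lt_succ hq⟩ : Fin (n + 1))))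
    · exact fun i j hij => Fin.succ_injective _ (hinj hij)
    · exact fun j => (h' j.succ).trans (congrArg l (Fin.succ_succAbove_succ
        (⟨q, Nat.lt_of_succ_lt_succ hq⟩ : Fin (n + 1)) j))

/-- Permutations of the factors are canonical, for different labels and with the labels permuted
in the same way. -/
lemma isCan_permEl : ∀ {n : ℕ} (c c' : Fin n → C.carrier) (σ : Equiv.Perm (Fin n))
    (h : ∀ i, c' i = c (σ i)) (l l' : Fin n → ι) (hl : ∀ j, x (l j) = c j)
    (hl' : ∀ j, x (l' j) = c' j) (hinj : Function.Injective l) (h' : ∀ i, l' i = l (σ i)),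
    IsCan (V := C.Und) (C.repTens c' l' hl') (C.repTens c l hl) (C.permEl c c' σ h)
  | 0, _, _, _, _, _, _, _, _, _, _ => IsCan.id (V := C.Und) _
  | n + 1, c, c', σ, h, l, l', hl, hl', hinj, h' =>
    isCan_elComp (isCan_unconsEl c' l' hl') (isCan_elComp (isCan_tEl
      (isCan_leaf (h' 0) _ (hl (σ 0)) _)
      (isCan_permEl (fun j => c ((σ 0).succAbove j)) (fun j => c' j.succ) (permTail σ) _
        (fun j => l ((σ 0).succAbove j)) (fun j => l' j.succ) (fun j => hl _) _
        (fun i j hij => Fin.succAbove_right_injective (hinj hij))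
        (fun j => by rw [h', succAbove_permTail])))
      (isCan_moveEl c _ (σ 0) _ l hl hinj _ _ (fun _ => rfl)))

end SymMonECat

end CanonicalElements

/-! ### Tensoring with identities and enriched composition -/

section TensorOperators

variable {E : Type u} [Category.{v} E] [MonoidalCategory E]

section

variable {C : Type w} [EnrichedCategory E C]

lemma elPost_comp (x y : C) {z z' : C} (b : 𝟙_ E ⟶ (z ⟶[E] z')) :
    ((x ⟶[E] y) ◁ elPost y b) ≫ eComp E x y z' = eComp E x y z ≫ elPost x b := by
  have h := e_assoc' E x y z z'
  simp only [elPost, MonoidalCategory.whiskerLeft_comp, Category.assoc]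
  rw [rightUnitor_inv_naturality_assoc, ← whisker_exchange_assoc, ← h]
  simp

lemma elPre_comp {x' x : C} (a : 𝟙_ E ⟶ (x' ⟶[E] x)) (y z : C) :
    (elPre a y ▷ (y ⟶[E] z)) ≫ eComp E x' y z = eComp E x y z ≫ elPre a z := by
  have h := e_assoc E x' x y z
  simp only [elPre, comp_whiskerRight, Category.assoc]
  rw [leftUnitor_inv_naturality_assoc, whisker_exchange_assoc, ← h]
  simp [-e_assoc]

lemma elPost_elPre_comp (x : C) {y y' : C} (a : 𝟙_ E ⟶ (y ⟶[E] y')) (z : C) :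
    (elPost x a ▷ (y' ⟶[E] z)) ≫ eComp E x y' z =
      ((x ⟶[E] y) ◁ elPre a z) ≫ eComp E x y z := by
  have h := e_assoc E x y y' z
  simp only [elPre, elPost, comp_whiskerRight, MonoidalCategory.whiskerLeft_comp, Category.assoc]
  rw [← h]
  simp [-e_assoc]

end

variable [SymmetricCategory E]

namespace SymMonECat

variable (C : SymMonECat.{v, u, w} E)

attribute [local instance] prodEnriched

/-- The tensor product of `C`, as an enriched functor. -/
def tFun : EnrichedFunctor E (C.carrier × C.carrier) C.carrier where
  obj x := C.tObj x.1 x.2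
  map x y := C.tHom x.1 y.1 x.2 y.2
  map_id x := C.tHom_id x.1 x.2
  map_comp x y z := (Category.assoc _ _ _).trans (C.tHom_comp x.1 y.1 z.1 x.2 y.2 z.2).symm

lemma tensor_elPre_tHom {x x₁ y y₁ : C.carrier} (a : 𝟙_ E ⟶ (x ⟶[E] x₁))
    (b : 𝟙_ E ⟶ (y ⟶[E] y₁)) (z t : C.carrier) :
    (elPre a z ⊗ₘ elPre b t) ≫ C.tHom x z y t = C.tHom x₁ z y₁ t ≫ elPre (C.tEl a b) _ := by
  have h := elPre_map C.tFun (x' := (x, y)) (x := (x₁, y₁)) (elPair a b) (z, t)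
  rw [prod_elPre] at h
  exact h

lemma tensor_elPost_tHom {z z₁ t t₁ : C.carrier} (a : 𝟙_ E ⟶ (z ⟶[E] z₁))
    (b : 𝟙_ E ⟶ (t ⟶[E] t₁)) (x y : C.carrier) :
    (elPost x a ⊗ₘ elPost y b) ≫ C.tHom x z₁ y t₁ = C.tHom x z y t ≫ elPost _ (C.tEl a b) := by
  have h := elPost_map C.tFun (x, y) (y := (z, t)) (y' := (z₁, t₁)) (elPair a b)
  rw [prod_elPost] at h
  exact h

/-- Tensoring with an object on the right, as an enriched functor. -/
def tensR (Z : C.carrier) : EnrichedFunctor E C.carrier C.carrier where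
  obj x := C.tObj x Z
  map x y := (ρ_ _).inv ≫ _ ◁ eId E Z ≫ C.tHom x y Z Z
  map_id x := by
    have h := C.tHom_id x Z
    rw [elPair_eq_right] at h
    simpa using h
  map_comp x y z := by
    have h := C.tHom_comp x y z Z Z Z
    have h1 := rightUnitor_monoidal_inv (x ⟶[E] y) (y ⟶[E] z)
    have h2 : (eId E Z ⊗ₘ eId E Z) ≫ eComp E Z Z Z = (λ_ _).hom ≫ eId E Z := by
      rw [← cancel_epi (λ_ _).inv, Iso.inv_hom_id_assoc]
      exact (Category.assoc _ _ _).symm.trans (id_elComp _)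
    simp only [← tensorHom_comp_tensorHom, Category.assoc]
    rw [h, ← id_tensorHom (y ⟶[E] z), ← id_tensorHom (x ⟶[E] y), tensorμ_natural_assoc,
      tensorHom_comp_tensorHom_assoc, h2, id_tensorHom_id, Category.id_comp,
      tensorHom_def' (eComp E x y z), Category.assoc, MonoidalCategory.whiskerLeft_comp,
      Category.assoc, reassoc_of% h1, rightUnitor_inv_naturality_assoc,
      whisker_exchange_assoc]

/-- Tensoring with an object on the left, on mapping objects. -/
def lW (Z x y : C.carrier) : (x ⟶[E] y) ⟶ (C.tObj Z x ⟶[E] C.tObj Z y) :=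
  (λ_ _).inv ≫ eId E Z ▷ _ ≫ C.tHom Z Z x y

/-- Tensoring with an object on the right, on mapping objects. -/
def rW (Z x y : C.carrier) : (x ⟶[E] y) ⟶ (C.tObj x Z ⟶[E] C.tObj y Z) :=
  (ρ_ _).inv ≫ _ ◁ eId E Z ≫ C.tHom x y Z Z

variable {C}

lemma rW_comp (Z x y z : C.carrier) : eComp E x y z ≫ C.rW Z x z =
    (C.rW Z x y ⊗ₘ C.rW Z y z) ≫ eComp E _ _ _ := (C.tensR Z).map_comp x y z

lemma el_rW {Z x y : C.carrier} (a : 𝟙_ E ⟶ (x ⟶[E] y)) :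
    a ≫ C.rW Z x y = C.tEl a (eId E Z) := by
  rw [tEl, elPair_eq_right]
  simp [rW]

lemma elPre_rW {Z x' x : C.carrier} (a : 𝟙_ E ⟶ (x' ⟶[E] x)) (y : C.carrier) :
    elPre a y ≫ C.rW Z x' y = C.rW Z x y ≫ elPre (C.tEl a (eId E Z)) _ := by
  rw [← el_rW]; exact elPre_map (C.tensR Z) a y

lemma elPost_rW {Z y y' : C.carrier} (a : 𝟙_ E ⟶ (y ⟶[E] y')) (x : C.carrier) :
    elPost x a ≫ C.rW Z x y' = C.rW Z x y ≫ elPost _ (C.tEl a (eId E Z)) := by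
  rw [← el_rW]; exact elPost_map (C.tensR Z) x a

/-- Tensoring with the identity of `Z` is dinatural in `Z`. -/
lemma rW_natural {Z Z' : C.carrier} (w : 𝟙_ E ⟶ (Z ⟶[E] Z')) (x y : C.carrier) :
    C.rW Z x y ≫ elPost _ (C.tEl (eId E y) w) = C.rW Z' x y ≫ elPre (C.tEl (eId E x) w) _ := by
  rw [rW, rW, Category.assoc, Category.assoc, Category.assoc, Category.assoc,
    ← tensor_elPost_tHom, ← tensor_elPre_tHom, elPost_id, elPre_id, id_tensorHom, id_tensorHom,
    ← whiskerLeft_comp_assoc, ← whiskerLeft_comp_assoc, comp_elPost, comp_elPre, id_elComp,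
    elComp_id]

/-- Tensoring with identities twice is tensoring with the identity of the tensor product. -/
lemma rW_rW (Z Z' x y : C.carrier) :
    C.rW Z x y ≫ C.rW Z' _ _ ≫ elPost _ (C.assoc y Z Z') =
      C.rW (C.tObj Z Z') x y ≫ elPre (C.assoc x Z Z') _ := by
  have h := C.assoc_natural x y Z Z Z' Z'
  simp only [rW, ← C.tHom_id, elPair_eq_right, Category.assoc, MonoidalCategory.whiskerLeft_comp]
  rw [rightUnitor_inv_naturality_assoc, ← whisker_exchange_assoc, h]
  simp

lemma rW_one (x y : C.carrier) :
    C.rW C.one x y ≫ elPost _ (C.rUnit y) = elPre (C.rUnit x) y := by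
  rw [rW, Category.assoc, Category.assoc]
  exact C.rUnit_natural x y

lemma lW_comm (Z x y : C.carrier) :
    C.lW Z x y ≫ elPost _ (C.comm Z y) = C.rW Z x y ≫ elPre (C.comm Z x) _ := by
  rw [lW, rW, Category.assoc, Category.assoc, Category.assoc, Category.assoc, C.comm_natural,
    BraidedCategory.braiding_naturality_left_assoc]
  simp

/-- The tensor product of mapping objects is tensoring with identities in the first variable,
followed by the second one. -/
lemma rW_lW_comp (x x' y y' : C.carrier) :
    (C.rW y x x' ⊗ₘ C.lW x' y y') ≫ eComp E _ _ _ = C.tHom x x' y y' := by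
  have h := C.tHom_comp x x' x' y y y'
  have hb : ((ρ_ (x ⟶[E] x')).inv ⊗ₘ (λ_ (y ⟶[E] y')).inv) ≫ tensorμ _ _ _ _ =
      (ρ_ _).inv ⊗ₘ (λ_ _).inv := by
    rw [tensorμ, braiding_unit]
    monoidal
  rw [rW, lW, ← tensorHom_comp_tensorHom, ← tensorHom_comp_tensorHom, Category.assoc,
    Category.assoc, h, ← id_tensorHom, ← tensorHom_id, tensorμ_natural_assoc,
    reassoc_of% hb, tensorHom_comp_tensorHom_assoc, tensorHom_comp_tensorHom_assoc,
    tensorHom_id, id_tensorHom, Category.assoc, Category.assoc, e_id_comp, e_comp_id,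
    id_tensorHom_id, Category.id_comp]

/-- The tensor product of mapping objects is tensoring with identities in the second variable,
followed by the first one. -/
lemma lW_rW_comp (x x' y y' : C.carrier) :
    (β_ _ _).hom ≫ (C.lW x y y' ⊗ₘ C.rW y' x x') ≫ eComp E _ _ _ = C.tHom x x' y y' := by
  have h := C.tHom_comp x x x' y y' y'
  have hb : (β_ (x ⟶[E] x') (y ⟶[E] y')).hom ≫ ((λ_ _).inv ⊗ₘ (ρ_ _).inv) ≫ tensorμ _ _ _ _ =
      (λ_ _).inv ⊗ₘ (ρ_ _).inv := by
    have h1 : ((λ_ (y ⟶[E] y')).inv ⊗ₘ (ρ_ (x ⟶[E] x')).inv) ≫ (α_ _ _ _).hom ≫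
        _ ◁ (α_ _ _ _).inv = (λ_ _).inv ≫ _ ◁ (ρ_ _).inv := by monoidal
    have h2 : (λ_ _).inv ≫ _ ◁ (ρ_ _).inv ≫ _ ◁ (α_ _ _ _).hom ≫ (α_ _ _ _).inv =
        (λ_ (x ⟶[E] x')).inv ⊗ₘ (ρ_ (y ⟶[E] y')).inv := by monoidal
    rw [tensorμ, reassoc_of% h1, ← h2]
    simp only [← whiskerLeft_comp_assoc]
    rw [← rightUnitor_inv_naturality_assoc, MonoidalCategory.whiskerLeft_comp, Category.assoc,
      ← leftUnitor_inv_naturality_assoc, SymmetricCategory.symmetry_assoc,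
      MonoidalCategory.whiskerLeft_comp, Category.assoc]
  rw [rW, lW, ← tensorHom_comp_tensorHom, ← tensorHom_comp_tensorHom, Category.assoc,
    Category.assoc, h, ← id_tensorHom, ← tensorHom_id, tensorμ_natural_assoc,
    reassoc_of% hb, tensorHom_comp_tensorHom_assoc, tensorHom_comp_tensorHom_assoc,
    tensorHom_id, id_tensorHom, Category.assoc, Category.assoc, e_id_comp, e_comp_id,
      id_tensorHom_id, Category.id_comp]

end SymMonECat

end TensorOperators

/-! ### Canonical insertions -/

namespace SymCoh

universe v₁ u₁

variable {V : Type u₁} [Category.{v₁} V] [MonoidalCategory V] [SymmetricCategory V]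
  {ι : Type*} {x : ι → V}

lemma ins_list_perm (a : ι) : ∀ s : List ι, (ins (x := x) a s).list.Perm (a :: s)
  | [] => List.Perm.refl _
  | b :: s => by
    by_cases h : WellOrderingRel b a
    · rw [ins_cons_lt h]
      exact ((ins_list_perm a s).cons b).trans (List.Perm.swap a b s)
    · rw [ins_cons_not_lt h]
      exact List.Perm.refl _

lemma Rep.app_list_perm {o : V} (r : Rep x o) : ∀ {X : V} (p : Sig x X),
    (r.app p).list.Perm (r.labels ++ p.list) := by
  induction r with
  | unit => exact fun p => List.Perm.refl _
  | leaf a h => exact fun p => ins_list_perm a p.list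
  | node r r' ih ih' =>
    intro X p
    have h := (ih (r'.app p)).trans ((ih' p).append_left r.labels)
    rw [← List.append_assoc] at h
    exact h

/-- A canonical morphism exists only between tensor products of the same factors. -/
lemma IsCan.labels_perm {o o' : V} {r : Rep x o} {r' : Rep x o'} {f : o ⟶ o'}
    (hf : IsCan r r' f) : r.labels.Perm r'.labels := by
  have h1 := r.app_list_perm (Sig.one x [])
  have h2 := r'.app_list_perm (Sig.one x [])
  have h3 := congrArg Sig.list (hf.pre_app (Sig.one x []))
  simp only [Sig.one, List.append_nil] at h1 h2
  exact h1.symm.trans (h3 ▸ h2)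

end SymCoh

section Insertions

variable {E : Type u} [Category.{v} E] [MonoidalCategory E] [SymmetricCategory E]

namespace SymMonECat

open SymCoh

variable {C : SymMonECat.{v, u, w} E} {ι : Type*} {x : ι → C.Und}

/-- A morphism `C(o, y) ⟶ C(p, p')` is a canonical insertion if it tensors with the identity of an
object `Z`, and then composes with canonical elements `p ⟶ o ⊗ Z` and `y ⊗ Z ⟶ p'`. -/
structure IsIns {o y p p' : C.carrier} (ro : Rep (V := C.Und) x o) (ry : Rep (V := C.Und) x y)
    (rp : Rep (V := C.Und) x p) (rp' : Rep (V := C.Und) x p')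
    (φ : (o ⟶[E] y) ⟶ (p ⟶[E] p')) : Prop where
  exists_eq : ∃ (Z : C.carrier) (rZ : Rep (V := C.Und) x Z) (s : 𝟙_ E ⟶ (p ⟶[E] C.tObj o Z))
    (s' : 𝟙_ E ⟶ (C.tObj y Z ⟶[E] p')), IsCan (V := C.Und) rp (Rep.node (V := C.Und) ro rZ) s ∧
      IsCan (V := C.Und) (Rep.node (V := C.Und) ry rZ) rp' s' ∧
      φ = C.rW Z o y ≫ elPre s _ ≫ elPost _ s'

namespace IsIns

variable {o y p p' q q' : C.carrier} {ro : Rep (V := C.Und) x o} {ry : Rep (V := C.Und) x y}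
  {rp : Rep (V := C.Und) x p} {rp' : Rep (V := C.Und) x p'} {rq : Rep (V := C.Und) x q}
  {rq' : Rep (V := C.Und) x q'}
  {φ : (o ⟶[E] y) ⟶ (p ⟶[E] p')} {ψ : (p ⟶[E] p') ⟶ (q ⟶[E] q')}

/-- A canonical insertion is determined by the factors of its source and of its target. -/
lemma eq {φ' : (o ⟶[E] y) ⟶ (p ⟶[E] p')} (h : IsIns ro ry rp rp' φ) (h' : IsIns ro ry rp rp' φ')
    (hp : rp.labels.Nodup) : φ = φ' := by
  obtain ⟨Z, rZ, s, s', hs, hs', rfl⟩ := h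
  obtain ⟨Z₁, rZ₁, t, t', ht, ht', rfl⟩ := h'
  have h1 : rZ.labels.Perm rZ₁.labels :=
    (List.perm_append_left_iff ro.labels).1 (hs.labels_perm.symm.trans ht.labels_perm)
  have h2 : (ro.labels ++ rZ.labels).Nodup := hs.labels_perm.nodup_iff.1 hp
  have h3 := (List.nodup_append.1 h2).2.1
  -- The two objects with which the insertions tensor have the same factors.
  obtain ⟨w, hw⟩ := exists_isCan rZ rZ₁ h3 (h1.nodup_iff.1 h3) (fun a => h1.mem_iff)
  have e1 : t = elComp s (C.tEl (eId E o) w.hom) :=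
    ht.eq (isCan_elComp hs (isCan_tEl (isCan_eId ro) hw))
  have e2 : s' = elComp (C.tEl (eId E y) w.hom) t' :=
    hs'.eq (isCan_elComp (isCan_tEl (isCan_eId ry) hw) ht')
  rw [e1, e2, ← elPost_elPost, ← elPre_elPre, reassoc_of% elPre_elPost, reassoc_of% rW_natural,
    Category.assoc]

lemma rW (rZ : Rep (V := C.Und) x q) :
    IsIns ro ry (Rep.node (V := C.Und) ro rZ) (Rep.node (V := C.Und) ry rZ) (C.rW q o y) :=
  ⟨_, rZ, eId E _, eId E _, isCan_eId _, isCan_eId _, by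
    change C.rW q o y = C.rW q o y ≫ elPre (eId E (C.tObj o q)) _ ≫
      elPost _ (eId E (C.tObj y q))
    rw [elPre_id, elPost_id, Category.comp_id, Category.comp_id]⟩

lemma id : IsIns ro ry ro ry (𝟙 (o ⟶[E] y)) :=
  ⟨_, Rep.unit (V := C.Und), C.rUnitInv o, C.rUnit y, isCan_rUnitInv _, IsCan.rightUnitor _, by
    change 𝟙 _ = C.rW C.one o y ≫ elPre (C.rUnitInv o) (C.tObj y C.one) ≫ elPost o (C.rUnit y)
    rw [elPre_elPost, reassoc_of% rW_one, elPre_elPre, C.rUnitInv_rUnit, elPre_id]⟩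

lemma comp_elPre (h : IsIns ro ry rp rp' φ) {a : 𝟙_ E ⟶ (q ⟶[E] p)}
    (ha : IsCan (V := C.Und) rq rp a) : IsIns ro ry rq rp' (φ ≫ elPre a p') := by
  obtain ⟨Z, rZ, s, s', hs, hs', rfl⟩ := h
  exact ⟨Z, rZ, elComp a s, s', isCan_elComp ha hs, hs', by
    rw [Category.assoc, Category.assoc, ← elPre_elPost, reassoc_of% elPre_elPre]⟩

lemma comp_elPost (h : IsIns ro ry rp rp' φ) {a : 𝟙_ E ⟶ (p' ⟶[E] q)}
    (ha : IsCan (V := C.Und) rp' rq a) : IsIns ro ry rp rq (φ ≫ elPost p a) := by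
  obtain ⟨Z, rZ, s, s', hs, hs', rfl⟩ := h
  exact ⟨Z, rZ, s, elComp s' a, hs, isCan_elComp hs' ha, by
    rw [Category.assoc, Category.assoc, elPost_elPost]⟩

lemma elPre_comp (h : IsIns ro ry rp rp' φ) {a : 𝟙_ E ⟶ (o ⟶[E] q)}
    (ha : IsCan (V := C.Und) ro rq a) : IsIns rq ry rp rp' (elPre a y ≫ φ) := by
  obtain ⟨Z, rZ, s, s', hs, hs', rfl⟩ := h
  exact ⟨Z, rZ, elComp s (C.tEl a (eId E Z)), s', isCan_elComp hs (isCan_tEl ha (isCan_eId _)),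
    hs', by rw [reassoc_of% elPre_rW, reassoc_of% elPre_elPre]⟩

lemma comp_rW (h : IsIns ro ry rp rp' φ) (rZ : Rep (V := C.Und) x q) :
    IsIns ro ry (Rep.node (V := C.Und) rp rZ) (Rep.node (V := C.Und) rp' rZ)
      (φ ≫ C.rW q p p') := by
  obtain ⟨Z, rZ', s, s', hs, hs', rfl⟩ := h
  refine ⟨_, Rep.node (V := C.Und) rZ' rZ, elComp (C.tEl s (eId E q)) (C.assoc _ _ _),
    elComp (C.assocInv _ _ _) (C.tEl s' (eId E q)),
    isCan_elComp (isCan_tEl hs (isCan_eId _)) (IsCan.associator _ _ _),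
    isCan_elComp (isCan_assocInv _ _ _) (isCan_tEl hs' (isCan_eId _)), ?_⟩
  change (C.rW Z o y ≫ elPre s _ ≫ elPost _ s') ≫ C.rW q p p' = C.rW (C.tObj Z q) o y ≫
    elPre (elComp (C.tEl s (eId E q)) (C.assoc o Z q)) (C.tObj y (C.tObj Z q)) ≫
      elPost (C.tObj p q) (elComp (C.assocInv y Z q) (C.tEl s' (eId E q)))
  rw [Category.assoc, Category.assoc, elPost_rW, reassoc_of% elPre_rW, ← elPre_elPre,
    ← elPost_elPost, Category.assoc, ← reassoc_of% rW_rW, ← reassoc_of% elPre_elPost,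
    reassoc_of% elPost_elPost, C.assoc_assocInv, elPost_id, Category.id_comp]

/-- Canonical insertions are closed under composition: `(- ⊗ Z) ⊗ Z'` is replaced by
`- ⊗ (Z ⊗ Z')`. -/
lemma comp (h : IsIns ro ry rp rp' φ) (h' : IsIns rp rp' rq rq' ψ) :
    IsIns ro ry rq rq' (φ ≫ ψ) := by
  obtain ⟨Z, rZ, s, s', hs, hs', rfl⟩ := h'
  have := ((h.comp_rW rZ).comp_elPre hs).comp_elPost hs'
  rwa [Category.assoc, Category.assoc] at this

lemma lW (rZ : Rep (V := C.Und) x q) (h : ∀ a ∈ rZ.labels, a ∉ ro.labels)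
    (h' : ∀ a ∈ rZ.labels, a ∉ ry.labels) :
    IsIns ro ry (Rep.node (V := C.Und) rZ ro) (Rep.node (V := C.Und) rZ ry) (C.lW q o y) :=
  ⟨_, rZ, C.comm _ _, C.comm _ _, IsCan.braiding (V := C.Und) _ _ h,
    IsCan.braiding (V := C.Und) _ _ (fun a ha hb => h' a hb ha), by
    change C.lW q o y = C.rW q o y ≫ elPre (C.comm q o) _ ≫ elPost _ (C.comm y q)
    rw [← reassoc_of% lW_comm, elPost_elPost, C.comm_comm, elPost_id, Category.comp_id]⟩

end IsIns

lemma lW_elPre {g c o y : C.carrier} (a : 𝟙_ E ⟶ (g ⟶[E] c)) :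
    C.lW c o y ≫ elPre (C.tEl a (eId E o)) _ = (λ_ _).inv ≫ a ▷ _ ≫ C.tHom g c o y := by
  rw [lW, Category.assoc, Category.assoc, ← tensor_elPre_tHom, elPre_id, tensorHom_id,
    ← comp_whiskerRight_assoc, comp_elPre, elComp_id]

/-- The recursive clause of `insertHom`, in terms of tensoring with an identity on the left. -/
lemma insertHom_succ {n m k : ℕ} (c : Fin (n + 2) → C.carrier) (e : Fin m → C.carrier)
    (g : Fin (k + 1) → C.carrier) (i : ℕ) (hi : i + 1 < n + 2) (h : IsGraft ⟨i + 1, hi⟩ c e g)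
    (h' : IsGraft ⟨i, Nat.lt_of_succ_lt_succ hi⟩ (fun j : Fin (n + 1) => c j.succ) e
      (fun j : Fin k => g j.succ)) (h0 : g 0 = c 0) :
    C.insertHom c e g ⟨i + 1, hi⟩ h = ((C.insertHom (fun j : Fin (n + 1) => c j.succ) e
      (fun j : Fin k => g j.succ) ⟨i, Nat.lt_of_succ_lt_succ hi⟩ h' ≫ C.lW (c 0) _ _) ≫
        elPre (C.tEl (elOfEq h0) (eId E _)) _) ≫ elPre (C.unconsEl g) _ := by
  rw [Category.assoc, Category.assoc, reassoc_of% lW_elPre, insertHom]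
  rfl

/-- Tensoring with identities is a canonical insertion. -/
lemma isIns_insertHom : ∀ {n m k : ℕ} (c : Fin n → C.carrier) (e : Fin m → C.carrier)
    (g : Fin k → C.carrier) (i : Fin n) (h : IsGraft i c e g) (lc : Fin n → ι) (le : Fin m → ι)
    (lg : Fin k → ι) (hc : ∀ j, x (lc j) = c j) (he : ∀ j, x (le j) = e j)
    (hg : ∀ j, x (lg j) = g j) (h' : IsGraft i lc le lg) (hlc : Function.Injective lc)
    (hlg : Function.Injective lg),
    IsIns (C.repTens e le he) (Rep.leaf (V := C.Und) (lc i) (hc i)) (C.repTens g lg hg)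
      (C.repTens c lc hc) (C.insertHom c e g i h)
  | 0, _, _, _, _, _, i, _, _, _, _, _, _, _, _, _, _ => i.elim0
  | 1, m, k, c, e, g, ⟨0, _⟩, h, lc, le, lg, hc, he, hg, h', hlc, hlg => by
    rw [insertHom, ← Category.id_comp (elPre _ _)]
    exact IsIns.id.comp_elPre (isCan_tens_congr (by have := h.length; omega) he hg
      (fun j p hp => h'.inner j p (by simpa using hp)) _)
  | n + 2, m, k, c, e, g, ⟨0, _⟩, h, lc, le, lg, hc, he, hg, h', hlc, hlg => by
    rw [insertHom]
    have h1 := (IsIns.rW (ro := C.repTens e le he) (ry := Rep.leaf (V := C.Und) (lc 0) (hc 0))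
      (C.repTens (fun j : Fin (n + 1) => c j.succ) (fun j => lc j.succ) (fun j => hc _))).comp_elPre
      (isCan_splitEl e (fun j : Fin (n + 1) => c j.succ) g (by have := h.length; omega)
          (fun j p hp => h.inner j p (by simpa using hp))
          (fun j p hp => h.outer j.succ p
            (Or.inr ⟨Fin.mk_lt_mk.2 (Nat.succ_pos _), by simp; omega⟩)) le (fun j => lc j.succ) lg
          he (fun j => hc _) hg (fun j p hp => h'.inner j p (by simpa using hp))
          (fun j p hp => h'.outer j.succ p
            (Or.inr ⟨Fin.mk_lt_mk.2 (Nat.succ_pos _), by simp; omega⟩)))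
    rw [SymMonECat.rW, Category.assoc, Category.assoc] at h1
    exact h1
  | n + 2, m, 0, _, _, _, ⟨_ + 1, _⟩, h, _, _, _, _, _, _, _, _, _ => absurd h.length (by omega)
  | n + 2, m, k + 1, c, e, g, ⟨i + 1, hi⟩, h, lc, le, lg, hc, he, hg, h', hlc, hlg => by
    have h0 := h'.outer 0 0 (Or.inl ⟨Fin.mk_lt_mk.2 (Nat.succ_pos _), rfl⟩)
    have h1 := isIns_insertHom (fun j : Fin (n + 1) => c j.succ) e (fun j : Fin k => g j.succ)
        ⟨i, Nat.lt_of_succ_lt_succ hi⟩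
        { length := by have := h.length; omega
          outer := fun j p hp => h.outer j.succ p.succ (by
            simp only [OuterPos, Fin.lt_def, Fin.val_succ] at hp ⊢; omega)
          inner := fun j p hp => h.inner j p.succ (by simp at hp ⊢; omega) }
        (fun j => lc j.succ) le (fun j => lg j.succ) (fun j => hc _) he (fun j => hg _)
        { length := by have := h.length; omega
          outer := fun j p hp => h'.outer j.succ p.succ (by
            simp only [OuterPos, Fin.lt_def, Fin.val_succ] at hp ⊢; omega)
          inner := fun j p hp => h'.inner j p.succ (by simp at hp ⊢; omega) }
        (fun a b hab => Fin.succ_injective _ (hlc hab))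
        (fun a b hab => Fin.succ_injective _ (hlg hab))
    have h2 := (((h1.comp (IsIns.lW (Rep.leaf (V := C.Und) (lc 0) (hc 0)) ?_ ?_)).comp_elPre
      (isCan_tEl (isCan_leaf h0 (hg 0) (hc 0) (h.outer 0 0
        (Or.inl ⟨Fin.mk_lt_mk.2 (Nat.succ_pos _), rfl⟩))) (isCan_eId _))).comp_elPre
      (isCan_unconsEl g lg hg))
    · rw [insertHom_succ]
      exact h2
    · intro a ha hb
      simp only [Rep.labels, List.mem_singleton] at ha
      rw [mem_labels_repTens] at hb
      obtain ⟨j, hj⟩ := hb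
      rw [ha, ← h0] at hj
      exact Fin.succ_ne_zero _ (hlg hj)
    · intro a ha hb
      simp only [Rep.labels, List.mem_singleton] at ha
      rw [mem_labels_repTens] at hb
      obtain ⟨j, hj⟩ := hb
      rw [ha] at hj
      exact Fin.succ_ne_zero _ (hlc hj)

end SymMonECat

end Insertions

/-! ### Grafting of lists and composition of canonical insertions -/

namespace IsGraft

universe w₁ w₂

variable {O : Type w₁} {n m k : ℕ} {i : Fin n} {c : Fin n → O} {e : Fin m → O} {g g' : Fin k → O}

/-- Every position in a grafted list is an outer or an inner one. -/
lemma pos_cases (h : k + 1 = n + m) (i : Fin n) (p : Fin k) :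
    (∃ j : Fin n, OuterPos i m j p.val) ∨ ∃ j : Fin m, p.val = i.val + j.val := by
  by_cases h1 : p.val < i.val
  · exact Or.inl ⟨⟨p.val, by omega⟩, Or.inl ⟨h1, rfl⟩⟩
  · by_cases h2 : p.val < i.val + m
    · exact Or.inr ⟨⟨p.val - i.val, by omega⟩, by simp; omega⟩
    · exact Or.inl ⟨⟨p.val + 1 - m, by omega⟩, Or.inr ⟨Fin.lt_def.2 (by simp; omega),
        by simp; omega⟩⟩

lemma exists_graft (h : k + 1 = n + m) (i : Fin n) (c : Fin n → O) (e : Fin m → O) :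
    ∃ g : Fin k → O, IsGraft i c e g := by
  refine ⟨fun p => if h1 : p.val < i.val then c ⟨p.val, by omega⟩ else
    if h2 : p.val < i.val + m then e ⟨p.val - i.val, by omega⟩ else c ⟨p.val + 1 - m, by omega⟩,
    h, fun j p hp => ?_, fun j p hp => ?_⟩
  · rcases hp with ⟨h1, h2⟩ | ⟨h1, h2⟩
    · have h3 : p.val < i.val := by omega
      simp only [h3, dif_pos]
      exact congrArg c (Fin.ext h2)
    · have h3 : ¬ p.val < i.val := by omega
      have h4 : ¬ p.val < i.val + m := by omega
      simp only [h3, h4, dif_neg, not_false_eq_true]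
      exact congrArg c (Fin.ext (by simp; omega))
  · have h3 : ¬ p.val < i.val := by omega
    have h4 : p.val < i.val + m := by omega
    simp only [h3, h4, dif_neg, dif_pos, not_false_eq_true]
    exact congrArg e (Fin.ext (by simp; omega))

lemma injective (h : IsGraft i c e g) (hc : Function.Injective c) (he : Function.Injective e)
    (hd : ∀ j j', c j ≠ e j') : Function.Injective g := by
  intro p q hpq
  rcases pos_cases h.length i p with ⟨j, hj⟩ | ⟨j, hj⟩ <;>
  rcases pos_cases h.length i q with ⟨j', hj'⟩ | ⟨j', hj'⟩
  · rw [h.outer j p hj, h.outer j' q hj'] at hpq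
    obtain rfl := hc hpq
    rcases hj with ⟨_, _⟩ | ⟨_, _⟩ <;> rcases hj' with ⟨_, _⟩ | ⟨_, _⟩ <;> exact Fin.ext (by omega)
  · rw [h.outer j p hj, h.inner j' q hj'] at hpq
    exact absurd hpq (hd _ _)
  · rw [h.inner j p hj, h.outer j' q hj'] at hpq
    exact absurd hpq.symm (hd _ _)
  · rw [h.inner j p hj, h.inner j' q hj'] at hpq
    obtain rfl := he hpq
    exact Fin.ext (by omega)

lemma forall_of {P : O → Prop} (h : IsGraft i c e g) (hc : ∀ j, P (c j)) (he : ∀ j, P (e j))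
    (p : Fin k) : P (g p) := by
  rcases pos_cases h.length i p with ⟨j, hj⟩ | ⟨j, hj⟩
  · rw [h.outer j p hj]; exact hc j
  · rw [h.inner j p hj]; exact he j

lemma map_eq {O' : Type w₂} {x : O → O'} {c' : Fin n → O'} {e' : Fin m → O'} {s : Fin k → O'}
    (h : IsGraft i c e g) (h' : IsGraft i c' e' s) (hc : ∀ j, x (c j) = c' j)
    (he : ∀ j, x (e j) = e' j) (p : Fin k) : x (g p) = s p := by
  rcases pos_cases h.length i p with ⟨j, hj⟩ | ⟨j, hj⟩
  · rw [h.outer j p hj, h'.outer j p hj, hc]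
  · rw [h.inner j p hj, h'.inner j p hj, he]

variable {l k' r : ℕ} {f : Fin l → O} {s : Fin k → O} {s' : Fin k' → O} {t : Fin r → O}

/-- Grafting `f` into the part `e` of a grafted list is grafting the result of grafting `f` into
`e`. -/
lemma assoc_seq {j : Fin m} {i' : Fin k} (hi' : i'.val = i.val + j.val) (hs : IsGraft i c e s)
    (ht : IsGraft i' s f t) (hs' : IsGraft j e f s') : IsGraft i c s' t where
  length := by have := hs.length; have := ht.length; have := hs'.length; omega
  outer a p hp := by
    have := hs.length; have := ht.length; have := hs'.length
    rcases hp with ⟨h1, h2⟩ | ⟨h1, h2⟩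
    · have h3 : p.val < k := by omega
      rw [ht.outer ⟨p.val, h3⟩ p (Or.inl ⟨Fin.lt_def.2 (by simp; omega), rfl⟩)]
      exact hs.outer a _ (Or.inl ⟨h1, h2⟩)
    · have h3 : p.val + 1 - l < k := by omega
      rw [ht.outer ⟨p.val + 1 - l, h3⟩ p (Or.inr ⟨Fin.lt_def.2 (by simp; omega), by simp; omega⟩)]
      exact hs.outer a _ (Or.inr ⟨h1, by simp; omega⟩)
  inner a p hp := by
    have := hs.length; have := ht.length; have := hs'.length
    rcases pos_cases hs'.length j a with ⟨b, hb⟩ | ⟨b, hb⟩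
    · rw [hs'.outer b a hb]
      have h3 : i.val + b.val < k := by omega
      rw [ht.outer ⟨i.val + b.val, h3⟩ p, hs.inner b _ rfl]
      rcases hb with ⟨h1, h2⟩ | ⟨h1, h2⟩
      · exact Or.inl ⟨Fin.lt_def.2 (by simp; omega), by simp; omega⟩
      · exact Or.inr ⟨Fin.lt_def.2 (by simp; omega), by simp; omega⟩
    · rw [hs'.inner b a hb, ht.inner b p (by omega)]

/-- Graftings at two different positions commute. -/
lemma assoc_par {j : Fin n} (hij : i ≠ j) {i' : Fin k'} {j' : Fin k}
    (hi' : OuterPos j l i i'.val) (hj' : OuterPos i m j j'.val)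
    (hs : IsGraft i c e s) (ht : IsGraft j' s f t) (hs' : IsGraft j c f s') :
    IsGraft i' s' e t where
  length := by have := hs.length; have := ht.length; have := hs'.length; omega
  outer a p hp := by
    have := hs.length; have := ht.length; have := hs'.length
    rcases pos_cases hs'.length j a with ⟨b, hb⟩ | ⟨b, hb⟩
    · rw [hs'.outer b a hb]
      have hbi : b ≠ i := by
        rintro rfl
        rcases hp with ⟨h1, h2⟩ | ⟨h1, h2⟩ <;> rcases hb with ⟨h3, h4⟩ | ⟨h3, h4⟩ <;>
          rcases hi' with ⟨h5, h6⟩ | ⟨h5, h6⟩ <;> omega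
      have hq : ∃ q : Fin k, OuterPos i m b q.val := by
        rcases lt_or_gt_of_ne hbi with h | h
        · exact ⟨⟨b.val, by omega⟩, Or.inl ⟨h, rfl⟩⟩
        · exact ⟨⟨b.val + m - 1, by omega⟩, Or.inr ⟨h, by simp; omega⟩⟩
      obtain ⟨q, hq⟩ := hq
      rw [ht.outer q p, hs.outer b q hq]
      unfold OuterPos at *
      omega
    · rw [hs'.inner b a hb, ht.inner b p]
      unfold OuterPos at *
      omega
  inner a p hp := by
    have := hs.length; have := ht.length; have := hs'.length
    have h3 : i.val + a.val < k := by omega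
    rw [ht.outer ⟨i.val + a.val, h3⟩ p, hs.inner a _ rfl]
    unfold OuterPos at *
    simp only [Fin.lt_def] at *
    omega

lemma perm {σ : Equiv.Perm (Fin n)}
    {τ : Equiv.Perm (Fin m)} {ρ : Equiv.Perm (Fin k)} (hρ : IsGraftPerm i σ τ ρ)
    (h : IsGraft (σ i) c e g) :
    IsGraft i (fun j => c (σ j)) (fun j => e (τ j)) (fun j => g (ρ j)) where
  length := h.length
  outer j p hp := h.outer _ _ (hρ.outer j p hp)
  inner j p hp := h.inner _ _ (hρ.inner j p hp)

end IsGraft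

section SeqPar

variable {E : Type u} [Category.{v} E] [MonoidalCategory E] [SymmetricCategory E]

namespace SymMonECat

open SymCoh

variable {C : SymMonECat.{v, u, w} E} {ι : Type*} {x : ι → C.Und}

lemma exists_isCan_of_perm {o o' : C.carrier} (r : Rep (V := C.Und) x o)
    (r' : Rep (V := C.Und) x o') (h : r.labels.Perm r'.labels) (hr : r.labels.Nodup) :
    ∃ f : 𝟙_ E ⟶ (o ⟶[E] o'), IsCan (V := C.Und) r r' f := by
  obtain ⟨f, hf⟩ := exists_isCan r r' hr (h.nodup_iff.1 hr) (fun a => h.mem_iff)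
  exact ⟨f.hom, hf⟩

namespace IsIns

variable {o y p p' q t a b e s s' f c y' : C.carrier} {ro : Rep (V := C.Und) x o}
  {ry : Rep (V := C.Und) x y}
  {rp : Rep (V := C.Und) x p} {rp' : Rep (V := C.Und) x p'} {rq : Rep (V := C.Und) x q}
  {rt : Rep (V := C.Und) x t} {ra : Rep (V := C.Und) x a} {rb : Rep (V := C.Und) x b}
  {re : Rep (V := C.Und) x e} {rs : Rep (V := C.Und) x s} {rs' : Rep (V := C.Und) x s'}
  {rf : Rep (V := C.Und) x f} {rc : Rep (V := C.Und) x c} {ry' : Rep (V := C.Und) x y'}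

/-- The factors of the identity in a canonical insertion are those which the source and the target
have in addition. -/
lemma perm {φ : (o ⟶[E] y) ⟶ (p ⟶[E] p')} (h : IsIns ro ry rp rp' φ) :
    ∃ L, rp.labels.Perm (ro.labels ++ L) ∧ (ry.labels ++ L).Perm rp'.labels := by
  obtain ⟨Z, rZ, s, s', hs, hs', rfl⟩ := h
  exact ⟨rZ.labels, hs.labels_perm, hs'.labels_perm⟩

/-- A canonical insertion maps canonical elements to canonical ones. -/
lemma isCan_el {φ : (o ⟶[E] y) ⟶ (p ⟶[E] p')} (h : IsIns ro ry rp rp' φ)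
    {a : 𝟙_ E ⟶ (o ⟶[E] y)} (ha : IsCan (V := C.Und) ro ry a) {b : 𝟙_ E ⟶ (p ⟶[E] p')}
    (hb : b = a ≫ φ) : IsCan (V := C.Und) rp rp' b := by
  obtain ⟨Z, rZ, s, s', hs, hs', rfl⟩ := h
  have h1 : a ≫ C.rW Z o y ≫ elPre s _ ≫ elPost _ s' =
      elComp (elComp s (C.tEl a (eId E Z))) s' := by
    rw [reassoc_of% el_rW, ← Category.assoc (C.tEl a (eId E Z)), _root_.comp_elPre,
        _root_.comp_elPost]
  rw [hb, h1]
  exact isCan_elComp (isCan_elComp hs (isCan_tEl ha (isCan_eId _))) hs'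

/-- Compatibility of canonical insertions with the composition. -/
lemma seq {φ : (o ⟶[E] y) ⟶ (p ⟶[E] p')} {φ' : (q ⟶[E] y) ⟶ (t ⟶[E] p')}
    {ψ : (a ⟶[E] b) ⟶ (q ⟶[E] o)} {ψ' : (a ⟶[E] b) ⟶ (t ⟶[E] p)} (hφ : IsIns ro ry rp rp' φ)
    (hφ' : IsIns rq ry rt rp' φ') (hψ : IsIns ra rb rq ro ψ) (hψ' : IsIns ra rb rt rp ψ')
    (ht : rt.labels.Nodup) :
    (ψ ▷ _) ≫ eComp E q o y ≫ φ' = (ψ' ⊗ₘ φ) ≫ eComp E t p p' := by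
  classical
  obtain ⟨Lψ, h1, h2⟩ := hψ.perm
  obtain ⟨Lψ', h3, h4⟩ := hψ'.perm
  obtain ⟨Z, rZ, s, s', hs, hs', rfl⟩ := hφ
  -- The remaining factors `Z` of `φ` serve for `φ'` as well, since `q` replaces `o`.
  have h5 : rt.labels.Perm (Rep.node (V := C.Und) rq rZ).labels := by
    have h6 := hs.labels_perm
    simp only [Rep.labels] at h6 ⊢
    rw [List.perm_iff_count] at h1 h2 h3 h4 h6 ⊢
    intro a
    have := h1 a; have := h2 a; have := h3 a; have := h4 a; have := h6 a
    simp only [List.count_append] at *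
    omega
  obtain ⟨u, hu⟩ := exists_isCan_of_perm (o' := C.tObj q Z) rt
    (Rep.node (V := C.Und) rq rZ) h5 ht
  have e1 : φ' = C.rW Z q y ≫ elPre u _ ≫ elPost _ s' := hφ'.eq ⟨Z, rZ, u, s', hu, hs', rfl⟩ ht
  have e2 : ψ' ≫ elPost _ s = (ψ ≫ C.rW Z q o) ≫ elPre u _ :=
    (hψ'.comp_elPost hs).eq ((hψ.comp_rW rZ).comp_elPre hu) ht
  have e3 : ψ' ⊗ₘ (C.rW Z o y ≫ elPre s _ ≫ elPost _ s') =
      (ψ' ⊗ₘ C.rW Z o y) ≫ (_ ◁ elPre s _) ≫ (_ ◁ elPost _ s') := by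
    simp only [← id_tensorHom, tensorHom_comp_tensorHom, Category.comp_id]
  rw [e1, reassoc_of% rW_comp, e3, Category.assoc, Category.assoc, _root_.elPost_comp,
    ← reassoc_of% elPost_elPre_comp, ← tensorHom_id (elPost _ s),
    tensorHom_comp_tensorHom_assoc, e2, Category.comp_id, ← tensorHom_id,
    tensorHom_comp_tensorHom_assoc, Category.id_comp]
  have e4 : (ψ ≫ C.rW Z q o) ≫ elPre u _ ⊗ₘ C.rW Z o y =
      (ψ ≫ C.rW Z q o ⊗ₘ C.rW Z o y) ≫ (elPre u _ ▷ _) := by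
    rw [← tensorHom_id, tensorHom_comp_tensorHom, Category.comp_id]
  rw [e4, Category.assoc, reassoc_of% _root_.elPre_comp]

/-- Canonical insertions into two different factors commute. -/
lemma par {z : C.carrier} {rz : Rep (V := C.Und) x z} {φ : (e ⟶[E] z) ⟶ (s ⟶[E] c)}
    {φ' : (e ⟶[E] z) ⟶ (t ⟶[E] s')}
    {ψ : (f ⟶[E] y) ⟶ (s' ⟶[E] c)} {ψ' : (f ⟶[E] y) ⟶ (t ⟶[E] s)} (hφ : IsIns re rz rs rc φ)
    (hφ' : IsIns re rz rt rs' φ') (hψ : IsIns rf ry rs' rc ψ) (hψ' : IsIns rf ry rt rs ψ')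
    {R : C.carrier} (rR : Rep (V := C.Und) x R)
    (hR : rc.labels.Perm (ry.labels ++ rz.labels ++ rR.labels)) (hc : rc.labels.Nodup)
    (hs : rs.labels.Nodup) (hs' : rs'.labels.Nodup) (ht : rt.labels.Nodup) :
    (ψ' ⊗ₘ φ) ≫ eComp E t s c = (β_ _ _).hom ≫ (φ' ⊗ₘ ψ) ≫ eComp E t s' c := by
  classical
  obtain ⟨L₁, h1, h1'⟩ := hφ.perm
  obtain ⟨L₂, h2, h2'⟩ := hφ'.perm
  obtain ⟨L₃, h3, h3'⟩ := hψ.perm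
  obtain ⟨L₄, h4, h4'⟩ := hψ'.perm
  have p1 : rt.labels.Perm (rf.labels ++ re.labels ++ rR.labels) ∧
      rs.labels.Perm (ry.labels ++ re.labels ++ rR.labels) ∧
      rs'.labels.Perm (rf.labels ++ rz.labels ++ rR.labels) := by
    simp only [List.perm_iff_count, List.count_append] at hR h1 h2 h3 h4 h1' h2' h3' h4' ⊢
    refine ⟨fun a => ?_, fun a => ?_, fun a => ?_⟩ <;>
    · have := h1 a; have := h2 a; have := h3 a; have := h4 a; have := hR a
      have := h1' a; have := h2' a; have := h3' a; have := h4' a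
      omega
  -- All four objects are tensor products of two of `f`, `e`, `y`, `z` with the other factors `R`.
  -- Hence all insertions are given by `lW` and `rW`, and the claim follows by `rW_lW_comp` and
  -- `lW_rW_comp`.
  obtain ⟨pt, ps, ps'⟩ := p1
  have disj : ∀ {l₁ l₂ l₃ l : List ι}, l.Perm (l₁ ++ l₂ ++ l₃) → l.Nodup → ∀ a ∈ l₁, a ∉ l₂ := by
    intro l₁ l₂ l₃ l h h' a ha ha'
    have h1 := (List.nodup_append.1 (List.nodup_append.1 (h.nodup_iff.1 h')).1).2.2
    exact h1 a ha a ha' rfl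
  obtain ⟨u, hu⟩ := exists_isCan_of_perm (o' := C.tObj (C.tObj f e) R) rt
    (Rep.node (V := C.Und) (Rep.node (V := C.Und) rf re) rR) pt ht
  obtain ⟨v, hv⟩ := exists_isCan_of_perm (o' := C.tObj (C.tObj y e) R) rs
    (Rep.node (V := C.Und) (Rep.node (V := C.Und) ry re) rR) ps hs
  obtain ⟨v', hv'⟩ := exists_isCan_of_perm (o' := C.tObj (C.tObj f z) R) rs'
    (Rep.node (V := C.Und) (Rep.node (V := C.Und) rf rz) rR) ps' hs'
  obtain ⟨k, hk⟩ := exists_isCan_of_perm (o := C.tObj (C.tObj y z) R)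
    (Rep.node (V := C.Und) (Rep.node (V := C.Und) ry rz) rR) rc hR.symm (hR.nodup_iff.1 hc)
  have e1 : ψ' ≫ elPost _ v = (C.rW e f y ≫ C.rW R _ _) ≫ elPre u _ :=
    (hψ'.comp_elPost hv).eq (((IsIns.rW re).comp_rW rR).comp_elPre hu) ht
  have e2 : φ = ((C.lW y e z ≫ C.rW R _ _) ≫ elPre v _) ≫ elPost _ k :=
    hφ.eq (((((IsIns.lW ry (disj ps hs) (disj hR hc)).comp_rW rR).comp_elPre hv).comp_elPost hk))
      hs
  have e3 : φ' ≫ elPost _ v' = (C.lW f e z ≫ C.rW R _ _) ≫ elPre u _ :=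
    (hφ'.comp_elPost hv').eq
      (((IsIns.lW rf (disj pt ht) (disj ps' hs')).comp_rW rR).comp_elPre hu) ht
  have e4 : ψ = ((C.rW z f y ≫ C.rW R _ _) ≫ elPre v' _) ≫ elPost _ k :=
    hψ.eq (((((IsIns.rW rz).comp_rW rR).comp_elPre hv').comp_elPost hk)) hs'
  have key : ∀ {P Q : E} {d₁ d₂ d₃ d₄ d₅ d₆ : C.carrier} (A : P ⟶ (d₁ ⟶[E] d₂))
      (A' : P ⟶ (d₃ ⟶[E] d₄)) (B : Q ⟶ (d₄ ⟶[E] d₅)) (v : 𝟙_ E ⟶ (d₂ ⟶[E] d₄))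
      (u : 𝟙_ E ⟶ (d₁ ⟶[E] d₃)) (k : 𝟙_ E ⟶ (d₅ ⟶[E] d₆)) (h : A ≫ elPost _ v = A' ≫ elPre u _),
      (A ⊗ₘ ((B ≫ elPre v _) ≫ elPost _ k)) ≫ eComp E d₁ d₂ d₆ =
        (A' ⊗ₘ B) ≫ eComp E d₃ d₄ d₅ ≫ elPre u _ ≫ elPost _ k := by
    intro P Q d₁ d₂ d₃ d₄ d₅ d₆ A A' B v u k h
    have f1 : A ⊗ₘ ((B ≫ elPre v _) ≫ elPost _ k) =
        (A ⊗ₘ B) ≫ (_ ◁ elPre v _) ≫ (_ ◁ elPost _ k) := by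
      simp only [← id_tensorHom, tensorHom_comp_tensorHom, Category.comp_id, Category.assoc]
    have f2 : (A ≫ elPost _ v) ⊗ₘ B = (A ⊗ₘ B) ≫ (elPost _ v ▷ _) := by
      simp only [← tensorHom_id, tensorHom_comp_tensorHom, Category.comp_id]
    have f3 : (A' ≫ elPre u _) ⊗ₘ B = (A' ⊗ₘ B) ≫ (elPre u _ ▷ _) := by
      simp only [← tensorHom_id, tensorHom_comp_tensorHom, Category.comp_id]
    rw [f1, Category.assoc, Category.assoc, _root_.elPost_comp, ← reassoc_of% elPost_elPre_comp,
      ← Category.assoc, ← f2, h, f3, Category.assoc, reassoc_of% _root_.elPre_comp]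
  rw [e2, e4]
  refine (key _ _ _ _ _ _ e1).trans (Eq.trans ?_ (congrArg (_ ≫ ·) (key _ _ _ _ _ _ e3)).symm)
  have g1 := rW_lW_comp (C := C) f y e z
  have g2 := lW_rW_comp (C := C) f y e z
  rw [← tensorHom_comp_tensorHom, ← tensorHom_comp_tensorHom, Category.assoc, Category.assoc,
    ← reassoc_of% rW_comp, ← reassoc_of% rW_comp, reassoc_of% g1, reassoc_of% g2]

end IsIns

end SymMonECat

end SeqPar

/-! ### Permutations and insertions in iterated tensor products -/

lemma List.exists_perm_cons_cons {α : Type*} {l : List α} {a b : α} (hab : a ≠ b) (ha : a ∈ l)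
    (hb : b ∈ l) : ∃ L, l.Perm (a :: b :: L) := by
  classical
  have h : b ∈ l.erase a := (List.mem_erase_of_ne hab.symm).2 hb
  exact ⟨_, (List.perm_cons_erase ha).trans ((List.perm_cons_erase h).cons _)⟩

section EndOperad

variable {E : Type u} [Category.{v} E] [MonoidalCategory E] [SymmetricCategory E]

namespace SymMonECat

open SymCoh

variable {C : SymMonECat.{v, u, w} E}

lemma permEl_one {n : ℕ} (c : Fin n → C.carrier) (h) : C.permEl c c 1 h = eId E (C.tens c) :=
  (isCan_permEl (x := (c : Fin n → C.Und)) c c 1 h _root_.id _root_.id (fun _ => rfl)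
    (fun _ => rfl) (fun _ _ h => h) (fun _ => rfl)).eq
      (isCan_eId (C.repTens c _root_.id (fun _ => rfl)))

lemma permEl_mul {n : ℕ} {c c' c'' : Fin n → C.carrier} (σ τ : Equiv.Perm (Fin n))
    (h : ∀ i, c' i = c (σ i)) (h' : ∀ i, c'' i = c' (τ i)) (h'' : ∀ i, c'' i = c ((σ * τ) i)) :
    elComp (C.permEl c' c'' τ h') (C.permEl c c' σ h) = C.permEl c c'' (σ * τ) h'' :=
  (isCan_elComp (isCan_permEl (x := (c : Fin n → C.Und)) c' c'' τ h' σ (fun j => σ (τ j))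
      (fun j => (h j).symm) (fun j => (h'' j).symm) σ.injective (fun _ => rfl))
    (isCan_permEl (x := (c : Fin n → C.Und)) c c' σ h _root_.id σ (fun _ => rfl)
      (fun j => (h j).symm) (fun _ _ h => h) (fun _ => rfl))).eq
    (isCan_permEl (x := (c : Fin n → C.Und)) c c'' (σ * τ) h'' _root_.id (fun j => σ (τ j))
      (fun _ => rfl) (fun j => (h'' j).symm) (fun _ _ h => h) (fun _ => rfl))

lemma eId_insertHom {n : ℕ} (c : Fin n → C.carrier) (i : Fin n)
    (h : IsGraft i c (fun _ : Fin 1 => c i) c) :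
    eId E (c i) ≫ C.insertHom c (fun _ : Fin 1 => c i) c i h = eId E (C.tens c) :=
  IsCan.eq (V := C.Und) ((isIns_insertHom (x := (c : Fin n → C.Und)) c (fun _ : Fin 1 => c i) c i h
      _root_.id (fun _ => i) _root_.id (fun _ => rfl) (fun _ => rfl) (fun _ => rfl)
      (IsGraft.one_right (fun _ _ => rfl) rfl) (fun _ _ h => h) (fun _ _ h => h)).isCan_el
      (isCan_eId (Rep.leaf (V := C.Und) i rfl)) rfl)
    (isCan_eId (C.repTens c _root_.id (fun _ => rfl)))

/-- The map `C(⨂ e, y) ⟶ C(⨂ g, ⨂ c)` which tensors with the identities of the `c j` for `j ≠ i`,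
where `y = c i`. -/
def insertAt (C : SymMonECat.{v, u, w} E) {n m k : ℕ} {c : Fin n → C.carrier}
    {e : Fin m → C.carrier} {g : Fin k → C.carrier} (i : Fin n) {y : C.carrier} (hy : c i = y)
    (h : IsGraft i c e g) : (C.tens e ⟶[E] y) ⟶ (C.tens g ⟶[E] C.tens c) :=
  eqToHom (by rw [hy]) ≫ C.insertHom c e g i h

lemma isIns_insertAt {ι : Type*} {x : ι → C.Und} {n m k : ℕ} {c : Fin n → C.carrier}
    {e : Fin m → C.carrier} {g : Fin k → C.carrier} (i : Fin n) {y : C.carrier} (hy : c i = y)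
    (h : IsGraft i c e g) {lc : Fin n → ι} {le : Fin m → ι} {lg : Fin k → ι} {ly : ι}
    (hc : ∀ j, x (lc j) = c j) (he : ∀ j, x (le j) = e j) (hg : ∀ j, x (lg j) = g j)
    (hly : x ly = y) (hi : lc i = ly) (h' : IsGraft i lc le lg) (hlc : Function.Injective lc)
    (hlg : Function.Injective lg) :
    IsIns (C.repTens e le he) (Rep.leaf (V := C.Und) ly hly) (C.repTens g lg hg)
      (C.repTens c lc hc) (C.insertAt i hy h) := by
  subst hy hi
  have := isIns_insertHom c e g i h lc le lg hc he hg h' hlc hlg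
  rw [insertAt, eqToHom_refl, Category.id_comp]
  exact this

lemma nodup_repTens {ι : Type*} {x : ι → C.Und} {n : ℕ} {c : Fin n → C.carrier} {l : Fin n → ι}
    (h : ∀ j, x (l j) = c j) (hl : Function.Injective l) : (C.repTens c l h).labels.Nodup := by
  rw [labels_repTens]
  exact List.nodup_ofFn.2 hl

section

variable {n m l k k' r : ℕ} {c : Fin n → C.carrier} {e : Fin m → C.carrier}
  {f : Fin l → C.carrier} {s : Fin k → C.carrier} {s' : Fin k' → C.carrier}
  {t : Fin r → C.carrier}

/-- Compatibility of the insertions with sequential grafting.  The three lists get different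
labels, in a sum type, so that coherence applies even if objects are repeated. -/
lemma insertAt_seq (i : Fin n) (j : Fin m)
    (i' : Fin k) {z y : C.carrier} (hx : c i = z) (hy : e j = y) (hy' : s i' = y)
    (hi' : i'.val = i.val + j.val) (hs : IsGraft i c e s) (hst : IsGraft i' s f t)
    (hs' : IsGraft j e f s') (hst' : IsGraft i c s' t) :
    (C.insertAt j hy hs' ▷ _) ≫ eComp E _ _ z ≫ C.insertAt i hx hst' =
      (C.insertAt i' hy' hst ⊗ₘ C.insertAt i hx hs) ≫ eComp E _ _ _ := by
  let lc : Fin n → Fin n ⊕ Fin m ⊕ Fin l := Sum.inl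
  let le : Fin m → Fin n ⊕ Fin m ⊕ Fin l := fun j => Sum.inr (Sum.inl j)
  let lf : Fin l → Fin n ⊕ Fin m ⊕ Fin l := fun j => Sum.inr (Sum.inr j)
  let x : Fin n ⊕ Fin m ⊕ Fin l → C.Und := Sum.elim c (Sum.elim e f)
  have hlc : Function.Injective lc := Sum.inl_injective
  have hle : Function.Injective le := Sum.inr_injective.comp Sum.inl_injective
  have hlf : Function.Injective lf := Sum.inr_injective.comp Sum.inr_injective
  obtain ⟨ls, gs⟩ := IsGraft.exists_graft hs.length i lc le
  obtain ⟨ls', gs'⟩ := IsGraft.exists_graft hs'.length j le lf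
  obtain ⟨lt, gt⟩ := IsGraft.exists_graft hst.length i' ls lf
  have gt' : IsGraft i lc ls' lt := IsGraft.assoc_seq hi' gs gt gs'
  have xs : ∀ p, x (ls p) = s p := gs.map_eq hs (fun _ => rfl) (fun _ => rfl)
  have xs' : ∀ p, x (ls' p) = s' p := gs'.map_eq hs' (fun _ => rfl) (fun _ => rfl)
  have xt : ∀ p, x (lt p) = t p := gt.map_eq hst xs (fun _ => rfl)
  have hls : Function.Injective ls := gs.injective hlc hle (fun _ _ h => by cases h)
  have hls' : Function.Injective ls' := gs'.injective hle hlf (fun _ _ h => by cases h)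
  have hlt : Function.Injective lt := gt.injective hls hlf
    (gs.forall_of (P := fun a => ∀ j', a ≠ lf j') (fun _ _ h => by cases h)
      (fun _ _ h => by cases h))
  refine (isIns_insertAt (x := x) (ly := lc i) i hx hs (fun _ => rfl) (fun _ => rfl)
      xs hx rfl gs hlc hls).seq
    (isIns_insertAt (x := x) (ly := lc i) i hx hst' (fun _ => rfl) xs' xt hx rfl gt' hlc hlt)
    (isIns_insertAt (x := x) (ly := le j) j hy hs' (fun _ => rfl) (fun _ => rfl) xs' hy rfl gs'
      hle hls')
    (isIns_insertAt (x := x) (ly := le j) i' hy' hst xs (fun _ => rfl) xt hy (gs.inner j i' hi')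
      gt hls hlt)
    (nodup_repTens _ hlt)

/-- Compatibility of the insertions with grafting at two different positions. -/
lemma insertAt_par (i j : Fin n) (hij : i ≠ j)
    (i' : Fin k') (j' : Fin k) {z y : C.carrier} (hx : c i = z) (hy : c j = y) (hx' : s' i' = z)
    (hy' : s j' = y) (hi' : OuterPos j l i i'.val) (hj' : OuterPos i m j j'.val)
    (hs : IsGraft i c e s) (hst : IsGraft j' s f t) (hs' : IsGraft j c f s')
    (hst' : IsGraft i' s' e t) :
    (C.insertAt j' hy' hst ⊗ₘ C.insertAt i hx hs) ≫ eComp E _ _ _ =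
      (β_ _ _).hom ≫ (C.insertAt i' hx' hst' ⊗ₘ C.insertAt j hy hs') ≫ eComp E _ _ _ := by
  let lc : Fin n → Fin n ⊕ Fin m ⊕ Fin l := Sum.inl
  let le : Fin m → Fin n ⊕ Fin m ⊕ Fin l := fun j => Sum.inr (Sum.inl j)
  let lf : Fin l → Fin n ⊕ Fin m ⊕ Fin l := fun j => Sum.inr (Sum.inr j)
  let x : Fin n ⊕ Fin m ⊕ Fin l → C.Und := Sum.elim c (Sum.elim e f)
  have hlc : Function.Injective lc := Sum.inl_injective
  have hle : Function.Injective le := Sum.inr_injective.comp Sum.inl_injective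
  have hlf : Function.Injective lf := Sum.inr_injective.comp Sum.inr_injective
  obtain ⟨ls, gs⟩ := IsGraft.exists_graft hs.length i lc le
  obtain ⟨ls', gs'⟩ := IsGraft.exists_graft hs'.length j lc lf
  obtain ⟨lt, gt⟩ := IsGraft.exists_graft hst.length j' ls lf
  have gt' : IsGraft i' ls' le lt := IsGraft.assoc_par hij hi' hj' gs gt gs'
  have xs : ∀ p, x (ls p) = s p := gs.map_eq hs (fun _ => rfl) (fun _ => rfl)
  have xs' : ∀ p, x (ls' p) = s' p := gs'.map_eq hs' (fun _ => rfl) (fun _ => rfl)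
  have xt : ∀ p, x (lt p) = t p := gt.map_eq hst xs (fun _ => rfl)
  have hls : Function.Injective ls := gs.injective hlc hle (fun _ _ h => by cases h)
  have hls' : Function.Injective ls' := gs'.injective hlc hlf (fun _ _ h => by cases h)
  have hlt : Function.Injective lt := gt.injective hls hlf
    (gs.forall_of (P := fun a => ∀ j', a ≠ lf j') (fun _ _ h => by cases h)
      (fun _ _ h => by cases h))
  -- The factors of `c` other than `c i` and `c j`.
  obtain ⟨L, hL⟩ := List.exists_perm_cons_cons (hlc.ne hij.symm) (List.mem_ofFn.2 ⟨j, rfl⟩)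
    (List.mem_ofFn.2 ⟨i, rfl⟩)
  refine (isIns_insertAt (x := x) (ly := lc i) i hx hs (fun _ => rfl) (fun _ => rfl)
      xs hx rfl gs hlc hls).par
    (isIns_insertAt (x := x) (ly := lc i) i' hx' hst' xs' (fun _ => rfl) xt hx (gs'.outer i i' hi')
      gt' hls' hlt)
    (isIns_insertAt (x := x) (ly := lc j) j hy hs' (fun _ => rfl) (fun _ => rfl) xs' hy rfl gs' hlc
      hls')
    (isIns_insertAt (x := x) (ly := lc j) j' hy' hst xs (fun _ => rfl) xt hy (gs.outer j j' hj')
      gt hls hlt)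
    (repT x L) ?_
    (nodup_repTens _ hlc) (nodup_repTens _ hls) (nodup_repTens _ hls') (nodup_repTens _ hlt)
  refine (List.Perm.of_eq (labels_repTens (C := C) (x := x) c lc (fun _ => rfl))).trans ?_
  change List.Perm _ (lc j :: lc i :: (repT x L).labels)
  rw [labels_repT]
  exact hL

end

/-- Compatibility of the insertions with permutations: both sides are canonical insertions. -/
lemma insertAt_perm {n m k : ℕ} {c c' : Fin n → C.carrier} {e e' : Fin m → C.carrier}
    {g g' : Fin k → C.carrier}
    (i : Fin n) {z : C.carrier} (σ : Equiv.Perm (Fin n)) (τ : Equiv.Perm (Fin m))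
    (ρ : Equiv.Perm (Fin k)) (hρ : IsGraftPerm i σ τ ρ) (hσ : ∀ j, c' j = c (σ j))
    (hτ : ∀ j, e' j = e (τ j)) (h : ∀ j, g' j = g (ρ j)) (hx : c (σ i) = z) (hx' : c' i = z)
    (hg : IsGraft (σ i) c e g) (hg' : IsGraft i c' e' g') :
    elPre (C.permEl e e' τ hτ) z ≫ C.insertAt i hx' hg' ≫ elPost _ (C.permEl c c' σ hσ) =
      C.insertAt (σ i) hx hg ≫ elPre (C.permEl g g' ρ h) _ := by
  let lc : Fin n → Fin n ⊕ Fin m := Sum.inl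
  let le : Fin m → Fin n ⊕ Fin m := Sum.inr
  let x : Fin n ⊕ Fin m → C.Und := Sum.elim c e
  have hlc : Function.Injective lc := Sum.inl_injective
  have hle : Function.Injective le := Sum.inr_injective
  obtain ⟨lg, gg⟩ := IsGraft.exists_graft hg.length (σ i) lc le
  have gg' := IsGraft.perm hρ gg
  have xg : ∀ p, x (lg p) = g p := gg.map_eq hg (fun _ => rfl) (fun _ => rfl)
  have hlg : Function.Injective lg := gg.injective hlc hle (fun _ _ h => by cases h)
  have xc' : ∀ j, x (lc (σ j)) = c' j := fun j => (hσ j).symm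
  have xe' : ∀ j, x (le (τ j)) = e' j := fun j => (hτ j).symm
  have xg' : ∀ j, x (lg (ρ j)) = g' j := fun j => (xg _).trans (h j).symm
  refine IsIns.eq (((isIns_insertAt (x := x) (ly := lc (σ i)) i hx' hg' xc' xe' xg' hx rfl gg'
      (hlc.comp σ.injective) (hlg.comp ρ.injective)).comp_elPost
      (isCan_permEl (x := x) c c' σ hσ lc _ (fun _ => rfl) xc' hlc (fun _ => rfl))).elPre_comp
      (isCan_permEl (x := x) e e' τ hτ le _ (fun _ => rfl) xe' hle (fun _ => rfl)))
    ((isIns_insertAt (x := x) (ly := lc (σ i)) (σ i) hx hg (fun _ => rfl) (fun _ => rfl)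
      xg hx rfl gg hlc
      hlg).comp_elPre (isCan_permEl (x := x) g g' ρ h lg _ xg xg' hlg (fun _ => rfl)))
    (nodup_repTens _ (hlg.comp ρ.injective))

end SymMonECat

end EndOperad

/-! ### The operad laws of `End(C)` -/

section EndOperad

variable {E : Type u} [Category.{v} E] [MonoidalCategory E] [SymmetricCategory E]

lemma comp_seq_braid (X Y F : E) :
    (β_ X Y).hom ▷ F ≫ (β_ (Y ⊗ X) F).hom ≫ (α_ F Y X).inv =
      (α_ X Y F).hom ≫ X ◁ (β_ Y F).hom ≫ (β_ X (F ⊗ Y)).hom := by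
  rw [BraidedCategory.braiding_naturality_left_assoc, BraidedCategory.braiding_tensor_left_hom,
    BraidedCategory.braiding_tensor_right_hom]
  simp only [Category.assoc]

lemma comp_par_braid (X Y F : E) :
    (β_ X Y).hom ▷ F ≫ (β_ (Y ⊗ X) F).hom ≫ (α_ F Y X).inv ≫ (β_ F Y).hom ▷ X =
      (α_ X Y F).hom ≫ X ◁ (β_ Y F).hom ≫ (α_ X F Y).inv ≫ (β_ X F).hom ▷ Y ≫
        (β_ (F ⊗ X) Y).hom ≫ (α_ Y F X).inv := by
  rw [reassoc_of% comp_seq_braid, comp_seq_braid X F Y, Iso.inv_hom_id_assoc,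
    ← BraidedCategory.braiding_naturality_right]

section

variable {C : Type w} [EnrichedCategory E C]

/-- Two partial compositions in succession precompose with the composite of the two inserted
operations. -/
lemma comp_comp_braid {Y F : E} {t s c d : C}
    (A : F ⟶ (t ⟶[E] s)) (B : Y ⟶ (s ⟶[E] c)) :
    ((β_ (c ⟶[E] d) Y).hom ≫ B ▷ _ ≫ eComp E s c d) ▷ F ≫ (β_ _ F).hom ≫ A ▷ _ ≫ eComp E t s d =
      (β_ (c ⟶[E] d) Y).hom ▷ F ≫ (β_ (Y ⊗ _) F).hom ≫ (α_ _ _ _).inv ≫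
        ((A ⊗ₘ B) ≫ eComp E t s c) ▷ _ ≫ eComp E t c d := by
  rw [comp_whiskerRight_assoc, BraidedCategory.braiding_naturality_left_assoc,
    MonoidalCategory.whiskerLeft_comp_assoc, whisker_exchange_assoc, whisker_exchange_assoc,
    ← e_assoc, comp_whiskerRight_assoc, MonoidalCategory.tensorHom_def, comp_whiskerRight]
  simp [-e_assoc]

/-- The sequential associativity of partial compositions follows from that of the insertions. -/
lemma assoc_seq_of_eq {F : E} {t s s' c d e x : C} (A : F ⟶ (t ⟶[E] s))
    (B : (e ⟶[E] x) ⟶ (s ⟶[E] c)) (A' : F ⟶ (s' ⟶[E] e)) (B' : (s' ⟶[E] x) ⟶ (t ⟶[E] c))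
    (key : (A' ▷ _) ≫ eComp E s' e x ≫ B' = (A ⊗ₘ B) ≫ eComp E t s c) :
    ((β_ (c ⟶[E] d) _).hom ≫ B ▷ _ ≫ eComp E s c d) ▷ F ≫ (β_ _ F).hom ≫ A ▷ _ ≫ eComp E t s d =
      (α_ _ _ _).hom ≫ (c ⟶[E] d) ◁ ((β_ (e ⟶[E] x) F).hom ≫ A' ▷ _ ≫ eComp E s' e x) ≫
        (β_ _ _).hom ≫ B' ▷ _ ≫ eComp E t c d := by
  rw [comp_comp_braid, reassoc_of% comp_seq_braid, ← key]
  simp only [MonoidalCategory.whiskerLeft_comp, comp_whiskerRight, Category.assoc]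
  simp only [BraidedCategory.braiding_naturality_right_assoc]

/-- The parallel associativity of partial compositions follows from that of the insertions. -/
lemma assoc_par_of_eq {Y F : E} {t s s' c d : C} (A : F ⟶ (t ⟶[E] s)) (B : Y ⟶ (s ⟶[E] c))
    (A' : Y ⟶ (t ⟶[E] s')) (B' : F ⟶ (s' ⟶[E] c))
    (key : (A ⊗ₘ B) ≫ eComp E t s c = (β_ _ _).hom ≫ (A' ⊗ₘ B') ≫ eComp E t s' c) :
    ((β_ (c ⟶[E] d) Y).hom ≫ B ▷ _ ≫ eComp E s c d) ▷ F ≫ (β_ _ F).hom ≫ A ▷ _ ≫ eComp E t s d =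
      (α_ _ _ _).hom ≫ (c ⟶[E] d) ◁ (β_ Y F).hom ≫ (α_ _ _ _).inv ≫
        ((β_ (c ⟶[E] d) F).hom ≫ B' ▷ _ ≫ eComp E s' c d) ▷ Y ≫ (β_ _ Y).hom ≫ A' ▷ _ ≫
          eComp E t s' d := by
  rw [comp_comp_braid, comp_comp_braid, key, comp_whiskerRight_assoc,
    reassoc_of% comp_par_braid]

/-- The equivariance of partial compositions follows from that of the insertions. -/
lemma act_comp_of_eq {c c' e e' g g' d x : C} (a : 𝟙_ E ⟶ (c' ⟶[E] c)) (b : 𝟙_ E ⟶ (e' ⟶[E] e))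
    (r : 𝟙_ E ⟶ (g' ⟶[E] g)) (A : (e' ⟶[E] x) ⟶ (g' ⟶[E] c')) (B : (e ⟶[E] x) ⟶ (g ⟶[E] c))
    (key : elPre b x ≫ A ≫ elPost g' a = B ≫ elPre r c) :
    (elPre a d ⊗ₘ elPre b x) ≫ (β_ _ _).hom ≫ A ▷ _ ≫ eComp E g' c' d =
      ((β_ _ _).hom ≫ B ▷ _ ≫ eComp E g c d) ≫ elPre r d := by
  rw [BraidedCategory.braiding_naturality_assoc, MonoidalCategory.tensorHom_def, Category.assoc,
    whisker_exchange_assoc, ← elPost_elPre_comp, ← comp_whiskerRight_assoc,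
    ← comp_whiskerRight_assoc, Category.assoc, key, Category.assoc, Category.assoc,
    ← elPre_comp, comp_whiskerRight_assoc]

end

section

variable (C : SymMonECat.{v, u, w} E)

lemma rightUnitor_inv_comp {X Y Z W : E} (a : 𝟙_ E ⟶ Y) (k : Y ⟶ Z) (q : Z ⊗ X ⟶ W) :
    (ρ_ X).inv ≫ X ◁ a ≫ (β_ X Y).hom ≫ k ▷ X ≫ q = (λ_ X).inv ≫ (a ≫ k) ▷ X ≫ q := by
  rw [BraidedCategory.braiding_naturality_right_assoc, comp_whiskerRight, Category.assoc]
  simp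

/-- The substitution of an element `a` into an operation is precomposition with the inserted
element. -/
lemma endData_comp_el {n m k : ℕ} {c : Fin n → C.carrier} {e : Fin m → C.carrier}
    {g : Fin k → C.carrier} (i : Fin n) {x : C.carrier} (hx : c i = x) (hg : IsGraft i c e g)
    (d : C.carrier) (a : 𝟙_ E ⟶ (C.tens e ⟶[E] x)) :
    (ρ_ (C.tens c ⟶[E] d)).inv ≫ (C.tens c ⟶[E] d) ◁ a ≫ (endData C).comp i hx hg d =
      elPre (a ≫ C.insertAt i hx hg) d :=
  rightUnitor_inv_comp _ _ _

lemma insertHom_one {m : ℕ} (c : Fin 1 → C.carrier) (e : Fin m → C.carrier)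
    (h : IsGraft (0 : Fin 1) c e e) : C.insertHom c e e 0 h = 𝟙 _ :=
  (show C.insertHom c e e ⟨0, Nat.zero_lt_one⟩ h = _ by
    rw [SymMonECat.insertHom, elOfEq_rfl]).trans
    (elPre_id (C.tens e) (c 0))

lemma leftUnitor_inv_comp {X Y Z : E} (b : 𝟙_ E ⟶ X) (k : Y ⟶ Y) (hk : k = 𝟙 Y) (q : Y ⊗ X ⟶ Z) :
    (λ_ Y).inv ≫ b ▷ Y ≫ (β_ X Y).hom ≫ k ▷ X ≫ q = (ρ_ Y).inv ≫ Y ◁ b ≫ q := by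
  rw [BraidedCategory.braiding_naturality_left_assoc, hk]
  simp

lemma insertAt_one {m : ℕ} (c : Fin 1 → C.carrier) (e : Fin m → C.carrier)
    (h : IsGraft (0 : Fin 1) c e e) : C.insertAt 0 rfl h = 𝟙 (C.tens e ⟶[E] c 0) :=
  (congrArg (· ≫ C.insertHom c e e 0 h) (eqToHom_refl _ _)).trans
    ((Category.id_comp _).trans (insertHom_one C c e h))

lemma endData_el_comp {n : ℕ} (c : Fin n → C.carrier) {d d' : C.carrier}
    (b : 𝟙_ E ⟶ (d ⟶[E] d')) : (endData C).post (d := d) (d' := d') c b = elPost (C.tens c) b :=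
  leftUnitor_inv_comp b _ (insertAt_one C (fun _ => d) c (IsGraft.one_left d)) _

lemma endData_comp_unit {n : ℕ} (c : Fin n → C.carrier) (i : Fin n) (d : C.carrier) :
    (ρ_ (C.tens c ⟶[E] d)).inv ≫ (C.tens c ⟶[E] d) ◁ eId E (c i) ≫
      (endData C).comp i rfl (IsGraft.one_right (fun _ _ => rfl) rfl) d =
        𝟙 (C.tens c ⟶[E] d) := by
  have h : eId E (c i) ≫ C.insertAt i rfl (IsGraft.one_right (fun _ _ => rfl) rfl) =
      eId E (C.tens c) :=
    (congrArg (eId E (c i) ≫ ·) (Category.id_comp _)).trans (SymMonECat.eId_insertHom c i _)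
  have h' := endData_comp_el C i rfl (IsGraft.one_right (fun _ _ => rfl) rfl) d (eId E (c i))
  exact h'.trans ((congrArg (fun a => elPre a d) h).trans (elPre_id _ _))

end

/-- The operad laws of the endomorphism operads. -/
theorem endData_isOperad (C : SymMonECat.{v, u, w} E) : (endData C).IsOperad where
  act_one {n} c d := (congrArg (fun a => elPre (C := C.carrier) a d)
    (SymMonECat.permEl_one (C := C) c _)).trans (elPre_id (C := C.carrier) _ _)
  act_mul σ τ h h' h'' d := (elPre_elPre (C := C.carrier) _ _ _).trans
    (congrArg (fun a => elPre (C := C.carrier) a d) (SymMonECat.permEl_mul σ τ h h' h''))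
  unit_comp c d := (endData_el_comp C c (eId E (C := C.carrier) d)).trans
    (elPost_id (C := C.carrier) _ _)
  comp_unit {n} c i d := endData_comp_unit C c i d
  assoc_seq {n m l k k' r c e f s s' t} i j i' x y hx hy hy' hi' hs hst hs' hst' d :=
    assoc_seq_of_eq (C := C.carrier) _ _ _ _ (C.insertAt_seq i j i' hx hy hy' hi' hs hst hs' hst')
  assoc_par {n m l k k' r c e f s s' t} i j hij i' j' x y hx hy hx' hy' hi' hj' hs hst hs' hst' d :=
    assoc_par_of_eq (C := C.carrier) _ _ _ _
      (C.insertAt_par i j hij i' j' hx hy hx' hy' hi' hj' hs hst hs' hst')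
  act_comp {n m k c c' e e' g g'} i x σ τ ρ hρ hσ hτ h hx hx' hg hg' d :=
    act_comp_of_eq (C := C.carrier) _ _ _ _ _
      (C.insertAt_perm i σ τ ρ hρ hσ hτ h hx hx' hg hg')

end EndOperad

/-! ### Lax symmetric monoidal functors and insertions -/

section LaxSquares

variable {E : Type u} [Category.{v} E] [MonoidalCategory E] [SymmetricCategory E]

namespace LaxHom

variable {C D : SymMonECat.{v, u, w} E} (f : LaxHom C D)

/-- The tensor product of two elements `p ⟶ f(o)` and `q ⟶ f(o')`, composed with the structural map
of `f`. -/
def tMu {o o' : C.carrier} {p q : D.carrier} (m : 𝟙_ E ⟶ (p ⟶[E] f.obj o))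
    (n : 𝟙_ E ⟶ (q ⟶[E] f.obj o')) : 𝟙_ E ⟶ (D.tObj p q ⟶[E] f.obj (C.tObj o o')) :=
  elComp (D.tEl m n) (f.mu o o')

/-- An element `a` of `C(o, o')` and an element `b` of `D(p, p')` form a commutative square with
elements `m` of `D(p, f(o))` and `m'` of `D(p', f(o'))`. -/
def Sq {o o' : C.carrier} {p p' : D.carrier} (m : 𝟙_ E ⟶ (p ⟶[E] f.obj o))
    (m' : 𝟙_ E ⟶ (p' ⟶[E] f.obj o')) (a : 𝟙_ E ⟶ (o ⟶[E] o')) (b : 𝟙_ E ⟶ (p ⟶[E] p')) : Prop :=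
  elComp m (a ≫ f.map o o') = elComp b m'

namespace Sq

variable {f} {o o' o'' o₁ o₁' o₂ : C.carrier} {p p' p'' p₁ p₁' p₂ : D.carrier}
  {m : 𝟙_ E ⟶ (p ⟶[E] f.obj o)} {m' : 𝟙_ E ⟶ (p' ⟶[E] f.obj o')}
  {m'' : 𝟙_ E ⟶ (p'' ⟶[E] f.obj o'')} {m₁ : 𝟙_ E ⟶ (p₁ ⟶[E] f.obj o₁)}
  {m₁' : 𝟙_ E ⟶ (p₁' ⟶[E] f.obj o₁')} {m₂ : 𝟙_ E ⟶ (p₂ ⟶[E] f.obj o₂)}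
  {a : 𝟙_ E ⟶ (o ⟶[E] o')} {b : 𝟙_ E ⟶ (p ⟶[E] p')}
  {a' : 𝟙_ E ⟶ (o' ⟶[E] o'')} {b' : 𝟙_ E ⟶ (p' ⟶[E] p'')}
  {a₁ : 𝟙_ E ⟶ (o₁ ⟶[E] o₁')} {b₁ : 𝟙_ E ⟶ (p₁ ⟶[E] p₁')}

lemma id (m : 𝟙_ E ⟶ (p ⟶[E] f.obj o)) : f.Sq m m (eId E o) (eId E p) := by
  rw [Sq, f.map_id, elComp_id, id_elComp]

lemma comp (h : f.Sq m m' a b) (h' : f.Sq m' m'' a' b') :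
    f.Sq m m'' (elComp a a') (elComp b b') := by
  rw [Sq, elComp_map, ← elComp_assoc, h, elComp_assoc, h', elComp_assoc]

lemma of_inv {a' : 𝟙_ E ⟶ (o' ⟶[E] o)} {b' : 𝟙_ E ⟶ (p' ⟶[E] p)} (h : f.Sq m m' a b)
    (ha : elComp a a' = eId E o) (hb : elComp b' b = eId E p') : f.Sq m' m a' b' := by
  rw [Sq, ← id_elComp m', ← hb, elComp_assoc b' b m', ← (show elComp m _ = elComp b m' from h),
    elComp_assoc b', elComp_assoc m, ← elComp_map,
    ha, f.map_id, elComp_id]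

lemma tEl (h : f.Sq m m' a b) (h₁ : f.Sq m₁ m₁' a₁ b₁) :
    f.Sq (f.tMu m m₁) (f.tMu m' m₁') (C.tEl a a₁) (D.tEl b b₁) := by
  rw [Sq, tMu, tMu, elComp_assoc, ← f.tEl_mu, ← elComp_assoc, ← elComp_assoc, ← D.tEl_comp,
    ← D.tEl_comp, h, h₁]

lemma assoc (m : 𝟙_ E ⟶ (p ⟶[E] f.obj o)) (m₁ : 𝟙_ E ⟶ (p₁ ⟶[E] f.obj o₁))
    (m₂ : 𝟙_ E ⟶ (p₂ ⟶[E] f.obj o₂)) :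
    f.Sq (f.tMu (f.tMu m m₁) m₂) (f.tMu m (f.tMu m₁ m₂)) (C.assoc o o₁ o₂) (D.assoc p p₁ p₂) := by
  have h1 : D.tEl (elComp (D.tEl m m₁) (f.mu o o₁)) m₂ =
      elComp (D.tEl (D.tEl m m₁) m₂) (D.tEl (f.mu o o₁) (eId E _)) := by
    rw [← D.tEl_comp, elComp_id]
  have h2 : D.tEl m (elComp (D.tEl m₁ m₂) (f.mu o₁ o₂)) =
      elComp (D.tEl m (D.tEl m₁ m₂)) (D.tEl (eId E _) (f.mu o₁ o₂)) := by
    rw [← D.tEl_comp, elComp_id]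
  rw [Sq, tMu, tMu, tMu, tMu, h1, h2, elComp_assoc, elComp_assoc, f.mu_assoc, elComp_assoc,
    ← elComp_assoc (D.assoc p p₁ p₂), ← D.el_assoc_natural, elComp_assoc]

lemma assocInv (m : 𝟙_ E ⟶ (p ⟶[E] f.obj o)) (m₁ : 𝟙_ E ⟶ (p₁ ⟶[E] f.obj o₁))
    (m₂ : 𝟙_ E ⟶ (p₂ ⟶[E] f.obj o₂)) :
    f.Sq (f.tMu m (f.tMu m₁ m₂)) (f.tMu (f.tMu m m₁) m₂) (C.assocInv o o₁ o₂)
      (D.assocInv p p₁ p₂) :=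
  (Sq.assoc m m₁ m₂).of_inv (C.assoc_assocInv _ _ _) (D.assocInv_assoc _ _ _)

lemma lUnit (m : 𝟙_ E ⟶ (p ⟶[E] f.obj o)) :
    f.Sq (f.tMu f.eps m) m (C.lUnit o) (D.lUnit p) := by
  have h : D.tEl f.eps m = elComp (D.tEl (eId E D.one) m) (D.tEl f.eps (eId E _)) := by
    rw [← D.tEl_comp, elComp_id, id_elComp]
  rw [Sq, tMu, h, elComp_assoc, elComp_assoc, f.mu_lUnit, D.el_lUnit_natural]

lemma lUnitInv (m : 𝟙_ E ⟶ (p ⟶[E] f.obj o)) :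
    f.Sq m (f.tMu f.eps m) (C.lUnitInv o) (D.lUnitInv p) :=
  (Sq.lUnit m).of_inv (C.lUnit_lUnitInv _) (D.lUnitInv_lUnit _)

lemma rUnit (m : 𝟙_ E ⟶ (p ⟶[E] f.obj o)) :
    f.Sq (f.tMu m f.eps) m (C.rUnit o) (D.rUnit p) := by
  have h : D.tEl m f.eps = elComp (D.tEl m (eId E D.one)) (D.tEl (eId E _) f.eps) := by
    rw [← D.tEl_comp, elComp_id, id_elComp]
  rw [Sq, tMu, h, elComp_assoc, elComp_assoc, f.mu_rUnit, D.el_rUnit_natural]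

lemma comm (m : 𝟙_ E ⟶ (p ⟶[E] f.obj o)) (m₁ : 𝟙_ E ⟶ (p₁ ⟶[E] f.obj o₁)) :
    f.Sq (f.tMu m m₁) (f.tMu m₁ m) (C.comm o o₁) (D.comm p p₁) := by
  rw [Sq, tMu, tMu, elComp_assoc, f.mu_comm, ← elComp_assoc, ← elComp_assoc, D.el_comm_natural]

/-- A commutative square of elements gives a commutative square of the maps on operations. -/
lemma elPre_map (h : f.Sq m m' a b) (d : C.carrier) :
    elPre a d ≫ f.map o d ≫ elPre m (f.obj d) =
      (f.map o' d ≫ elPre m' (f.obj d)) ≫ elPre b (f.obj d) := by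
  rw [elPre_map_assoc, Category.assoc, elPre_elPre, elPre_elPre, h]

lemma leaf {x y : C.carrier} (h : x = y) :
    f.Sq (eId E (f.obj x)) (eId E (f.obj y)) (elOfEq h) (elOfEq (congrArg f.obj h)) := by
  subst h
  rw [elOfEq_rfl, elOfEq_rfl]
  exact Sq.id _

lemma tens_congr {n k : ℕ} (hk : k = n) {c : Fin n → C.carrier} {g : Fin k → C.carrier}
    (h : ∀ (j : Fin n) (p : Fin k), p.val = j.val → g p = c j) (e : C.tens g = C.tens c)
    (e' : D.tens (fun j => f.obj (g j)) = D.tens (fun j => f.obj (c j))) :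
    f.Sq (f.muN g) (f.muN c) (elOfEq e) (elOfEq e') := by
  subst hk
  obtain rfl : g = c := funext fun j => h j j rfl
  rw [elOfEq_rfl, elOfEq_rfl]
  exact Sq.id _

lemma consEl {n : ℕ} (c : Fin (n + 1) → C.carrier) :
    f.Sq (f.tMu (eId E (f.obj (c 0))) (f.muN (fun j : Fin n => c j.succ))) (f.muN c) (C.consEl c)
      (D.consEl (fun j => f.obj (c j))) := by
  cases n with
  | zero => exact Sq.rUnit _
  | succ n => exact Sq.id _

lemma unconsEl {n : ℕ} (c : Fin (n + 1) → C.carrier) :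
    f.Sq (f.muN c) (f.tMu (eId E (f.obj (c 0))) (f.muN (fun j : Fin n => c j.succ)))
      (C.unconsEl c) (D.unconsEl (fun j => f.obj (c j))) :=
  (Sq.consEl c).of_inv (SymMonECat.consEl_unconsEl c) (SymMonECat.unconsEl_consEl _)

lemma splitEl : ∀ {m l k : ℕ} (a : Fin m → C.carrier) (b : Fin l → C.carrier)
    (g : Fin k → C.carrier) (hk : k = m + l)
    (ha : ∀ (j : Fin m) (p : Fin k), p.val = j.val → g p = a j)
    (hb : ∀ (j : Fin l) (p : Fin k), p.val = m + j.val → g p = b j),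
    f.Sq (f.muN g) (f.tMu (f.muN a) (f.muN b)) (C.splitEl a b g hk ha hb)
      (D.splitEl (fun j => f.obj (a j)) (fun j => f.obj (b j)) (fun j => f.obj (g j)) hk
        (fun j p h => congrArg f.obj (ha j p h)) (fun j p h => congrArg f.obj (hb j p h)))
  | 0, l, k, a, b, g, hk, ha, hb =>
    (Sq.tens_congr (by omega) (fun j p hp => hb j p (by omega)) _ _).comp (Sq.lUnitInv _)
  | m + 1, l, 0, _, _, _, hk, _, _ => absurd hk (by omega)
  | m + 1, l, k + 1, a, b, g, hk, ha, hb =>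
    (Sq.unconsEl g).comp (((Sq.leaf (ha 0 0 rfl)).tEl (splitEl (fun j : Fin m => a j.succ) b
      (fun j : Fin k => g j.succ) (by omega)
          (fun j p hp => ha j.succ p.succ (by simp [hp]))
          (fun j p hp => hb j p.succ (by simp [hp]; omega)))).comp
      ((Sq.assocInv _ _ _).comp ((Sq.consEl a).tEl (Sq.id _))))

lemma moveEl : ∀ {n : ℕ} (c : Fin (n + 1) → C.carrier) (c' : Fin n → C.carrier)
    (q : Fin (n + 1)) (h : ∀ j, c' j = c (q.succAbove j)),
    f.Sq (f.tMu (eId E (f.obj (c q))) (f.muN c')) (f.muN c) (C.moveEl c c' q h)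
      (D.moveEl (fun j => f.obj (c j)) (fun j => f.obj (c' j)) q
        (fun j => congrArg f.obj (h j)))
  | n, c, c', ⟨0, _⟩, h => by
    cases n <;>
    exact ((Sq.id _).tEl (Sq.tens_congr rfl (fun j p hp => by rw [Fin.ext hp, h j]; rfl) _ _)).comp
      (Sq.consEl c)
  | 0, _, _, ⟨q + 1, hq⟩, _ => absurd hq (by omega)
  | n + 1, c, c', ⟨q + 1, hq⟩, h =>
    ((Sq.id _).tEl (Sq.unconsEl c')).comp ((Sq.assocInv _ _ _).comp
      (((Sq.comm _ _).tEl (Sq.id _)).comp ((Sq.assoc _ _ _).comp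
        ((Sq.leaf _).tEl (moveEl (fun j : Fin (n + 1) => c j.succ) (fun j : Fin n => c' j.succ)
          ⟨q, Nat.lt_of_succ_lt_succ hq⟩
          (fun j => (h j.succ).trans (congrArg c (Fin.succ_succAbove_succ
            (⟨q, Nat.lt_of_succ_lt_succ hq⟩ : Fin (n + 1)) j))))))))

lemma permEl : ∀ {n : ℕ} (c c' : Fin n → C.carrier) (σ : Equiv.Perm (Fin n))
    (h : ∀ i, c' i = c (σ i)), f.Sq (f.muN c') (f.muN c) (C.permEl c c' σ h)
      (D.permEl (fun j => f.obj (c j)) (fun j => f.obj (c' j)) σ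
        (fun j => congrArg f.obj (h j)))
  | 0, _, _, _, _ => Sq.id _
  | n + 1, c, c', σ, h =>
    (Sq.unconsEl c').comp (((Sq.leaf (h 0)).tEl (permEl (fun j => c ((σ 0).succAbove j))
      (fun j => c' j.succ) (permTail σ) (fun j => by rw [h, succAbove_permTail]))).comp
        (Sq.moveEl c (fun j => c ((σ 0).succAbove j)) (σ 0) (fun _ => rfl)))

end Sq

lemma eId_map_elPre (x : C.carrier) :
    eId E x ≫ f.map x x ≫ elPre (eId E (f.obj x)) (f.obj x) = eId E (f.obj x) := by
  rw [elPre_id, Category.comp_id, f.map_id]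

/-- Two morphisms `C(o, y) ⟶ C(q, q')` and `D(p, f(y)) ⟶ D(r, r')` form a commutative square with
the maps given by `f` and by elements of `D(p, f(o))`, `D(r, f(q))` and `D(r', f(q'))`. -/
def InsSq {o y q q' : C.carrier} {p r r' : D.carrier} (m : 𝟙_ E ⟶ (p ⟶[E] f.obj o))
    (k : 𝟙_ E ⟶ (r ⟶[E] f.obj q)) (k' : 𝟙_ E ⟶ (r' ⟶[E] f.obj q'))
    (φ : (o ⟶[E] y) ⟶ (q ⟶[E] q')) (ψ : (p ⟶[E] f.obj y) ⟶ (r ⟶[E] r')) : Prop :=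
  φ ≫ f.map q q' ≫ elPre k _ = f.map o y ≫ elPre m _ ≫ ψ ≫ elPost r k'

/-- The naturality of the structural maps of `f`, with respect to tensoring with an identity. -/
lemma rW_map {o y z : C.carrier} {p t : D.carrier} (m : 𝟙_ E ⟶ (p ⟶[E] f.obj o))
    (n : 𝟙_ E ⟶ (t ⟶[E] f.obj z)) :
    C.rW z o y ≫ f.map _ _ ≫ elPre (f.tMu m n) _ =
      f.map o y ≫ elPre m _ ≫ D.rW t p (f.obj y) ≫ elPost _ (f.tMu (eId E _) n) := by
  have h := f.mu_natural o y z z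
  have h1 : D.tEl m n = elComp (D.tEl m (eId E t)) (D.tEl (eId E _) n) := by
    rw [← D.tEl_comp, elComp_id, id_elComp]
  have h2 : C.rW z o y ≫ f.map _ _ ≫ elPre (f.mu o z) _ =
      f.map o y ≫ D.rW (f.obj z) _ _ ≫ elPost _ (f.mu y z) := by
    rw [SymMonECat.rW, SymMonECat.rW, Category.assoc, Category.assoc, ← h,
      Category.assoc, Category.assoc, rightUnitor_inv_naturality_assoc, ← id_tensorHom,
        ← id_tensorHom, ← tensorHom_id,
      tensorHom_comp_tensorHom_assoc, tensorHom_comp_tensorHom_assoc, f.map_id, Category.comp_id,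
      Category.id_comp, Category.id_comp]
  rw [tMu, tMu, h1, ← elPost_elPost, reassoc_of% SymMonECat.elPre_rW, reassoc_of% elPre_elPost,
    reassoc_of% SymMonECat.rW_natural, elPre_elPost, reassoc_of% elPre_elPost, ← reassoc_of% h2,
      ← elPre_elPre, ← elPre_elPre]

namespace InsSq

variable {f} {o y q q' s s' z : C.carrier} {p r r' t t' : D.carrier}
  {m : 𝟙_ E ⟶ (p ⟶[E] f.obj o)}
  {k : 𝟙_ E ⟶ (r ⟶[E] f.obj q)} {k' : 𝟙_ E ⟶ (r' ⟶[E] f.obj q')}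
  {l : 𝟙_ E ⟶ (t ⟶[E] f.obj s)}
  {φ : (o ⟶[E] y) ⟶ (q ⟶[E] q')} {ψ : (p ⟶[E] f.obj y) ⟶ (r ⟶[E] r')}

lemma id (m : 𝟙_ E ⟶ (p ⟶[E] f.obj o)) : f.InsSq (y := y) m m (eId E _) (𝟙 _) (𝟙 _) := by
  rw [InsSq, elPost_id, Category.id_comp, Category.id_comp, Category.comp_id]

lemma comp_elPre (h : f.InsSq m k k' φ ψ) {a : 𝟙_ E ⟶ (s ⟶[E] q)} {b : 𝟙_ E ⟶ (t ⟶[E] r)}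
    (hab : f.Sq l k a b) : f.InsSq m l k' (φ ≫ elPre a _) (ψ ≫ elPre b _) := by
  rw [InsSq] at *
  rw [Category.assoc, reassoc_of% elPre_map f.toEnrichedFunctor, elPre_elPre, hab, ← elPre_elPre,
    reassoc_of% h, Category.assoc, elPre_elPost]

lemma comp_elPost (h : f.InsSq m k k' φ ψ) {l : 𝟙_ E ⟶ (t ⟶[E] f.obj s)} {a : 𝟙_ E ⟶ (q' ⟶[E] s)}
    {b : 𝟙_ E ⟶ (r' ⟶[E] t)}
    (hab : f.Sq k' l a b) : f.InsSq m k l (φ ≫ elPost _ a) (ψ ≫ elPost _ b) := by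
  rw [InsSq] at *
  rw [Category.assoc, reassoc_of% elPost_map f.toEnrichedFunctor, ← elPre_elPost, reassoc_of% h,
    Category.assoc, elPost_elPost, elPost_elPost, hab]

lemma comp_rW (h : f.InsSq m k k' φ ψ) (l : 𝟙_ E ⟶ (t ⟶[E] f.obj s)) :
    f.InsSq m (f.tMu k l) (f.tMu k' l) (φ ≫ C.rW s _ _) (ψ ≫ D.rW t _ _) := by
  have h1 : elComp (D.tEl k' (eId E t)) (f.tMu (eId E _) l) = f.tMu k' l := by
    rw [tMu, ← elComp_assoc, ← D.tEl_comp, elComp_id, id_elComp, tMu]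
  rw [InsSq] at *
  rw [Category.assoc, rW_map, reassoc_of% h, reassoc_of% SymMonECat.elPost_rW, elPost_elPost, h1,
    Category.assoc]

lemma comp_lW (h : f.InsSq m k k' φ ψ) (l : 𝟙_ E ⟶ (t ⟶[E] f.obj s)) :
    f.InsSq m (f.tMu l k) (f.tMu l k') (φ ≫ C.lW s _ _) (ψ ≫ D.lW t _ _) := by
  have h1 := ((h.comp_rW l).comp_elPre (Sq.comm l k)).comp_elPost (Sq.comm k' l)
  rw [Category.assoc, Category.assoc, Category.assoc, Category.assoc,
    ← reassoc_of% SymMonECat.lW_comm, ← reassoc_of% SymMonECat.lW_comm, elPost_elPost,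
    elPost_elPost, C.comm_comm, D.comm_comm, elPost_id, elPost_id, Category.comp_id,
    Category.comp_id] at h1
  exact h1

/-- The functor is compatible with the insertions, by the recursion which defines them. -/
lemma insertHom : ∀ {n m k : ℕ} (c : Fin n → C.carrier) (e : Fin m → C.carrier)
    (g : Fin k → C.carrier) (i : Fin n) (h : IsGraft i c e g),
    f.InsSq (f.muN e) (f.muN g) (f.muN c) (C.insertHom c e g i h)
      (D.insertHom (fun j => f.obj (c j)) (fun j => f.obj (e j)) (fun j => f.obj (g j)) i
        (h.map f.obj))
  | 0, _, _, _, _, _, i, _ => i.elim0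
  | 1, m, k, c, e, g, ⟨0, _⟩, h => by
    rw [SymMonECat.insertHom, SymMonECat.insertHom, ← Category.id_comp (elPre _ _),
      ← Category.id_comp (elPre (E := E) (C := D.carrier) _ _)]
    exact (InsSq.id (f.muN e)).comp_elPre (Sq.tens_congr (by have := h.length; omega)
      (fun j p hp => h.inner j p (by simpa using hp)) _ _)
  | n + 2, m, k, c, e, g, ⟨0, _⟩, h => by
    rw [SymMonECat.insertHom, SymMonECat.insertHom]
    have h1 := ((InsSq.id (y := c 0) (f.muN e)).comp_rW
        (f.muN (fun j : Fin (n + 1) => c j.succ))).comp_elPre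
      (Sq.splitEl e (fun j : Fin (n + 1) => c j.succ) g (by have := h.length; omega)
          (fun j p hp => h.inner j p (by simpa using hp))
          (fun j p hp => h.outer j.succ p
            (Or.inr ⟨Fin.mk_lt_mk.2 (Nat.succ_pos _), by simp; omega⟩)))
    rw [SymMonECat.rW, SymMonECat.rW, Category.id_comp, Category.id_comp, Category.assoc,
      Category.assoc, Category.assoc, Category.assoc] at h1
    exact h1
  | n + 2, m, 0, _, _, _, ⟨_ + 1, _⟩, h => absurd h.length (by omega)
  | n + 2, m, k + 1, c, e, g, ⟨i + 1, hi⟩, h => by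
    have h0 := h.outer 0 0 (Or.inl ⟨Fin.mk_lt_mk.2 (Nat.succ_pos _), rfl⟩)
    have h' : IsGraft ⟨i, Nat.lt_of_succ_lt_succ hi⟩ (fun j : Fin (n + 1) => c j.succ) e
        (fun j : Fin k => g j.succ) :=
        { length := by have := h.length; omega
          outer := fun j p hp => h.outer j.succ p.succ (by
            simp only [OuterPos, Fin.lt_def, Fin.val_succ] at hp ⊢; omega)
          inner := fun j p hp => h.inner j p.succ (by simp at hp ⊢; omega) }
    have h1 := (((insertHom _ _ _ _ h').comp_lW (eId E (f.obj (c 0)))).comp_elPre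
      ((Sq.leaf h0).tEl (Sq.id _))).comp_elPre (Sq.unconsEl g)
    rw [SymMonECat.insertHom_succ c e g i hi h h' h0,
      SymMonECat.insertHom_succ (fun j => f.obj (c j)) (fun j => f.obj (e j))
        (fun j => f.obj (g j)) i hi (h.map f.obj) (h'.map f.obj) (congrArg f.obj h0)]
    exact h1

lemma insertAt {n m k : ℕ} {c : Fin n → C.carrier} {e : Fin m → C.carrier}
    {g : Fin k → C.carrier} (i : Fin n) {y : C.carrier} (hy : c i = y) (h : IsGraft i c e g) :
    f.InsSq (f.muN e) (f.muN g) (f.muN c) (C.insertAt i hy h)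
      (D.insertAt i (congrArg f.obj hy) (h.map f.obj)) := by
  subst hy
  rw [SymMonECat.insertAt, SymMonECat.insertAt, eqToHom_refl, eqToHom_refl, Category.id_comp,
    Category.id_comp]
  exact insertHom c e g i h

/-- A commutative square of insertions gives a commutative square for partial compositions. -/
lemma comp_map (h : f.InsSq m k k' φ ψ) (d : C.carrier) :
    ((β_ (q' ⟶[E] d) (o ⟶[E] y)).hom ≫ φ ▷ (q' ⟶[E] d) ≫ eComp E q q' d) ≫
        f.map q d ≫ elPre k (f.obj d) =
      ((f.map q' d ≫ elPre k' (f.obj d)) ⊗ₘ (f.map o y ≫ elPre m (f.obj y))) ≫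
        (β_ _ _).hom ≫ ψ ▷ _ ≫ eComp E r r' (f.obj d) := by
  have h1 : φ ≫ f.map q q' ≫ elPre k _ = f.map o y ≫ elPre m _ ≫ ψ ≫ elPost r k' := h
  have h2 : eComp E q q' d ≫ f.map q d ≫ elPre k (f.obj d) =
      ((f.map q q' ≫ elPre k _) ⊗ₘ f.map q' d) ≫ eComp E _ _ _ := by
    rw [f.map_comp_assoc, ← elPre_comp, ← tensorHom_id, tensorHom_comp_tensorHom_assoc,
      Category.comp_id]
  rw [Category.assoc, Category.assoc, h2, ← tensorHom_id, tensorHom_comp_tensorHom_assoc, h1,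
    Category.id_comp, BraidedCategory.braiding_naturality_assoc, ← tensorHom_id ψ,
    tensorHom_comp_tensorHom_assoc, Category.comp_id]
  have h3 : (f.map o y ≫ elPre m _ ≫ ψ ≫ elPost r k') ⊗ₘ f.map q' d =
      ((f.map o y ≫ elPre m _) ≫ ψ ⊗ₘ f.map q' d) ≫ elPost r k' ▷ _ := by
    rw [← tensorHom_id, tensorHom_comp_tensorHom, Category.comp_id]
    simp only [Category.assoc]
  rw [h3, Category.assoc, elPost_elPre_comp, ← id_tensorHom, tensorHom_comp_tensorHom_assoc,
    Category.comp_id]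

end InsSq

end LaxHom

/-- The laws of a morphism of operads for `End(f)`. -/
theorem endHomData_isHom {C D : SymMonECat.{v, u, w} E} (f : LaxHom C D) :
    (endHomData f).IsHom where
  map_act {n c c'} σ h d :=
    (LaxHom.Sq.permEl c c' σ h).elPre_map d
  map_comp i x hx hg d := (LaxHom.InsSq.insertAt (f := f) i hx hg).comp_map d
  map_unit x := LaxHom.eId_map_elPre f x

end LaxSquares

/-! ### Monoidal natural transformations -/

section Transformations

variable {E : Type u} [Category.{v} E] [MonoidalCategory E] [SymmetricCategory E]

lemma elOfEq_elOfEq {C : Type w} [EnrichedCategory E C] {x y z : C} (h : x = y) (h' : y = z) :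
    elComp (elOfEq (E := E) h) (elOfEq h') = elOfEq (h.trans h') := by
  subst h h'
  rw [elOfEq_rfl, elComp_id]

namespace SymMonECat

variable (C : SymMonECat.{v, u, w} E)

/-- The iterated tensor product of a family of elements. -/
def tensEl : {n : ℕ} → {x y : Fin n → C.carrier} → (∀ j, 𝟙_ E ⟶ (x j ⟶[E] y j)) →
    (𝟙_ E ⟶ (C.tens x ⟶[E] C.tens y))
  | 0, _, _, _ => eId E C.one
  | 1, _, _, a => a 0
  | n + 2, x, y, a => C.tEl (a 0) (tensEl (x := fun j : Fin (n + 1) => x j.succ)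
      (y := fun j => y j.succ) (fun j => a j.succ))

variable {C}

lemma tensEl_id : ∀ {n : ℕ} (x : Fin n → C.carrier), C.tensEl (fun j => eId E (x j)) = eId E _
  | 0, _ => rfl
  | 1, _ => rfl
  | n + 2, x => (congrArg (C.tEl _) (tensEl_id fun j : Fin (n + 1) => x j.succ)).trans
      (C.tEl_id _ _)

lemma tensEl_comp : ∀ {n : ℕ} {x y z : Fin n → C.carrier} (a : ∀ j, 𝟙_ E ⟶ (x j ⟶[E] y j))
    (b : ∀ j, 𝟙_ E ⟶ (y j ⟶[E] z j)),
    elComp (C.tensEl a) (C.tensEl b) = C.tensEl (fun j => elComp (a j) (b j))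
  | 0, _, _, _, _, _ => id_elComp _
  | 1, _, _, _, _, _ => rfl
  | n + 2, x, y, z, a, b => (C.tEl_comp _ _ _ _).symm.trans (congrArg (C.tEl _)
      (tensEl_comp (x := fun j : Fin (n + 1) => x j.succ) (y := fun j => y j.succ)
        (z := fun j => z j.succ) (fun j => a j.succ) (fun j => b j.succ)))

lemma tensEl_elOfEq {n : ℕ} (x y : Fin n → C.carrier) (h : ∀ j, x j = y j)
    (k : C.tens x = C.tens y) : C.tensEl (fun j => elOfEq (h j)) = elOfEq k := by
  obtain rfl : x = y := funext h
  exact (congrArg C.tensEl (funext fun j => elOfEq_rfl (x j))).trans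
    ((tensEl_id x).trans (elOfEq_rfl _).symm)

lemma tEl_elOfEq {x x' y y' : C.carrier} (h : x = x') (h' : y = y') (k : C.tObj x y = C.tObj x' y')
    :
    C.tEl (elOfEq h) (elOfEq h') = elOfEq k := by
  subst h h'
  rw [elOfEq_rfl, elOfEq_rfl, elOfEq_rfl, C.tEl_id]

lemma el_lW {Z x y : C.carrier} (a : 𝟙_ E ⟶ (x ⟶[E] y)) :
    a ≫ C.lW Z x y = C.tEl (eId E Z) a := by
  rw [tEl_eq_left, lW]

lemma tEl_elPre_elOfEq {x x' y y' : C.carrier} (a : 𝟙_ E ⟶ (x ⟶[E] x')) (k : y = y') :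
    C.tEl a (eId E y') ≫ elPre (elOfEq (congrArg (C.tObj x) k)) _ = C.tEl a (elOfEq k) := by
  subst k
  rw [elOfEq_rfl, elOfEq_rfl, elPre_id, Category.comp_id]

lemma comp_lW_elPre {X : E} {x x' y y' : C.carrier} (a : 𝟙_ E ⟶ X) (φ : X ⟶ (y ⟶[E] y'))
    (q : 𝟙_ E ⟶ (y ⟶[E] y')) (h : a ≫ φ = q) (h₀ : x = x') :
    a ≫ (φ ≫ C.lW x' y y') ≫ elPre (C.tEl (elOfEq h₀) (eId E y)) _ = C.tEl (elOfEq h₀) q := by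
  rw [Category.assoc, reassoc_of% h, reassoc_of% el_lW, comp_elPre, ← C.tEl_comp, elComp_id,
    id_elComp]

lemma comp_rW_elPre {x x' y z : C.carrier} (a : 𝟙_ E ⟶ (x ⟶[E] x'))
    (s : 𝟙_ E ⟶ (z ⟶[E] C.tObj x y)) :
    a ≫ (ρ_ _).inv ≫ _ ◁ eId E y ≫ C.tHom x x' y y ≫ elPre s _ =
      C.tEl a (eId E y) ≫ elPre s _ := by
  rw [tEl_eq_right]
  simp only [Category.assoc]

open SymCoh in
/-- Splitting off the first factor is an identity. -/
lemma splitEl_one {n : ℕ} (e : Fin 1 → C.carrier) (b : Fin (n + 1) → C.carrier)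
    (g : Fin (n + 2) → C.carrier) (hk ha hb)
    (k : C.tens g = C.tObj (C.tens e) (C.tens b)) :
    C.splitEl e b g hk ha hb = elOfEq k := by
  obtain rfl : (fun j : Fin (n + 1) => g j.succ) = b := funext fun j => hb j j.succ (by simp; omega)
  obtain rfl : (fun _ => g 0) = e := funext fun j => by
    obtain rfl := Subsingleton.elim j 0
    exact ha 0 0 rfl
  have h := isCan_splitEl (x := (g : Fin (n + 2) → C.Und)) (fun _ : Fin 1 => g 0)
    (fun j : Fin (n + 1) => g j.succ) g hk ha hb (fun _ => 0) Fin.succ _root_.id (fun _ => rfl)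
    (fun _ => rfl) (fun _ => rfl) (fun j p hp => by obtain rfl := Subsingleton.elim j 0; exact Fin.ext hp)
    (fun j p hp => Fin.ext (by simp [hp]; omega))
  exact (IsCan.eq (V := C.Und) h (isCan_eId (C.repTens g _root_.id (fun _ => rfl)))).trans
    (elOfEq_rfl (C.tens g)).symm

/-- The insertion of one element `a` is a tensor product of elements, all of which but one are
identities. -/
lemma el_insertHom : ∀ {n : ℕ} (c g : Fin n → C.carrier) (i : Fin n)
    (h : IsGraft i c (fun _ : Fin 1 => g i) g) (a : 𝟙_ E ⟶ (g i ⟶[E] c i))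
    (b : ∀ j, 𝟙_ E ⟶ (g j ⟶[E] c j)) (hb : b i = a)
    (hb' : ∀ j (hj : g j = c j), j ≠ i → b j = elOfEq hj),
    a ≫ C.insertHom c (fun _ : Fin 1 => g i) g i h = C.tensEl b
  | 0, _, _, i, _, _, _, _, _ => i.elim0
  | 1, c, g, ⟨0, _⟩, h, a, b, hb, hb' => by
    rw [insertHom]
    exact (congrArg (a ≫ ·) ((congrArg (elPre · (c 0)) (elOfEq_rfl (E := E) (g 0))).trans
      (elPre_id _ _))).trans ((Category.comp_id a).trans hb.symm)
  | n + 2, c, g, ⟨0, _⟩, h, a, b, hb, hb' => by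
    have hj : ∀ j : Fin (n + 1), g j.succ = c j.succ := fun j => h.outer j.succ j.succ
      (Or.inr ⟨Fin.mk_lt_mk.2 (Nat.succ_pos _), by simp⟩)
    have k : C.tens (fun j : Fin (n + 1) => g j.succ) = C.tens (fun j : Fin (n + 1) => c j.succ) :=
      congrArg C.tens (funext hj)
    have hb₀ : (fun j : Fin (n + 1) => b j.succ) = fun j => elOfEq (hj j) :=
      funext fun j => hb' j.succ (hj j) (Fin.succ_ne_zero j)
    have h1 : C.tensEl (x := fun j : Fin (n + 1) => g j.succ) (y := fun j => c j.succ)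
        (fun j => b j.succ) = elOfEq k := (congrArg _ hb₀).trans (tensEl_elOfEq _ _ hj k)
    have sk : n + 2 = 1 + (n + 1) := by omega
    have sa : ∀ (j : Fin 1) (p : Fin (n + 2)), p.val = j.val → g p = g 0 :=
      fun j p hp => h.inner j p (by simpa using hp)
    have sb : ∀ (j : Fin (n + 1)) (p : Fin (n + 2)), p.val = 1 + j.val → g p = c j.succ :=
      fun j p hp => h.outer j.succ p
        (Or.inr ⟨Fin.mk_lt_mk.2 (Nat.succ_pos _), by simp; omega⟩)
    have h2 := splitEl_one (fun _ : Fin 1 => g 0) (fun j : Fin (n + 1) => c j.succ) g sk sa sb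
      (congrArg (C.tObj (g 0)) k)
    have h3 := tEl_elPre_elOfEq (x := g 0) (x' := c 0) a k
    have h4 : a ≫ C.insertHom c (fun _ : Fin 1 => g 0) g 0 h =
        C.tEl a (eId E (C.tens fun j : Fin (n + 1) => c j.succ)) ≫ elPre (C.splitEl
          (fun _ : Fin 1 => g 0) (fun j : Fin (n + 1) => c j.succ) g sk sa sb) _ := by
      exact comp_rW_elPre (x := g 0) (x' := c 0) a (C.splitEl (fun _ : Fin 1 => g 0)
        (fun j : Fin (n + 1) => c j.succ) g sk sa sb)
    exact h4.trans ((congrArg (fun s => C.tEl a (eId E _) ≫ elPre s _) h2).trans (h3.trans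
      ((congrArg (C.tEl a) h1.symm).trans (congrArg (fun a => C.tEl a _) hb.symm))))
  | n + 2, c, g, ⟨i + 1, hi⟩, h, a, b, hb, hb' => by
    have h0 := h.outer 0 0 (Or.inl ⟨Fin.mk_lt_mk.2 (Nat.succ_pos _), rfl⟩)
    have h' : IsGraft ⟨i, Nat.lt_of_succ_lt_succ hi⟩ (fun j : Fin (n + 1) => c j.succ)
        (fun _ : Fin 1 => g ⟨i + 1, hi⟩) (fun j : Fin (n + 1) => g j.succ) :=
        { length := by have := h.length; omega
          outer := fun j p hp => h.outer j.succ p.succ (by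
            simp only [OuterPos, Fin.lt_def, Fin.val_succ] at hp ⊢; omega)
          inner := fun j p hp => h.inner j p.succ (by simp at hp ⊢; omega) }
    have ih := el_insertHom (fun j : Fin (n + 1) => c j.succ) (fun j : Fin (n + 1) => g j.succ)
      ⟨i, Nat.lt_of_succ_lt_succ hi⟩ h' a (fun j => b j.succ) hb
      (fun j hj hne => hb' j.succ hj (fun e => hne (Fin.ext (Nat.succ_injective
        (congrArg Fin.val e)))))
    have hu : elPre (C.unconsEl g) (C.tens c) = 𝟙 _ := elPre_id _ _
    have hb₀ := hb' 0 h0 (by simp [Fin.ext_iff])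
    rw [insertHom_succ c _ g i hi h h' h0]
    refine (congrArg (a ≫ ·) ((congrArg (_ ≫ ·) hu).trans (Category.comp_id _))).trans ?_
    exact (comp_lW_elPre a _ _ ih h0).trans (congrArg (fun z => C.tEl z _) hb₀.symm)

lemma el_insertAt {n : ℕ} {c g : Fin n → C.carrier} (i : Fin n) {x y : C.carrier} (hx : c i = x)
    (hy : g i = y) (h : IsGraft i c (fun _ : Fin 1 => y) g) (a : 𝟙_ E ⟶ (y ⟶[E] x))
    (b : ∀ j, 𝟙_ E ⟶ (g j ⟶[E] c j)) (hb : b i = elComp (elOfEq hy) (elComp a (elOfEq hx.symm)))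
    (hb' : ∀ j (hj : g j = c j), j ≠ i → b j = elOfEq hj) :
    a ≫ C.insertAt i hx h = C.tensEl b := by
  subst hx hy
  rw [elOfEq_rfl, elOfEq_rfl, elComp_id, id_elComp] at hb
  rw [insertAt, eqToHom_refl, Category.id_comp]
  exact el_insertHom c g i h a b hb hb'

end SymMonECat

/-- Precomposition with the first `t` elements only: the others are replaced by identities. -/
lemma endData_preUpTo (C : SymMonECat.{v, u, w} E) {n : ℕ} {x y : Fin n → C.carrier}
    (a : ∀ j, 𝟙_ E ⟶ (y j ⟶[E] x j)) (d : C.carrier) : ∀ (t : ℕ) (ht : t ≤ n)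
    (c' : Fin n → C.carrier) (hc hc') (b : ∀ j, 𝟙_ E ⟶ (c' j ⟶[E] x j))
    (hb : ∀ j (h : c' j = y j), j.val < t → b j = elComp (elOfEq h) (a j))
    (hb' : ∀ j (h : c' j = x j), t ≤ j.val → b j = elOfEq h),
    (endData C).preUpTo (x := x) (y := y) a d t ht x c' hc hc' = elPre (C.tensEl b) d
  | 0, ht, c', hc, hc', b, hb, hb' => by
    obtain rfl : x = c' := funext fun j => ((hc' j).trans (if_neg (Nat.not_lt_zero _))).symm
    obtain rfl : b = fun j => eId E (x j) := funext fun j => (hb' j rfl (Nat.zero_le _)).trans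
        (elOfEq_rfl _)
    rw [SymMonECat.tensEl_id, elPre_id]
    exact (endData C).preUpTo_zero a d ht x hc hc'
  | t + 1, ht, c', hc, hc', b, hb, hb' => by
    -- The list and the elements of the induction hypothesis; `b₂` has the one new element.
    let c₁ : Fin n → C.carrier := fun j => if j.val < t then y j else x j
    let b₁ : ∀ j, 𝟙_ E ⟶ (c₁ j ⟶[E] x j) := fun j =>
      if h : j.val < t then elComp (elOfEq (if_pos h)) (a j) else elOfEq (if_neg h)
    have hb₁ : ∀ j (h : j.val < t), b₁ j = elComp (elOfEq (if_pos h)) (a j) :=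
      fun j h => dif_pos h
    have hb₁' : ∀ j (h : ¬ j.val < t), b₁ j = elOfEq (if_neg h) := fun j h => dif_neg h
    have ih := endData_preUpTo C a d t (Nat.le_of_succ_le ht) c₁ (fun _ _ => rfl) (fun _ => rfl) b₁
      (fun j h hj => hb₁ j hj) (fun j h hj => hb₁' j (by omega))
    have hx : c₁ ⟨t, ht⟩ = x ⟨t, ht⟩ := if_neg (lt_irrefl t)
    have hy : c' ⟨t, ht⟩ = y ⟨t, ht⟩ := (hc' _).trans (if_pos (Nat.lt_succ_self t))
    have hne : ∀ j, j ≠ ⟨t, ht⟩ → c' j = c₁ j := fun j hj => by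
      have h1 : j.val ≠ t := fun h => hj (Fin.ext h)
      exact (hc' j).trans (if_congr (by omega) rfl rfl)
    let b₂ : ∀ j, 𝟙_ E ⟶ (c' j ⟶[E] c₁ j) := fun j =>
      if h : j = ⟨t, ht⟩ then elComp (elOfEq (h ▸ hy)) (elComp (a ⟨t, ht⟩) (elOfEq (h ▸ hx.symm)))
      else elOfEq (hne j h)
    have hb₂ : b₂ ⟨t, ht⟩ = elComp (elOfEq hy) (elComp (a ⟨t, ht⟩) (elOfEq hx.symm)) :=
      dif_pos rfl
    have hb₂' : ∀ j (h : c' j = c₁ j), j ≠ ⟨t, ht⟩ → b₂ j = elOfEq h := fun j h hj => dif_neg hj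
    have key : (endData C).preUpTo (x := x) (y := y) a d (t + 1) ht x c' hc hc' =
        elPre (C.tensEl b₁) d ≫ elPre (C.tensEl b₂) d := by
      refine ((endData C).preUpTo_succ a d t ht x c₁ c' hc hc' (fun _ => rfl)).trans ?_
      have h1 := endData_comp_el C ⟨t, ht⟩ hx (IsGraft.one_right hne hy) d (a ⟨t, ht⟩)
      have h2 := SymMonECat.el_insertAt ⟨t, ht⟩ hx hy (IsGraft.one_right hne hy) (a ⟨t, ht⟩) b₂
        hb₂ hb₂'
      exact congr (congrArg CategoryStruct.comp ih) (h1.trans (congrArg (elPre · d) h2))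
    rw [key, elPre_elPre, SymMonECat.tensEl_comp]
    congr 2
    funext j
    rcases lt_trichotomy j.val t with hj | hj | hj
    · have e : c' j = y j := (hc' j).trans (if_pos (by omega))
      rw [hb₂' j (hne j (fun h => hj.ne (congrArg Fin.val h)))
          (fun h => hj.ne (congrArg Fin.val h)), hb₁ j hj,
        hb j e (by omega), ← elComp_assoc, elOfEq_elOfEq]
    · obtain rfl : j = ⟨t, ht⟩ := Fin.ext hj
      rw [hb₂, hb₁' _ (lt_irrefl t), hb _ hy (Nat.lt_succ_self t), elComp_assoc, elComp_assoc,
        elOfEq_elOfEq, elOfEq_rfl, elComp_id]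
    · have e : c' j = x j := (hc' j).trans (if_neg (by omega))
      rw [hb₂' j (hne j (fun h => hj.ne' (congrArg Fin.val h)))
          (fun h => hj.ne' (congrArg Fin.val h)),
        hb₁' j (by omega), hb' j e (by omega), elOfEq_elOfEq]

/-- Precomposition of an operation with unary operations is precomposition with their tensor
product. -/
lemma endData_pre (C : SymMonECat.{v, u, w} E) {n : ℕ} {x y : Fin n → C.carrier}
    (a : ∀ j, 𝟙_ E ⟶ (y j ⟶[E] x j)) (d : C.carrier) :
    (endData C).pre (x := x) (y := y) a d = elPre (C.tensEl a) d :=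
  endData_preUpTo C a d n le_rfl y _ _ a
    (fun j h _ => by rw [elOfEq_rfl, id_elComp]) (fun j h hj => absurd j.isLt (by omega))

/-- Monoidal transformations are compatible with iterated structural maps. -/
lemma MonTrans.muN_app {C D : SymMonECat.{v, u, w} E} {f g : LaxHom C D} (η : MonTrans f g) :
    ∀ {n : ℕ} (c : Fin n → C.carrier),
      elComp (f.muN c) (η.app (C.tens c)) =
        elComp (D.tensEl (fun j => η.app (c j))) (g.muN c)
  | 0, _ => η.app_one.trans (id_elComp _).symm
  | 1, c => (id_elComp _).trans (elComp_id _).symm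
  | n + 2, c => by
    have h := muN_app η (fun j : Fin (n + 1) => c j.succ)
    have h1 : elComp (elComp (D.tEl (eId E (f.obj (c 0))) (f.muN fun j : Fin (n + 1) => c j.succ))
        (f.mu (c 0) _)) (η.app (C.tObj (c 0) (C.tens fun j : Fin (n + 1) => c j.succ))) =
      elComp (D.tEl (η.app (c 0)) (D.tensEl (fun j : Fin (n + 1) => η.app (c j.succ))))
        (elComp (D.tEl (eId E (g.obj (c 0))) (g.muN fun j : Fin (n + 1) => c j.succ))
        (g.mu (c 0) _)) := by
      rw [elComp_assoc, η.app_tensor, ← elComp_assoc, ← elComp_assoc, ← D.tEl_comp, ← D.tEl_comp,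
        h, elComp_id, id_elComp]
    exact h1

/-- The naturality of `End(η)`. -/
theorem endData_isOperadTrans {C D : SymMonECat.{v, u, w} E} {f g : LaxHom C D}
    (η : MonTrans f g) : IsOperadTrans (endHomData f) (endHomData g) η.app := by
  intro n c d
  refine (congrArg (_ ≫ ·) (endData_el_comp D (fun j => f.obj (c j)) (η.app d))).trans
    (Eq.trans ?_ (congrArg (_ ≫ ·) (endData_pre D (fun j => η.app (c j)) (g.obj d))).symm)
  have h (c : Fin n → C.carrier) (d : C.carrier) :
      (f.map (C.tens c) d ≫ elPre (f.muN c) (f.obj d)) ≫ elPost _ (η.app d) =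
      (g.map (C.tens c) d ≫ elPre (g.muN c) (g.obj d)) ≫
        elPre (D.tensEl (fun j => η.app (c j))) _ := by
    rw [Category.assoc, Category.assoc, elPre_elPost, elPre_elPre, ← MonTrans.muN_app,
      ← elPre_elPre, reassoc_of% η.natural]
  exact h c d

end Transformations

/-! ### The comparison map `End(C) ⊗ End(D) ⟶ End(C ⊗ D)` -/

section HadamardComparison

variable {E : Type u} [Category.{v} E] [MonoidalCategory E] [SymmetricCategory E]

attribute [local instance] prodEnriched

namespace SymMonECat

variable {C D : SymMonECat.{v, u, w} E}

lemma elOfEq_prod {x y : C.carrier × D.carrier} (h : x = y) :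
    (elOfEq h : 𝟙_ E ⟶ (x ⟶[E] y)) =
      elPair (elOfEq (congrArg Prod.fst h)) (elOfEq (congrArg Prod.snd h)) := by
  subst h
  rw [elOfEq_rfl, elOfEq_rfl, elOfEq_rfl]
  rfl

/-- The identification of `⨂ (x, y)` with `(⨂ x, ⨂ y)`. -/
def prodEl (C D : SymMonECat.{v, u, w} E) {n : ℕ} (c : Fin n → (C.tensor D).carrier) :
    𝟙_ E ⟶ ((C.tensor D).tens c ⟶[E] (LaxHom.id (C.tensor D)).obj
      ((C.tens (fun j => (c j).1), D.tens (fun j => (c j).2)) : C.carrier × D.carrier)) :=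
  elOfEq (C.tens_tensor D c)

/-- The identifications of tensor products are compatible with splitting off the first factor. -/
lemma tMu_prodEl {n : ℕ} (c : Fin (n + 2) → (C.tensor D).carrier) :
    (LaxHom.id (C.tensor D)).tMu
      (o := c 0) (o' := (C.tens (fun j : Fin (n + 1) => (c j.succ).1),
        D.tens (fun j : Fin (n + 1) => (c j.succ).2)))
      (eId E (c 0)) (C.prodEl D (fun j : Fin (n + 1) => c j.succ)) =
      C.prodEl D c := by
  refine (elComp_id _).trans ?_
  refine Eq.trans ?_ ((C.tensor D).tEl_elOfEq (x := c 0) rfl (C.tens_tensor D fun j : Fin (n + 1) =>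
      c j.succ) _)
  rw [elOfEq_rfl]
  rfl

/-- A commutative square of elements of `C ⊗ D`, one side of which has the components `a`
and `b`. -/
abbrev ProdSq {o o' : (C.tensor D).carrier} {p p' : (C.tensor D).carrier}
    (m : 𝟙_ E ⟶ (p ⟶[E] (LaxHom.id (C.tensor D)).obj o))
    (m' : 𝟙_ E ⟶ (p' ⟶[E] (LaxHom.id (C.tensor D)).obj o'))
    (a : 𝟙_ E ⟶ (o.1 ⟶[E] o'.1)) (b : 𝟙_ E ⟶ (o.2 ⟶[E] o'.2)) (t : 𝟙_ E ⟶ (p ⟶[E] p')) : Prop :=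
  (LaxHom.id (C.tensor D)).Sq (o := o) (o' := o') m m' (elPair a b) t

namespace ProdSq

variable {o o' o'' o₁ o₁' o₂ : (C.tensor D).carrier} {p p' p'' p₁ p₁' p₂ : (C.tensor D).carrier}
  {m : 𝟙_ E ⟶ (p ⟶[E] (LaxHom.id (C.tensor D)).obj o)}
    {m' : 𝟙_ E ⟶ (p' ⟶[E] (LaxHom.id (C.tensor D)).obj o')}
  {m'' : 𝟙_ E ⟶ (p'' ⟶[E] (LaxHom.id (C.tensor D)).obj o'')}
    {m₁ : 𝟙_ E ⟶ (p₁ ⟶[E] (LaxHom.id (C.tensor D)).obj o₁)}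
  {m₁' : 𝟙_ E ⟶ (p₁' ⟶[E] (LaxHom.id (C.tensor D)).obj o₁')}
  {a : 𝟙_ E ⟶ (o.1 ⟶[E] o'.1)} {b : 𝟙_ E ⟶ (o.2 ⟶[E] o'.2)} {t : 𝟙_ E ⟶ (p ⟶[E] p')}
  {a' : 𝟙_ E ⟶ (o'.1 ⟶[E] o''.1)} {b' : 𝟙_ E ⟶ (o'.2 ⟶[E] o''.2)} {t' : 𝟙_ E ⟶ (p' ⟶[E] p'')}
  {a₁ : 𝟙_ E ⟶ (o₁.1 ⟶[E] o₁'.1)} {b₁ : 𝟙_ E ⟶ (o₁.2 ⟶[E] o₁'.2)} {t₁ : 𝟙_ E ⟶ (p₁ ⟶[E] p₁')}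

lemma comp (h : ProdSq m m' a b t) (h' : ProdSq m' m'' a' b' t') :
    ProdSq m m'' (elComp a a') (elComp b b') (elComp t t') := by
  exact (congrArg (fun s => (LaxHom.id (C.tensor D)).Sq (o := o) (o' := o'') m m'' s (elComp t t'))
    (prod_elComp a b a' b')).mp (LaxHom.Sq.comp h h')

lemma tEl (h : ProdSq m m' a b t) (h' : ProdSq m₁ m₁' a₁ b₁ t₁) :
    ProdSq (C := C) (D := D) ((LaxHom.id (C.tensor D)).tMu m m₁)
      ((LaxHom.id (C.tensor D)).tMu m' m₁') (C.tEl a a₁)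
      (D.tEl b b₁) ((C.tensor D).tEl t t₁) := by
  have h1 := LaxHom.Sq.tEl h h'
  have h2 : (C.tensor D).tEl (x := o) (x' := o') (y := o₁) (y' := o₁') (elPair a b) (elPair a₁ b₁) =
    elPair (C.tEl a a₁) (D.tEl b b₁) := prod_tEl a b a₁ b₁ _ _
  rw [h2] at h1
  exact h1

lemma leaf {x y : (C.tensor D).carrier} (h : x = y) :
    ProdSq (C := C) (D := D) (o := x) (o' := y) (eId E x) (eId E y) (elOfEq (congrArg Prod.fst h))
      (elOfEq (congrArg Prod.snd h))
      (elOfEq h) := by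
  exact (congrArg (fun s => (LaxHom.id (C.tensor D)).Sq (o := x) (o' := y) (eId E x) (eId E y) s
    (elOfEq h)) (elOfEq_prod (C := C) (D := D) h)).mp
    (LaxHom.Sq.leaf (f := LaxHom.id (C.tensor D)) h)

end ProdSq

lemma ProdSq.tens_congr {n k : ℕ} (hk : k = n) {c : Fin n → (C.tensor D).carrier}
    {g : Fin k → (C.tensor D).carrier}
    (h : ∀ (j : Fin n) (p : Fin k), p.val = j.val → g p = c j)
    (e₁ : C.tens (fun j => (g j).1) = C.tens (fun j => (c j).1))
    (e₂ : D.tens (fun j => (g j).2) = D.tens (fun j => (c j).2))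
    (e' : (C.tensor D).tens g = (C.tensor D).tens c) :
    ProdSq (C.prodEl D g) (C.prodEl D c) (elOfEq e₁) (elOfEq e₂) (elOfEq e') := by
  subst hk
  obtain rfl : g = c := funext fun j => h j j rfl
  rw [elOfEq_rfl, elOfEq_rfl, elOfEq_rfl]
  exact LaxHom.Sq.id _

lemma ProdSq.consEl {n : ℕ} (c : Fin (n + 1) → (C.tensor D).carrier) :
    ProdSq ((LaxHom.id (C.tensor D)).tMu (o := c 0) (eId E (c 0))
      (C.prodEl D (fun j : Fin n => c j.succ)))
      (C.prodEl D c) (C.consEl (fun j => (c j).1)) (D.consEl (fun j => (c j).2))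
      ((C.tensor D).consEl c) := by
  cases n with
  | zero =>
    have h : C.prodEl D (fun j : Fin 0 => c j.succ) = (LaxHom.id (C.tensor D)).eps := elOfEq_rfl _
    have h' : C.prodEl D c = eId E (c 0) := elOfEq_rfl _
    rw [h, h']
    exact LaxHom.Sq.rUnit _
  | succ n =>
    rw [tMu_prodEl]
    exact LaxHom.Sq.id _

lemma ProdSq.unconsEl {n : ℕ} (c : Fin (n + 1) → (C.tensor D).carrier) :
    ProdSq (C.prodEl D c)
      ((LaxHom.id (C.tensor D)).tMu (o := c 0) (eId E (c 0))
        (C.prodEl D (fun j : Fin n => c j.succ)))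
      (C.unconsEl (fun j => (c j).1)) (D.unconsEl (fun j => (c j).2))
      ((C.tensor D).unconsEl c) :=
  LaxHom.Sq.of_inv (ProdSq.consEl c)
    ((prod_elComp _ _ _ _).trans (congrArg₂ elPair (consEl_unconsEl _) (consEl_unconsEl _)))
    (unconsEl_consEl _)

lemma ProdSq.id {o p : (C.tensor D).carrier} (m : 𝟙_ E ⟶ (p ⟶[E] (LaxHom.id (C.tensor D)).obj o)) :
    ProdSq m m (eId E _) (eId E _) (eId E _) :=
  LaxHom.Sq.id _

lemma ProdSq.splitEl : ∀ {m l k : ℕ} (a : Fin m → (C.tensor D).carrier)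
    (b : Fin l → (C.tensor D).carrier)
    (g : Fin k → (C.tensor D).carrier) (hk : k = m + l)
    (ha : ∀ (j : Fin m) (p : Fin k), p.val = j.val → g p = a j)
    (hb : ∀ (j : Fin l) (p : Fin k), p.val = m + j.val → g p = b j),
    ProdSq (C.prodEl D g) ((LaxHom.id (C.tensor D)).tMu (C.prodEl D a) (C.prodEl D b))
      (C.splitEl (fun j => (a j).1) (fun j => (b j).1) (fun j => (g j).1) hk
        (fun j p h => congrArg Prod.fst (ha j p h)) (fun j p h => congrArg Prod.fst (hb j p h)))
      (D.splitEl (fun j => (a j).2) (fun j => (b j).2) (fun j => (g j).2) hk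
        (fun j p h => congrArg Prod.snd (ha j p h)) (fun j p h => congrArg Prod.snd (hb j p h)))
      ((C.tensor D).splitEl a b g hk ha hb)
  | 0, l, k, a, b, g, hk, ha, hb => by
    have h : C.prodEl D a = (LaxHom.id (C.tensor D)).eps := elOfEq_rfl _
    rw [h]
    exact (ProdSq.tens_congr (by omega) (fun j p hp => hb j p (by omega)) _ _ _).comp
      (LaxHom.Sq.lUnitInv _)
  | m + 1, l, 0, _, _, _, hk, _, _ => absurd hk (by omega)
  | m + 1, l, k + 1, a, b, g, hk, ha, hb =>
    (ProdSq.unconsEl g).comp (((ProdSq.leaf (ha 0 0 rfl)).tEl (splitEl (fun j : Fin m => a j.succ) b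
      (fun j : Fin k => g j.succ) (by omega)
          (fun j p hp => ha j.succ p.succ (by simp [hp]))
          (fun j p hp => hb j p.succ (by simp [hp]; omega)))).comp
      (ProdSq.comp (LaxHom.Sq.assocInv _ _ _) ((ProdSq.consEl a).tEl (ProdSq.id _))))

lemma ProdSq.moveEl : ∀ {n : ℕ} (c : Fin (n + 1) → (C.tensor D).carrier)
    (c' : Fin n → (C.tensor D).carrier)
    (q : Fin (n + 1)) (h : ∀ j, c' j = c (q.succAbove j)),
    ProdSq ((LaxHom.id (C.tensor D)).tMu (o := c q) (eId E (c q)) (C.prodEl D c')) (C.prodEl D c)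
      (C.moveEl (fun j => (c j).1) (fun j => (c' j).1) q (fun j => congrArg Prod.fst (h j)))
      (D.moveEl (fun j => (c j).2) (fun j => (c' j).2) q (fun j => congrArg Prod.snd (h j)))
      ((C.tensor D).moveEl c c' q h)
  | n, c, c', ⟨0, _⟩, h => by
    cases n <;>
    exact ((ProdSq.id _).tEl
      (ProdSq.tens_congr rfl (fun j p hp => by rw [Fin.ext hp, h j]; rfl) _ _ _)).comp
      (ProdSq.consEl c)
  | 0, _, _, ⟨q + 1, hq⟩, _ => absurd hq (by omega)
  | n + 1, c, c', ⟨q + 1, hq⟩, h => by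
    have ih := moveEl (fun j : Fin (n + 1) => c j.succ) (fun j : Fin n => c' j.succ)
      ⟨q, Nat.lt_of_succ_lt_succ hq⟩
      (fun j => (h j.succ).trans (congrArg c (Fin.succ_succAbove_succ
        (⟨q, Nat.lt_of_succ_lt_succ hq⟩ : Fin (n + 1)) j)))
    have h1 := (ProdSq.leaf ((h 0).trans (congrArg c (Fin.succ_succAbove_zero
      (⟨q, Nat.lt_of_succ_lt_succ hq⟩ : Fin (n + 1)))))).tEl ih
    rw [show (LaxHom.id (C.tensor D)).tMu (o := c 0) (eId E (c 0))
      (C.prodEl D fun j : Fin (n + 1) => c j.succ) = C.prodEl D c from tMu_prodEl c] at h1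
    exact ((ProdSq.id _).tEl (ProdSq.unconsEl c')).comp (ProdSq.comp (LaxHom.Sq.assocInv _ _ _)
      ((ProdSq.tEl (LaxHom.Sq.comm _ _) (ProdSq.id _)).comp (ProdSq.comp (LaxHom.Sq.assoc _ _ _)
        h1)))

lemma ProdSq.permEl : ∀ {n : ℕ} (c c' : Fin n → (C.tensor D).carrier) (σ : Equiv.Perm (Fin n))
    (h : ∀ i, c' i = c (σ i)), ProdSq (C.prodEl D c') (C.prodEl D c)
      (C.permEl (fun j => (c j).1) (fun j => (c' j).1) σ (fun j => congrArg Prod.fst (h j)))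
      (D.permEl (fun j => (c j).2) (fun j => (c' j).2) σ (fun j => congrArg Prod.snd (h j)))
      ((C.tensor D).permEl c c' σ h)
  | 0, _, _, _, _ => by
    have h (c : Fin 0 → (C.tensor D).carrier) : C.prodEl D c = eId E (C.tensor D).one :=
      elOfEq_rfl _
    rw [h, h]
    exact LaxHom.Sq.id (f := LaxHom.id (C.tensor D)) (o := (C.tensor D).one) (eId E _)
  | n + 1, c, c', σ, h =>
    (ProdSq.unconsEl c').comp (((ProdSq.leaf (h 0)).tEl (permEl (fun j => c ((σ 0).succAbove j))
      (fun j => c' j.succ) (permTail σ) (fun j => by rw [h, succAbove_permTail]))).comp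
        (ProdSq.moveEl c (fun j => c ((σ 0).succAbove j)) (σ 0) (fun _ => rfl)))

/-- Tensoring with an identity in `C ⊗ D` is done componentwise. -/
lemma prod_rW {x y z : (C.tensor D).carrier} :
    (C.tensor D).rW z x y = (C.rW z.1 x.1 y.1 ⊗ₘ D.rW z.2 x.2 y.2) := by
  have h := rightUnitor_inv_elPair (X := (x.1 ⟶[E] y.1)) (Y := (x.2 ⟶[E] y.2))
    (eId E z.1) (eId E z.2)
  change (ρ_ (_ ⊗ _)).inv ≫ _ ◁ elPair _ _ ≫ tensorμ _ _ _ _ ≫ (_ ⊗ₘ _) = _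
  rw [reassoc_of% h]
  simp only [tensorHom_comp_tensorHom, rW, Category.assoc]

lemma prod_lW {x y z : (C.tensor D).carrier} :
    (C.tensor D).lW z x y = (C.lW z.1 x.1 y.1 ⊗ₘ D.lW z.2 x.2 y.2) := by
  have h := leftUnitor_inv_elPair (X := (x.1 ⟶[E] y.1)) (Y := (x.2 ⟶[E] y.2))
    (eId E z.1) (eId E z.2)
  change (λ_ (_ ⊗ _)).inv ≫ elPair _ _ ▷ _ ≫ tensorμ _ _ _ _ ≫ (_ ⊗ₘ _) = _
  rw [reassoc_of% h]
  simp only [tensorHom_comp_tensorHom, lW, Category.assoc]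

lemma rW_comp_eq (C : SymMonECat.{v, u, w} E) (Z x y : C.carrier) {X : E}
    (a : (C.tObj x Z ⟶[E] C.tObj y Z) ⟶ X) :
    C.rW Z x y ≫ a = (ρ_ _).inv ≫ _ ◁ eId E Z ≫ C.tHom x y Z Z ≫ a := by
  simp only [rW, Category.assoc]

lemma _root_.LaxHom.InsSq.ofSq {f : LaxHom C D} {o y q : C.carrier} {p r : D.carrier}
    {m : 𝟙_ E ⟶ (p ⟶[E] f.obj o)} {k : 𝟙_ E ⟶ (r ⟶[E] f.obj q)}
    {a : 𝟙_ E ⟶ (q ⟶[E] o)} {b : 𝟙_ E ⟶ (r ⟶[E] p)} (h : f.Sq k m a b) :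
    f.InsSq m k (eId E (f.obj y)) (elPre a y) (elPre b (f.obj y)) := by
  have h1 := (LaxHom.InsSq.id (y := y) m).comp_elPre h
  rw [Category.id_comp, Category.id_comp] at h1
  exact h1

lemma _root_.LaxHom.InsSq.rW {f : LaxHom C D} {o y s : C.carrier} {p t : D.carrier}
    (m : 𝟙_ E ⟶ (p ⟶[E] f.obj o)) (l : 𝟙_ E ⟶ (t ⟶[E] f.obj s)) :
    f.InsSq m (f.tMu m l) (f.tMu (eId E (f.obj y)) l) (C.rW s o y) (D.rW t p (f.obj y)) := by
  have h1 := (LaxHom.InsSq.id (y := y) m).comp_rW l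
  rw [Category.id_comp, Category.id_comp] at h1
  exact h1

/-- A morphism `(C ⊗ D)(o, y) ⟶ (C ⊗ D)(q, q')` with components `φ` and `χ` and a morphism
`(C ⊗ D)(p, y) ⟶ (C ⊗ D)(r, r')` form a commutative square with the identifications `m`, `k`,
`k'`. -/
abbrev ProdInsSq {o y q q' p r r' : (C.tensor D).carrier}
    (m : 𝟙_ E ⟶ (p ⟶[E] (LaxHom.id (C.tensor D)).obj o))
    (k : 𝟙_ E ⟶ (r ⟶[E] (LaxHom.id (C.tensor D)).obj q))
    (k' : 𝟙_ E ⟶ (r' ⟶[E] (LaxHom.id (C.tensor D)).obj q'))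
    (φ : (o.1 ⟶[E] y.1) ⟶ (q.1 ⟶[E] q'.1)) (χ : (o.2 ⟶[E] y.2) ⟶ (q.2 ⟶[E] q'.2))
    (ψ : (p ⟶[E] y) ⟶ (r ⟶[E] r')) : Prop :=
  (LaxHom.id (C.tensor D)).InsSq (o := o) (y := y) (q := q) (q' := q') m k k' (φ ⊗ₘ χ) ψ

namespace ProdInsSq

variable {o y q q' s s' z p r r' t t' : (C.tensor D).carrier}
  {m : 𝟙_ E ⟶ (p ⟶[E] (LaxHom.id (C.tensor D)).obj o)}
  {k : 𝟙_ E ⟶ (r ⟶[E] (LaxHom.id (C.tensor D)).obj q)}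
  {k' : 𝟙_ E ⟶ (r' ⟶[E] (LaxHom.id (C.tensor D)).obj q')}
  {l : 𝟙_ E ⟶ (t ⟶[E] (LaxHom.id (C.tensor D)).obj s)}
  {φ : (o.1 ⟶[E] y.1) ⟶ (q.1 ⟶[E] q'.1)} {χ : (o.2 ⟶[E] y.2) ⟶ (q.2 ⟶[E] q'.2)}
  {ψ : (p ⟶[E] y) ⟶ (r ⟶[E] r')}

lemma congr {k'' : 𝟙_ E ⟶ (r' ⟶[E] (LaxHom.id (C.tensor D)).obj q')}
    {φ' : (o.1 ⟶[E] y.1) ⟶ (q.1 ⟶[E] q'.1)} {χ' : (o.2 ⟶[E] y.2) ⟶ (q.2 ⟶[E] q'.2)}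
    {ψ' : (p ⟶[E] y) ⟶ (r ⟶[E] r')} (h : ProdInsSq m k k' φ χ ψ) (hk : k' = k'')
    (hφ : φ = φ') (hχ : χ = χ') (hψ : ψ = ψ') : ProdInsSq m k k'' φ' χ' ψ' := by
  subst hk hφ hχ hψ
  exact h

lemma ofSq {a : 𝟙_ E ⟶ (s.1 ⟶[E] o.1)} {b : 𝟙_ E ⟶ (s.2 ⟶[E] o.2)} {c : 𝟙_ E ⟶ (t ⟶[E] p)}
    (hab : ProdSq l m a b c) :
    ProdInsSq (y := y) m l (eId E _) (elPre a _) (elPre b _) (elPre c _) :=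
  (congrArg (fun a => (LaxHom.id (C.tensor D)).InsSq (o := o) (y := y) (q := s) (q' := y)
    m l (eId E y) a (elPre c y)) (prod_elPre a b y)).mp (LaxHom.InsSq.ofSq hab)

lemma comp_elPre (h : ProdInsSq m k k' φ χ ψ) {a : 𝟙_ E ⟶ (s.1 ⟶[E] q.1)}
    {b : 𝟙_ E ⟶ (s.2 ⟶[E] q.2)} {c : 𝟙_ E ⟶ (t ⟶[E] r)}
    (hab : ProdSq l k a b c) :
    ProdInsSq m l k' (φ ≫ elPre a _) (χ ≫ elPre b _) (ψ ≫ elPre c _) := by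
  have h1 := LaxHom.InsSq.comp_elPre h hab
  exact (congrArg (fun a => (LaxHom.id (C.tensor D)).InsSq (o := o) (y := y) (q := s) (q' := q')
    m l k' a (ψ ≫ elPre c _)) ((congrArg ((φ ⊗ₘ χ) ≫ ·) (prod_elPre a b q')).trans
      (tensorHom_comp_tensorHom _ _ _ _))).mp h1

lemma rW (m : 𝟙_ E ⟶ (p ⟶[E] (LaxHom.id (C.tensor D)).obj o))
    (l : 𝟙_ E ⟶ (t ⟶[E] (LaxHom.id (C.tensor D)).obj s)) :
    ProdInsSq (C := C) (D := D) (y := y) (q := (C.tensor D).tObj o s) (q' := (C.tensor D).tObj y s)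
      m ((LaxHom.id (C.tensor D)).tMu m l)
      ((LaxHom.id (C.tensor D)).tMu (eId E y) l) (C.rW s.1 _ _) (D.rW s.2 _ _)
      ((C.tensor D).rW t _ _) :=
  (congrArg (fun a => (LaxHom.id (C.tensor D)).InsSq (o := o) (y := y)
    (q := (C.tensor D).tObj o s) (q' := (C.tensor D).tObj y s)
    m ((LaxHom.id (C.tensor D)).tMu m l) ((LaxHom.id (C.tensor D)).tMu (eId E y) l) a
    ((C.tensor D).rW t _ _)) (prod_rW (x := o) (y := y) (z := s))).mp (LaxHom.InsSq.rW m l)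

lemma comp_lW (h : ProdInsSq m k k' φ χ ψ) (l : 𝟙_ E ⟶ (t ⟶[E] (LaxHom.id (C.tensor D)).obj s)) :
    ProdInsSq (C := C) (D := D) m ((LaxHom.id (C.tensor D)).tMu l k)
      ((LaxHom.id (C.tensor D)).tMu l k')
      (φ ≫ C.lW s.1 _ _) (χ ≫ D.lW s.2 _ _) (ψ ≫ (C.tensor D).lW t _ _) := by
  have h1 := LaxHom.InsSq.comp_lW h l
  exact (congrArg (fun a => (LaxHom.id (C.tensor D)).InsSq (o := o) (y := y)
    (q := (C.tensor D).tObj s q) (q' := (C.tensor D).tObj s q')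
    m _ _ a (ψ ≫ (C.tensor D).lW t _ _))
      ((congrArg ((φ ⊗ₘ χ) ≫ ·) (prod_lW (x := q) (y := q') (z := s))).trans
      (tensorHom_comp_tensorHom _ _ _ _))).mp h1

lemma insertHom : ∀ {n m k : ℕ} (c : Fin n → (C.tensor D).carrier)
    (e : Fin m → (C.tensor D).carrier) (g : Fin k → (C.tensor D).carrier) (i : Fin n)
    (h : IsGraft i c e g),
    ProdInsSq (y := c i) (C.prodEl D e) (C.prodEl D g) (C.prodEl D c)
      (C.insertHom (fun j => (c j).1) (fun j => (e j).1) (fun j => (g j).1) i (h.map Prod.fst))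
      (D.insertHom (fun j => (c j).2) (fun j => (e j).2) (fun j => (g j).2) i (h.map Prod.snd))
      ((C.tensor D).insertHom c e g i h)
  | 0, _, _, _, _, _, i, _ => i.elim0
  | 1, m, k, c, e, g, ⟨0, _⟩, h => by
    have h' : C.prodEl D c = eId E (c 0) := elOfEq_rfl _
    exact (ProdInsSq.ofSq (y := c 0) (ProdSq.tens_congr
      (by have := h.length; omega) (fun j p hp => h.inner j p (by simpa using hp))
      (C.tens_congr (c := fun j => (e j).1) (g := fun j => (g j).1) (by have := h.length; omega)
        fun j p hp => congrArg Prod.fst (h.inner j p (by simpa using hp)))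
      (D.tens_congr (c := fun j => (e j).2) (g := fun j => (g j).2) (by have := h.length; omega)
        fun j p hp => congrArg Prod.snd (h.inner j p (by simpa using hp)))
      ((C.tensor D).tens_congr (c := e) (g := g) (by have := h.length; omega)
        fun j p hp => h.inner j p (by simpa using hp)))).congr h'.symm rfl rfl rfl
  | n + 2, m, k, c, e, g, ⟨0, _⟩, h => by
    exact ((ProdInsSq.rW (y := c 0) (C.prodEl D e)
      (C.prodEl D (fun j : Fin (n + 1) => c j.succ))).comp_elPre
      (ProdSq.splitEl e (fun j : Fin (n + 1) => c j.succ) g (by have := h.length; omega)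
          (fun j p hp => h.inner j p (by simpa using hp))
          (fun j p hp => h.outer j.succ p
            (Or.inr ⟨Fin.mk_lt_mk.2 (Nat.succ_pos _), by simp; omega⟩)))).congr (tMu_prodEl c)
      (C.rW_comp_eq _ _ _ _) (D.rW_comp_eq _ _ _ _) ((C.tensor D).rW_comp_eq _ _ _ _)
  | n + 2, m, 0, _, _, _, ⟨_ + 1, _⟩, h => absurd h.length (by omega)
  | n + 2, m, k + 1, c, e, g, ⟨i + 1, hi⟩, h => by
    have h0 := h.outer 0 0 (Or.inl ⟨Fin.mk_lt_mk.2 (Nat.succ_pos _), rfl⟩)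
    have h' : IsGraft ⟨i, Nat.lt_of_succ_lt_succ hi⟩ (fun j : Fin (n + 1) => c j.succ) e
        (fun j : Fin k => g j.succ) :=
        { length := by have := h.length; omega
          outer := fun j p hp => h.outer j.succ p.succ (by
            simp only [OuterPos, Fin.lt_def, Fin.val_succ] at hp ⊢; omega)
          inner := fun j p hp => h.inner j p.succ (by simp at hp ⊢; omega) }
    have h1 := (((insertHom _ _ _ _ h').comp_lW (eId E (c 0))).comp_elPre
      ((ProdSq.leaf h0).tEl (ProdSq.id _))).comp_elPre (ProdSq.unconsEl g)
    rw [show (LaxHom.id (C.tensor D)).tMu (o := c 0) (eId E (c 0))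
      (C.prodEl D fun j : Fin (n + 1) => c j.succ) = C.prodEl D c from tMu_prodEl c] at h1
    rw [SymMonECat.insertHom_succ c e g i hi h h' h0,
      SymMonECat.insertHom_succ (fun j => (c j).1) (fun j => (e j).1)
        (fun j => (g j).1) i hi (h.map Prod.fst) (h'.map Prod.fst) (congrArg Prod.fst h0),
      SymMonECat.insertHom_succ (fun j => (c j).2) (fun j => (e j).2)
        (fun j => (g j).2) i hi (h.map Prod.snd) (h'.map Prod.snd) (congrArg Prod.snd h0)]
    exact h1

lemma insertAt {n m k : ℕ} {c : Fin n → (C.tensor D).carrier} {e : Fin m → (C.tensor D).carrier}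
    {g : Fin k → (C.tensor D).carrier} (i : Fin n) {y : (C.tensor D).carrier} (hy : c i = y)
    (h : IsGraft i c e g) :
    ProdInsSq (y := y) (C.prodEl D e) (C.prodEl D g) (C.prodEl D c)
      (C.insertAt i (congrArg Prod.fst hy) (h.map Prod.fst))
      (D.insertAt i (congrArg Prod.snd hy) (h.map Prod.snd))
      ((C.tensor D).insertAt i hy h) := by
  subst hy
  rw [SymMonECat.insertAt, SymMonECat.insertAt, SymMonECat.insertAt, eqToHom_refl, eqToHom_refl,
    eqToHom_refl, Category.id_comp, Category.id_comp, Category.id_comp]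
  exact insertHom c e g i h

end ProdInsSq

/-- The Hadamard product of two partial compositions. -/
lemma prod_comp {X₁ X₂ Y₁ Y₂ Z₁ Z₂ Q₁ Q₂ : E} (φ : Y₁ ⟶ Z₁) (χ : Y₂ ⟶ Z₂) (f : Z₁ ⊗ X₁ ⟶ Q₁)
    (g : Z₂ ⊗ X₂ ⟶ Q₂) :
    tensorμ X₁ X₂ Y₁ Y₂ ≫ (((β_ X₁ Y₁).hom ≫ φ ▷ X₁ ≫ f) ⊗ₘ ((β_ X₂ Y₂).hom ≫ χ ▷ X₂ ≫ g)) =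
      (β_ (X₁ ⊗ X₂) (Y₁ ⊗ Y₂)).hom ≫ (φ ⊗ₘ χ) ▷ (X₁ ⊗ X₂) ≫ tensorμ _ _ _ _ ≫ (f ⊗ₘ g) := by
  rw [← tensorHom_comp_tensorHom, ← tensorHom_comp_tensorHom, ← Category.assoc, tensorμ_braiding,
    Category.assoc, tensorμ_natural_left_assoc]

end SymMonECat

lemma LaxHom.Sq.elPre_id_map {C : SymMonECat.{v, u, w} E} {o o' p p' : C.carrier}
    {m : 𝟙_ E ⟶ (p ⟶[E] o)} {m' : 𝟙_ E ⟶ (p' ⟶[E] o')} {a : 𝟙_ E ⟶ (o ⟶[E] o')}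
    {b : 𝟙_ E ⟶ (p ⟶[E] p')} (h : (LaxHom.id C).Sq m m' a b) (d : C.carrier) :
    elPre a d ≫ elPre m d = elPre m' d ≫ elPre b d := by
  rw [elPre_elPre, elPre_elPre, ← show elComp m (a ≫ 𝟙 _) = elComp b m' from h, Category.comp_id]

lemma LaxHom.InsSq.comp_id_map {C : SymMonECat.{v, u, w} E} {o y q q' p r r' : C.carrier}
    {m : 𝟙_ E ⟶ (p ⟶[E] o)} {k : 𝟙_ E ⟶ (r ⟶[E] q)} {k' : 𝟙_ E ⟶ (r' ⟶[E] q')}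
    {φ : (o ⟶[E] y) ⟶ (q ⟶[E] q')} {ψ : (p ⟶[E] y) ⟶ (r ⟶[E] r')}
    (h : (LaxHom.id C).InsSq m k k' φ ψ) (d : C.carrier) :
    ((β_ (q' ⟶[E] d) (o ⟶[E] y)).hom ≫ φ ▷ (q' ⟶[E] d) ≫ eComp E q q' d) ≫ elPre k d =
      (elPre k' d ⊗ₘ elPre m y) ≫ (β_ _ _).hom ≫ ψ ▷ _ ≫ eComp E r r' d := by
  have h1 := h.comp_map d
  change _ ≫ 𝟙 _ ≫ elPre k d = ((𝟙 _ ≫ elPre k' d) ⊗ₘ (𝟙 _ ≫ elPre m y)) ≫ _ at h1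
  rw [Category.id_comp, Category.id_comp, Category.id_comp] at h1
  exact h1

lemma comp_elPre_elOfEq {C : Type w} [EnrichedCategory E C] {X : E} (x y : C) (a : X ⟶ (x ⟶[E] y)) :
    a ≫ elPre (elOfEq rfl) y = a := by
  rw [elOfEq_rfl, elPre_id, Category.comp_id]

/-- The canonical map `End(C) ⊗ End(D) ⟶ End(C ⊗ D)` is a morphism of operads. -/
theorem endMu_isHom (C D : SymMonECat.{v, u, w} E) : (endMu C D).IsHom where
  map_act {n c c'} σ h d := by
    have h1 := LaxHom.Sq.elPre_id_map (C := C.tensor D) (SymMonECat.ProdSq.permEl c c' σ h) d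
    exact (congrArg (· ≫ _) (prod_elPre (E := E) (C := C.carrier) (D := D.carrier)
        _ _ d).symm).trans h1
  map_comp {n m k c e g} i x hx hg d := by
    have h1 := LaxHom.InsSq.comp_id_map (C := C.tensor D)
      (SymMonECat.ProdInsSq.insertAt i hx hg) d
    exact (congrArg (· ≫ _) (SymMonECat.prod_comp (C.insertAt i (congrArg Prod.fst hx)
        (hg.map Prod.fst))
      (D.insertAt i (congrArg Prod.snd hx) (hg.map Prod.snd)) (eComp E (C := C.carrier) _ _ d.1)
        (eComp E (C := D.carrier) _ _ d.2))).trans h1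
  map_unit x := comp_elPre_elOfEq (C := (C.tensor D).carrier) x x
    (elPair (eId E (C := C.carrier) x.1) (eId E (C := D.carrier) x.2))

end HadamardComparison

/-! ### The comparison map `uCom ⟶ End(I)` -/

section UnitComparison

variable {E : Type u} [Category.{v} E] [MonoidalCategory E] [SymmetricCategory E]

attribute [local instance] SymMonECat.unitEnriched

namespace SymMonECat

lemma unit_elOfEq {x y : PUnit.{w + 1}} (h : x = y) :
    elOfEq (E := E) (C := PUnit.{w + 1}) h = 𝟙 (𝟙_ E) :=
  elOfEq_rfl (C := PUnit.{w + 1}) x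

lemma unit_tEl {x x' y y' : PUnit.{w + 1}} {a b : 𝟙_ E ⟶ 𝟙_ E} (ha : a = 𝟙 _) (hb : b = 𝟙 _) :
    (unit.{v, u, w} E).tEl (x := x) (x' := x') (y := y) (y' := y') a b = 𝟙 (𝟙_ E) := by
  subst ha hb
  exact unit_pair

lemma unit_unconsEl {n : ℕ} (c : Fin (n + 1) → PUnit.{w + 1}) :
    (unit.{v, u, w} E).unconsEl c = 𝟙 (𝟙_ E) := by
  cases n <;> rfl

lemma unit_consEl {n : ℕ} (c : Fin (n + 1) → PUnit.{w + 1}) :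
    (unit.{v, u, w} E).consEl c = 𝟙 (𝟙_ E) := by
  cases n <;> rfl

lemma unit_splitEl : ∀ {m l k : ℕ} (a : Fin m → PUnit.{w + 1}) (b : Fin l → PUnit.{w + 1})
    (g : Fin k → PUnit.{w + 1}) (hk : k = m + l) (ha hb),
    (unit.{v, u, w} E).splitEl a b g hk ha hb = 𝟙 (𝟙_ E)
  | 0, l, k, a, b, g, hk, ha, hb => unit_elComp (unit_elOfEq _) rfl
  | m + 1, l, 0, _, _, _, hk, _, _ => absurd hk (by omega)
  | m + 1, l, k + 1, a, b, g, hk, ha, hb =>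
    unit_elComp (unit_unconsEl g) (unit_elComp (unit_tEl (unit_elOfEq _) (unit_splitEl _ _ _ _ _ _))
      (unit_elComp rfl (unit_tEl (unit_consEl a) rfl)))

lemma unit_moveEl : ∀ {n : ℕ} (c : Fin (n + 1) → PUnit.{w + 1}) (c' : Fin n → PUnit.{w + 1})
    (q : Fin (n + 1)) (h : ∀ j, c' j = c (q.succAbove j)),
    (unit.{v, u, w} E).moveEl c c' q h = 𝟙 (𝟙_ E)
  | n, c, c', ⟨0, _⟩, h => by
    cases n <;>
    exact unit_elComp (unit_tEl rfl (unit_elOfEq _)) (unit_consEl c)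
  | 0, _, _, ⟨q + 1, hq⟩, _ => absurd hq (by omega)
  | n + 1, c, c', ⟨q + 1, hq⟩, h =>
    unit_elComp (unit_tEl rfl (unit_unconsEl c')) (unit_elComp rfl (unit_elComp (unit_tEl rfl rfl)
      (unit_elComp rfl (unit_tEl (unit_elOfEq _) (unit_moveEl _ _ _ _)))))

lemma unit_permEl : ∀ {n : ℕ} (c c' : Fin n → PUnit.{w + 1}) (σ : Equiv.Perm (Fin n))
    (h : ∀ i, c' i = c (σ i)), (unit.{v, u, w} E).permEl c c' σ h = 𝟙 (𝟙_ E)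
  | 0, _, _, _, _ => rfl
  | n + 1, c, c', σ, h =>
    unit_elComp (unit_unconsEl c') (unit_elComp (unit_tEl (unit_elOfEq _) (unit_permEl _ _ _ _))
      (unit_moveEl _ _ _ _))

lemma unit_elPre_eq {x y z : PUnit.{w + 1}} {a : 𝟙_ E ⟶ 𝟙_ E} (ha : a = 𝟙 _) :
    elPre (C := PUnit.{w + 1}) (x' := x) (x := y) a z = 𝟙 (𝟙_ E) := by
  subst ha
  exact unit_elPre x y z

lemma unit_rW {a b : 𝟙_ E ⟶ 𝟙_ E} (ha : a = 𝟙 _) (hb : b = 𝟙 _) :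
    (ρ_ (𝟙_ E)).inv ≫ 𝟙_ E ◁ a ≫ (λ_ (𝟙_ E)).hom ≫ b = 𝟙 _ := by
  subst ha hb
  simp [unitors_equal]

lemma unit_lW {a b c : 𝟙_ E ⟶ 𝟙_ E} (ha : a = 𝟙 _) (hb : b = 𝟙 _) (hc : c = 𝟙 _) :
    c ≫ (λ_ (𝟙_ E)).inv ≫ a ▷ 𝟙_ E ≫ (λ_ (𝟙_ E)).hom ≫ b = 𝟙 _ := by
  subst ha hb hc
  simp

lemma unit_insertHom : ∀ {n m k : ℕ} (c : Fin n → PUnit.{w + 1}) (e : Fin m → PUnit.{w + 1})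
    (g : Fin k → PUnit.{w + 1}) (i : Fin n) (h : IsGraft i c e g),
    (unit.{v, u, w} E).insertHom c e g i h = 𝟙 (𝟙_ E)
  | 0, _, _, _, _, _, i, _ => i.elim0
  | 1, m, k, c, e, g, ⟨0, _⟩, h => unit_elPre_eq (unit_elOfEq _)
  | n + 2, m, k, c, e, g, ⟨0, _⟩, h => unit_rW rfl (unit_elPre_eq (unit_splitEl _ _ _ _ _ _))
  | n + 2, m, 0, _, _, _, ⟨_ + 1, _⟩, h => absurd h.length (by omega)
  | n + 2, m, k + 1, c, e, g, ⟨i + 1, hi⟩, h =>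
    unit_lW (unit_elOfEq _) (unit_elPre_eq (unit_unconsEl g)) (unit_insertHom _ _ _ _ _)

end SymMonECat

/-- The canonical map `uCom ⟶ End(I)` is a morphism of operads. -/
theorem endEps_isHom : (endEps.{v, u, w} E).IsHom where
  map_act σ h d := (congrArg (𝟙 (𝟙_ E) ≫ ·)
    (SymMonECat.unit_elPre_eq (SymMonECat.unit_permEl _ _ σ (fun i => h i)))).symm
  map_comp {n m k c e g} i x hx hg d := by
    obtain rfl := hx
    have h := SymMonECat.unit_insertHom (E := E) c e g i hg
    have h' {a : 𝟙_ E ⟶ 𝟙_ E} (ha : a = 𝟙 _) : (λ_ (𝟙_ E)).hom ≫ 𝟙 (𝟙_ E) =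
        (𝟙 (𝟙_ E) ⊗ₘ 𝟙 (𝟙_ E)) ≫ (β_ _ _).hom ≫ (𝟙 _ ≫ a) ▷ _ ≫ (λ_ (𝟙_ E)).hom := by
      subst ha
      rw [braiding_unit]
      simp
    exact h' h
  map_unit x := Category.comp_id _

/-- All the parts of the construction of endomorphism operads are well defined. -/
theorem endWellDefined (E : Type u) [Category.{v} E] [MonoidalCategory E] [SymmetricCategory E] :
    EndWellDefined.{v, u, w} E where
  obj C := endData_isOperad C
  map f := endHomData_isHom f
  map₂ η := endData_isOperadTrans η
  mu C D := endMu_isHom C D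
  eps := endEps_isHom

end UnitComparison

/-! ### Strict 2-functoriality -/

section StrictTwoFunctor

variable {E : Type u} [Category.{v} E] [MonoidalCategory E] [SymmetricCategory E]

namespace LaxHom

variable {C D D' : SymMonECat.{v, u, w} E}

lemma muN_id : ∀ {n : ℕ} (c : Fin n → C.carrier), (LaxHom.id C).muN c = eId E (C.tens c)
  | 0, _ => rfl
  | 1, _ => rfl
  | n + 2, c => (elComp_id _).trans ((congrArg (C.tEl (eId E (c 0)))
      (muN_id (fun j : Fin (n + 1) => c j.succ))).trans (C.tEl_id _ _))

lemma muN_comp (f : LaxHom C D) (g : LaxHom D D') : ∀ {n : ℕ} (c : Fin n → C.carrier),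
    (f.comp g).muN c = elComp (g.muN (fun j => f.obj (c j))) (f.muN c ≫ g.map _ _)
  | 0, _ => rfl
  | 1, c => by
    refine Eq.symm ((congrArg (elComp _) (g.map_id (f.obj (c 0)))).trans (elComp_id _))
  | n + 2, c => by
    have ih := muN_comp f g (fun j : Fin (n + 1) => c j.succ)
    have h : elComp (D'.tEl (eId E (g.obj (f.obj (c 0))))
          (elComp (g.muN (fun j : Fin (n + 1) => f.obj (c j.succ)))
            (f.muN (fun j : Fin (n + 1) => c j.succ) ≫ g.map _ _)))
          (elComp (g.mu _ _) (f.mu (c 0) (C.tens (fun j : Fin (n + 1) => c j.succ)) ≫ g.map _ _)) =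
        elComp (elComp (D'.tEl (eId E (g.obj (f.obj (c 0))))
            (g.muN (fun j : Fin (n + 1) => f.obj (c j.succ)))) (g.mu _ _))
          (elComp (D.tEl (eId E (f.obj (c 0))) (f.muN (fun j : Fin (n + 1) => c j.succ)))
            (f.mu (c 0) (C.tens (fun j : Fin (n + 1) => c j.succ))) ≫ g.map _ _) := by
      have h1 := g.tEl_mu (eId E (f.obj (c 0))) (f.muN (fun j : Fin (n + 1) => c j.succ))
      rw [EnrichedFunctor.map_id] at h1
      rw [SymMonECat.tEl_id_comp, elComp_map, elComp_assoc, elComp_assoc,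
        ← elComp_assoc (D'.tEl _ (_ ≫ _)), h1, elComp_assoc]
    exact (congrArg (fun a => elComp (D'.tEl (eId E (g.obj (f.obj (c 0)))) a) _) ih).trans h

lemma map_elPre_map (g : LaxHom D D') {X : E} {p q d : D.carrier} {r : D'.carrier}
    (φ : X ⟶ (q ⟶[E] d)) (m : 𝟙_ E ⟶ (p ⟶[E] q)) (n : 𝟙_ E ⟶ (r ⟶[E] g.obj p)) :
    (φ ≫ g.map q d) ≫ elPre (elComp n (m ≫ g.map p q)) _ =
      (φ ≫ elPre m d) ≫ g.map p d ≫ elPre n _ := by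
  rw [← elPre_elPre, Category.assoc, Category.assoc, elPre_map_assoc]

lemma map_elPre_eId (g : LaxHom D D') {X : E} {x d : D.carrier} (φ : X ⟶ (x ⟶[E] d)) :
    φ ≫ g.map x d ≫ elPre (eId E (g.obj x)) _ = φ ≫ g.map x d := by
  rw [elPre_id, Category.comp_id]

end LaxHom

/-- Composition of unary operations in `End(C)` is composition in `C`. -/
lemma endData_uComp (C : SymMonECat.{v, u, w} E) {x y z : C.carrier} (b : 𝟙_ E ⟶ (y ⟶[E] z))
    (a : 𝟙_ E ⟶ (x ⟶[E] y)) :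
    (endData C).uComp (x := x) (y := y) (z := z) b a = elComp a b :=
  ((endData C).comp_post (x := x) (d := y) (d' := z) a b).symm.trans
    ((congrArg (a ≫ ·) (endData_el_comp C (fun _ : Fin 1 => x) b)).trans (comp_elPost a b))

/-- The construction `End` is a strict 2-functor. -/
theorem EndWellDefined.isStrictTwoFunctor (h : EndWellDefined.{v, u, w} E) :
    IsStrictTwoFunctor h.toStruct := by
  have h_id (C : SymMonECat.{v, u, w} E) : h.toStruct.map (𝟙 C) = 𝟙 (h.toStruct.obj C) := by
    refine OperadHom.ext_of (P := endData C) (Q := endData C) rfl (heq_of_eq ?_)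
    funext n c d
    exact (Category.id_comp _).trans ((congrArg (fun a => elPre (C := C.carrier) a d)
        (LaxHom.muN_id c)).trans
      (elPre_id (C := C.carrier) _ d))
  have h_comp {C D D' : SymMonECat.{v, u, w} E} (f : C ⟶ D) (g : D ⟶ D') :
      h.toStruct.map (f ≫ g) = h.toStruct.map f ≫ h.toStruct.map g := by
    refine OperadHom.ext_of (P := endData C) (Q := endData D') rfl (heq_of_eq ?_)
    funext n c d
    exact (congrArg (fun a => _ ≫ elPre (C := D'.carrier) a _) (LaxHom.muN_comp f g c)).trans
      (LaxHom.map_elPre_map g _ _ _)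
  refine ⟨StrictPseudofunctor.mk''
    { toPrelaxFunctorStruct := h.toStruct
      map₂_id := fun f => OperadTrans.hom_ext fun x => rfl
      map₂_comp := fun {C D} f g k η θ => OperadTrans.hom_ext fun x => ?_
      map_id := h_id
      map_comp := h_comp
      map₂_whisker_left := fun {C D D'} f g k η => ?_
      map₂_whisker_right := fun {C D D'} f g η k => ?_ }, rfl⟩
  · exact (endData_uComp D (MonTrans.app θ x) (MonTrans.app η x)).symm
  · exact OperadTrans.eq_conj (P := h.toStruct.obj C) (Q := h.toStruct.obj D') _ _ fun x => HEq.rfl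
  · exact OperadTrans.eq_conj (P := h.toStruct.obj C) (Q := h.toStruct.obj D') _ _ fun x =>
      heq_of_eq (LaxHom.map_elPre_eId (x := f.obj x) (d := g.obj x) k (MonTrans.app η x)).symm

end StrictTwoFunctor

/-! ### Universal operations -/

section FullyFaithful

variable {E : Type u} [Category.{v} E] [MonoidalCategory E] [SymmetricCategory E]

lemma tensor_naturality_of_braiding {X Y Z X' Y' Z' : E} {k : Y ⟶ Y} {k' : Y' ⟶ Y'} (hk : k = 𝟙 Y)
    (hk' : k' = 𝟙 Y') {q : Y ⊗ X ⟶ Z} {q' : Y' ⊗ X' ⟶ Z'} {r : Z ⟶ Z'} {s : X ⟶ X'} {t : Y ⟶ Y'}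
    (h : ((β_ X Y).hom ≫ k ▷ X ≫ q) ≫ r = (s ⊗ₘ t) ≫ (β_ X' Y').hom ≫ k' ▷ X' ≫ q') :
    q ≫ r = (t ⊗ₘ s) ≫ q' := by
  subst hk hk'
  rw [BraidedCategory.braiding_naturality_assoc, Category.assoc, cancel_epi] at h
  simpa using h

lemma leftUnitor_inv_comp_braiding {X Y Z W : E} (b : 𝟙_ E ⟶ X) (k : Y ⟶ Z) (q : Z ⊗ X ⟶ W) :
    (λ_ Y).inv ≫ b ▷ Y ≫ (β_ X Y).hom ≫ k ▷ X ≫ q = k ≫ (ρ_ Z).inv ≫ Z ◁ b ≫ q := by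
  rw [BraidedCategory.braiding_naturality_left_assoc, whisker_exchange_assoc,
    rightUnitor_inv_naturality_assoc, braiding_tensorUnit_left]
  simp

lemma comp_comp_comp_assoc {X Y Z W V : E} (a : X ⟶ Y) (b : Y ⟶ Z) (c : Z ⟶ W) (d : W ⟶ V) :
    (a ≫ b ≫ c) ≫ d = a ≫ b ≫ c ≫ d := by
  simp only [Category.assoc]

lemma leftUnitor_inv_tensorHom {X Y X' Y' Z : E} (b : 𝟙_ E ⟶ X) (s : X ⟶ X') (t : Y ⟶ Y')
    (q : X' ⊗ Y' ⟶ Z) :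
    (λ_ Y).inv ≫ b ▷ Y ≫ (s ⊗ₘ t) ≫ q = t ≫ (λ_ Y').inv ≫ (b ≫ s) ▷ Y' ≫ q := by
  rw [leftUnitor_inv_naturality_assoc, MonoidalCategory.tensorHom_def, Category.assoc,
    comp_whiskerRight_assoc, whisker_exchange_assoc, whisker_exchange_assoc]

lemma rightUnitor_inv_tensorHom {X Y X' Y' Z : E} (b : 𝟙_ E ⟶ Y) (s : X ⟶ X') (t : Y ⟶ Y')
    (q : X' ⊗ Y' ⟶ Z) :
    (ρ_ X).inv ≫ X ◁ b ≫ (s ⊗ₘ t) ≫ q = s ≫ (ρ_ X').inv ≫ X' ◁ (b ≫ t) ≫ q := by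
  rw [rightUnitor_inv_naturality_assoc, tensorHom_def', Category.assoc,
    whiskerLeft_comp_assoc, ← whisker_exchange_assoc, ← whisker_exchange_assoc]

namespace OperadHom

variable {C D : SymMonECat.{v, u, w} E} (F : OperadHom (endData C) (endData D))

/-- A morphism of operads `End(C) ⟶ End(D)` on objects. -/
def ob (x : C.carrier) : D.carrier := F.onOb x

/-- A morphism of operads `End(C) ⟶ End(D)` on operations. -/
def mapN {n : ℕ} (c : Fin n → C.carrier) (d : C.carrier) :
    (C.tens c ⟶[E] d) ⟶ (D.tens (fun j => F.ob (c j)) ⟶[E] F.ob d) := F.map c d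

/-- The image of the universal operation `1 : ⨂ c ⟶ ⨂ c`. -/
def elN {n : ℕ} (c : Fin n → C.carrier) :
    𝟙_ E ⟶ (D.tens (fun j => F.ob (c j)) ⟶[E] F.ob (C.tens c)) :=
  eId E (C.tens c) ≫ F.mapN c (C.tens c)

/-- The enriched functor given by the unary operations. -/
def enrichedFunctor : EnrichedFunctor E C.carrier D.carrier where
  obj x := F.ob x
  map x y := F.mapN (fun _ : Fin 1 => x) y
  map_id x := F.isHom.map_unit x
  map_comp x y z := tensor_naturality_of_braiding
    (insertAt_one C (fun _ => y) (fun _ => x) (IsGraft.one_left y))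
    (insertAt_one D (fun _ => F.ob y) (fun _ => F.ob x) (IsGraft.one_left (F.ob y)))
    (F.isHom.map_comp (c := fun _ : Fin 1 => y) (e := fun _ : Fin 1 => x) (0 : Fin 1) (x := y) rfl
      (IsGraft.one_left y) z)

/-- A morphism of operads is determined by its values on unary operations and on the universal
operations: every operation is the substitution of a universal operation into a unary one. -/
lemma mapN_eq {n : ℕ} (c : Fin n → C.carrier) (d : C.carrier) :
    F.mapN c d = F.enrichedFunctor.map (C.tens c) d ≫ elPre (F.elN c) (F.ob d) := by
  have h := congrArg (fun a => (ρ_ (C.tens c ⟶[E] d)).inv ≫ _ ◁ eId E (C.tens c) ≫ a)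
    (F.isHom.map_comp (c := fun _ : Fin 1 => C.tens c) (e := c) (0 : Fin 1) (x := C.tens c) rfl
      (IsGraft.one_left _) d)
  have h1 := endData_comp_el C (c := fun _ : Fin 1 => C.tens c) 0 rfl (IsGraft.one_left (e := c)
      (C.tens c)) d
    (eId E (C.tens c))
  have h2 := endData_comp_el D (c := fun _ : Fin 1 => F.ob (C.tens c)) 0 rfl
    (IsGraft.one_left (e := fun j => F.ob (c j)) (F.ob (C.tens c))) (F.ob d) (F.elN c)
  have h3 := insertAt_one C (fun _ => C.tens c) c (IsGraft.one_left _)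
  have h4 := insertAt_one D (fun _ => F.ob (C.tens c)) (fun j => F.ob (c j)) (IsGraft.one_left _)
  have e1 : elPre (eId E (C.tens c) ≫ C.insertAt (c := fun _ : Fin 1 => C.tens c)
      0 rfl (IsGraft.one_left (e := c) (C.tens c))) d = 𝟙 _ :=
    (congrArg (fun a => elPre (C := C.carrier) (eId E (C.tens c) ≫ a) d) h3).trans
      ((congrArg (fun a => elPre (C := C.carrier) a d) (Category.comp_id _)).trans
        (elPre_id (C := C.carrier) _ _))
  have e2 : elPre (F.elN c ≫ D.insertAt (c := fun _ : Fin 1 => F.ob (C.tens c)) 0 rfl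
      (IsGraft.one_left (e := fun j => F.ob (c j)) (F.ob (C.tens c)))) (F.ob d) = elPre (F.elN c)
        (F.ob d) :=
    (congrArg (fun a => elPre (C := D.carrier) (F.elN c ≫ a) (F.ob d)) h4).trans
      (congrArg (fun a => elPre (C := D.carrier) a (F.ob d)) (Category.comp_id _))
  have h5 := rightUnitor_inv_tensorHom (eId E (C.tens c))
    (F.mapN (fun _ : Fin 1 => C.tens c) d) (F.mapN c (C.tens c))
    ((endData D).comp (c := fun _ : Fin 1 => F.ob (C.tens c)) 0 rfl
      (IsGraft.one_left (e := fun j => F.ob (c j)) (F.ob (C.tens c))) (F.ob d))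
  have l1 : F.mapN c d = (ρ_ (C.tens c ⟶[E] d)).inv ≫ _ ◁ eId E (C.tens c) ≫
      (endData C).comp (c := fun _ : Fin 1 => C.tens c) 0 rfl (IsGraft.one_left (e := c) (C.tens c))
        d ≫ F.mapN c d :=
    ((congrArg (· ≫ F.mapN c d) (h1.trans e1)).trans (Category.id_comp _)).symm.trans
      (comp_comp_comp_assoc _ _ _ _)
  exact l1.trans (h.trans (h5.trans (congrArg (F.enrichedFunctor.map (C.tens c) d ≫ ·)
      (h2.trans e2))))

/-- The substitution into a universal operation is an insertion, so that a morphism of operads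
commutes with insertions up to universal operations. -/
lemma insertAt_mapN {n m k : ℕ} {c : Fin n → C.carrier} {e : Fin m → C.carrier}
    {g : Fin k → C.carrier} (i : Fin n) {x : C.carrier} (hx : c i = x) (hg : IsGraft i c e g) :
    C.insertAt i hx hg ≫ F.mapN g (C.tens c) =
      F.mapN e x ≫ D.insertAt i (congrArg F.ob hx) (hg.map F.ob) ≫ elPost _ (F.elN c) := by
  have h := congrArg (fun a => (λ_ (C.tens e ⟶[E] x)).inv ≫ eId E (C.tens c) ▷ _ ≫ a)
    (F.isHom.map_comp (c := c) (e := e) i hx hg (C.tens c))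
  have h1 := leftUnitor_inv_comp_braiding (eId E (C.tens c)) (C.insertAt i hx hg)
    (eComp E (C.tens g) (C.tens c) (C.tens c))
  have h1' : C.insertAt i hx hg ≫ (ρ_ _).inv ≫ _ ◁ eId E (C.tens c) ≫ eComp E (C.tens g) (C.tens c)
      (C.tens c) = C.insertAt i hx hg := by
    rw [e_comp_id, Category.comp_id]
  have h2 := leftUnitor_inv_comp_braiding (F.elN c) (D.insertAt i (congrArg F.ob hx) (hg.map F.ob))
    (eComp E (D.tens (fun j => F.ob (g j))) (D.tens (fun j => F.ob (c j))) (F.ob (C.tens c)))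
  have h3 := leftUnitor_inv_tensorHom (eId E (C.tens c)) (F.mapN c (C.tens c)) (F.mapN e x)
    ((endData D).comp (c := fun j => F.ob (c j)) i (congrArg F.ob hx) (hg.map F.ob)
      (F.ob (C.tens c)))
  have l1 := congrArg (· ≫ F.mapN g (C.tens c)) (h1.trans h1').symm
  exact l1.trans ((comp_comp_comp_assoc _ _ _ _).trans
    (h.trans (h3.trans (congrArg (F.mapN e x ≫ ·) h2))))

/-- The previous formula, in terms of unary operations and universal operations only. -/
lemma insertAt_map {n m k : ℕ} {c : Fin n → C.carrier} {e : Fin m → C.carrier}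
    {g : Fin k → C.carrier} (i : Fin n) {x : C.carrier} (hx : c i = x) (hg : IsGraft i c e g) :
    C.insertAt i hx hg ≫ F.enrichedFunctor.map (C.tens g) (C.tens c) ≫ elPre (F.elN g) _ =
      F.enrichedFunctor.map (C.tens e) x ≫ elPre (F.elN e) _ ≫
        D.insertAt i (congrArg F.ob hx) (hg.map F.ob) ≫ elPost _ (F.elN c) :=
  (congrArg (C.insertAt i hx hg ≫ ·) (F.mapN_eq g (C.tens c))).symm.trans
    ((F.insertAt_mapN i hx hg).trans ((congrArg (· ≫ _) (F.mapN_eq e x)).trans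
      (Category.assoc _ _ _)))

end OperadHom

end FullyFaithful

/-! ### Substitution into universal operations -/

section LaxHomOfOperadHom

variable {E : Type u} [Category.{v} E] [MonoidalCategory E] [SymmetricCategory E]

namespace SymMonECat

variable (C : SymMonECat.{v, u, w} E) {O : Type w} (φ : O → C.carrier)

lemma insertAt_rfl {n m k : ℕ} (c : Fin n → C.carrier) (e : Fin m → C.carrier)
    (g : Fin k → C.carrier) (i : Fin n) (h : IsGraft i c e g) :
    C.insertAt i rfl h = C.insertHom c e g i h :=
  (congrArg (· ≫ C.insertHom c e g i h) (eqToHom_refl _ _)).trans (Category.id_comp _)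

lemma insertHom_zero {n m k : ℕ} (c : Fin (n + 2) → C.carrier) (e : Fin m → C.carrier)
    (g : Fin k → C.carrier) (h : IsGraft 0 c e g) (hk ha hb) :
    C.insertHom c e g 0 h = C.rW (C.tens fun j : Fin (n + 1) => c j.succ) (C.tens e) (c 0) ≫
      elPre (C.splitEl e (fun j : Fin (n + 1) => c j.succ) g hk ha hb) _ :=
  (C.rW_comp_eq _ _ _ _).symm

lemma isGraft_pair_one {m : ℕ} (x y : O) (e : Fin m → O) :
    IsGraft (1 : Fin 2) ![x, y] e (Fin.cons x e : Fin (m + 1) → O) where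
  length := by omega
  outer j p hp := by
    rcases hp with ⟨h, hp⟩ | ⟨h, hp⟩
    · obtain rfl : j = 0 := by omega
      obtain rfl : p = 0 := Fin.ext hp
      rfl
    · omega
  inner j p hp := by
    obtain rfl : p = j.succ := Fin.ext (by rw [hp]; simp; omega)
    rfl

lemma insertAt_pair_one {m : ℕ} (x y : O) (e : Fin m → O)
    (h : IsGraft (1 : Fin 2) (fun j => φ (![x, y] j)) (fun j => φ (e j))
      (fun j : Fin (m + 1) => φ ((Fin.cons x e : Fin (m + 1) → O) j))) :
    C.insertAt (1 : Fin 2) rfl h = C.lW (φ x) (C.tens fun j => φ (e j)) (φ y) ≫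
      elPre (C.unconsEl fun j : Fin (m + 1) => φ ((Fin.cons x e : Fin (m + 1) → O) j)) _ := by
  have h' : IsGraft (0 : Fin 1) (fun j : Fin 1 => φ (![x, y] j.succ)) (fun j => φ (e j))
      (fun j => φ (e j)) := by
    have := IsGraft.one_left (e := fun j => φ (e j)) (φ y)
    exact ⟨this.length, fun j p hp => by
      rcases hp with ⟨h, _⟩ | ⟨h, _⟩ <;> omega, this.inner⟩
  have h1 := _root_.insertHom_one C (fun j : Fin 1 => φ (![x, y] j.succ)) (fun j => φ (e j)) h'
  have h2 := C.insertHom_succ (fun j => φ (![x, y] j)) (fun j => φ (e j))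
    (fun j : Fin (m + 1) => φ ((Fin.cons x e : Fin (m + 1) → O) j)) 0 (by omega) h h' rfl
  have h3 : elPre (C.tEl (elOfEq (rfl : φ x = φ x)) (eId E (C.tens fun j => φ (e j))))
      (C.tObj (φ x) (φ y)) = 𝟙 _ := by
    rw [elOfEq_rfl, C.tEl_id, elPre_id]
  have h4 {X Y Z : E} {a : X ⟶ X} {b : X ⟶ Y} {c : Y ⟶ Y} {d : Y ⟶ Z} (ha : a = 𝟙 X)
      (hc : c = 𝟙 Y) : ((a ≫ b) ≫ c) ≫ d = b ≫ d := by
    rw [ha, hc, Category.id_comp, Category.comp_id]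
  exact (C.insertAt_rfl _ _ _ _ _).trans (h2.trans (h4 h1 h3))

lemma insertAt_pair_unary (x x' y : O)
    (h : IsGraft (0 : Fin 2) (fun j => φ (![x', y] j)) (fun _ : Fin 1 => φ x)
      (fun j => φ (![x, y] j))) :
    C.insertAt (0 : Fin 2) rfl h = C.rW (φ y) (φ x) (φ x') := by
  have h1 := C.insertHom_zero (fun j => φ (![x', y] j)) (fun _ : Fin 1 => φ x)
    (fun j => φ (![x, y] j)) h rfl (fun j p hp => h.inner j p (by simpa using hp))
    (fun j p hp => h.outer j.succ p (Or.inr ⟨Fin.succ_pos j, by simp; omega⟩))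
  have h2 := C.splitEl_one (fun _ : Fin 1 => φ x) (fun j : Fin 1 => φ (![x', y] j.succ))
    (fun j => φ (![x, y] j)) rfl (fun j p hp => h.inner j p (by simpa using hp))
    (fun j p hp => h.outer j.succ p (Or.inr ⟨Fin.succ_pos j, by simp; omega⟩)) rfl
  have h3 : elPre (elOfEq (E := E) (rfl : C.tObj (φ x) (φ y) = C.tObj (φ x) (φ y)))
      (C.tObj (φ x') (φ y)) = 𝟙 _ := by
    rw [elOfEq_rfl, elPre_id]
  exact (C.insertAt_rfl _ _ _ _ _).trans (h1.trans ((congrArg (fun a => _ ≫ elPre a _) h2).trans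
    ((congrArg (C.rW (φ y) (φ x) (φ x') ≫ ·) h3).trans (Category.comp_id _))))

/-- Splitting off two of three factors is the inverse associator. -/
lemma splitEl_pair (x y z o : O) (hk ha hb) :
    C.splitEl (fun j => φ (![x, y] j)) (fun j : Fin 1 => φ (![o, z] j.succ))
      (fun j => φ (![x, y, z] j)) hk ha hb =
      C.assocInv (φ x) (φ y) (φ z) := by
  have h1 := C.splitEl_one (fun j : Fin 1 => φ (![x, y] j.succ))
    (fun j : Fin 1 => φ (![o, z] j.succ))
    (fun j : Fin 2 => φ (![x, y, z] j.succ)) rfl (fun j p hp => ha j.succ p.succ (by simp [hp]))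
    (fun j p hp => hb j p.succ (by simp only [Fin.val_succ, hp]; omega)) rfl
  have h2 : C.tEl (elOfEq (E := E) (rfl : φ x = φ x))
      (elOfEq (rfl : C.tObj (φ y) (φ z) = C.tObj (φ y) (φ z))) =
    eId E _ := by rw [elOfEq_rfl, elOfEq_rfl, C.tEl_id]
  have h3 {a : 𝟙_ E ⟶ (C.tObj (φ x) (C.tObj (φ y) (φ z)) ⟶[E] C.tObj (φ x) (C.tObj (φ y) (φ z)))}
      (ha : a = eId E _) : elComp (eId E _) (elComp a (elComp (C.assocInv (φ x) (φ y) (φ z))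
        (C.tEl (eId E _) (eId E _)))) = C.assocInv (φ x) (φ y) (φ z) := by
    rw [ha, id_elComp, id_elComp, C.tEl_id, elComp_id]
  exact h3 ((congrArg (C.tEl (elOfEq (E := E) (rfl : φ x = φ x))) h1).trans h2)

lemma splitEl_zero (o y : O) (a : Fin 0 → C.carrier) (hk ha hb) :
    C.splitEl a (fun j : Fin 1 => φ (![o, y] j.succ)) (fun _ : Fin 1 => φ y) hk ha hb =
      C.lUnitInv (φ y) := by
  have h (k : φ y = φ y) : elComp (elOfEq k) (C.lUnitInv (φ y)) = C.lUnitInv (φ y) := by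
    rw [elOfEq_rfl, id_elComp]
  exact h _

lemma el_insertAt_zero {m k : ℕ} (o z : O) (e : Fin m → C.carrier) (g : Fin k → C.carrier)
    (h : IsGraft (0 : Fin 2) (fun j => φ (![o, z] j)) e g) (hk ha hb)
    (a : 𝟙_ E ⟶ (C.tens e ⟶[E] φ o)) :
    a ≫ C.insertAt (0 : Fin 2) rfl h =
      elComp (C.splitEl e (fun j : Fin 1 => φ (![o, z] j.succ)) g hk ha hb)
        (C.tEl a (eId E (φ z))) := by
  have h1 : a ≫ C.insertAt (0 : Fin 2) rfl h = a ≫ C.rW (φ z) (C.tens e) (φ o) ≫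
      elPre (C.splitEl e (fun j : Fin 1 => φ (![o, z] j.succ)) g hk ha hb) _ :=
    congrArg (a ≫ ·) ((C.insertAt_rfl _ _ _ _ _).trans (C.insertHom_zero _ _ _ h hk ha hb))
  have h2 {t : C.carrier} (b : 𝟙_ E ⟶ (t ⟶[E] C.tObj (C.tens e) (φ z))) :
      a ≫ C.rW (φ z) (C.tens e) (φ o) ≫ elPre b _ = elComp b (C.tEl a (eId E (φ z))) := by
    rw [← Category.assoc, el_rW, comp_elPre]
  exact h1.trans (h2 _)

open SymCoh in
lemma permEl_swap (x y : O) (h) :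
    C.permEl (fun j => φ (![y, x] j)) (fun j => φ (![x, y] j)) (Equiv.swap 0 1) h =
      C.comm (φ x) (φ y) := by
  have h1 := isCan_permEl (x := ((fun j => φ (![y, x] j)) : Fin 2 → C.Und))
    (fun j => φ (![y, x] j)) (fun j => φ (![x, y] j)) (Equiv.swap 0 1) h (fun j => j) ![1, 0]
    (fun _ => rfl) (fun j => by fin_cases j <;> rfl) (fun _ _ h => h)
    (fun j => by fin_cases j <;> rfl)
  refine IsCan.eq (V := C.Und) h1 ?_
  exact IsCan.braiding (V := C.Und) (x := ((fun j => φ (![y, x] j)) : Fin 2 → C.Und))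
      (Rep.leaf 1 rfl)
    (Rep.leaf 0 rfl) (fun a ha hb => by
      simp only [Rep.labels, List.mem_singleton] at ha hb
      rw [ha] at hb
      exact absurd hb (by decide))

end SymMonECat

namespace OperadHom

variable {C D : SymMonECat.{v, u, w} E} (F : OperadHom (endData C) (endData D))

lemma elN_unary (x : C.carrier) : F.elN (fun _ : Fin 1 => x) = eId E (F.ob x) :=
  F.isHom.map_unit x

/-- The substitution of a universal operation into a universal operation. -/
lemma elN_graft {n m k : ℕ} {c : Fin n → C.carrier} {e : Fin m → C.carrier}
    {g : Fin k → C.carrier} (i : Fin n) (hx : c i = C.tens e) (hg : IsGraft i c e g) :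
    elComp (F.elN g) ((eId E (C.tens e) ≫ C.insertAt i hx hg) ≫
        F.enrichedFunctor.map (C.tens g) (C.tens c)) =
      elComp (F.elN e ≫ D.insertAt i (congrArg F.ob hx) (hg.map F.ob)) (F.elN c) := by
  have h := congrArg (eId E (C.tens e) ≫ ·) (F.insertAt_map i hx hg)
  have h1 {X Y : E} {a : 𝟙_ E ⟶ X} {t : X ⟶ Y} {p q r : D.carrier} {k : Y ⟶ (q ⟶[E] r)}
      {b : 𝟙_ E ⟶ (p ⟶[E] q)} : a ≫ t ≫ k ≫ elPre b _ = elComp b ((a ≫ t) ≫ k) := by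
    rw [← comp_elPre, Category.assoc, Category.assoc]
  have h2 {o o' p p' q : D.carrier} {b : 𝟙_ E ⟶ (o ⟶[E] o')}
      {t : (o ⟶[E] o') ⟶ (p ⟶[E] p')} {r : 𝟙_ E ⟶ (p' ⟶[E] q)} :
      eId E o' ≫ elPre b _ ≫ t ≫ elPost p r = elComp (b ≫ t) r := by
    rw [← Category.assoc, comp_elPre, elComp_id, ← comp_elPost, Category.assoc]
  have h3 : eId E (C.tens e) ≫ F.enrichedFunctor.map (C.tens e) (C.tens e) =
    eId E (F.ob (C.tens e)) := F.enrichedFunctor.map_id _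
  exact h1.symm.trans (h.trans ((Category.assoc _ _ _).symm.trans
    ((congrArg (· ≫ _) h3).trans h2)))

end OperadHom

lemma elComp_of_conj {C : Type w} [EnrichedCategory E C] {D : Type w} [EnrichedCategory E D]
    (F : EnrichedFunctor E C D) {p q r : D} {o o' : C} {u : 𝟙_ E ⟶ (p ⟶[E] F.obj o)}
    {t' : 𝟙_ E ⟶ (o ⟶[E] o')} {t : 𝟙_ E ⟶ (o' ⟶[E] o)} {s' : 𝟙_ E ⟶ (p ⟶[E] q)}
    {s : 𝟙_ E ⟶ (q ⟶[E] p)} {a : 𝟙_ E ⟶ (q ⟶[E] r)} {b : 𝟙_ E ⟶ (r ⟶[E] F.obj o')}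
    (h : elComp u (t' ≫ F.map _ _) = elComp (elComp s' a) b) (hs : elComp s s' = eId E q)
    (ht : elComp t' t = eId E o) : elComp a (elComp b (t ≫ F.map _ _)) = elComp s u := by
  have h1 : elComp a b = elComp s (elComp u (t' ≫ F.map _ _)) := by
    rw [h, ← elComp_assoc, ← elComp_assoc, hs, id_elComp]
  rw [← elComp_assoc, h1, elComp_assoc, elComp_assoc, ← elComp_map, ht, F.map_id, elComp_id]

namespace OperadHom

variable {C D : SymMonECat.{v, u, w} E} (F : OperadHom (endData C) (endData D))

/-- Substitution of a universal operation into the second input of the universal binary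
operation. -/
lemma elN_cons {m : ℕ} (x : C.carrier) (e : Fin m → C.carrier) :
    elComp (F.elN (Fin.cons x e : Fin (m + 1) → C.carrier))
        (C.unconsEl (Fin.cons x e : Fin (m + 1) → C.carrier) ≫ F.enrichedFunctor.map _ _) =
      elComp (elComp (D.unconsEl fun j : Fin (m + 1) =>
        F.ob ((Fin.cons x e : Fin (m + 1) → C.carrier) j))
        (D.tEl (eId E (F.ob x)) (F.elN e))) (F.elN ![x, C.tens e]) := by
  have h := F.elN_graft (c := ![x, C.tens e]) 1 rfl (SymMonECat.isGraft_pair_one x (C.tens e) e)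
  have h1 := C.insertAt_pair_one (fun x => x) x (C.tens e) e
    (SymMonECat.isGraft_pair_one x (C.tens e) e)
  have h2 := D.insertAt_pair_one F.ob x (C.tens e) e
    ((SymMonECat.isGraft_pair_one x (C.tens e) e).map F.ob)
  have h3 {K : SymMonECat.{v, u, w} E} {x y z t : K.carrier} (a : 𝟙_ E ⟶ (y ⟶[E] z))
      (b : 𝟙_ E ⟶ (t ⟶[E] K.tObj x y)) :
      a ≫ K.lW x y z ≫ elPre b _ = elComp b (K.tEl (eId E x) a) := by
    rw [← Category.assoc, SymMonECat.el_lW, comp_elPre]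
  have h4 := (congrArg (eId E (C.tens e) ≫ ·) h1).trans (h3 _ _)
  have h5 := (congrArg (F.elN e ≫ ·) h2).trans (h3 _ _)
  have h6 {K : SymMonECat.{v, u, w} E} {x y t : K.carrier} (b : 𝟙_ E ⟶ (t ⟶[E] K.tObj x y)) :
      elComp b (K.tEl (eId E x) (eId E y)) = b := by
    rw [K.tEl_id, elComp_id]
  exact (congrArg (fun a => elComp (F.elN (Fin.cons x e : Fin (m + 1) → C.carrier))
    (a ≫ F.enrichedFunctor.map _ _)) (h4.trans (h6 _)).symm).trans (h.trans
      (congrArg (fun a => elComp a (F.elN ![x, C.tens e])) h5))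

end OperadHom

end LaxHomOfOperadHom

/-! ### The lax symmetric monoidal functor of a morphism of operads -/

section ToLaxHom

variable {E : Type u} [Category.{v} E] [MonoidalCategory E] [SymmetricCategory E]

/-- Naturality up to elements is compatible with composition. -/
lemma comp_natural_of_elPost {C : Type w} [EnrichedCategory E C] {D : Type w}
    [EnrichedCategory E D] (F : EnrichedFunctor E C D) {X X' Y Y' : E} {p p' p'' : C}
    {q q' q'' : D} {a : X ⟶ (p ⟶[E] p')} {b : Y ⟶ (p' ⟶[E] p'')} {a' : X' ⟶ (q ⟶[E] q')}
    {b' : Y' ⟶ (q' ⟶[E] q'')} {s : X ⟶ X'} {t : Y ⟶ Y'} {m : 𝟙_ E ⟶ (q ⟶[E] F.obj p)}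
    {m' : 𝟙_ E ⟶ (q' ⟶[E] F.obj p')} {m'' : 𝟙_ E ⟶ (q'' ⟶[E] F.obj p'')}
    (ha : a ≫ F.map _ _ ≫ elPre m _ = s ≫ a' ≫ elPost _ m')
    (hb : b ≫ F.map _ _ ≫ elPre m' _ = t ≫ b' ≫ elPost _ m'') :
    ((a ⊗ₘ b) ≫ eComp E _ _ _) ≫ F.map _ _ ≫ elPre m _ =
      (s ⊗ₘ t) ≫ ((a' ⊗ₘ b') ≫ eComp E _ _ _) ≫ elPost _ m'' := by
  have h1 : ((a ⊗ₘ b) ≫ eComp E _ _ _) ≫ F.map _ _ ≫ elPre m _ =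
      ((a ≫ F.map _ _ ≫ elPre m _) ⊗ₘ (b ≫ F.map _ _)) ≫ eComp E _ _ _ := by
    rw [Category.assoc, EnrichedFunctor.map_comp_assoc, ← elPre_comp,
      tensorHom_comp_tensorHom_assoc, ← tensorHom_id, tensorHom_comp_tensorHom_assoc,
      Category.comp_id, Category.assoc]
  have h2 : ((s ≫ a' ≫ elPost _ m') ⊗ₘ (b ≫ F.map _ _)) ≫ eComp E _ _ _ =
      ((s ≫ a') ⊗ₘ (b ≫ F.map _ _ ≫ elPre m' _)) ≫ eComp E _ _ _ := by
    rw [← Category.assoc s, ← Category.comp_id (b ≫ F.map _ _), ← tensorHom_comp_tensorHom_assoc,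
      tensorHom_id, elPost_elPre_comp, ← id_tensorHom, tensorHom_comp_tensorHom_assoc,
      Category.comp_id, Category.assoc]
  rw [h1, ha, h2, hb, ← Category.assoc t, ← Category.comp_id (s ≫ a'),
    ← tensorHom_comp_tensorHom_assoc, id_tensorHom, elPost_comp,
    ← tensorHom_comp_tensorHom_assoc, Category.assoc]

namespace OperadHom

variable {C D : SymMonECat.{v, u, w} E} (F : OperadHom (endData C) (endData D))

lemma elN_one (c : Fin 1 → C.carrier) : F.elN c = eId E (F.ob (c 0)) := by
  obtain ⟨x, rfl⟩ : ∃ x, c = fun _ => x :=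
    ⟨c 0, funext fun j => congrArg c (Subsingleton.elim _ _)⟩
  exact F.elN_unary x

/-- The structural maps of the lax symmetric monoidal functor given by a morphism of operads. -/
def mu₂ (x y : C.carrier) :
    𝟙_ E ⟶ (D.tObj (F.ob x) (F.ob y) ⟶[E] F.ob (C.tObj x y)) :=
  F.elN ![x, y]

/-- The structural map at the unit object given by a morphism of operads. -/
def eps₀ : 𝟙_ E ⟶ (D.one ⟶[E] F.ob C.one) := F.elN ![]

/-- The functor given by the unary operations, on mapping objects. -/
def map₁ (x y : C.carrier) : (x ⟶[E] y) ⟶ (F.ob x ⟶[E] F.ob y) := F.enrichedFunctor.map x y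

/-- The image of the universal operation of a list is determined by those of the universal binary
operations. -/
lemma elN_cons_succ {m : ℕ} (x : C.carrier) (e : Fin (m + 1) → C.carrier) :
    F.elN (Fin.cons x e : Fin (m + 2) → C.carrier) =
      elComp (D.tEl (eId E (F.ob x)) (F.elN e)) (F.mu₂ x (C.tens e)) := by
  have h1 {a : D.carrier} {o : C.carrier} (u : 𝟙_ E ⟶ (a ⟶[E] F.enrichedFunctor.obj o)) :
      elComp u (eId E o ≫ F.enrichedFunctor.map o o) = u := by
    rw [F.enrichedFunctor.map_id, elComp_id]
  have h2 {a b r : D.carrier} (p : 𝟙_ E ⟶ (a ⟶[E] b)) (q : 𝟙_ E ⟶ (b ⟶[E] r)) :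
      elComp (elComp (eId E a) p) q = elComp p q := by
    rw [id_elComp]
  exact (h1 _).symm.trans ((F.elN_cons x e).trans (h2 _ _))

lemma map₁_rW (x x' y : C.carrier) :
    C.rW y x x' ≫ F.map₁ _ _ ≫ elPre (F.mu₂ x y) _ =
      F.map₁ x x' ≫ D.rW (F.ob y) _ _ ≫ elPost _ (F.mu₂ x' y) := by
  have hg : IsGraft (0 : Fin 2) ![x', y] (fun _ : Fin 1 => x) ![x, y] :=
    IsGraft.one_right (fun j hj => by fin_cases j; exacts [absurd rfl hj, rfl]) rfl
  have h := F.insertAt_map (c := ![x', y]) 0 rfl hg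
  have h1 := C.insertAt_pair_unary (fun x => x) x x' y hg
  have h2 := D.insertAt_pair_unary F.ob x x' y (hg.map F.ob)
  have h3 : elPre (F.elN (fun _ : Fin 1 => x)) (F.ob x') = 𝟙 _ :=
    (congrArg (fun a => elPre (C := D.carrier) a (F.ob x')) (F.elN_unary x)).trans (elPre_id _ _)
  have h4 {X Y Z W : E} {a : X ⟶ Y} {b : Y ⟶ Y} {c c' : Y ⟶ Z} {d : Z ⟶ W} (hb : b = 𝟙 Y)
      (hc : c = c') : a ≫ b ≫ c ≫ d = a ≫ c' ≫ d := by
    rw [hb, hc, Category.id_comp]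
  exact (congrArg (· ≫ _) h1).symm.trans (h.trans (h4 h3 h2))

lemma map₁_lW (x y y' : C.carrier) :
    C.lW x y y' ≫ F.map₁ _ _ ≫ elPre (F.mu₂ x y) _ =
      F.map₁ y y' ≫ D.lW (F.ob x) _ _ ≫ elPost _ (F.mu₂ x y') := by
  have hg := SymMonECat.isGraft_pair_one x y' ![y]
  have h := F.insertAt_map (c := ![x, y']) 1 rfl hg
  have h1 := C.insertAt_pair_one (fun x => x) x y' ![y] hg
  have h2 := D.insertAt_pair_one F.ob x y' ![y] (hg.map F.ob)
  have h3 : elPre (F.elN ![y]) (F.ob y') = 𝟙 _ :=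
    (congrArg (fun a => elPre (C := D.carrier) a (F.ob y')) (F.elN_one ![y])).trans (elPre_id _ _)
  have h4 {X Y Z W : E} {a : X ⟶ Y} {b : Y ⟶ Y} {c c' : Y ⟶ Z} {d : Z ⟶ W} (hb : b = 𝟙 Y)
      (hc : c = c') : a ≫ b ≫ c ≫ d = a ≫ c' ≫ d := by
    rw [hb, hc, Category.id_comp]
  have h5 {K : SymMonECat.{v, u, w} E} (x y y' : K.carrier) :
      K.lW x y y' ≫ elPre (eId E _) _ = K.lW x y y' := by
    rw [elPre_id, Category.comp_id]
  have h6 : F.elN (Fin.cons x ![y] : Fin 2 → C.carrier) = F.mu₂ x y := rfl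
  exact (congr (congrArg CategoryStruct.comp (h1.trans (h5 x y y')))
    (congrArg (fun a => F.map₁ _ _ ≫ elPre (C := D.carrier) a _) h6)).symm.trans
      (h.trans (h4 h3 (h2.trans (h5 _ _ _))))


lemma isGraft_pair_zero (x y z o : C.carrier) : IsGraft (0 : Fin 2) ![o, z] ![x, y] ![x, y, z] where
  length := rfl
  outer j p hp := by
    rcases hp with ⟨h, hp⟩ | ⟨h, hp⟩
    · exact absurd h (Fin.not_lt_zero j)
    · obtain rfl : j = 1 := by omega
      obtain rfl : p = 2 := Fin.ext (by simpa using hp)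
      rfl
  inner j p hp := by
    obtain rfl : p = j.castSucc := Fin.ext (by simpa using hp)
    fin_cases j <;> rfl

lemma isGraft_nil_zero (x o : C.carrier) :
    IsGraft (0 : Fin 2) ![o, x] (![] : Fin 0 → C.carrier) (fun _ : Fin 1 => x) where
  length := rfl
  outer j p hp := by
    rcases hp with ⟨h, hp⟩ | ⟨h, hp⟩
    · exact absurd h (Fin.not_lt_zero j)
    · obtain rfl : j = 1 := by omega
      rfl
  inner j := j.elim0

/-- The structural maps are natural in both variables, since they are natural in each one. -/
lemma map₁_tHom (x x' y y' : C.carrier) :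
    (F.map₁ x x' ⊗ₘ F.map₁ y y') ≫ D.tHom _ _ _ _ ≫ elPost _ (F.mu₂ x' y') =
      C.tHom x x' y y' ≫ F.map₁ _ _ ≫ elPre (F.mu₂ x y) _ := by
  have h := comp_natural_of_elPost F.enrichedFunctor (F.map₁_rW x x' y) (F.map₁_lW x' y y')
  have h1 := C.rW_lW_comp x x' y y'
  have h2 := D.rW_lW_comp (F.ob x) (F.ob x') (F.ob y) (F.ob y')
  exact (congrArg (fun a => (F.map₁ x x' ⊗ₘ F.map₁ y y') ≫ a ≫ elPost _ (F.mu₂ x' y'))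
      h2).symm.trans
    (h.symm.trans (congrArg (fun a => a ≫ F.map₁ _ _ ≫ elPre (F.mu₂ x y) _) h1))

/-- Both sides are given by the image of the universal ternary operation, which is a substitution of
binary ones in two ways. -/
lemma mu₂_assoc (x y z : C.carrier) :
    elComp (D.tEl (F.mu₂ x y) (eId E (F.ob z)))
        (elComp (F.mu₂ (C.tObj x y) z) (C.assoc x y z ≫ F.map₁ _ _)) =
      elComp (D.assoc _ _ _) (elComp (D.tEl (eId E (F.ob x)) (F.mu₂ y z))
        (F.mu₂ x (C.tObj y z))) := by
  have hg := isGraft_pair_zero x y z (C.tObj x y)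
  have h := F.elN_graft (c := ![C.tObj x y, z]) (e := ![x, y]) (g := ![x, y, z]) 0 rfl hg
  have h3 {K : SymMonECat.{v, u, w} E} {x y t : K.carrier} (b : 𝟙_ E ⟶ (t ⟶[E] K.tObj x y)) :
      elComp b (K.tEl (eId E x) (eId E y)) = b := by
    rw [K.tEl_id, elComp_id]
  have ha : ∀ (j : Fin 2) (p : Fin 3), p.val = j.val →
      (![x, y, z] : Fin 3 → C.carrier) p = ![x, y] j := fun j p hp =>
        hg.inner j p (by simpa using hp)
  have hb : ∀ (j : Fin 1) (p : Fin 3), p.val = 2 + j.val →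
      (![x, y, z] : Fin 3 → C.carrier) p = ![C.tObj x y, z] j.succ := fun j p hp =>
    hg.outer j.succ p (Or.inr ⟨Fin.succ_pos j, by simp; omega⟩)
  have h1 : eId E (C.tens ![x, y]) ≫ C.insertAt 0 rfl hg = C.assocInv x y z :=
    (C.el_insertAt_zero (fun x => x) (C.tObj x y) z ![x, y] ![x, y, z] hg rfl ha hb _).trans
      ((h3 _).trans (C.splitEl_pair (fun x => x) x y z _ rfl ha hb))
  have h2 : F.elN ![x, y] ≫ D.insertAt 0 rfl (hg.map F.ob) =
      elComp (D.assocInv (F.ob x) (F.ob y) (F.ob z)) (D.tEl (F.mu₂ x y) (eId E (F.ob z))) :=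
    (D.el_insertAt_zero F.ob (C.tObj x y) z (fun j => F.ob (![x, y] j))
      (fun j => F.ob (![x, y, z] j)) (hg.map F.ob) rfl (fun j p hp => congrArg F.ob (ha j p hp))
      (fun j p hp => congrArg F.ob (hb j p hp)) _).trans
      (congrArg (fun a => elComp a (D.tEl (F.mu₂ x y) (eId E (F.ob z))))
        (D.splitEl_pair F.ob x y z _ rfl _ _))
  have h4 : elComp (F.elN ![x, y, z]) (C.assocInv x y z ≫ F.enrichedFunctor.map _ _) =
      elComp (elComp (D.assocInv (F.ob x) (F.ob y) (F.ob z))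
        (D.tEl (F.mu₂ x y) (eId E (F.ob z)))) (F.mu₂ (C.tObj x y) z) :=
    (congrArg (fun a => elComp (F.elN ![x, y, z]) (a ≫ F.enrichedFunctor.map _ _)) h1).symm.trans
      (h.trans (congrArg (fun a => elComp a (F.mu₂ (C.tObj x y) z)) h2))
  have h5 := elComp_of_conj F.enrichedFunctor h4 (D.assoc_assocInv _ _ _) (C.assocInv_assoc x y z)
  exact h5.trans (congrArg (elComp (D.assoc _ _ _)) (F.elN_cons_succ x ![y, z]))

/-- The identity is the substitution of the universal nullary operation into the universal binary
one, in the first place. -/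
lemma mu₂_lUnit (x : C.carrier) :
    elComp (D.tEl F.eps₀ (eId E (F.ob x))) (elComp (F.mu₂ C.one x) (C.lUnit x ≫ F.map₁ _ _)) =
      D.lUnit (F.ob x) := by
  have hg := isGraft_nil_zero x C.one
  have h := F.elN_graft (c := ![C.one, x]) (e := ![]) (g := fun _ : Fin 1 => x) 0 rfl hg
  have h3 {K : SymMonECat.{v, u, w} E} {x y t : K.carrier} (b : 𝟙_ E ⟶ (t ⟶[E] K.tObj x y)) :
      elComp b (K.tEl (eId E x) (eId E y)) = b := by
    rw [K.tEl_id, elComp_id]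
  have h1 : eId E (C.tens ![]) ≫ C.insertAt 0 rfl hg = C.lUnitInv x :=
    (C.el_insertAt_zero (fun x => x) C.one x ![] (fun _ : Fin 1 => x) hg rfl (fun j => j.elim0)
      (fun j p hp => hg.outer j.succ p (Or.inr ⟨Fin.succ_pos j, by simp⟩)) _).trans
      ((h3 _).trans (C.splitEl_zero (fun x => x) C.one x ![] rfl _ _))
  have h2 : F.elN ![] ≫ D.insertAt 0 rfl (hg.map F.ob) =
      elComp (D.lUnitInv (F.ob x)) (D.tEl F.eps₀ (eId E (F.ob x))) :=
    (D.el_insertAt_zero F.ob C.one x (fun j => F.ob ((![] : Fin 0 → C.carrier) j))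
      (fun _ : Fin 1 => F.ob x) (hg.map F.ob) rfl (fun j => j.elim0)
      (fun j p hp => (hg.map F.ob).outer j.succ p (Or.inr ⟨Fin.succ_pos j, by simp⟩)) _).trans
      (congrArg (fun a => elComp a (D.tEl F.eps₀ (eId E (F.ob x))))
        (D.splitEl_zero F.ob C.one x _ rfl _ _))
  have h4 : elComp (eId E (F.ob x)) (C.lUnitInv x ≫ F.enrichedFunctor.map _ _) =
      elComp (elComp (D.lUnitInv (F.ob x)) (D.tEl F.eps₀ (eId E (F.ob x)))) (F.mu₂ C.one x) :=
    (congr (congrArg (fun u a => elComp u (a ≫ F.enrichedFunctor.map x (C.tObj C.one x)))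
      (F.elN_unary x)) h1).symm.trans
      (h.trans (congrArg (fun a => elComp a (F.mu₂ C.one x)) h2))
  exact (elComp_of_conj F.enrichedFunctor h4 (D.lUnit_lUnitInv (F.ob x))
    (C.lUnitInv_lUnit x)).trans (elComp_id _)

lemma mu₂_rUnit (x : C.carrier) :
    elComp (D.tEl (eId E (F.ob x)) F.eps₀) (elComp (F.mu₂ x C.one) (C.rUnit x ≫ F.map₁ _ _)) =
      D.rUnit (F.ob x) := by
  have h := F.elN_cons x ![]
  have h1 := F.elN_one (Fin.cons x ![])
  have h2 : elComp (eId E (F.ob x)) (C.rUnitInv x ≫ F.enrichedFunctor.map x (C.tObj x C.one)) =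
      elComp (elComp (D.rUnitInv (F.ob x)) (D.tEl (eId E (F.ob x)) F.eps₀)) (F.mu₂ x C.one) :=
    (congrArg (fun a => elComp (C := D.carrier) a (C.rUnitInv x ≫ F.map₁ _ _)) h1).symm.trans h
  exact (elComp_of_conj F.enrichedFunctor h2 (D.rUnit_rUnitInv (F.ob x))
    (C.rUnitInv_rUnit x)).trans (elComp_id _)

/-- The equivariance with respect to the transposition of a universal binary operation. -/
lemma mu₂_comm (x y : C.carrier) :
    elComp (F.mu₂ x y) (C.comm x y ≫ F.map₁ _ _) = elComp (D.comm _ _) (F.mu₂ y x) := by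
  have hs : ∀ i, (![x, y] : Fin 2 → C.carrier) i = ![y, x] (Equiv.swap 0 1 i) := fun i => by
    fin_cases i <;> rfl
  have h := congrArg (eId E (C.tens ![y, x]) ≫ ·)
    (F.isHom.map_act (c := ![y, x]) (c' := ![x, y]) (Equiv.swap 0 1) hs (C.tens ![y, x]))
  have h1 : eId E (C.tObj y x) ≫ elPre (C.permEl ![y, x] ![x, y] (Equiv.swap 0 1) hs) (C.tObj y x) =
      C.comm x y :=
    (_root_.comp_elPre _ _).trans ((elComp_id _).trans (C.permEl_swap (fun x => x) x y hs))
  have h2 : F.elN ![y, x] ≫ elPre (D.permEl (fun j => F.ob (![y, x] j)) (fun j => F.ob (![x, y] j))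
      (Equiv.swap 0 1) fun i => congrArg F.ob (hs i)) (F.ob (C.tObj y x)) =
        elComp (D.comm _ _) (F.mu₂ y x) :=
    (_root_.comp_elPre _ _).trans (congrArg (fun a => elComp a (F.mu₂ y x))
      (D.permEl_swap F.ob x y _))
  have h3 : C.comm x y ≫ F.mapN ![x, y] (C.tObj y x) =
      elComp (F.mu₂ x y) (C.comm x y ≫ F.map₁ _ _) :=
    (congrArg (C.comm x y ≫ ·) (F.mapN_eq ![x, y] (C.tObj y x))).trans
      ((Category.assoc _ _ _).symm.trans (_root_.comp_elPre _ _))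
  exact h3.symm.trans ((congrArg (· ≫ F.mapN ![x, y] (C.tObj y x)) h1).symm.trans
    ((Category.assoc _ _ _).trans (h.trans ((Category.assoc _ _ _).symm.trans h2))))

/-- The lax symmetric monoidal functor given by a morphism between operads `End`. -/
def toLaxHom : LaxHom C D where
  toEnrichedFunctor := F.enrichedFunctor
  mu := F.mu₂
  eps := F.eps₀
  mu_natural := F.map₁_tHom
  mu_assoc := F.mu₂_assoc
  mu_lUnit := F.mu₂_lUnit
  mu_rUnit := F.mu₂_rUnit
  mu_comm := F.mu₂_comm

/-- The iterated structural maps are the images of the universal operations. -/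
lemma muN_toLaxHom : ∀ {n : ℕ} (c : Fin n → C.carrier), F.toLaxHom.muN c = F.elN c
  | 0, c => by
    obtain rfl : c = ![] := Subsingleton.elim _ _
    rfl
  | 1, c => (F.elN_one c).symm
  | n + 2, c => by
    obtain ⟨x, e, rfl⟩ : ∃ (x : C.carrier) (e : Fin (n + 1) → C.carrier), c = Fin.cons x e :=
      ⟨c 0, Fin.tail c, (Fin.cons_self_tail c).symm⟩
    exact (congrArg (fun a => elComp (D.tEl (eId E (F.ob x)) a) (F.mu₂ x (C.tens e)))
      (muN_toLaxHom e)).trans (F.elN_cons_succ x e).symm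

end OperadHom

end ToLaxHom

/-! ### Full faithfulness -/

section StrictlyFullyFaithful

variable {E : Type u} [Category.{v} E] [MonoidalCategory E] [SymmetricCategory E]

namespace LaxHom

variable {C D : SymMonECat.{v, u, w} E} (f g : LaxHom C D)

lemma muN_pair (x y : C.carrier) : f.muN ![x, y] = f.mu x y := by
  have h {K : SymMonECat.{v, u, w} E} {x y t : K.carrier} (b : 𝟙_ E ⟶ (K.tObj x y ⟶[E] t)) :
      elComp (K.tEl (eId E x) (eId E y)) b = b := by
    rw [K.tEl_id, id_elComp]
  exact h _

/-- The universal operations are mapped to the iterated structural maps. -/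
lemma eId_endHomData_map {n : ℕ} (c : Fin n → C.carrier) :
    eId E (C.tens c) ≫ (endHomData f).map c (C.tens c) = f.muN c := by
  have h : eId E (C.tens c) ≫ f.map _ _ ≫ elPre (f.muN c) _ = f.muN c := by
    rw [EnrichedFunctor.map_id_assoc, comp_elPre, elComp_id]
  exact h

lemma endHomData_map_unary (x y : C.carrier) :
    (endHomData f).map (fun _ : Fin 1 => x) y = f.map x y := by
  have h : f.map x y ≫ elPre (eId E (f.obj x)) _ = f.map x y := by
    rw [elPre_id, Category.comp_id]
  exact h

lemma toLaxHom_endHomData (h : (endHomData f).IsHom) :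
    OperadHom.toLaxHom ⟨endHomData f, h⟩ = f :=
  LaxHom.ext_of rfl (heq_of_eq (by funext x y; exact f.endHomData_map_unary x y))
    (heq_of_eq (by funext x y; exact (f.eId_endHomData_map ![x, y]).trans (f.muN_pair x y)))
    (heq_of_eq (f.eId_endHomData_map ![]))

end LaxHom

lemma OperadHom.endHomData_toLaxHom {C D : SymMonECat.{v, u, w} E}
    (F : OperadHom (endData C) (endData D)) (h : (endHomData F.toLaxHom).IsHom) :
    OperadHom.mk (endHomData F.toLaxHom) h = F :=
  OperadHom.ext_of rfl (heq_of_eq (by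
    funext n c d
    exact (congrArg (fun a => F.enrichedFunctor.map (C.tens c) d ≫ elPre (C := D.carrier)
        a (F.ob d))
      (F.muN_toLaxHom c)).trans (F.mapN_eq c d).symm))

section Transformations

variable {C D : SymMonECat.{v, u, w} E} {f g : LaxHom C D}
  {app : ∀ x : C.carrier, 𝟙_ E ⟶ (f.obj x ⟶[E] g.obj x)}

/-- The naturality of a transformation with respect to the universal operations. -/
lemma muN_app_of_isOperadTrans (h : IsOperadTrans (endHomData f) (endHomData g) app) {n : ℕ}
    (c : Fin n → C.carrier) :
    elComp (f.muN c) (app (C.tens c)) = elComp (D.tensEl (fun j => app (c j))) (g.muN c) := by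
  have h1 := congrArg (eId E (C.tens c) ≫ ·) (h c (C.tens c))
  have h2 := endData_el_comp D (fun j => f.obj (c j)) (app (C.tens c))
  have h3 := endData_pre D (fun j => app (c j)) (g.obj (C.tens c))
  have h4 := (Category.assoc _ _ _).trans h1
  have h5 := (congr (congrArg CategoryStruct.comp (f.eId_endHomData_map c)) h2).symm.trans
    (h4.trans ((Category.assoc _ _ _).symm.trans
      (congr (congrArg CategoryStruct.comp (g.eId_endHomData_map c)) h3)))
  exact (comp_elPost _ _).symm.trans (h5.trans (comp_elPre _ _))

lemma natural_of_isOperadTrans (h : IsOperadTrans (endHomData f) (endHomData g) app)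
    (x y : C.carrier) :
    f.map x y ≫ elPost (f.obj x) (app y) = g.map x y ≫ elPre (app x) (g.obj y) := by
  have h1 := h (fun _ : Fin 1 => x) y
  have h2 := endData_el_comp D (fun _ : Fin 1 => f.obj x) (app y)
  have h3 := endData_pre D (fun _ : Fin 1 => app x) (g.obj y)
  exact (congr (congrArg CategoryStruct.comp (f.endHomData_map_unary x y)) h2).symm.trans
    (h1.trans (congr (congrArg CategoryStruct.comp (g.endHomData_map_unary x y)) h3))

/-- A natural transformation between morphisms of operads is a monoidal transformation. -/
def monTransOfIsOperadTrans (h : IsOperadTrans (endHomData f) (endHomData g) app) :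
    MonTrans f g where
  app := app
  natural := natural_of_isOperadTrans h
  app_tensor x y := (congrArg (fun a => elComp a (app (C.tObj x y))) (f.muN_pair x y)).symm.trans
    ((muN_app_of_isOperadTrans h ![x, y]).trans (congrArg (elComp _) (g.muN_pair x y)))
  app_one := (muN_app_of_isOperadTrans h ![]).trans (id_elComp _)

end Transformations

/-- The inverse of `End` on 1-morphisms is `OperadHom.toLaxHom`, and on 2-morphisms the naturality
with respect to all operations says the same as that of a monoidal transformation. -/
lemma EndWellDefined.isStrictlyFullyFaithful (h : EndWellDefined.{v, u, w} E) :
    IsStrictlyFullyFaithful h.toStruct := fun C D =>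
  ⟨⟨fun f g k => (LaxHom.toLaxHom_endHomData f (h.map f)).symm.trans
      ((congrArg OperadHom.toLaxHom k).trans (LaxHom.toLaxHom_endHomData g (h.map g))),
    fun F => ⟨OperadHom.toLaxHom F, OperadHom.endHomData_toLaxHom F (h.map _)⟩⟩,
  fun f g => ⟨fun η θ k => MonTrans.ext (congrArg OperadTrans.app k),
    fun η => ⟨monTransOfIsOperadTrans η.natural, OperadTrans.ext rfl⟩⟩⟩

end StrictlyFullyFaithful

/-! ### Iterated tensor products and strict symmetric monoidal functors -/

section StrictComparison

variable {E : Type u} [Category.{v} E] [MonoidalCategory E] [SymmetricCategory E]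

section

variable {C D : Type w} [EnrichedCategory E C] [EnrichedCategory E D] (F : EnrichedFunctor E C D)

/-- The case of a structural map `M` which is an identity.  Its source and target are equal, and the
hypothesis is stated for every proof of this equality, since none is fixed by the data. -/
lemma elPre_elOfEq_map {p s z : C} {r : D} {M : 𝟙_ E ⟶ (r ⟶[E] F.obj s)} (h : s = p)
    (hr : r = F.obj p) (hM : ∀ k, M = elOfEq k) :
    elPre (elOfEq h) z ≫ F.map s z ≫ elPre M _ = F.map p z ≫ elPre (elOfEq hr) _ := by
  subst h
  rw [hM hr, elOfEq_rfl, elPre_id, Category.id_comp]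

lemma elComp_elOfEq_rfl {x y : C} (a : 𝟙_ E ⟶ (x ⟶[E] y)) :
    elComp a (elOfEq rfl) = elComp (elOfEq rfl) a := by
  rw [elOfEq_rfl, elOfEq_rfl, elComp_id, id_elComp]

lemma elPre_elOfEq_elOfEq {x y z d : C} (h : x = y) (h' : y = z) :
    elPre (E := E) (elOfEq h') d ≫ elPre (elOfEq h) d = elPre (elOfEq (h.trans h')) d := by
  rw [elPre_elPre, elOfEq_elOfEq]

lemma elPre_elOfEq_symm {x y d : C} (h : x = y) :
    elPre (E := E) (elOfEq h) d ≫ elPre (elOfEq h.symm) d = 𝟙 _ := by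
  subst h
  rw [elOfEq_rfl, elPre_id, Category.comp_id]

lemma elPre_elOfEq_map_comp {p p' s z : C} {r q : D} {a : (p ⟶[E] z) ⟶ (p' ⟶[E] z)}
    {b : (F.obj p ⟶[E] F.obj z) ⟶ (q ⟶[E] F.obj z)} {M : 𝟙_ E ⟶ (r ⟶[E] F.obj s)} (h : p' = p)
    (h' : s = p') (hq : q = F.obj p) (hr : r = q) (ha : a = elPre (elOfEq h) z)
    (hb : b = elPre (elOfEq hq) _) (hM : ∀ k, M = elOfEq k) :
    a ≫ elPre (elOfEq h') z ≫ F.map s z ≫ elPre M _ = F.map p z ≫ b ≫ elPre (elOfEq hr) _ := by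
  rw [ha, hb, elPre_elOfEq_elOfEq, ← Category.assoc, elPre_elOfEq_elOfEq]
  exact elPre_elOfEq_map F _ _ hM

lemma map_eq_of_elPre_elOfEq {p s z : C} {a : (p ⟶[E] z) ⟶ (p ⟶[E] z)}
    {M : 𝟙_ E ⟶ (F.obj p ⟶[E] F.obj s)} (h : s = p) (ha : a = 𝟙 _) (hM : ∀ k, M = elOfEq k) :
    F.map p z = a ≫ elPre (elOfEq h) z ≫ F.map s z ≫ elPre M _ := by
  rw [ha, Category.id_comp, elPre_elOfEq_map F h rfl hM, elOfEq_rfl, elPre_id, Category.comp_id]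

lemma map_elPre_elOfEq {p s z : C} {q r : D} {N : 𝟙_ E ⟶ (q ⟶[E] F.obj p)}
    {M : 𝟙_ E ⟶ (r ⟶[E] F.obj s)} (h : s = p) (hr : r = q)
    (hM : elComp M (elOfEq (congrArg F.obj h)) = elComp (elOfEq hr) N) :
    (F.map p z ≫ elPre N _) ≫ elPre (elOfEq hr) _ =
      elPre (elOfEq h) z ≫ F.map s z ≫ elPre M _ := by
  subst h hr
  rw [elOfEq_rfl, elOfEq_rfl, elComp_id, id_elComp] at hM
  rw [elOfEq_rfl, elOfEq_rfl, elPre_id, elPre_id, Category.comp_id, Category.id_comp, hM]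

end

section

variable {C D : Type w} [EnrichedCategory E C] [EnrichedCategory E D]

attribute [local instance] prodEnriched

lemma elPre_elOfEq_tensor_id {p q z : C} {x y : D} (h : p = q) (k : (p, x) = (q, x)) :
    (elPre (elOfEq h) z ⊗ₘ 𝟙 (x ⟶[E] y)) = elPre (C := C × D) (elOfEq k) (z, y) := by
  subst h
  rw [elOfEq_rfl, elOfEq_rfl, elPre_id, elPre_id, id_tensorHom_id]
  rfl

lemma id_tensor_elPre_elOfEq {p q z : D} {x y : C} (h : p = q) (k : (x, p) = (x, q)) :
    (𝟙 (x ⟶[E] y) ⊗ₘ elPre (elOfEq h) z) = elPre (C := C × D) (elOfEq k) (y, z) := by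
  subst h
  rw [elOfEq_rfl, elOfEq_rfl, elPre_id, elPre_id, id_tensorHom_id]
  rfl

end

namespace LaxHom

variable {C D C' D' : SymMonECat.{v, u, w} E}

lemma tens_obj_eq (f : LaxHom C D) (hmu : ∀ x y, D.tObj (f.obj x) (f.obj y) = f.obj (C.tObj x y))
    (hone : D.one = f.obj C.one) :
    ∀ {n : ℕ} (c : Fin n → C.carrier), D.tens (fun j => f.obj (c j)) = f.obj (C.tens c)
  | 0, _ => hone
  | 1, _ => rfl
  | n + 2, c => (congrArg (D.tObj (f.obj (c 0))) (tens_obj_eq f hmu hone fun j : Fin (n + 1) =>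
      c j.succ)).trans (hmu _ _)

/-- The structural maps of a strict symmetric monoidal functor are identities. -/
lemma muN_eq_elOfEq (f : LaxHom C D) (hobj : ∀ x y, D.tObj (f.obj x) (f.obj y) = f.obj (C.tObj x y))
    (hone : D.one = f.obj C.one) (hmu : ∀ x y, f.mu x y = elOfEq (hobj x y))
    (heps : f.eps = elOfEq hone) :
    ∀ {n : ℕ} (c : Fin n → C.carrier) (k : D.tens (fun j => f.obj (c j)) = f.obj (C.tens c)),
      f.muN c = elOfEq k
  | 0, c, k => heps
  | 1, c, k => (elOfEq_rfl _).symm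
  | n + 2, c, k => by
    have h := f.tens_obj_eq hobj hone fun j : Fin (n + 1) => c j.succ
    have h1 := muN_eq_elOfEq f hobj hone hmu heps (fun j : Fin (n + 1) => c j.succ) h
    have h2 : elComp (D.tEl (eId E (f.obj (c 0))) (elOfEq h)) (elOfEq (hobj (c 0) _)) =
        elOfEq ((congrArg (D.tObj (f.obj (c 0))) h).trans (hobj _ _)) := by
      rw [← elOfEq_rfl, D.tEl_elOfEq rfl h (congrArg (D.tObj (f.obj (c 0))) h), elOfEq_elOfEq]
    exact (congr (congrArg (fun a => elComp (D.tEl (eId E (f.obj (c 0))) a)) h1) (hmu _ _)).trans h2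

lemma mu_elOfEq (f : LaxHom C D) {x y y' : C.carrier} {q r : D.carrier}
    {M : 𝟙_ E ⟶ (q ⟶[E] f.obj y)} {N : 𝟙_ E ⟶ (r ⟶[E] f.obj y')} (h : y = y') (hq : q = r)
    (hM : elComp M (elOfEq (congrArg f.obj h)) = elComp (elOfEq hq) N) (k k') :
    elComp (elComp (D.tEl (eId E (f.obj x)) M) (f.mu x y)) (elOfEq k) =
      elComp (elOfEq k') (elComp (D.tEl (eId E (f.obj x)) N) (f.mu x y')) := by
  subst h hq
  rw [elOfEq_rfl, elOfEq_rfl, elComp_id, id_elComp] at hM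
  rw [elOfEq_rfl, elOfEq_rfl, elComp_id, id_elComp, hM]

attribute [local instance] prodEnriched in
lemma elComp_tEl_elPair {x y y' z : (C.tensor D).carrier} (a : 𝟙_ E ⟶ (y.1 ⟶[E] y'.1))
    (b : 𝟙_ E ⟶ (y.2 ⟶[E] y'.2)) (a' : 𝟙_ E ⟶ (C.tObj x.1 y'.1 ⟶[E] z.1))
    (b' : 𝟙_ E ⟶ (D.tObj x.2 y'.2 ⟶[E] z.2)) :
    elComp (x := (C.tensor D).tObj x y) (y := (C.tensor D).tObj x y') (z := z)
      ((C.tensor D).tEl (x := x) (x' := x) (y := y) (y' := y') (eId E x) (elPair a b))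
        (elPair a' b') =
      elPair (elComp (C.tEl (eId E x.1) a) a') (elComp (D.tEl (eId E x.2) b) b') :=
  (congrArg (fun k => elComp (x := (C.tensor D).tObj x y) (y := (C.tensor D).tObj x y') (z := z) k
    (elPair a' b')) (prod_tEl (eId E x.1) (eId E x.2) a b _ _)).trans
    (prod_elComp (C := C.carrier) (D := D.carrier) (x := (C.tensor D).tObj x y)
      (y := (C.tensor D).tObj x y') (z := z) _ _ a' b')

/-- Up to the identification of tensor products in `C ⊗ D`, the structural maps of `f ⊗ g` are the
pairs of the structural maps of `f` and `g`. -/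
lemma muN_tensor (f : LaxHom C C') (g : LaxHom D D') : ∀ {n : ℕ} (c : Fin n → (C.tensor D).carrier),
    elComp ((f.tensor g).muN c) (elOfEq (congrArg (f.tensor g).obj (C.tens_tensor D c))) =
      elComp (x := (C'.tensor D').tens fun j => (f.tensor g).obj (c j))
        (y := (C'.tens fun j => f.obj (c j).1, D'.tens fun j => g.obj (c j).2))
        (z := (f.obj (C.tens fun j => (c j).1), g.obj (D.tens fun j => (c j).2)))
        (elOfEq (C'.tens_tensor D' fun j => (f.tensor g).obj (c j)))
        (elPair (f.muN fun j => (c j).1) (g.muN fun j => (c j).2))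
  | 0, c => elComp_elOfEq_rfl (C := (C'.tensor D').carrier)
    (x := (C'.one, D'.one)) (y := (f.obj C.one, g.obj D.one)) (elPair f.eps g.eps)
  | 1, c => elComp_elOfEq_rfl (C := (C'.tensor D').carrier) (eId E ((f.tensor g).obj (c 0)))
  | n + 2, c =>
    ((f.tensor g).mu_elOfEq (C.tens_tensor D fun j : Fin (n + 1) => c j.succ)
      (C'.tens_tensor D' fun j : Fin (n + 1) => (f.tensor g).obj (c j.succ))
      (muN_tensor f g fun j : Fin (n + 1) => c j.succ) _ _).trans
      (congrArg (elComp (C := (C'.tensor D').carrier) _) (elComp_tEl_elPair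
        (x := (f.tensor g).obj (c 0))
        (y := (C'.tens fun j : Fin (n + 1) => f.obj (c j.succ).1,
          D'.tens fun j : Fin (n + 1) => g.obj (c j.succ).2))
        (y' := (f.obj (C.tens fun j : Fin (n + 1) => (c j.succ).1),
          g.obj (D.tens fun j : Fin (n + 1) => (c j.succ).2)))
        (z := (f.obj (C.tens fun j => (c j).1), g.obj (D.tens fun j => (c j).2)))
        (f.muN fun j : Fin (n + 1) => (c j.succ).1) (g.muN fun j : Fin (n + 1) => (c j.succ).2)
        (f.mu (c 0).1 _) (g.mu (c 0).2 _)))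

end LaxHom

end StrictComparison

/-! ### The strong context structure -/

section StrongContext

variable {E : Type u} [Category.{v} E] [MonoidalCategory E] [SymmetricCategory E]

/-- A commutative square whose vertical sides are invertible may be turned around. -/
lemma comp_eq_comp_of_inverse {X X' Y Y' : E} {p : X ⟶ Y} {q : X' ⟶ Y'} {m : X ⟶ X'} {i : X' ⟶ X}
    {m' : Y ⟶ Y'} {i' : Y' ⟶ Y} (h : p ≫ m' = m ≫ q) (hi : i ≫ m = 𝟙 _) (hm : m' ≫ i' = 𝟙 _) :
    q ≫ i' = i ≫ p := by
  rw [← Category.comp_id p, ← hm, reassoc_of% h, reassoc_of% hi]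

/-- The inverse of `endMu`. -/
def endMuInv (C D : SymMonECat.{v, u, w} E) :
    OperadHomData (endData (C.tensor D)) ((endData C).tensor (endData D)) where
  onOb x := x
  map c d := elPre (C := (C.tensor D).carrier)
    (x' := (C.tens (fun j => (c j).1), D.tens (fun j => (c j).2)))
    (elOfEq (C := (C.tensor D).carrier) (C.tens_tensor D c).symm) d

lemma endMu_map_endMuInv_map {C D : SymMonECat.{v, u, w} E} {n : ℕ}
    (c : Fin n → (C.tensor D).carrier) (d : (C.tensor D).carrier) :
    (endMu C D).map c d ≫ (endMuInv C D).map c d = 𝟙 (((endData C).tensor (endData D)).obj c d) :=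
  elPre_elOfEq_symm (C := (C.tensor D).carrier)
    (y := (C.tens (fun j => (c j).1), D.tens (fun j => (c j).2))) (C.tens_tensor D c)

lemma endMuInv_map_endMu_map {C D : SymMonECat.{v, u, w} E} {n : ℕ}
    (c : Fin n → (C.tensor D).carrier) (d : (C.tensor D).carrier) :
    (endMuInv C D).map c d ≫ (endMu C D).map c d = 𝟙 ((endData (C.tensor D)).obj c d) :=
  elPre_elOfEq_symm (C := (C.tensor D).carrier)
    (x := (C.tens (fun j => (c j).1), D.tens (fun j => (c j).2))) (C.tens_tensor D c).symm

lemma endMuInv_isHom (C D : SymMonECat.{v, u, w} E) : (endMuInv C D).IsHom where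
  map_act {n c c'} σ h d := comp_eq_comp_of_inverse ((endMu_isHom C D).map_act σ h d)
    (endMuInv_map_endMu_map c d) (endMu_map_endMuInv_map c' d)
  map_comp {n m k c e g} i x hx hg d :=
    comp_eq_comp_of_inverse ((endMu_isHom C D).map_comp i hx hg d)
      ((tensorHom_comp_tensorHom _ _ _ _).trans
        ((congrArg₂ (· ⊗ₘ ·) (endMuInv_map_endMu_map c d) (endMuInv_map_endMu_map e x)).trans
          (id_tensorHom_id _ _)))
      (endMu_map_endMuInv_map g d)
  map_unit x := comp_elPre_elOfEq (C := (C.tensor D).carrier) x x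
    (elPair (eId E (C := C.carrier) x.1) (eId E (C := D.carrier) x.2))

variable (E) in
/-- The inverse of `endEps`. -/
def endEpsInv : OperadHomData (endData (SymMonECat.unit.{v, u, w} E)) (OperadData.uCom.{v, u, w} E)
    where
  onOb x := x
  map _ _ := 𝟙 (𝟙_ E)

lemma endEpsInv_isHom : (endEpsInv.{v, u, w} E).IsHom where
  map_act {n c c'} σ h d := comp_eq_comp_of_inverse (endEps_isHom.map_act (c := c) (c' := c') σ h d)
    (Category.comp_id (𝟙 (𝟙_ E))) (Category.comp_id (𝟙 (𝟙_ E)))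
  map_comp {n m k c e g} i x hx hg d :=
    comp_eq_comp_of_inverse (endEps_isHom.map_comp (c := c) (e := e) (g := g) i hx hg d)
      ((tensorHom_comp_tensorHom _ _ _ _).trans
        ((congrArg₂ (· ⊗ₘ ·) (Category.comp_id (𝟙 (𝟙_ E))) (Category.comp_id (𝟙 (𝟙_ E)))).trans
          (id_tensorHom_id _ _)))
      (Category.comp_id (𝟙 (𝟙_ E)))
  map_unit x := Category.comp_id _

namespace EndWellDefined

variable (h : EndWellDefined.{v, u, w} E)

/-- The canonical isomorphism `End(C) ⊗ End(D) ≅ End(C ⊗ D)`. -/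
def muIso (C D : SymMonECat.{v, u, w} E) :
    h.toStruct.obj C ⊗ h.toStruct.obj D ≅ h.toStruct.obj (C ⊗ D) where
  hom := h.muHom C D
  inv := OperadHom.mk (endMuInv C D) (endMuInv_isHom C D)
  hom_inv_id := OperadHom.ext_of rfl (heq_of_eq (by
    funext n c d; exact endMu_map_endMuInv_map c d))
  inv_hom_id := OperadHom.ext_of rfl (heq_of_eq (by
    funext n c d; exact endMuInv_map_endMu_map c d))

/-- The canonical isomorphism `uCom ≅ End(I)`. -/
def epsIso : 𝟙_ (EnrichedOperad.{v, u, w} E) ≅ h.toStruct.obj (𝟙_ (SymMonECat.{v, u, w} E)) where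
  hom := h.epsHom
  inv := OperadHom.mk (endEpsInv E) endEpsInv_isHom
  hom_inv_id := OperadHom.ext_of rfl (heq_of_eq (by
    funext n c d; exact Category.comp_id (𝟙 (𝟙_ E))))
  inv_hom_id := OperadHom.ext_of rfl (heq_of_eq (by
    funext n c d; exact Category.comp_id (𝟙 (𝟙_ E))))

attribute [local instance] prodEnriched in
/-- The canonical maps are natural, with respect to 1-morphisms. -/
lemma muHom_natural {C C' D D' : SymMonECat.{v, u, w} E} (f : C ⟶ C') (g : D ⟶ D') :
    (h.toStruct.map f ⊗ₘ h.toStruct.map g) ≫ h.muHom C' D' =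
      h.muHom C D ≫ h.toStruct.map (f ⊗ₘ g) := by
  refine OperadHom.ext_of rfl (heq_of_eq ?_)
  funext n c d
  have h1 : (OperadHom.tensor (h.toStruct.map f) (h.toStruct.map g)).map c d =
      (LaxHom.tensor f g).map (C.tens fun j => (c j).1, D.tens fun j => (c j).2) d ≫
        elPre (C := C'.carrier × D'.carrier)
          (x' := (C'.tens fun j => f.obj (c j).1, D'.tens fun j => g.obj (c j).2))
          (x := (f.obj (C.tens fun j => (c j).1), g.obj (D.tens fun j => (c j).2)))
          (elPair (LaxHom.muN f fun j => (c j).1) (LaxHom.muN g fun j => (c j).2))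
          (f.obj d.1, g.obj d.2) :=
    (tensorHom_comp_tensorHom _ _ _ _).symm.trans (congrArg (_ ≫ ·) (prod_elPre (C := C'.carrier)
      (D := D'.carrier) (x := (C'.tens fun j => f.obj (c j).1, D'.tens fun j => g.obj (c j).2))
      (y := (f.obj (C.tens fun j => (c j).1), g.obj (D.tens fun j => (c j).2)))
      (LaxHom.muN f fun j => (c j).1) (LaxHom.muN g fun j => (c j).2)
      (f.obj d.1, g.obj d.2)).symm)
  exact (congrArg (· ≫ _) h1).trans (map_elPre_elOfEq (LaxHom.tensor f g).toEnrichedFunctor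
    (p := (C.tens fun j => (c j).1, D.tens fun j => (c j).2))
    (q := (C'.tens fun j => f.obj (c j).1, D'.tens fun j => g.obj (c j).2))
    (C.tens_tensor D c) (C'.tens_tensor D' _) (LaxHom.muN_tensor f g c))

lemma muHom_associativity (C D K : SymMonECat.{v, u, w} E) :
    (h.muHom C D ⊗ₘ 𝟙 (h.toStruct.obj K)) ≫ h.muHom (C ⊗ D) K ≫ h.toStruct.map (α_ C D K).hom =
      (α_ _ _ _).hom ≫ (𝟙 (h.toStruct.obj C) ⊗ₘ h.muHom D K) ≫ h.muHom C (D ⊗ K) := by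
  refine OperadHom.ext_of rfl (heq_of_eq ?_)
  funext n c d
  have hm := LaxHom.muN_eq_elOfEq (LaxHom.associator C D K) (fun _ _ => rfl) rfl
    (fun _ _ => (elOfEq_rfl _).symm) (elOfEq_rfl _).symm c
  exact elPre_elOfEq_map_comp (LaxHom.associator C D K).toEnrichedFunctor
    (p := ((C.tens fun j => (c j).1.1, D.tens fun j => (c j).1.2), K.tens fun j => (c j).2))
    (p' := ((C.tensor D).tens fun j => (c j).1, K.tens fun j => (c j).2))
    (q := (C.tens fun j => (c j).1.1, (D.tensor K).tens fun j => ((c j).1.2, (c j).2)))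
    (Prod.ext (C.tens_tensor D fun j => (c j).1) rfl) ((C.tensor D).tens_tensor K c)
    (Prod.ext rfl (D.tens_tensor K fun j => ((c j).1.2, (c j).2)))
    (C.tens_tensor (D.tensor K) fun j => ((c j).1.1, ((c j).1.2, (c j).2)))
    (elPre_elOfEq_tensor_id _ _) (id_tensor_elPre_elOfEq _ _) hm

lemma muHom_left_unitality (C : SymMonECat.{v, u, w} E) :
    (λ_ (h.toStruct.obj C)).hom =
      (h.epsHom ⊗ₘ 𝟙 (h.toStruct.obj C)) ≫ h.muHom (𝟙_ _) C ≫ h.toStruct.map (λ_ C).hom := by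
  refine OperadHom.ext_of rfl (heq_of_eq ?_)
  funext n c d
  have hm := LaxHom.muN_eq_elOfEq (LaxHom.leftUnitor C) (fun _ _ => rfl) rfl
    (fun _ _ => (elOfEq_rfl _).symm) (elOfEq_rfl _).symm c
  exact map_eq_of_elPre_elOfEq (LaxHom.leftUnitor C).toEnrichedFunctor
    (p := ((SymMonECat.unit E).tens fun j => (c j).1, C.tens fun j => (c j).2))
    ((SymMonECat.unit E).tens_tensor C c) (id_tensorHom_id _ _) hm

lemma muHom_right_unitality (C : SymMonECat.{v, u, w} E) :
    (ρ_ (h.toStruct.obj C)).hom =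
      (𝟙 (h.toStruct.obj C) ⊗ₘ h.epsHom) ≫ h.muHom C (𝟙_ _) ≫ h.toStruct.map (ρ_ C).hom := by
  refine OperadHom.ext_of rfl (heq_of_eq ?_)
  funext n c d
  have hm := LaxHom.muN_eq_elOfEq (LaxHom.rightUnitor C) (fun _ _ => rfl) rfl
    (fun _ _ => (elOfEq_rfl _).symm) (elOfEq_rfl _).symm c
  exact map_eq_of_elPre_elOfEq (LaxHom.rightUnitor C).toEnrichedFunctor
    (p := (C.tens fun j => (c j).1, (SymMonECat.unit E).tens fun j => (c j).2))
    (C.tens_tensor (SymMonECat.unit E) c) (id_tensorHom_id _ _) hm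

lemma muHom_braiding (C D : SymMonECat.{v, u, w} E) :
    h.muHom C D ≫ h.toStruct.map (β_ C D).hom = (β_ _ _).hom ≫ h.muHom D C := by
  refine OperadHom.ext_of rfl (heq_of_eq ?_)
  funext n c d
  have hm := LaxHom.muN_eq_elOfEq (LaxHom.braiding C D) (fun _ _ => rfl) rfl
    (fun _ _ => (elOfEq_rfl _).symm) (elOfEq_rfl _).symm c
  exact elPre_elOfEq_map (LaxHom.braiding C D).toEnrichedFunctor
    (p := (C.tens fun j => (c j).1, D.tens fun j => (c j).2)) (C.tens_tensor D c)
    (D.tens_tensor C fun j => ((c j).2, (c j).1)) hm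

/-- The strong symmetric monoidal structure on `End`. -/
def coreMonoidal (hF : IsStrictTwoFunctor h.toStruct) : hF.functor.CoreMonoidal where
  εIso := h.epsIso
  μIso := h.muIso
  μIso_hom_natural_left {C C'} f D := by
    have h1 := h.muHom_natural f (𝟙 D)
    have h2 : h.toStruct.map (𝟙 D) = 𝟙 (h.toStruct.obj D) := hF.functor.map_id D
    rw [h2, tensorHom_id, tensorHom_id] at h1
    exact h1
  μIso_hom_natural_right {D D'} C g := by
    have h1 := h.muHom_natural (𝟙 C) g
    have h2 : h.toStruct.map (𝟙 C) = 𝟙 (h.toStruct.obj C) := hF.functor.map_id C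
    rw [h2, id_tensorHom, id_tensorHom] at h1
    exact h1
  associativity C D K := h.muHom_associativity C D K
  left_unitality C := h.muHom_left_unitality C
  right_unitality C := h.muHom_right_unitality C

/-- The strong symmetric monoidal structure on `End` is compatible with the braiding. -/
@[reducible]
def braided (hF : IsStrictTwoFunctor h.toStruct) : hF.functor.Braided :=
  { (h.coreMonoidal hF).toMonoidal with
    braided := fun C D => h.muHom_braiding C D }

/-- `End` is a strong context functor. -/
def strongContextStructure (hF : IsStrictTwoFunctor h.toStruct) :
    StrongContextStructure h.toStruct hF where
  braided := h.braided hF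
  μ_natural₂ {C C' D D' f f' g g'} η θ := by
    refine OperadTrans.eq_conj (P := h.toStruct.obj C ⊗ h.toStruct.obj D)
      (Q := h.toStruct.obj (C' ⊗ D')) _ _ fun x => heq_of_eq ?_
    exact comp_elPre_elOfEq (C := (C'.tensor D').carrier) (f.obj x.1, g.obj x.2)
      (f'.obj x.1, g'.obj x.2) (elPair (MonTrans.app η x.1) (MonTrans.app θ x.2))

end EndWellDefined

end StrongContext

theorem proposition3 (E : Type u) [Category.{v} E] [MonoidalCategory E] [SymmetricCategory E] :
    ∃ (h : EndWellDefined.{v, u, w} E) (hF : IsStrictTwoFunctor h.toStruct),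
      IsStrictlyFullyFaithful h.toStruct ∧
      ∃ S : StrongContextStructure h.toStruct hF,
        letI := S.braided
        (∀ C D : SymMonECat.{v, u, w} E, Functor.LaxMonoidal.μ hF.functor C D = h.muHom C D) ∧
        Functor.LaxMonoidal.ε hF.functor = h.epsHom :=
  ⟨endWellDefined E, (endWellDefined E).isStrictTwoFunctor,
    (endWellDefined E).isStrictlyFullyFaithful,
    (endWellDefined E).strongContextStructure (endWellDefined E).isStrictTwoFunctor,
    fun _ _ => rfl, rfl⟩
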